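/- **Model.** Write $[n]=\{0,\dots,n-1\}$. A quantum circuit of space $S$ with oracle access to $f:[M]\to[N]$ operates on $S$ qubits, initially $|0\rangle^{\otimes S}$, by a finite sequence of gates: arbitrary unitaries on at most three qubits; oracle gates $|x,p\rangle\mapsto e^{2\pi i\,p f(x)/N}|x,p\rangle$ ($x\in[M]$, $p\in[N]$ written in binary on $\lceil\log_2 M\rceil+\lceil\log_2 N\rceil$ qubits of the memory, other basis states being unchanged); measure-and-reset gates, setting a qubit back to $|0\rangle$; and output gates, placed at predefined positions, which write a memory qubit in the computational basis on a fresh output qubit that is not used later and is not counted in $S$. The time $T$ is the total number of gates. A (bounded-error quantum) algorithm is a family of such circuits, one for each problem size. A collision of $f$ is a pair $(x_1,x_2)$ with $x_1\ne x_2$ and $f(x_1)=f(x_2)$; two collisions are disjoint if their four entries are all different. A circuit solves Element Distinctness on domain size $N$ with bounded error if, for a uniformly random $f:[N]\to[N^2]$ conditioned on having a collision, it outputs a collision of $f$ with probability at least $2/3$. A circuit finds $K$ disjoint collisions in a random $f:[M]\to[N]$ with bounded error if, with probability at least $2/3$ over the uniformly random $f$ and the measurements, its output is a list of pairs, each of which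 is either a collision of $f$ or of the form $(x,x)$ (meaning "nothing is output here"), that contains at least $K$ mutually disjoint collisions. Further, $u(N)\le\widetilde O(v(N))$ means $u(N)\le C\,v(N)(\log N)^k$ for some constants $C,k$ and all sufficiently large $N$. **Statement.** There is an absolute constant $c>0$ such that the following holds for all real constants $\alpha,\beta,\gamma$. Suppose that there is a family of circuits, of time $T(N)$ and space $S(N)$, that solves Element Distinctness on domain size $N$ with bounded error for all sufficiently large $N$, and that satisfies $T(N)^{\alpha}S(N)^{\beta}\le\widetilde O\bigl(N^{2(\gamma-\alpha)}\bigr)$. Then there is a family of circuits, of time $T'(N)$ and space $S'(N)$, that finds $\lceil cN/\log N\rceil$ disjoint collisions in a random function $f:[10N]\to[N]$ with bounded error for all sufficiently large $N$, and that satisfies $T'(N)^{\alpha}S'(N)^{\beta}\le\widetilde O\bigl(N^{\gamma}\bigr)$. -/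

import Mathlib

open Filter Asymptotics
open scoped BigOperators

noncomputable section

/-! ### Quantum circuits with oracle gates, in the time-space model -/

/-- The basis states of a memory of `S` qubits. -/
abbrev Cfg (S : ℕ) : Type := Fin S → Bool

/-- A (not necessarily normalized) pure state of `S` qubits, given by its amplitudes. -/
abbrev QState (S : ℕ) : Type := Cfg S → ℂ

/-- The elementary gates of a circuit operating on `S` qubits with oracle access to a function
`[M] → [N]`, where `[n] = {0, …, n - 1}`. -/
inductive Gate (M N S : ℕ) : Type
  /-- A unitary gate on at most three (distinct) qubits. -/
  | unitary (r : ℕ) (hr : r ≤ 3) (t : Fin r ↪ Fin S)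
      (U : Matrix.unitaryGroup (Fin r → Bool) ℂ) : Gate M N S
  /-- An oracle gate. It acts on a query register of `⌈log₂ M⌉` qubits and a phase register of
  `⌈log₂ N⌉` qubits, at distinct places of the memory. -/
  | query (t : Fin (Nat.clog 2 M) ⊕ Fin (Nat.clog 2 N) ↪ Fin S) : Gate M N S
  /-- An output gate: the qubit `i` is written (in the computational basis) on the next output
  qubit, which is not available afterwards and is not part of the memory. -/
  | output (i : Fin S) : Gate M N S
  /-- The qubit `i` is measured, the result is forgotten, and the qubit is set back to `|0⟩`. -/
  | reset (i : Fin S) : Gate M N S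

/-- A circuit on `S` qubits is a finite sequence of gates. -/
abbrev Circuit (M N S : ℕ) : Type := List (Gate M N S)

/-- The time complexity of a circuit is the number of its gates, of all kinds. (The space
complexity is the parameter `S`.) -/
def Circuit.time {M N S : ℕ} (C : Circuit M N S) : ℕ := List.length C

/-- The initial state `|0…0⟩`. -/
def initState (S : ℕ) : QState S := Pi.single (fun _ => false) 1

/-- The squared Euclidean norm of a state. -/
def normSqState {S : ℕ} (ψ : QState S) : ℝ := ∑ w, ‖ψ w‖ ^ 2

/-- `U` applied to the qubits `t 0, …, t (r - 1)`, and the identity on the others.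
Here `Function.extend t b w` is `w` with the bits at the places `t j` replaced by `b j`. -/
def applyUnitary {S r : ℕ} (t : Fin r ↪ Fin S) (U : Matrix (Fin r → Bool) (Fin r → Bool) ℂ)
    (ψ : QState S) : QState S :=
  fun w => ∑ b : Fin r → Bool, U (fun j => w (t j)) b * ψ (Function.extend t b w)

/-- The phase oracle `|x, p⟩ ↦ ω_N ^ (p * f x) |x, p⟩`, `ω_N = exp (2πi/N)`, for `x ∈ [M]` and
`p ∈ [N]`; both registers hold binary numbers (least significant bit first), and basis states
whose registers do not hold elements of `[M]` and `[N]` are left unchanged. -/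
def applyQuery {M N S : ℕ} (f : Fin M → Fin N)
    (t : Fin (Nat.clog 2 M) ⊕ Fin (Nat.clog 2 N) ↪ Fin S) (ψ : QState S) : QState S :=
  fun w =>
    let x : ℕ := Nat.ofBits fun j => w (t (Sum.inl j))
    let p : ℕ := Nat.ofBits fun j => w (t (Sum.inr j))
    if hx : x < M then
      if p < N then
        Complex.exp (2 * Real.pi * Complex.I * ((p : ℂ) * ((f ⟨x, hx⟩ : ℕ) : ℂ)) / (N : ℂ)) * ψ w
      else ψ w
    else ψ w

/-- The projection on the basis states whose qubit `i` has value `b`. -/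
def projBit {S : ℕ} (i : Fin S) (b : Bool) (ψ : QState S) : QState S :=
  fun w => if w i = b then ψ w else 0

/-- The operator `|0⟩⟨b|` on the qubit `i`. -/
def resetBit {S : ℕ} (i : Fin S) (b : Bool) (ψ : QState S) : QState S :=
  fun w => if w i = false then ψ (Function.update w i b) else 0

open Classical in
/-- `probFrom f R C z ψ` is the probability (times the squared norm of `ψ`) that the whole output
satisfies `R`, if the circuit `C` is run with oracle `f` from the memory state `ψ`, the output
qubits `z` having been written before. -/
def probFrom {M N S : ℕ} (f : Fin M → Fin N) (R : List Bool → Prop) :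
    Circuit M N S → List Bool → QState S → ℝ
  | [], z, ψ => if R z then normSqState ψ else 0
  | .unitary _ _ t U :: C, z, ψ => probFrom f R C z (applyUnitary t U.1 ψ)
  | .query t :: C, z, ψ => probFrom f R C z (applyQuery f t ψ)
  | .output i :: C, z, ψ => ∑ b : Bool, probFrom f R C (z ++ [b]) (projBit i b ψ)
  | .reset i :: C, z, ψ => ∑ b : Bool, probFrom f R C z (resetBit i b ψ)

/-- The probability that the output of `C` on input `f` satisfies the relation `R`. -/
def successProb {M N S : ℕ} (C : Circuit M N S) (f : Fin M → Fin N) (R : List Bool → Prop) : ℝ :=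
  probFrom f R C [] (initState S)

/-! ### Collisions -/

/-- The pair `P` is a collision of `f`. -/
def IsCollision {M N : ℕ} (f : Fin M → Fin N) (P : Fin M × Fin M) : Prop :=
  P.1 ≠ P.2 ∧ f P.1 = f P.2

/-- Two pairs have no element in common. -/
def DisjointPairs {M : ℕ} (P Q : Fin M × Fin M) : Prop :=
  P.1 ≠ Q.1 ∧ P.1 ≠ Q.2 ∧ P.2 ≠ Q.1 ∧ P.2 ≠ Q.2

/-- A pair of elements of `[M]` as a string of `2 ⌈log₂ M⌉` bits. -/
def encodePair {M : ℕ} (P : Fin M × Fin M) : List Bool :=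
  (List.ofFn fun j : Fin (Nat.clog 2 M) => Nat.testBit (P.1 : ℕ) j) ++
    List.ofFn fun j : Fin (Nat.clog 2 M) => Nat.testBit (P.2 : ℕ) j

/-- The output `z` is a collision of `f`. -/
def OutputsCollision {M N : ℕ} (f : Fin M → Fin N) (z : List Bool) : Prop :=
  ∃ P : Fin M × Fin M, z = encodePair P ∧ IsCollision f P

/-- The output `z` is a list of pairs that contains at least `K` mutually disjoint collisions
of `f` and no wrong claim. As output gates are at fixed places of the circuit, a pair `(x, x)`
stands for "nothing is output here"; every other pair has to be a collision. Collisions may be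
repeated and need not all be disjoint. -/
def OutputsDisjointCollisions {M N : ℕ} (f : Fin M → Fin N) (K : ℕ) (z : List Bool) : Prop :=
  ∃ L : List (Fin M × Fin M), z = L.flatMap encodePair ∧
    (∀ P ∈ L, P.1 ≠ P.2 → IsCollision f P) ∧
    ∃ D : Finset (Fin M × Fin M), K ≤ D.card ∧
      (∀ P ∈ D, P ∈ L ∧ IsCollision f P) ∧
      ∀ P ∈ D, ∀ Q ∈ D, P ≠ Q → DisjointPairs P Q

open Classical in
/-- `C` solves Element Distinctness on domain size `n` with bounded error: for a uniformly random
function `f : [n] → [n²]`, conditioned on `f` having a collision at all, the output is a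
collision of `f` with probability at least `2/3`. -/
def SolvesED {n S : ℕ} (C : Circuit n (n ^ 2) S) : Prop :=
  2 / 3 ≤ Finset.expect (Finset.univ.filter fun f : Fin n → Fin (n ^ 2) => ∃ P, IsCollision f P)
    fun f => successProb C f (OutputsCollision f)

/-- `C` finds `K` disjoint collisions in a uniformly random function `f : [M] → [N]` with bounded
error, i.e. with probability at least `2/3` over `f` and the measurements. -/
def FindsDisjointCollisions {M N S : ℕ} (C : Circuit M N S) (K : ℕ) : Prop :=
  2 / 3 ≤ Finset.expect Finset.univ
    fun f : Fin M → Fin N => successProb C f (OutputsDisjointCollisions f K)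

/-! ### Asymptotics -/

/-- `u ≤ Õ(v)`: `u = O(v * (log N) ^ k)` for some `k`, as `N → ∞`. -/
def IsTildeO (u v : ℕ → ℝ) : Prop :=
  ∃ k : ℕ, u =O[atTop] fun N : ℕ => v N * Real.log N ^ k

end

set_option linter.unusedSectionVars false

noncomputable section

/-! The substantial case is α > 0, β ≥ 0. Put n = ⌊√N⌋ and k = ⌈log₂ n⌉, so that n² ≤ N ≤ n² + 2n
and 4^k ≤ 10N. Inside [10N] sits the affine plane over the field with 2^k elements. Every
non-vertical line of this plane has 2^k ≥ n points, and f restricted to the first n of them is a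
uniformly random function [n] → [N]. With probability at least 1/9 all its values are below n²
(`small_prob_ge`), and then it is a uniform instance of Element Distinctness; such an instance has a
collision with probability at least 1/5 (`card_collision_ge`). Hence running the given circuit once
on each of the 4^k ≈ N lines finds a collision on a constant fraction of them, on average.

Lines fit the purpose for two reasons. Parallel lines are disjoint, so for a fixed slope the 2^k
restrictions are independent (`expect_prod_blockBound`), and an exponential moment bound with a
union bound over the slopes gives a constant fraction of successes for every slope. Two distinct
points lie on at most one line (`eq_of_onCurve`), so the collisions found on different lines are
different. Since f takes no value more than O(log N) times, except with small probability
(`expect_load_le`), a collision meets only O(log N) others, and a maximal disjoint subfamily of the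
collisions found has size of order N / log N (`exists_disjoint_of_load`).

The given circuit queries F : [n] → [n²] by phases that are multiples of 1/n², whereas f provides
multiples of 1/N. A query is therefore simulated coherently. Hadamard tests on controlled phases
read f(x) digit by digit, beginning with the least significant bits, so that each later decision
only distinguishes a phase near 0 from one near 1/2 (`stdReader_value`). A recursive majority of
repeated tests makes a wrong decision have probability (3/4)^(2^t) (`majProb_le`). Then the desired
phase is applied, linearly in the digits, and the tests are undone; the result is close in norm to
the ideal query (`QuerySim.nsq_op_sub_le`). Errors accumulate through a circuit with measurements by
a quasi-triangle inequality for quadratic functionals with parameter κ = 1/T, which costs the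
constant factor (1 + 1/T)^T ≤ 3 and an additive term (`run_le_sim`).

A wrong claim spoils the whole output, so before a pair (x, y) is written its values are compared by
an equality test: the phases 2^s (f x - f y) / N always pass if the values agree, and all pass with
probability at most 1/4 otherwise (`prod_cos_sq_le`); after r repetitions this is 4^(-r). A pair
that fails is output as (x, x). At the end of a block all qubits are reset, so the blocks are
independent given f (`run_blocks`).

The new circuit takes time N · T · polylog and space S + polylog. As n² is N up to a constant, T'^α
S'^β is at most (n²)^α · n^(2(γ-α)) = (n²)^γ up to polylogarithmic factors (`cost_le`). If α or β is
negative, a longer or larger circuit only helps, and comparing all pairs with enough padding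
suffices (`exists_family_of_all`); if α = 0 ≤ β, then S ≥ 1 forces γ ≥ 0 and the comparison of all
pairs suffices again.

At the technical level, programs are written with macro gates (controlled phases, oracle queries and
xors governed by Boolean formulas) and compiled to elementary gates by computing the formulas in
scratch qubits and uncomputing them (`Mac.run_compileL`). -/

namespace QCirc

/-! ### Instructions with classical outcomes -/

/-- States of a memory whose qubits are indexed by `Q`. -/
abbrev St (Q : Type) : Type := (Q → Bool) → ℂ

/-- An instruction is a list of branches; each branch emits some bits and acts linearly. -/
abbrev Instr (Q : Type) : Type := List (List Bool × (St Q →ₗ[ℂ] St Q))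

section Run

variable {Q : Type}

/-- The expectation of `F (output) (final unnormalized state)`. -/
def run : List (Instr Q) → List Bool → St Q → (List Bool → St Q → ℝ) → ℝ
  | [], z, ψ, F => F z ψ
  | I :: C, z, ψ, F => (I.map fun b => run C (z ++ b.1) (b.2 ψ) F).sum

/-- The instruction with a single branch and no output. -/
def pureI (X : St Q →ₗ[ℂ] St Q) : Instr Q := [([], X)]

@[simp] lemma run_nil (z : List Bool) (ψ : St Q) (F) : run [] z ψ F = F z ψ := rfl

lemma run_cons (I : Instr Q) (C) (z : List Bool) (ψ : St Q) (F) :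
    run (I :: C) z ψ F = (I.map fun b => run C (z ++ b.1) (b.2 ψ) F).sum := rfl

@[simp] lemma run_pureI_cons (X : St Q →ₗ[ℂ] St Q) (C) (z : List Bool) (ψ : St Q) (F) :
    run (pureI X :: C) z ψ F = run C z (X ψ) F := by
  simp [run_cons, pureI]

lemma run_append (C D : List (Instr Q)) (z : List Bool) (ψ : St Q) (F) :
    run (C ++ D) z ψ F = run C z ψ (fun z ψ => run D z ψ F) := by
  induction C generalizing z ψ with
  | nil => rfl
  | cons I C ih => simp only [List.cons_append, run_cons, ih]

lemma run_mono (C : List (Instr Q)) (z : List Bool) (ψ : St Q) {F G : List Bool → St Q → ℝ}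
    (h : ∀ z ψ, F z ψ ≤ G z ψ) : run C z ψ F ≤ run C z ψ G := by
  induction C generalizing z ψ with
  | nil => exact h z ψ
  | cons I C ih =>
    simp only [run_cons]
    exact List.sum_le_sum fun b _ => ih _ _

lemma run_congr (C : List (Instr Q)) (z : List Bool) (ψ : St Q) {F G : List Bool → St Q → ℝ}
    (h : ∀ z ψ, F z ψ = G z ψ) : run C z ψ F = run C z ψ G := by
  have : F = G := by funext z ψ; exact h z ψ
  rw [this]

lemma run_add (C : List (Instr Q)) (z : List Bool) (ψ : St Q) (F G : List Bool → St Q → ℝ) :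
    run C z ψ (fun z ψ => F z ψ + G z ψ) = run C z ψ F + run C z ψ G := by
  induction C generalizing z ψ with
  | nil => rfl
  | cons I C ih => simp only [run_cons, ih, List.sum_map_add]

lemma run_mul_left (C : List (Instr Q)) (z : List Bool) (ψ : St Q) (c : ℝ)
    (F : List Bool → St Q → ℝ) :
    run C z ψ (fun z ψ => c * F z ψ) = c * run C z ψ F := by
  induction C generalizing z ψ with
  | nil => rfl
  | cons I C ih => simp only [run_cons, ih, List.sum_map_mul_left]

lemma run_zero (C : List (Instr Q)) (z : List Bool) (ψ : St Q) :
    run C z ψ (fun _ _ => 0) = 0 := by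
  simpa using run_mul_left C z ψ 0 (fun _ _ => 0)

lemma run_sum {ι : Type*} (s : Finset ι) (C : List (Instr Q)) (z : List Bool) (ψ : St Q)
    (F : ι → List Bool → St Q → ℝ) :
    run C z ψ (fun z ψ => ∑ i ∈ s, F i z ψ) = ∑ i ∈ s, run C z ψ (F i) := by
  classical
  induction s using Finset.induction_on with
  | empty => simpa using run_zero C z ψ
  | insert a s ha ih => simp only [Finset.sum_insert ha, run_add, ih]

lemma run_nonneg (C : List (Instr Q)) (z : List Bool) (ψ : St Q) {F : List Bool → St Q → ℝ}
    (h : ∀ z ψ, 0 ≤ F z ψ) : 0 ≤ run C z ψ F := by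
  rw [← run_zero C z ψ]
  exact run_mono C z ψ h

/-- No branch emits anything. -/
def Silent (C : List (Instr Q)) : Prop := ∀ I ∈ C, ∀ b ∈ I, b.1 = []

/-- What was output before can be moved into the final functional; this gives a silent program a
distribution that does not depend on its position in a longer program. -/
lemma run_silent {C : List (Instr Q)} (hC : Silent C) (z : List Bool) (ψ : St Q) (F) :
    run C z ψ F = run C [] ψ (fun _ ψ => F z ψ) := by
  suffices h : ∀ z' ψ, run C z' ψ (fun _ ψ => F z ψ) = run C z ψ F from (h _ _).symm
  induction C generalizing ψ with
  | nil => intro z' ψ; rfl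
  | cons I C ih =>
    intro z' ψ
    simp only [run_cons]
    congr 1
    refine List.map_congr_left fun b hb => ?_
    have hb' : b.1 = [] := hC I (by simp) b hb
    rw [hb', List.append_nil, List.append_nil]
    exact ih (fun I hI => hC I (by simp [hI])) ψ z' _

/-- A quadratic functional: it scales with the square of the state. -/
def Homog (F : List Bool → St Q → ℝ) : Prop :=
  ∀ z (c : ℂ) ψ, F z (c • ψ) = ‖c‖ ^ 2 * F z ψ

lemma Homog.run {F : List Bool → St Q → ℝ} (hF : Homog F) (C : List (Instr Q)) :
    Homog fun z ψ => run C z ψ F := by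
  induction C with
  | nil => exact hF
  | cons I C ih =>
    intro z c ψ
    simp only [run_cons, map_smul]
    rw [← List.sum_map_mul_left]
    congr 1
    exact List.map_congr_left fun b _ => ih _ _ _

/-- The quasi-triangle inequality of quadratic functionals. -/
def QuasiTri (κ : ℝ) (F : List Bool → St Q → ℝ) : Prop :=
  ∀ z ψ φ, F z (ψ + φ) ≤ (1 + κ) * F z ψ + (1 + κ⁻¹) * F z φ

/-- Branches act linearly, so the inequality holds branch by branch and survives the sum. The
constants do not change: an error made once is charged once, however many gates follow. -/
lemma QuasiTri.run {κ : ℝ} {F : List Bool → St Q → ℝ} (hF : QuasiTri κ F)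
    (C : List (Instr Q)) : QuasiTri κ fun z ψ => run C z ψ F := by
  induction C with
  | nil => exact hF
  | cons I C ih =>
    intro z ψ φ
    simp only [run_cons, map_add]
    rw [← List.sum_map_mul_left, ← List.sum_map_mul_left, ← List.sum_map_add]
    exact List.sum_le_sum fun b _ => ih _ _ _

variable [Fintype Q] [DecidableEq Q]

/-- The squared norm of a state. -/
def nsq (ψ : St Q) : ℝ := ∑ w, ‖ψ w‖ ^ 2

lemma nsq_nonneg (ψ : St Q) : 0 ≤ nsq ψ := Finset.sum_nonneg fun _ _ => by positivity

/-- The cross term 2‖a‖‖b‖ is at most κ‖a‖² + κ⁻¹‖b‖². A small κ keeps the main term almost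
unchanged at the price of a large factor on the error. -/
lemma norm_add_sq_quasi {κ : ℝ} (hκ : 0 < κ) (a b : ℂ) :
    ‖a + b‖ ^ 2 ≤ (1 + κ) * ‖a‖ ^ 2 + (1 + κ⁻¹) * ‖b‖ ^ 2 := by
  have h1 : ‖a + b‖ ^ 2 ≤ (‖a‖ + ‖b‖) ^ 2 := by gcongr; exact norm_add_le a b
  have h2 : 0 ≤ κ⁻¹ * (κ * ‖a‖ - ‖b‖) ^ 2 := by positivity
  have h3 : κ⁻¹ * (κ * ‖a‖ - ‖b‖) ^ 2 = κ * ‖a‖ ^ 2 - 2 * (‖a‖ * ‖b‖) + κ⁻¹ * ‖b‖ ^ 2 := by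
    field_simp
    ring
  nlinarith

/-- The expectation of an observable that is diagonal in the computational basis. -/
def dia (H : List Bool → (Q → Bool) → ℝ) (z : List Bool) (ψ : St Q) : ℝ :=
  ∑ w, ‖ψ w‖ ^ 2 * H z w

lemma dia_quasiTri {κ : ℝ} (hκ : 0 < κ) {H : List Bool → (Q → Bool) → ℝ}
    (hH : ∀ z w, 0 ≤ H z w) : QuasiTri κ (dia H) := by
  intro z ψ φ
  simp only [dia, Finset.mul_sum]
  rw [← Finset.sum_add_distrib]
  refine Finset.sum_le_sum fun w _ => ?_
  have := mul_le_mul_of_nonneg_right (norm_add_sq_quasi hκ (ψ w) (φ w)) (hH z w)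
  simp only [Pi.add_apply]
  linarith

lemma dia_homog (H : List Bool → (Q → Bool) → ℝ) : Homog (dia H) := by
  intro z c ψ
  simp only [dia, Finset.mul_sum, Pi.smul_apply, smul_eq_mul, norm_mul, mul_pow, mul_assoc]

lemma dia_one (z : List Bool) (ψ : St Q) : dia (fun _ _ => 1) z ψ = nsq ψ := by
  simp [dia, nsq]

/-- An instruction that preserves the total squared norm. -/
def Iso (I : Instr Q) : Prop := ∀ ψ, (I.map fun b => nsq (b.2 ψ)).sum = nsq ψ

lemma run_nsq {C : List (Instr Q)} (hC : ∀ I ∈ C, Iso I) (z : List Bool) (ψ : St Q) :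
    run C z ψ (fun _ ψ => nsq ψ) = nsq ψ := by
  induction C generalizing z ψ with
  | nil => rfl
  | cons I C ih =>
    rw [run_cons, ← hC I (by simp) ψ]
    congr 1
    exact List.map_congr_left fun b _ => ih (fun I hI => hC I (by simp [hI])) _ _

end Run

/-! ### Elementary operators -/

section Ops

variable {Q : Type}

/-- `U` on the qubits `t`, the identity elsewhere. -/
def applyU {r : ℕ} (t : Fin r ↪ Q) (U : Matrix (Fin r → Bool) (Fin r → Bool) ℂ) :
    St Q →ₗ[ℂ] St Q where
  toFun ψ w := ∑ b : Fin r → Bool, U (fun j => w (t j)) b * ψ (Function.extend t b w)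
  map_add' ψ φ := by funext w; simp [mul_add, Finset.sum_add_distrib]
  map_smul' c ψ := by
    funext w
    simp only [Pi.smul_apply, smul_eq_mul, RingHom.id_apply, Finset.mul_sum]
    exact Finset.sum_congr rfl fun b _ => by ring

lemma applyU_apply {r : ℕ} (t : Fin r ↪ Q) (U : Matrix (Fin r → Bool) (Fin r → Bool) ℂ)
    (ψ : St Q) (w : Q → Bool) : applyU t U ψ w =
      ∑ b : Fin r → Bool, U (fun j => w (t j)) b * ψ (Function.extend t b w) := rfl

/-- Multiplication by a function of the basis state. -/
def diagOp (θ : (Q → Bool) → ℂ) : St Q →ₗ[ℂ] St Q where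
  toFun ψ w := θ w * ψ w
  map_add' ψ φ := by funext w; simp [mul_add]
  map_smul' c ψ := by funext w; simp; ring

@[simp] lemma diagOp_apply (θ : (Q → Bool) → ℂ) (ψ : St Q) (w : Q → Bool) :
    diagOp θ ψ w = θ w * ψ w := rfl

/-- Composition with a map of the basis states. -/
def permOp (σ : (Q → Bool) → (Q → Bool)) : St Q →ₗ[ℂ] St Q where
  toFun ψ w := ψ (σ w)
  map_add' _ _ := rfl
  map_smul' _ _ := rfl

@[simp] lemma permOp_apply (σ : (Q → Bool) → (Q → Bool)) (ψ : St Q) (w : Q → Bool) :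
    permOp σ ψ w = ψ (σ w) := rfl

/-- The phase of the oracle at the query `x`, `p`. -/
def queryPhase {M N : ℕ} (f : Fin M → Fin N) (x p : ℕ) : ℂ :=
  if hx : x < M then
    if p < N then
      Complex.exp (2 * Real.pi * Complex.I * ((p : ℂ) * ((f ⟨x, hx⟩ : ℕ) : ℂ)) / (N : ℂ))
    else 1
  else 1

lemma norm_exp_two_pi_I (x : ℝ) : ‖Complex.exp (2 * Real.pi * Complex.I * x)‖ = 1 := by
  rw [show (2 * Real.pi * Complex.I * x : ℂ) = ((2 * Real.pi * x : ℝ) : ℂ) * Complex.I by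
    push_cast; ring]
  exact Complex.norm_exp_ofReal_mul_I _

lemma queryPhase_of_lt {M N : ℕ} (f : Fin M → Fin N) {x p : ℕ} (hx : x < M) (hp : p < N) :
    queryPhase f x p =
      Complex.exp (2 * Real.pi * Complex.I * ((p * (f ⟨x, hx⟩ : ℕ) / N : ℝ) : ℂ)) := by
  rw [queryPhase, dif_pos hx, if_pos hp]
  congr 1
  push_cast
  ring

lemma norm_queryPhase {M N : ℕ} (f : Fin M → Fin N) (x p : ℕ) : ‖queryPhase f x p‖ = 1 := by
  by_cases hx : x < M
  · by_cases hp : p < N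
    · rw [queryPhase_of_lt f hx hp, norm_exp_two_pi_I]
    · simp [queryPhase, hp]
  · simp [queryPhase, hx]

/-- The oracle with query registers `t`. -/
def applyQ {M N : ℕ} (f : Fin M → Fin N)
    (t : Fin (Nat.clog 2 M) ⊕ Fin (Nat.clog 2 N) ↪ Q) : St Q →ₗ[ℂ] St Q :=
  diagOp fun w => queryPhase f (Nat.ofBits fun j => w (t (Sum.inl j)))
    (Nat.ofBits fun j => w (t (Sum.inr j)))

variable [DecidableEq Q]

/-- The projection on the basis states whose qubit `i` has value `b`. -/
def projOp (i : Q) (b : Bool) : St Q →ₗ[ℂ] St Q := diagOp fun w => if w i = b then 1 else 0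

/-- The operator `|0⟩⟨b|` on the qubit `i`. -/
def resetOp (i : Q) (b : Bool) : St Q →ₗ[ℂ] St Q where
  toFun ψ w := if w i = false then ψ (Function.update w i b) else 0
  map_add' ψ φ := by
    funext w
    by_cases h : w i = false <;> simp [h]
  map_smul' c ψ := by
    funext w
    by_cases h : w i = false <;> simp [h]

lemma resetOp_apply (i : Q) (b : Bool) (ψ : St Q) (w : Q → Bool) :
    resetOp i b ψ w = if w i = false then ψ (Function.update w i b) else 0 := rfl

variable [Fintype Q]

lemma extend_extend {T V : Type} (t : T ↪ Q) (b c : T → V) (w : Q → V) :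
    Function.extend t c (Function.extend t b w) = Function.extend t c w := by
  funext q
  by_cases h : ∃ j, t j = q
  · obtain ⟨j, rfl⟩ := h
    simp [t.injective.extend_apply]
  · simp [Function.extend_apply' _ _ _ h]

lemma extend_self {T V : Type} (t : T ↪ Q) (w : Q → V) :
    Function.extend t (fun j => w (t j)) w = w := by
  funext q
  by_cases h : ∃ j, t j = q
  · obtain ⟨j, rfl⟩ := h
    simp [t.injective.extend_apply]
  · simp [Function.extend_apply' _ _ _ h]

/-- Exchanging `b` with the restriction of `w` to `t` is an involution of the pairs (w, b). The
identity replaces conditioning on the coordinates outside `t`: it is used both for amplitudes, with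
`V = Bool`, and for random functions. -/
lemma sum_extend {T V : Type} [Fintype T] [DecidableEq T] [Fintype V] (t : T ↪ Q) (h : (Q → V) → ℝ) :
    ∑ w : Q → V, ∑ b : T → V, h (Function.extend t b w) = Fintype.card (T → V) * ∑ w, h w := by
  let e : (Q → V) × (T → V) → (Q → V) × (T → V) :=
    fun p => (Function.extend t p.2 p.1, fun j => p.1 (t j))
  have he : Function.Involutive e := by
    rintro ⟨w, b⟩
    simp only [e, Prod.mk.injEq]
    refine ⟨?_, ?_⟩
    · rw [extend_extend, extend_self]
    · funext j; simp [t.injective.extend_apply]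
  rw [← Fintype.sum_prod_type' (fun w b => h (Function.extend t b w))]
  rw [← Equiv.sum_comp (Function.Involutive.toPerm e he)
    (fun p : (Q → V) × (T → V) => h (Function.extend t p.2 p.1))]
  have : ∀ p : (Q → V) × (T → V),
      h (Function.extend t (Function.Involutive.toPerm e he p).2 (Function.Involutive.toPerm e he p).1) = h p.1 := by
    rintro ⟨w, b⟩
    change h (Function.extend t (fun j => w (t j)) (Function.extend t b w)) = h w
    rw [extend_extend, extend_self]
  simp only [this]
  rw [Fintype.sum_prod_type]
  simp only [Finset.sum_const, Finset.card_univ, nsmul_eq_mul, Finset.mul_sum]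

lemma nsq_mulVec_unitary {ι : Type*} [Fintype ι] [DecidableEq ι]
    (U : Matrix.unitaryGroup ι ℂ) (x : ι → ℂ) :
    ∑ i, ‖∑ j, U.1 i j * x j‖ ^ 2 = ∑ i, ‖x i‖ ^ 2 := by
  have h : star (U.1.mulVec x) ⬝ᵥ (U.1.mulVec x) = star x ⬝ᵥ x := by
    rw [Matrix.star_mulVec, Matrix.dotProduct_mulVec, Matrix.vecMul_vecMul,
      ← Matrix.star_eq_conjTranspose, Matrix.mem_unitaryGroup_iff'.1 U.2, Matrix.vecMul_one]
  have key : ∀ y : ι → ℂ, star y ⬝ᵥ y = ((∑ i, ‖y i‖ ^ 2 : ℝ) : ℂ) := by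
    intro y
    simp only [dotProduct, Pi.star_apply, RCLike.star_def]
    push_cast
    exact Finset.sum_congr rfl fun i _ => by rw [Complex.conj_mul']
  rw [key, key] at h
  exact_mod_cast h

/-- By `sum_extend` it suffices to compare norms on each fibre where the bits outside `t` are fixed,
and there the operator is the matrix itself. -/
lemma nsq_applyU {r : ℕ} (t : Fin r ↪ Q) (U : Matrix.unitaryGroup (Fin r → Bool) ℂ)
    (ψ : St Q) : nsq (applyU t U.1 ψ) = nsq ψ := by
  have h2 : (Fintype.card (Fin r → Bool) : ℝ) ≠ 0 := by
    exact_mod_cast Fintype.card_ne_zero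
  refine mul_left_cancel₀ h2 ?_
  rw [nsq, nsq, ← sum_extend t, ← sum_extend t]
  refine Finset.sum_congr rfl fun w _ => ?_
  rw [← nsq_mulVec_unitary U fun b => ψ (Function.extend t b w)]
  refine Finset.sum_congr rfl fun b _ => ?_
  simp only [applyU_apply, t.injective.extend_apply, extend_extend]

lemma nsq_diagOp {θ : (Q → Bool) → ℂ} (hθ : ∀ w, ‖θ w‖ = 1) (ψ : St Q) :
    nsq (diagOp θ ψ) = nsq ψ := by
  simp [nsq, hθ]

lemma nsq_permOp {σ : (Q → Bool) → (Q → Bool)} (hσ : Function.Involutive σ) (ψ : St Q) :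
    nsq (permOp σ ψ) = nsq ψ :=
  Equiv.sum_comp hσ.toPerm (fun w => ‖ψ w‖ ^ 2)

lemma sum_split_bit (i : Q) (h : (Q → Bool) → ℝ) :
    ∑ w, h w = ∑ w : Q → Bool, if w i = false then
      h (Function.update w i false) + h (Function.update w i true) else 0 := by
  have hflip : Function.Involutive fun w : Q → Bool => Function.update w i (!w i) := by
    intro w
    simp
  have h1 : ∑ w : Q → Bool, (if w i = true then h w else 0) =
      ∑ w : Q → Bool, if w i = false then h (Function.update w i true) else 0 := by
    rw [← Equiv.sum_comp hflip.toPerm]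
    refine Finset.sum_congr rfl fun w _ => ?_
    cases hw : w i <;> simp [hw]
  have h2 : ∀ w : Q → Bool, h w = (if w i = true then h w else 0) +
      if w i = false then h (Function.update w i false) else 0 := by
    intro w
    cases hw : w i
    · simp [← hw]
    · simp
  calc ∑ w, h w = ∑ w : Q → Bool, ((if w i = true then h w else 0) +
      if w i = false then h (Function.update w i false) else 0) :=
        Finset.sum_congr rfl fun w _ => h2 w
    _ = _ := by
      rw [Finset.sum_add_distrib, h1, ← Finset.sum_add_distrib]
      refine Finset.sum_congr rfl fun w _ => ?_
      cases hw : w i <;> simp [add_comm]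

lemma nsq_projOp (i : Q) (ψ : St Q) :
    nsq (projOp i false ψ) + nsq (projOp i true ψ) = nsq ψ := by
  simp only [nsq]
  rw [← Finset.sum_add_distrib]
  refine Finset.sum_congr rfl fun w _ => ?_
  cases hw : w i <;> simp [projOp, hw]

lemma nsq_resetOp (i : Q) (ψ : St Q) :
    nsq (resetOp i false ψ) + nsq (resetOp i true ψ) = nsq ψ := by
  simp only [nsq]
  rw [← Finset.sum_add_distrib, sum_split_bit i (fun w => ‖ψ w‖ ^ 2)]
  refine Finset.sum_congr rfl fun w _ => ?_
  cases hw : w i <;> simp [resetOp_apply, hw]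

end Ops

/-! ### Gates on a memory indexed by an arbitrary type -/

/-- The gates of a circuit whose memory qubits are indexed by `Q`. -/
inductive GGate (M N : ℕ) (Q : Type) : Type
  | unitary (r : ℕ) (hr : r ≤ 3) (t : Fin r ↪ Q)
      (U : Matrix.unitaryGroup (Fin r → Bool) ℂ) : GGate M N Q
  | query (t : Fin (Nat.clog 2 M) ⊕ Fin (Nat.clog 2 N) ↪ Q) : GGate M N Q
  | output (i : Q) : GGate M N Q
  | reset (i : Q) : GGate M N Q

namespace GGate

variable {M N : ℕ} {Q Q' : Type}

/-- Relabelling of the qubits. -/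
def map (ι : Q ↪ Q') : GGate M N Q → GGate M N Q'
  | unitary r hr t U => unitary r hr (t.trans ι) U
  | query t => query (t.trans ι)
  | output i => output (ι i)
  | reset i => reset (ι i)

/-- The gates of `Defs` are the gates on `Fin S`. -/
def toGate {S : ℕ} : GGate M N (Fin S) → Gate M N S
  | unitary r hr t U => .unitary r hr t U
  | query t => .query t
  | output i => .output i
  | reset i => .reset i

/-- The gates of `Defs` are the gates on `Fin S`. -/
def ofGate {S : ℕ} : Gate M N S → GGate M N (Fin S)
  | .unitary r hr t U => unitary r hr t U
  | .query t => query t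
  | .output i => output i
  | .reset i => reset i

variable [DecidableEq Q]

/-- The action of a gate, for the oracle `f`. -/
def instr (f : Fin M → Fin N) : GGate M N Q → Instr Q
  | unitary _ _ t U => pureI (applyU t U.1)
  | query t => pureI (applyQ f t)
  | output i => [([false], projOp i false), ([true], projOp i true)]
  | reset i => [([], resetOp i false), ([], resetOp i true)]

@[simp] lemma instr_unitary (f : Fin M → Fin N) (r hr) (t : Fin r ↪ Q) (U) :
    (unitary r hr t U : GGate M N Q).instr f = pureI (applyU t U.1) := rfl

@[simp] lemma instr_query (f : Fin M → Fin N) (t) :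
    (query t : GGate M N Q).instr f = pureI (applyQ f t) := rfl

@[simp] lemma instr_output (f : Fin M → Fin N) (i : Q) :
    (output i : GGate M N Q).instr f = [([false], projOp i false), ([true], projOp i true)] := rfl

@[simp] lemma instr_reset (f : Fin M → Fin N) (i : Q) :
    (reset i : GGate M N Q).instr f = [([], resetOp i false), ([], resetOp i true)] := rfl

lemma instr_iso [Fintype Q] (f : Fin M → Fin N) (g : GGate M N Q) : Iso (g.instr f) := by
  intro ψ
  cases g with
  | unitary r hr t U => simpa [instr, pureI] using nsq_applyU t U ψ
  | query t => simpa [instr, pureI, applyQ] using nsq_diagOp (fun _ => norm_queryPhase f _ _) ψ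
  | output i => simpa [instr] using nsq_projOp i ψ
  | reset i => simpa [instr] using nsq_resetOp i ψ

end GGate

open Classical in
-- The success probability becomes one instance of a run with an arbitrary final functional. The
-- generality is needed for induction and composition: the rest of a program is itself such a
-- functional.
lemma probFrom_eq_run {M N S : ℕ} (f : Fin M → Fin N) (R : List Bool → Prop)
    (C : Circuit M N S) (z : List Bool) (ψ : St (Fin S)) :
    probFrom f R C z ψ = run (C.map fun g => (GGate.ofGate g).instr f) z ψ
      (dia fun z _ => if R z then 1 else 0) := by
  induction C generalizing z ψ with
  | nil =>
    by_cases h : R z <;> simp [probFrom, h, dia, normSqState]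
  | cons g C ih =>
    cases g with
    | unitary r hr t U =>
      rw [List.map_cons, show GGate.ofGate (Gate.unitary r hr t U : Gate M N S) =
        .unitary r hr t U from rfl, GGate.instr_unitary, run_pureI_cons, ← ih]
      rfl
    | query t =>
      rw [List.map_cons, show GGate.ofGate (Gate.query t : Gate M N S) = .query t from rfl,
        GGate.instr_query, run_pureI_cons, ← ih, probFrom]
      congr 1
      funext w
      simp only [applyQuery, applyQ, diagOp_apply, queryPhase]
      split_ifs <;> simp
    | output i =>
      rw [List.map_cons, show GGate.ofGate (Gate.output i : Gate M N S) = .output i from rfl,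
        GGate.instr_output, run_cons, probFrom]
      simp only [List.map_cons, ← ih, List.map_nil, List.sum_cons, List.sum_nil,
        Fintype.sum_bool]
      rw [add_zero, add_comm]
      congr 2 <;> (funext w; simp [projBit, projOp])
    | reset i =>
      rw [List.map_cons, show GGate.ofGate (Gate.reset i : Gate M N S) = .reset i from rfl,
        GGate.instr_reset, run_cons, probFrom]
      simp only [List.map_cons, ← ih, List.map_nil, List.sum_cons, List.sum_nil,
        Fintype.sum_bool, List.append_nil]
      rw [add_zero, add_comm]
      rfl

/-! ### Embedding a memory into a larger one -/

section Lift

variable {M N : ℕ} {Q Q' : Type}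

open Classical in
/-- The state of the larger memory whose additional qubits are `|0⟩`. -/
def lift (ι : Q ↪ Q') : St Q →ₗ[ℂ] St Q' where
  toFun ψ w := if ∀ q, q ∉ Set.range ι → w q = false then ψ (fun q => w (ι q)) else 0
  map_add' ψ φ := by
    funext w
    simp only [Pi.add_apply]
    split_ifs <;> simp
  map_smul' c ψ := by
    funext w
    simp only [Pi.smul_apply, RingHom.id_apply]
    split_ifs <;> simp

lemma lift_of_clean (ι : Q ↪ Q') (ψ : St Q) {w : Q' → Bool}
    (h : ∀ q, q ∉ Set.range ι → w q = false) : lift ι ψ w = ψ (fun q => w (ι q)) :=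
  if_pos h

lemma lift_of_not_clean (ι : Q ↪ Q') (ψ : St Q) {w : Q' → Bool}
    (h : ¬ ∀ q, q ∉ Set.range ι → w q = false) : lift ι ψ w = 0 :=
  if_neg h

lemma extend_trans_comp (ι : Q ↪ Q') {r : ℕ} (t : Fin r ↪ Q) (b : Fin r → Bool) (w : Q' → Bool) :
    (fun q => Function.extend (t.trans ι) b w (ι q)) =
      Function.extend t b fun q => w (ι q) := by
  funext q
  by_cases h : ∃ j, t j = q
  · obtain ⟨j, rfl⟩ := h
    rw [t.injective.extend_apply]
    exact (t.trans ι).injective.extend_apply b w j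
  · rw [Function.extend_apply' _ _ _ h, Function.extend_apply']
    rintro ⟨j, hj⟩
    exact h ⟨j, ι.injective hj⟩

lemma extend_trans_of_notMem (ι : Q ↪ Q') {r : ℕ} (t : Fin r ↪ Q) (b : Fin r → Bool)
    (w : Q' → Bool) {q : Q'} (hq : q ∉ Set.range ι) :
    Function.extend (t.trans ι) b w q = w q := by
  rw [Function.extend_apply']
  rintro ⟨j, hj⟩
  exact hq ⟨t j, hj⟩

lemma applyU_lift (ι : Q ↪ Q') {r : ℕ} (t : Fin r ↪ Q) (U) (ψ : St Q) :
    applyU (t.trans ι) U (lift ι ψ) = lift ι (applyU t U ψ) := by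
  funext w
  by_cases h : ∀ q, q ∉ Set.range ι → w q = false
  · rw [lift_of_clean ι _ h, applyU_apply, applyU_apply]
    refine Finset.sum_congr rfl fun b _ => ?_
    rw [lift_of_clean ι _ fun q hq => by rw [extend_trans_of_notMem ι t b w hq, h q hq],
      extend_trans_comp]
    rfl
  · rw [lift_of_not_clean ι _ h, applyU_apply]
    refine Finset.sum_eq_zero fun b _ => ?_
    rw [lift_of_not_clean, mul_zero]
    intro h'
    exact h fun q hq => by rw [← extend_trans_of_notMem ι t b w hq, h' q hq]

lemma diagOp_lift (ι : Q ↪ Q') (θ : (Q → Bool) → ℂ) (ψ : St Q) :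
    diagOp (fun w => θ fun q => w (ι q)) (lift ι ψ) = lift ι (diagOp θ ψ) := by
  funext w
  by_cases h : ∀ q, q ∉ Set.range ι → w q = false
  · rw [lift_of_clean ι _ h, diagOp_apply, lift_of_clean ι _ h, diagOp_apply]
  · rw [lift_of_not_clean ι _ h, diagOp_apply, lift_of_not_clean ι _ h, mul_zero]

variable [DecidableEq Q] [DecidableEq Q']

lemma resetOp_lift (ι : Q ↪ Q') (i : Q) (b : Bool) (ψ : St Q) :
    resetOp (ι i) b (lift ι ψ) = lift ι (resetOp i b ψ) := by
  funext w
  have hne : ∀ q, q ∉ Set.range ι → q ≠ ι i := fun q hq h => hq ⟨i, h.symm⟩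
  by_cases h : ∀ q, q ∉ Set.range ι → w q = false
  · rw [lift_of_clean ι _ h, resetOp_apply, resetOp_apply]
    rw [lift_of_clean ι _ fun q hq => by rw [Function.update_of_ne (hne q hq), h q hq]]
    congr 2
    funext q
    by_cases hq : q = i
    · subst hq; simp
    · rw [Function.update_of_ne hq, Function.update_of_ne fun h => hq (ι.injective h)]
  · rw [lift_of_not_clean ι _ h, resetOp_apply, lift_of_not_clean]
    · simp
    · intro h'
      exact h fun q hq => by rw [← h' q hq, Function.update_of_ne (hne q hq)]

/-- Relabelled gates never touch the additional qubits, which stay `|0⟩` in every branch. -/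
lemma run_map_lift (f : Fin M → Fin N) (ι : Q ↪ Q') (C : List (GGate M N Q)) (z : List Bool)
    (ψ : St Q) (F) :
    run (C.map fun g => (g.map ι).instr f) z (lift ι ψ) F =
      run (C.map fun g => g.instr f) z ψ fun z ψ => F z (lift ι ψ) := by
  induction C generalizing z ψ with
  | nil => rfl
  | cons g C ih =>
    cases g with
    | unitary r hr t U =>
      rw [List.map_cons, List.map_cons, GGate.map, GGate.instr_unitary, GGate.instr_unitary,
        run_pureI_cons, run_pureI_cons, applyU_lift, ih]
    | query t =>
      rw [List.map_cons, List.map_cons, GGate.map, GGate.instr_query, GGate.instr_query,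
        run_pureI_cons, run_pureI_cons, ← ih]
      exact congrArg (fun ψ => run _ z ψ F) (diagOp_lift ι (fun w => queryPhase f
        (Nat.ofBits fun j => w (t (Sum.inl j))) (Nat.ofBits fun j => w (t (Sum.inr j)))) ψ)
    | output i =>
      have : ∀ b, projOp (ι i) b (lift ι ψ) = lift ι (projOp i b ψ) := fun b =>
        diagOp_lift ι (fun w => if w i = b then 1 else 0) ψ
      rw [List.map_cons, List.map_cons, GGate.map, GGate.instr_output, GGate.instr_output,
        run_cons, run_cons]
      simp only [List.map_cons, List.map_nil, this, ih]
    | reset i =>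
      rw [List.map_cons, List.map_cons, GGate.map, GGate.instr_reset, GGate.instr_reset,
        run_cons, run_cons]
      simp only [List.map_cons, List.map_nil, resetOp_lift, ih]

variable [Fintype Q] [Fintype Q']

lemma sum_lift (ι : Q ↪ Q') (ψ : St Q) (H : (Q' → Bool) → ℝ) :
    ∑ w, ‖lift ι ψ w‖ ^ 2 * H w =
      ∑ w, ‖ψ w‖ ^ 2 * H (Function.extend ι w fun _ => false) := by
  classical
  have hinj : Function.Injective fun w : Q → Bool => Function.extend ι w fun _ => false := by
    intro w w' h
    funext q
    have := congrFun h (ι q)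
    simpa [ι.injective.extend_apply] using this
  have hclean : ∀ w : Q → Bool, ∀ q, q ∉ Set.range ι →
      Function.extend ι w (fun _ => false) q = false := by
    intro w q hq
    rw [Function.extend_apply']
    exact hq
  rw [← Finset.sum_subset (Finset.subset_univ
    (Finset.univ.image fun w : Q → Bool => Function.extend ι w fun _ => false))]
  · rw [Finset.sum_image fun a _ b _ h => hinj h]
    refine Finset.sum_congr rfl fun w _ => ?_
    rw [lift_of_clean ι ψ (hclean w)]
    simp [ι.injective.extend_apply]
  · intro w _ hw
    rw [lift_of_not_clean]
    · simp
    · intro h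
      apply hw
      simp only [Finset.mem_image, Finset.mem_univ, true_and]
      refine ⟨fun q => w (ι q), ?_⟩
      funext q
      by_cases hq : q ∈ Set.range ι
      · obtain ⟨p, rfl⟩ := hq
        simp [ι.injective.extend_apply]
      · rw [h q hq, Function.extend_apply']
        exact hq

end Lift

/-- The basis state all of whose qubits are `|0⟩`. -/
def initSt (Q : Type) [DecidableEq Q] [Fintype Q] : St Q := Pi.single (fun _ => false) 1

lemma lift_initSt {Q Q' : Type} [DecidableEq Q] [DecidableEq Q'] [Fintype Q] [Fintype Q']
    (ι : Q ↪ Q') : lift ι (initSt Q) = initSt Q' := by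
  funext w
  by_cases hw : w = fun _ => false
  · subst hw
    rw [lift_of_clean ι _ (by simp)]
    simp [initSt]
  · rw [show initSt Q' w = 0 from Pi.single_eq_of_ne hw 1]
    by_cases h : ∀ q, q ∉ Set.range ι → w q = false
    · rw [lift_of_clean ι _ h, initSt, Pi.single_eq_of_ne]
      intro h'
      apply hw
      funext q
      by_cases hq : q ∈ Set.range ι
      · obtain ⟨p, rfl⟩ := hq
        exact congrFun h' p
      · exact h q hq
    · exact lift_of_not_clean ι _ h

lemma nsq_initSt (Q : Type) [DecidableEq Q] [Fintype Q] : nsq (initSt Q) = 1 := by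
  rw [nsq, Finset.sum_eq_single (fun _ => false)]
  · simp [initSt]
  · intro w _ hw
    simp [initSt, Pi.single_eq_of_ne hw]
  · simp

/-! ### Reversible classical steps -/

/-- The step that adds `φ` of some bits to another bit, the first of the list `t`. -/
structure PStep (Q : Type) where
  r : ℕ
  hr : r + 1 ≤ 3
  t : Fin (r + 1) → Q
  φ : (Fin r → Bool) → Bool

section PStep

variable {Q : Type} [DecidableEq Q] {M N : ℕ}

namespace PStep

/-- The bits of a step are at different places. -/
abbrev Valid (s : PStep Q) : Prop := Function.Injective s.t

/-- The action of a step on the basis states. -/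
def act (s : PStep Q) (w : Q → Bool) : Q → Bool :=
  Function.update w (s.t 0) (xor (w (s.t 0)) (s.φ fun i => w (s.t i.succ)))

lemma act_involutive {s : PStep Q} (hs : s.Valid) : Function.Involutive s.act := by
  intro w
  have h : (fun i : Fin s.r => Function.update w (s.t 0)
      (xor (w (s.t 0)) (s.φ fun i => w (s.t i.succ))) (s.t i.succ)) =
      fun i => w (s.t i.succ) := by
    funext i
    rw [Function.update_of_ne]
    intro h
    exact Fin.succ_ne_zero i (hs h)
  simp only [act, h, Function.update_self, Function.update_idem]
  simp

lemma act_of_ne (s : PStep Q) (w : Q → Bool) {q : Q} (hq : q ≠ s.t 0) : s.act w q = w q :=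
  Function.update_of_ne hq _ _

lemma act_update (s : PStep Q) (w : Q → Bool) {q : Q} (hq : q ∉ Set.range s.t) (b : Bool) :
    s.act (Function.update w q b) = Function.update (s.act w) q b := by
  have h : ∀ j, s.t j ≠ q := fun j h => hq ⟨j, h⟩
  simp only [act, Function.update_of_ne (h _)]
  rw [Function.update_comm (h 0).symm]

/-- The action of a step on its own bits. -/
def flip (s : PStep Q) (b : Fin (s.r + 1) → Bool) : Fin (s.r + 1) → Bool :=
  Function.update b 0 (xor (b 0) (s.φ fun i => b i.succ))

lemma flip_involutive (s : PStep Q) : Function.Involutive s.flip := by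
  intro b
  have h : (fun i : Fin s.r => Function.update b 0
      (xor (b 0) (s.φ fun i => b i.succ)) i.succ) = fun i => b i.succ := by
    funext i
    rw [Function.update_of_ne (Fin.succ_ne_zero i)]
  simp only [flip, h, Function.update_self, Function.update_idem]
  simp

/-- The permutation matrix of a step. -/
def matrix (s : PStep Q) : Matrix.unitaryGroup (Fin (s.r + 1) → Bool) ℂ :=
  ⟨Matrix.of fun b c => if c = s.flip b then 1 else 0, by
    rw [Matrix.mem_unitaryGroup_iff]
    ext b d
    simp only [Matrix.mul_apply, Matrix.star_apply, Matrix.of_apply, Matrix.one_apply]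
    rw [Finset.sum_eq_single (s.flip b)]
    · simp only [if_true, one_mul, s.flip_involutive.injective.eq_iff]
      by_cases h : b = d <;> simp [h]
    · intro c _ hc
      simp [hc]
    · simp⟩

lemma matrix_apply (s : PStep Q) (b c) :
    s.matrix.1 b c = if c = s.flip b then 1 else 0 := rfl

open Classical in
/-- The gate that performs a step. -/
def gate (s : PStep Q) : GGate M N Q :=
  if h : s.Valid then .unitary (s.r + 1) s.hr ⟨s.t, h⟩ s.matrix
  else .unitary 0 (by omega) ⟨fun i => i.elim0, fun i => i.elim0⟩ 1

lemma gate_instr (f : Fin M → Fin N) {s : PStep Q} (hs : s.Valid) :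
    (s.gate : GGate M N Q).instr f = pureI (permOp s.act) := by
  rw [gate, dif_pos hs, GGate.instr_unitary]
  congr 1
  ext1 ψ
  funext w
  rw [applyU_apply, permOp_apply, Finset.sum_eq_single (s.flip fun j => w (s.t j))]
  · rw [matrix_apply]
    simp only [Function.Embedding.coeFn_mk]
    rw [if_true, one_mul]
    congr 1
    funext q
    by_cases hq : ∃ j, s.t j = q
    · obtain ⟨j, rfl⟩ := hq
      rw [Function.Injective.extend_apply hs]
      by_cases hj : j = 0
      · subst hj
        simp [flip, act]
      · rw [act_of_ne _ _ fun h => hj (hs h)]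
        simp [flip, Function.update_of_ne hj]
    · rw [Function.extend_apply' _ _ _ hq, act_of_ne]
      exact fun h => hq ⟨0, h.symm⟩
  · intro c _ hc
    rw [matrix_apply]
    simp only [Function.Embedding.coeFn_mk]
    rw [if_neg hc, zero_mul]
  · simp

end PStep

/-- The action of a list of steps. -/
def actL (K : List (PStep Q)) (w : Q → Bool) : Q → Bool := K.foldl (fun w s => s.act w) w

@[simp] lemma actL_nil (w : Q → Bool) : actL [] w = w := rfl

@[simp] lemma actL_cons (s : PStep Q) (K) (w : Q → Bool) :
    actL (s :: K) w = actL K (s.act w) := rfl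

lemma actL_append (K K' : List (PStep Q)) (w : Q → Bool) :
    actL (K ++ K') w = actL K' (actL K w) := List.foldl_append

lemma actL_reverse_actL {K : List (PStep Q)} (hK : ∀ s ∈ K, s.Valid) (w : Q → Bool) :
    actL K.reverse (actL K w) = w := by
  induction K generalizing w with
  | nil => rfl
  | cons s K ih =>
    rw [List.reverse_cons, actL_append, actL_cons s K, ih (fun s hs => hK s (by simp [hs]))]
    exact PStep.act_involutive (hK s (by simp)) w

lemma actL_actL_reverse {K : List (PStep Q)} (hK : ∀ s ∈ K, s.Valid) (w : Q → Bool) :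
    actL K (actL K.reverse w) = w := by
  have := actL_reverse_actL (K := K.reverse) (fun s hs => hK s (by simpa using hs)) w
  rwa [List.reverse_reverse] at this

/-- The amplitude at `w` after a permutation is the old amplitude at the preimage of `w`. Each step
is its own inverse, hence the preimage is obtained by the reversed list. -/
lemma run_steps (f : Fin M → Fin N) {K : List (PStep Q)} (hK : ∀ s ∈ K, s.Valid) (C) (z)
    (ψ : St Q) (F) :
    run ((K.map fun s => (s.gate : GGate M N Q).instr f) ++ C) z ψ F =
      run C z (permOp (actL K.reverse) ψ) F := by
  induction K generalizing ψ with
  | nil => rfl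
  | cons s K ih =>
    rw [List.map_cons, List.cons_append, PStep.gate_instr f (hK s (by simp)), run_pureI_cons,
      ih (fun s hs => hK s (by simp [hs]))]
    congr 1
    funext w
    simp [actL_append]

/-- The pattern compute, act, uncompute, on which every macro gate with formulas is built. -/
lemma run_conj (f : Fin M → Fin N) {K : List (PStep Q)} (hK : ∀ s ∈ K, s.Valid)
    (g : GGate M N Q) {X : St Q →ₗ[ℂ] St Q} (hg : g.instr f = pureI X) (z) (ψ : St Q) (F) :
    run ((K.map PStep.gate ++ g :: K.reverse.map PStep.gate).map
      fun g => (g : GGate M N Q).instr f) z ψ F =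
        F z (permOp (actL K) (X (permOp (actL K.reverse) ψ))) := by
  have hK' : ∀ s ∈ K.reverse, s.Valid := fun s hs => hK s (by simpa using hs)
  rw [List.map_append, List.map_map, List.map_cons, List.map_map]
  have h1 := run_steps f hK (pureI X :: K.reverse.map fun s => (s.gate : GGate M N Q).instr f)
    z ψ F
  have h2 := run_steps f hK' [] z (X (permOp (actL K.reverse) ψ)) F
  rw [List.append_nil, List.reverse_reverse] at h2
  rw [hg]
  exact h1.trans (by rw [run_pureI_cons]; exact h2)

end PStep

/-! ### Boolean formulas -/

/-- Boolean formulas with arbitrary binary connectives. -/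
inductive BExpr (A : Type) : Type
  | lit (b : Bool) : BExpr A
  | var (a : A) : BExpr A
  | op (φ : Bool → Bool → Bool) (e₁ e₂ : BExpr A) : BExpr A

namespace BExpr

variable {A : Type}

/-- The value of a formula. -/
def eval : BExpr A → (A → Bool) → Bool
  | lit b, _ => b
  | var a, w => w a
  | op φ e₁ e₂, w => φ (e₁.eval w) (e₂.eval w)

/-- The number of symbols of a formula. -/
def size : BExpr A → ℕ
  | lit _ => 1
  | var _ => 1
  | op _ e₁ e₂ => e₁.size + e₂.size + 1

/-- `a` is a variable of the formula. -/
def Uses : BExpr A → A → Prop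
  | lit _, _ => False
  | var b, a => b = a
  | op _ e₁ e₂, a => e₁.Uses a ∨ e₂.Uses a

lemma size_pos (e : BExpr A) : 0 < e.size := by
  cases e <;> simp [size]

lemma eval_congr {e : BExpr A} {w w' : A → Bool} (h : ∀ a, e.Uses a → w a = w' a) :
    e.eval w = e.eval w' := by
  induction e with
  | lit b => rfl
  | var a => exact h a rfl
  | op φ e₁ e₂ ih₁ ih₂ =>
    simp only [eval]
    rw [ih₁ fun a ha => h a (Or.inl ha), ih₂ fun a ha => h a (Or.inr ha)]

lemma eval_update [DecidableEq A] {e : BExpr A} {a : A} (h : ¬ e.Uses a) (w : A → Bool)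
    (b : Bool) : e.eval (Function.update w a b) = e.eval w :=
  eval_congr fun a' ha' => Function.update_of_ne (by rintro rfl; exact h ha') _ _

variable {Q : Type} [DecidableEq Q]

/-- The steps that compute the formula, with the values of the subformulas on the wires `wr`. -/
def compile (inj : A → Q) : BExpr A → (ℕ → Q) → List (PStep Q)
  | lit b, wr => [⟨0, by omega, fun _ => wr 0, fun _ => b⟩]
  | var a, wr => [⟨1, by omega, ![wr 0, inj a], fun u => u 0⟩]
  | op φ e₁ e₂, wr => e₁.compile inj wr ++ (e₂.compile inj fun i => wr (e₁.size + i)) ++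
      [⟨2, by omega, ![wr (e₁.size + e₂.size), wr (e₁.size - 1), wr (e₁.size + (e₂.size - 1))],
        fun u => φ (u 0) (u 1)⟩]

@[simp] lemma length_compile (inj : A → Q) (e : BExpr A) (wr : ℕ → Q) :
    (e.compile inj wr).length = e.size := by
  induction e generalizing wr with
  | lit b => rfl
  | var a => rfl
  | op φ e₁ e₂ ih₁ ih₂ => simp [compile, size, ih₁, ih₂, add_assoc]

/-- The wires are different from each other and from the variables. -/
def Fresh (inj : A → Q) (wr : ℕ → Q) (n : ℕ) : Prop :=
  (∀ i < n, ∀ j < n, wr i = wr j → i = j) ∧ ∀ i < n, ∀ a, wr i ≠ inj a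

lemma compile_valid {inj : A → Q} {e : BExpr A} {wr : ℕ → Q} (h : Fresh inj wr e.size) :
    ∀ s ∈ e.compile inj wr, s.Valid := by
  induction e generalizing wr with
  | lit b =>
    intro s hs
    simp only [compile, List.mem_singleton] at hs
    subst hs
    intro i j _
    exact Subsingleton.elim (α := Fin 1) i j
  | var a =>
    intro s hs
    simp only [compile, List.mem_singleton] at hs
    subst hs
    have := h.2 0 (by simp [size]) a
    intro i j hij
    change Fin 2 at i j
    fin_cases i <;> fin_cases j <;> simp_all
  | op φ e₁ e₂ ih₁ ih₂ =>
    intro s hs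
    simp only [compile, List.mem_append, List.mem_singleton] at hs
    have p1 := e₁.size_pos
    have p2 := e₂.size_pos
    have hsz : (op φ e₁ e₂).size = e₁.size + e₂.size + 1 := rfl
    rcases hs with (hs | hs) | hs
    · exact ih₁ ⟨fun i hi j hj => h.1 i (by omega) j (by omega),
        fun i hi => h.2 i (by omega)⟩ s hs
    · exact ih₂ ⟨fun i hi j hj hij => by
        have := h.1 (e₁.size + i) (by omega) (e₁.size + j) (by omega) hij
        omega, fun i hi => h.2 _ (by omega)⟩ s hs
    · subst hs
      have h1 : wr (e₁.size + e₂.size) ≠ wr (e₁.size - 1) := fun hh => by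
        have := h.1 _ (by omega) _ (by omega) hh; omega
      have h2 : wr (e₁.size + e₂.size) ≠ wr (e₁.size + (e₂.size - 1)) := fun hh => by
        have := h.1 _ (by omega) _ (by omega) hh; omega
      have h3 : wr (e₁.size - 1) ≠ wr (e₁.size + (e₂.size - 1)) := fun hh => by
        have := h.1 _ (by omega) _ (by omega) hh; omega
      intro i j hij
      change Fin 3 at i j
      fin_cases i <;> fin_cases j <;> simp_all

/-- The subformulas occupy consecutive wires in postfix order, so the value of a formula is on the
last of its wires. The first conclusion, that nothing else changes, is what lets the second
subformula start on clean wires. -/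
lemma compile_spec {inj : A → Q} {e : BExpr A} {wr : ℕ → Q} (h : Fresh inj wr e.size)
    {w : Q → Bool} (hw : ∀ i < e.size, w (wr i) = false) :
    (∀ q, (∀ i < e.size, q ≠ wr i) → actL (e.compile inj wr) w q = w q) ∧
      actL (e.compile inj wr) w (wr (e.size - 1)) = e.eval fun a => w (inj a) := by
  induction e generalizing wr w with
  | lit b =>
    refine ⟨fun q hq => ?_, ?_⟩
    · exact PStep.act_of_ne _ _ (hq 0 (by simp [size]))
    · have := hw 0 (by simp [size])
      simp [compile, PStep.act, size, eval, this]
  | var a =>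
    refine ⟨fun q hq => ?_, ?_⟩
    · exact PStep.act_of_ne _ _ (hq 0 (by simp [size]))
    · have := hw 0 (by simp [size])
      simp [compile, PStep.act, size, eval, this]
  | op φ e₁ e₂ ih₁ ih₂ =>
    have p1 := e₁.size_pos
    have p2 := e₂.size_pos
    have hsz : (op φ e₁ e₂).size = e₁.size + e₂.size + 1 := rfl
    rw [hsz] at h hw ⊢
    have hne : ∀ i ≤ e₁.size + e₂.size, ∀ j ≤ e₁.size + e₂.size, i ≠ j → wr i ≠ wr j :=
      fun i hi j hj hij hh => hij (h.1 i (by omega) j (by omega) hh)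
    obtain ⟨a1, b1⟩ := ih₁ (wr := wr) (w := w)
      ⟨fun i hi j hj => h.1 i (by omega) j (by omega), fun i hi => h.2 i (by omega)⟩
      (fun i hi => hw i (by omega))
    set w1 := actL (e₁.compile inj wr) w with hw1
    have c1 : (fun a => w1 (inj a)) = fun a => w (inj a) := by
      funext a
      exact a1 _ fun i hi => (h.2 i (by omega) a).symm
    obtain ⟨a2, b2⟩ := ih₂ (wr := fun i => wr (e₁.size + i)) (w := w1)
      ⟨fun i hi j hj hij => by
        have := h.1 (e₁.size + i) (by omega) (e₁.size + j) (by omega) hij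
        omega, fun i hi => h.2 _ (by omega)⟩
      (fun i hi => by
        rw [a1 _ fun j hj => hne _ (by omega) _ (by omega) (by omega)]
        exact hw _ (by omega))
    set w2 := actL (e₂.compile inj fun i => wr (e₁.size + i)) w1 with hw2
    have hfin : actL ((op φ e₁ e₂).compile inj wr) w =
        Function.update w2 (wr (e₁.size + e₂.size))
          (xor (w2 (wr (e₁.size + e₂.size)))
            (φ (w2 (wr (e₁.size - 1))) (w2 (wr (e₁.size + (e₂.size - 1)))))) := by
      rw [compile, actL_append, actL_append]
      rfl
    rw [hfin]
    refine ⟨fun q hq => ?_, ?_⟩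
    · rw [Function.update_of_ne (hq _ (by omega)), a2 q fun i hi => hq _ (by omega),
        a1 q fun i hi => hq _ (by omega)]
    · rw [show e₁.size + e₂.size + 1 - 1 = e₁.size + e₂.size by omega, Function.update_self]
      rw [a2 (wr (e₁.size + e₂.size)) fun i hi => hne _ (by omega) _ (by omega) (by omega),
        a1 (wr (e₁.size + e₂.size)) fun i hi => hne _ (by omega) _ (by omega) (by omega),
        hw _ (by omega), a2 (wr (e₁.size - 1)) fun i hi => hne _ (by omega) _ (by omega) (by omega),
        b1, b2, c1]
      simp [eval]

/-- Needed for the xor macro: changing its target commutes with the computation of the formula, so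
that the uncomputation still cleans the wires after the target has been changed. -/
lemma compile_update {inj : A → Q} {e : BExpr A} {wr : ℕ → Q} (hinj : Function.Injective inj)
    {a : A} (ha : ¬ e.Uses a) (hwr : ∀ i, wr i ≠ inj a) (w : Q → Bool) (b : Bool) :
    actL (e.compile inj wr) (Function.update w (inj a) b) =
      Function.update (actL (e.compile inj wr) w) (inj a) b := by
  induction e generalizing wr w with
  | lit b' =>
    refine PStep.act_update _ _ ?_ b
    rintro ⟨i, hi⟩
    exact hwr 0 hi
  | var a' =>
    refine PStep.act_update _ _ ?_ b
    rintro ⟨i, hi⟩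
    change Fin 2 at i
    fin_cases i
    · exact hwr 0 hi
    · exact ha (hinj hi)
  | op φ e₁ e₂ ih₁ ih₂ =>
    simp only [Uses, not_or] at ha
    simp only [compile, actL_append]
    rw [ih₁ ha.1 hwr, ih₂ ha.2 fun i => hwr _]
    refine PStep.act_update _ _ ?_ b
    rintro ⟨i, hi⟩
    change Fin 3 at i
    fin_cases i
    · exact hwr _ hi
    · exact hwr _ hi
    · exact hwr _ hi

end BExpr

/-! ### Macro gates -/

/-- Macro gates: elementary gates, phases and oracle queries controlled by formulas, and the
addition of a formula to a qubit. -/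
inductive Mac (M N : ℕ) (A : Type) : Type
  | gate (g : GGate M N A) : Mac M N A
  | phase (e : BExpr A) (θ : ℝ) : Mac M N A
  | query (ex : Fin (Nat.clog 2 M) ⊕ Fin (Nat.clog 2 N) → BExpr A) : Mac M N A
  | xor (a : A) (e : BExpr A) (h : ¬ e.Uses a) : Mac M N A

/-- `e ^ (2πi θ)`. -/
def ephase (θ : ℝ) : ℂ := Complex.exp (2 * Real.pi * Complex.I * θ)

lemma norm_ephase (θ : ℝ) : ‖ephase θ‖ = 1 := norm_exp_two_pi_I θ

/-- The one-qubit gate that multiplies `|1⟩` by `e ^ (2πi θ)`. -/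
def phaseMatrix (θ : ℝ) : Matrix.unitaryGroup (Fin 1 → Bool) ℂ :=
  ⟨Matrix.diagonal fun b => if b 0 then ephase θ else 1, by
    rw [Matrix.mem_unitaryGroup_iff, Matrix.star_eq_conjTranspose,
      Matrix.diagonal_conjTranspose, Matrix.diagonal_mul_diagonal, ← Matrix.diagonal_one]
    congr 1
    funext b
    rw [Pi.star_apply, RCLike.star_def, Complex.mul_conj']
    by_cases h : b 0 = true <;> simp [h, norm_ephase]⟩

lemma phaseMatrix_val (θ : ℝ) : (phaseMatrix θ).1 =
    Matrix.diagonal fun b => if b 0 then ephase θ else 1 := rfl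

lemma phaseMatrix_instr {M N : ℕ} {Q : Type} [DecidableEq Q] (f : Fin M → Fin N) (q : Q)
    (h : 1 ≤ 3) (t : Fin 1 ↪ Q) (ht : t 0 = q) (θ : ℝ) :
    (GGate.unitary 1 h t (phaseMatrix θ) : GGate M N Q).instr f =
      pureI (diagOp fun w => if w q then ephase θ else 1) := by
  subst ht
  rw [GGate.instr_unitary]
  congr 1
  ext1 ψ
  funext w
  rw [applyU_apply, Finset.sum_eq_single fun j => w (t j)]
  · rw [extend_self', phaseMatrix_val, Matrix.diagonal_apply_eq, diagOp_apply]
  · intro b _ hb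
    rw [phaseMatrix_val, Matrix.diagonal_apply_ne' _ hb, zero_mul]
  · simp
where
  extend_self' {Q : Type} {r : ℕ} {t : Fin r ↪ Q} {w : Q → Bool} :
      Function.extend t (fun j => w (t j)) w = w := by
    funext q
    by_cases h : ∃ j, t j = q
    · obtain ⟨j, rfl⟩ := h
      simp [t.injective.extend_apply]
    · simp [Function.extend_apply' _ _ _ h]

/-- The places of a register for each formula of a macro gate. -/
abbrev Slot (M N : ℕ) : Type := Option (Fin (Nat.clog 2 M) ⊕ Fin (Nat.clog 2 N))

/-- A memory with scratch space. -/
abbrev WithScratch (M N B : ℕ) (A : Type) : Type := A ⊕ (Slot M N × Fin (B + 1))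

namespace Mac

variable {M N B : ℕ} {A : Type}

/-- The scratch qubits of a slot. -/
def wire (B : ℕ) (s : Slot M N) (i : ℕ) : WithScratch M N B A := Sum.inr (s, Fin.ofNat (B + 1) i)

lemma wire_inj {s s' : Slot M N} {i j : ℕ} (hi : i < B + 1) (hj : j < B + 1)
    (h : (wire B s i : WithScratch M N B A) = wire B s' j) : s = s' ∧ i = j := by
  simp only [wire, Sum.inr.injEq, Prod.mk.injEq, Fin.ext_iff, Fin.val_ofNat,
    Nat.mod_eq_of_lt hi, Nat.mod_eq_of_lt hj] at h
  exact h

lemma fresh_wire (s : Slot M N) {n : ℕ} (hn : n ≤ B + 1) :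
    BExpr.Fresh (Sum.inl : A → WithScratch M N B A) (wire B s) n :=
  ⟨fun i hi j hj h => (wire_inj (by omega) (by omega) h).2, fun i hi a => by simp [wire]⟩

variable [DecidableEq A]

/-- The steps that compute a formula in a slot. -/
def steps (B : ℕ) (s : Slot M N) (e : BExpr A) : List (PStep (WithScratch M N B A)) :=
  e.compile Sum.inl (wire B s)

/-- The steps that compute several formulas in their slots. -/
def stepsL (B : ℕ) (ex : Fin (Nat.clog 2 M) ⊕ Fin (Nat.clog 2 N) → BExpr A)
    (l : List (Fin (Nat.clog 2 M) ⊕ Fin (Nat.clog 2 N))) : List (PStep (WithScratch M N B A)) :=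
  l.flatMap fun q => steps B (some q) (ex q)

/-- The result qubits of the formulas of a query. -/
def queryRegs (B : ℕ) (ex : Fin (Nat.clog 2 M) ⊕ Fin (Nat.clog 2 N) → BExpr A) :
    Fin (Nat.clog 2 M) ⊕ Fin (Nat.clog 2 N) ↪ WithScratch M N B A :=
  ⟨fun q => wire B (some q) ((ex q).size - 1), fun q q' h => by
    simp only [wire, Sum.inr.injEq, Prod.mk.injEq, Option.some.injEq] at h
    exact h.1⟩

/-- The elementary gates of a macro gate. -/
def compile (B : ℕ) : Mac M N A → List (GGate M N (WithScratch M N B A))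
  | gate g => [g.map ⟨Sum.inl, Sum.inl_injective⟩]
  | phase e θ => (steps B none e).map PStep.gate ++
      .unitary 1 (by omega) ⟨fun _ => wire B none (e.size - 1),
        fun i j _ => Subsingleton.elim i j⟩ (phaseMatrix θ) ::
        (steps B none e).reverse.map PStep.gate
  | query ex => (stepsL B ex Finset.univ.toList).map PStep.gate ++
      .query (queryRegs B ex) :: (stepsL B ex Finset.univ.toList).reverse.map PStep.gate
  | xor a e _ => (steps B none e).map PStep.gate ++
      PStep.gate ⟨1, by omega, ![Sum.inl a, wire B none (e.size - 1)], fun u => u 0⟩ ::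
        (steps B none e).reverse.map PStep.gate

/-- The action of a macro gate, for the oracle `f`. -/
def instr (f : Fin M → Fin N) : Mac M N A → Instr A
  | gate g => g.instr f
  | phase e θ => pureI (diagOp fun w => if e.eval w then ephase θ else 1)
  | query ex => pureI (diagOp fun w => queryPhase f
      (Nat.ofBits fun j => (ex (Sum.inl j)).eval w) (Nat.ofBits fun j => (ex (Sum.inr j)).eval w))
  | xor a e _ => pureI (permOp fun w => Function.update w a (Bool.xor (w a) (e.eval w)))

/-- The formulas of the macro gate have size at most `B + 1`. -/
def Fits (B : ℕ) : Mac M N A → Prop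
  | gate _ => True
  | phase e _ => e.size ≤ B + 1
  | query ex => ∀ q, (ex q).size ≤ B + 1
  | xor _ e _ => e.size ≤ B + 1

lemma xor_involutive {a : A} {e : BExpr A} (h : ¬ e.Uses a) :
    Function.Involutive fun w : A → Bool => Function.update w a (Bool.xor (w a) (e.eval w)) := by
  intro w
  simp [BExpr.eval_update h]

lemma instr_iso [Fintype A] (f : Fin M → Fin N) (m : Mac M N A) : Iso (m.instr f) := by
  cases m with
  | gate g => exact g.instr_iso f
  | phase e θ =>
    intro ψ
    simp only [instr, pureI, List.map_cons, List.map_nil, List.sum_cons, List.sum_nil, add_zero]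
    exact nsq_diagOp (fun w => by split_ifs <;> simp [norm_ephase]) ψ
  | query ex =>
    intro ψ
    simp only [instr, pureI, List.map_cons, List.map_nil, List.sum_cons, List.sum_nil, add_zero]
    exact nsq_diagOp (fun w => norm_queryPhase f _ _) ψ
  | xor a e h =>
    intro ψ
    simp only [instr, pureI, List.map_cons, List.map_nil, List.sum_cons, List.sum_nil, add_zero]
    exact nsq_permOp (xor_involutive h) ψ

lemma length_stepsL {ex : Fin (Nat.clog 2 M) ⊕ Fin (Nat.clog 2 N) → BExpr A}
    (hex : ∀ q, (ex q).size ≤ B + 1) (l) : (stepsL B ex l).length ≤ l.length * (B + 1) := by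
  induction l with
  | nil => simp [stepsL]
  | cons q l ih =>
    simp only [stepsL, List.flatMap_cons, List.length_append, List.length_cons] at ih ⊢
    have : (steps B (some q) (ex q)).length ≤ B + 1 := by simpa [steps] using hex q
    nlinarith

lemma length_compile_le {m : Mac M N A} (hm : m.Fits B) :
    (m.compile B).length ≤ 2 * ((Nat.clog 2 M + Nat.clog 2 N + 1) * (B + 1)) + 1 := by
  cases m with
  | gate g => simp [compile]
  | phase e θ =>
    have : e.size ≤ B + 1 := hm
    simp [compile, steps]
    nlinarith [Nat.zero_le (Nat.clog 2 M + Nat.clog 2 N)]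
  | query ex =>
    have := length_stepsL hm Finset.univ.toList
    simp [compile] at this ⊢
    nlinarith
  | xor a e h =>
    have : e.size ≤ B + 1 := hm
    simp [compile, steps]
    nlinarith [Nat.zero_le (Nat.clog 2 M + Nat.clog 2 N)]

/-- The embedding of a memory into the memory with scratch space. -/
abbrev inlE (M N B : ℕ) (A : Type) : A ↪ WithScratch M N B A := ⟨Sum.inl, Sum.inl_injective⟩

lemma clean_iff {w : WithScratch M N B A → Bool} :
    (∀ q, q ∉ Set.range (inlE M N B A) → w q = false) ↔ ∀ s, w (Sum.inr s) = false := by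
  constructor
  · intro h s
    exact h _ (by rintro ⟨a, ha⟩; exact absurd ha (by simp [inlE]))
  · rintro h (a | s) hq
    · exact absurd ⟨a, rfl⟩ hq
    · exact h s

lemma stepsL_spec {ex : Fin (Nat.clog 2 M) ⊕ Fin (Nat.clog 2 N) → BExpr A}
    (hex : ∀ q, (ex q).size ≤ B + 1) {l} (hl : l.Nodup) {w : WithScratch M N B A → Bool}
    (hw : ∀ q ∈ l, ∀ i < (ex q).size, w (wire B (some q) i) = false) :
    (∀ p, (∀ q ∈ l, ∀ i < (ex q).size, p ≠ wire B (some q) i) →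
      actL (stepsL B ex l) w p = w p) ∧
    ∀ q ∈ l, actL (stepsL B ex l) w (wire B (some q) ((ex q).size - 1)) =
      (ex q).eval fun a => w (Sum.inl a) := by
  induction l generalizing w with
  | nil => simp [stepsL]
  | cons q l ih =>
    obtain ⟨hq, hl⟩ := List.nodup_cons.1 hl
    obtain ⟨a1, b1⟩ := BExpr.compile_spec (fresh_wire (A := A) (some q) (hex q))
      (hw q (by simp))
    set w1 := actL ((ex q).compile Sum.inl (wire B (some q))) w with hw1
    have hne : ∀ q' ∈ l, ∀ i < (ex q').size, ∀ j < (ex q).size,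
        (wire B (some q') i : WithScratch M N B A) ≠ wire B (some q) j := by
      intro q' hq' i hi j hj h
      have := (wire_inj (lt_of_lt_of_le hi (hex q')) (lt_of_lt_of_le hj (hex q)) h).1
      simp only [Option.some.injEq] at this
      exact hq (this ▸ hq')
    obtain ⟨a2, b2⟩ := ih hl (w := w1) (fun q' hq' i hi => by
      rw [a1 _ (hne q' hq' i hi)]
      exact hw q' (by simp [hq']) i hi)
    have hact : actL (stepsL B ex (q :: l)) w = actL (stepsL B ex l) w1 := by
      simp only [stepsL, List.flatMap_cons, actL_append]
      rfl
    rw [hact]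
    refine ⟨fun p hp => ?_, fun q' hq' => ?_⟩
    · rw [a2 p fun q' hq' => hp q' (by simp [hq']), a1 p (hp q (by simp))]
    · have c1 : (fun a => w1 (Sum.inl a)) = fun a => w (Sum.inl a) := by
        funext a
        exact a1 _ fun i hi => by simp [wire]
      rcases List.mem_cons.1 hq' with rfl | hq'
      · rw [a2, b1]
        intro q'' hq'' i hi h
        exact hne q'' hq'' i hi _ (by have := (ex q').size_pos; omega) h.symm
      · rw [b2 q' hq', c1]

lemma stepsL_valid {ex : Fin (Nat.clog 2 M) ⊕ Fin (Nat.clog 2 N) → BExpr A}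
    (hex : ∀ q, (ex q).size ≤ B + 1) (l) : ∀ s ∈ stepsL B ex l, s.Valid := by
  intro s hs
  simp only [stepsL, List.mem_flatMap] at hs
  obtain ⟨q, _, hs⟩ := hs
  exact BExpr.compile_valid (fresh_wire (some q) (hex q)) s hs

/-- Conjugating a diagonal operator by a permutation of the basis states keeps it diagonal; on clean
scratch only its values after the computation matter. -/
lemma conj_diagOp_lift {K : List (PStep (WithScratch M N B A))} (hK : ∀ s ∈ K, s.Valid)
    {θ : (WithScratch M N B A → Bool) → ℂ} {η : (A → Bool) → ℂ}
    (h : ∀ w, (∀ s, w (Sum.inr s) = false) → θ (actL K w) = η fun a => w (Sum.inl a))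
    (ψ : St A) :
    permOp (actL K) (diagOp θ (permOp (actL K.reverse) (lift (inlE M N B A) ψ))) =
      lift (inlE M N B A) (diagOp η ψ) := by
  funext w
  simp only [permOp_apply, diagOp_apply, actL_reverse_actL hK]
  by_cases hw : ∀ q, q ∉ Set.range (inlE M N B A) → w q = false
  · rw [lift_of_clean _ _ hw, lift_of_clean _ _ hw, h w (clean_iff.1 hw)]
    rfl
  · rw [lift_of_not_clean _ _ hw, lift_of_not_clean _ _ hw, mul_zero]

lemma run_compile_one (f : Fin M → Fin N) {m : Mac M N A} (hm : m.Fits B) (z) (ψ : St A) (F) :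
    run ((m.compile B).map fun g => g.instr f) z (lift (inlE M N B A) ψ) F =
      run [m.instr f] z ψ fun z ψ => F z (lift (inlE M N B A) ψ) := by
  cases m with
  | gate g => exact run_map_lift f (inlE M N B A) [g] z ψ F
  | phase e θ =>
    have hval : ∀ s ∈ (steps B none e : List (PStep (WithScratch M N B A))), s.Valid :=
      BExpr.compile_valid (fresh_wire none hm)
    rw [compile, run_conj f hval _ (phaseMatrix_instr f _ _ _ rfl θ)]
    rw [show run [(phase e θ : Mac M N A).instr f] z ψ
      (fun z ψ => F z (lift (inlE M N B A) ψ)) = F z (lift (inlE M N B A)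
        (diagOp (fun w => if e.eval w then ephase θ else 1) ψ)) by
          rw [instr, run_pureI_cons, run_nil]]
    congr 1
    refine conj_diagOp_lift hval (fun w hw => ?_) ψ
    have h1 : actL (steps B none e) w (wire B none (e.size - 1)) = _ :=
      (BExpr.compile_spec (fresh_wire none hm) fun i _ => hw _).2
    change (if actL (steps B none e) w (wire B none (e.size - 1)) = true then _ else _) = _
    rw [h1]
  | query ex =>
    have hval := stepsL_valid hm Finset.univ.toList
    rw [compile, run_conj f hval _ (GGate.instr_query f _)]
    rw [instr, run_pureI_cons, run_nil]
    congr 1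
    refine conj_diagOp_lift hval (fun w hw => ?_) ψ
    have hs := (stepsL_spec hm (Finset.nodup_toList Finset.univ) (w := w)
      fun q _ i _ => hw _).2
    have hs' : ∀ q, actL (stepsL B ex Finset.univ.toList) w (queryRegs B ex q) =
      (ex q).eval fun a => w (Sum.inl a) := fun q => hs q (by simp)
    simp only [hs']
  | xor a e h =>
    have hval : ∀ s ∈ (steps B none e : List (PStep (WithScratch M N B A))), s.Valid :=
      BExpr.compile_valid (fresh_wire none hm)
    have hst : PStep.Valid (⟨1, by omega, ![Sum.inl a, wire B none (e.size - 1)], fun u => u 0⟩ :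
        PStep (WithScratch M N B A)) := by
      intro i j hij
      change Fin 2 at i j
      fin_cases i <;> fin_cases j <;> simp_all [wire]
    rw [compile, run_conj f hval _ (PStep.gate_instr f hst)]
    rw [instr, run_pureI_cons, run_nil]
    congr 1
    set K := (steps B none e : List (PStep (WithScratch M N B A))) with hKdef
    set st : PStep (WithScratch M N B A) :=
      ⟨1, by omega, ![Sum.inl a, wire B none (e.size - 1)], fun u => u 0⟩ with hst'
    set ρ : (WithScratch M N B A → Bool) → (WithScratch M N B A → Bool) := fun u =>
      Function.update u (Sum.inl a) (Bool.xor (u (Sum.inl a)) (e.eval fun a => u (Sum.inl a)))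
      with hρ
    -- On clean scratch, computing and then adding the result wire to the target is the same as
    -- changing the target first and computing afterwards.
    have key : ∀ u : WithScratch M N B A → Bool, (∀ s, u (Sum.inr s) = false) →
        st.act (actL K u) = actL K (ρ u) := by
      intro u hu
      obtain ⟨a1, b1⟩ := BExpr.compile_spec (fresh_wire (M := M) (N := N) (A := A) none hm)
        (w := u) fun i _ => hu _
      rw [hρ, hKdef, steps, BExpr.compile_update Sum.inl_injective h (by simp [wire])]
      have h1 : actL (e.compile Sum.inl (wire B none)) u (Sum.inl a) = u (Sum.inl a) :=
        a1 _ fun i _ => by simp [wire]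
      simp only [PStep.act]
      congr 1
      change Bool.xor (actL (e.compile Sum.inl (wire B none)) u (Sum.inl a))
        (actL (e.compile Sum.inl (wire B none)) u (wire B none (e.size - 1))) = _
      rw [h1, b1]
    have hρclean : ∀ u : WithScratch M N B A → Bool, (∀ s, u (Sum.inr s) = false) →
        ∀ s, ρ u (Sum.inr s) = false := by
      intro u hu s
      rw [hρ]
      simp [hu]
    funext w
    simp only [permOp_apply]
    by_cases hw : ∀ s, w (Sum.inr s) = false
    · rw [key w hw, actL_reverse_actL hval, lift_of_clean _ _ (clean_iff.2 (hρclean w hw)),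
        lift_of_clean _ _ (clean_iff.2 hw), permOp_apply]
      congr 1
      funext a'
      by_cases ha' : a' = a
      · subst ha'; simp [hρ]
      · simp [hρ, Function.update_of_ne ha']
    · rw [lift_of_not_clean _ _ (fun h => hw (clean_iff.1 h)), lift_of_not_clean]
      intro h'
      have hu := clean_iff.1 h'
      apply hw
      have h3 := key _ hu
      rw [actL_actL_reverse hval, PStep.act_involutive hst] at h3
      -- A basis state with dirty scratch cannot be mapped to a clean one: the conjugated step is an
      -- involution and preserves cleanness.
      have h4 : w = ρ (actL K.reverse (st.act (actL K w))) := by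
        rw [← actL_reverse_actL hval (ρ _), ← h3, actL_reverse_actL hval]
      rw [h4]
      exact hρclean _ hu

/-- Compilation of a list of macro gates. -/
def compileL (B : ℕ) (C : List (Mac M N A)) : List (GGate M N (WithScratch M N B A)) :=
  C.flatMap (compile B)

lemma run_compileL (f : Fin M → Fin N) {C : List (Mac M N A)} (hC : ∀ m ∈ C, m.Fits B) (z)
    (ψ : St A) (F) :
    run ((compileL B C).map fun g => g.instr f) z (lift (inlE M N B A) ψ) F =
      run (C.map fun m => m.instr f) z ψ fun z ψ => F z (lift (inlE M N B A) ψ) := by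
  induction C generalizing z ψ with
  | nil => rfl
  | cons m C ih =>
    rw [compileL, List.flatMap_cons, List.map_append, run_append,
      run_compile_one f (hC m (by simp)), List.map_cons,
      show m.instr f :: C.map (fun m => m.instr f) = [m.instr f] ++ C.map (fun m => m.instr f)
        from rfl, run_append]
    exact run_congr _ _ _ fun z ψ => ih (fun m hm => hC m (by simp [hm])) z ψ

lemma length_compileL_le {C : List (Mac M N A)} (hC : ∀ m ∈ C, m.Fits B) :
    (compileL B C).length ≤
      C.length * (2 * ((Nat.clog 2 M + Nat.clog 2 N + 1) * (B + 1)) + 1) := by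
  induction C with
  | nil => simp [compileL]
  | cons m C ih =>
    have h1 := length_compile_le (hC m (by simp))
    have h2 := ih fun m hm => hC m (by simp [hm])
    simp only [compileL, List.flatMap_cons, List.length_append, List.length_cons] at h2 ⊢
    linarith

end Mac

/-! ### Phases -/

lemma ephase_zero : ephase 0 = 1 := by simp [ephase]

lemma ephase_add (x y : ℝ) : ephase (x + y) = ephase x * ephase y := by
  rw [ephase, ephase, ephase, ← Complex.exp_add]
  congr 1
  push_cast
  ring

lemma ephase_neg (x : ℝ) : ephase (-x) * ephase x = 1 := by
  rw [← ephase_add, neg_add_cancel, ephase_zero]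

lemma ephase_int (k : ℤ) : ephase k = 1 := by
  rw [ephase, show (2 * Real.pi * Complex.I * ((k : ℝ) : ℂ) : ℂ) = k * (2 * Real.pi * Complex.I) by
    push_cast; ring]
  exact Complex.exp_int_mul_two_pi_mul_I k

lemma ephase_add_int (x : ℝ) (k : ℤ) : ephase (x + k) = ephase x := by
  rw [ephase_add, ephase_int, mul_one]

lemma ephase_re (x : ℝ) : (ephase x).re = Real.cos (2 * Real.pi * x) := by
  rw [ephase, show (2 * Real.pi * Complex.I * (x : ℂ) : ℂ) =
    ((2 * Real.pi * x : ℝ) : ℂ) * Complex.I by push_cast; ring, Complex.exp_ofReal_mul_I_re]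

/-- The amplitude of the outcome `b` in a Hadamard test of the phase `x`. -/
def amp (x : ℝ) (b : Bool) : ℂ := (1 + (if b then -1 else 1) * ephase x) / 2

/-- The outcome is biased by the distance of the phase from an integer: the test answers `false`
surely at 0 and `true` surely at 1/2. -/
lemma normSq_amp (x : ℝ) (b : Bool) :
    ‖amp x b‖ ^ 2 = if b then Real.sin (Real.pi * x) ^ 2 else Real.cos (Real.pi * x) ^ 2 := by
  have h1 : ‖ephase x‖ ^ 2 = 1 := by rw [norm_ephase]; norm_num
  rw [Complex.sq_norm, Complex.normSq_apply] at h1 ⊢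
  have h2 := ephase_re x
  rw [show 2 * Real.pi * x = 2 * (Real.pi * x) by ring, Real.cos_two_mul] at h2
  have h3 := Real.sin_sq_add_cos_sq (Real.pi * x)
  cases b
  · simp only [amp, Bool.false_eq_true, if_false, one_mul]
    have : ((1 + ephase x) / 2).re = (1 + (ephase x).re) / 2 := by simp
    have h4 : ((1 + ephase x) / 2).im = (ephase x).im / 2 := by simp
    rw [this, h4]
    nlinarith
  · simp only [amp, if_true]
    have : ((1 + -1 * ephase x) / 2).re = (1 - (ephase x).re) / 2 := by
      simp [sub_eq_add_neg]
    have h4 : ((1 + -1 * ephase x) / 2).im = -(ephase x).im / 2 := by simp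
    rw [this, h4]
    nlinarith

lemma sum_normSq_amp (x : ℝ) : ‖amp x false‖ ^ 2 + ‖amp x true‖ ^ 2 = 1 := by
  rw [normSq_amp, normSq_amp]
  simp

/-! ### Hadamard tests -/

section Tests

variable {A : Type} [DecidableEq A] {M N : ℕ}

/-- The entries of the Hadamard matrix. -/
def hcoef (b c : Bool) : ℂ := ((Real.sqrt 2)⁻¹ : ℝ) * if b && c then -1 else 1

lemma sqrt_two_inv_sq : ((Real.sqrt 2)⁻¹ : ℂ) * (Real.sqrt 2 : ℂ)⁻¹ = 1 / 2 := by
  rw [← mul_inv, ← Complex.ofReal_mul, Real.mul_self_sqrt (by norm_num)]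
  norm_num

/-- The Hadamard matrix. -/
def hadMatrix : Matrix.unitaryGroup (Fin 1 → Bool) ℂ :=
  ⟨Matrix.of fun b c => hcoef (b 0) (c 0), by
    rw [Matrix.mem_unitaryGroup_iff]
    ext b d
    simp only [Matrix.mul_apply, Matrix.star_apply, Matrix.of_apply, Matrix.one_apply]
    rw [← (Equiv.funUnique (Fin 1) Bool).symm.sum_comp]
    have hbd : (b = d) ↔ b 0 = d 0 := by
      constructor
      · rintro rfl; rfl
      · intro h
        funext i
        rw [Subsingleton.elim i 0, h]
    rw [if_congr hbd rfl rfl]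
    simp only [Fintype.sum_bool]
    have hs : ∀ b c, star (hcoef b c) = hcoef b c := by
      intro b c
      cases b <;> cases c <;> simp [hcoef]
    have h2 := sqrt_two_inv_sq
    cases hb : b 0 <;> cases hd : d 0 <;>
      simp [hcoef, h2] <;> norm_num⟩

lemma hadMatrix_apply (b c) : hadMatrix.1 b c = hcoef (b 0) (c 0) := rfl

/-- The Hadamard operator on the qubit `q`. -/
def hadOp (q : A) : St A →ₗ[ℂ] St A where
  toFun ψ w := ∑ c : Bool, hcoef (w q) c * ψ (Function.update w q c)
  map_add' ψ φ := by funext w; simp [mul_add]; ring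
  map_smul' c ψ := by funext w; simp; ring

lemma hadOp_apply (q : A) (ψ : St A) (w : A → Bool) :
    hadOp q ψ w = ∑ c : Bool, hcoef (w q) c * ψ (Function.update w q c) := rfl

/-- The Hadamard gate. -/
def hadMac (q : A) : Mac M N A :=
  .gate (.unitary 1 (by omega) ⟨fun _ => q, fun i j _ => Subsingleton.elim i j⟩ hadMatrix)

lemma hadMac_instr (f : Fin M → Fin N) (q : A) :
    (hadMac q : Mac M N A).instr f = pureI (hadOp q) := by
  rw [hadMac, Mac.instr, GGate.instr_unitary]
  congr 1
  ext1 ψ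
  funext w
  rw [applyU_apply, hadOp_apply, ← (Equiv.funUnique (Fin 1) Bool).symm.sum_comp]
  refine Finset.sum_congr rfl fun c _ => ?_
  rw [hadMatrix_apply]
  congr 2
  funext a
  by_cases ha : a = q
  · subst ha
    rw [Function.update_self]
    exact Function.Injective.extend_apply
      (fun i j _ => Subsingleton.elim i j : Function.Injective fun _ : Fin 1 => a) _ _ 0
  · rw [Function.update_of_ne ha, Function.extend_apply']
    rintro ⟨_, h⟩
    exact ha h.symm

lemma hadOp_hadOp (q : A) (ψ : St A) : hadOp q (hadOp q ψ) = ψ := by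
  funext w
  have h2 := sqrt_two_inv_sq
  simp only [hadOp_apply, Fintype.sum_bool, Function.update_self, Function.update_idem]
  cases hw : w q
  · rw [show Function.update w q false = w by rw [← hw]; simp]
    simp only [hcoef, Bool.and_true, Bool.and_false,
      Bool.false_eq_true, if_true, if_false]
    push_cast
    linear_combination 2 * ψ w * h2
  · rw [show Function.update w q true = w by rw [← hw]; simp]
    simp only [hcoef, Bool.and_true, Bool.and_false,
      Bool.false_eq_true, if_true, if_false]
    push_cast
    linear_combination 2 * ψ w * h2

/-- The controlled phase of a Hadamard test. -/
def cphase (q : A) (θ : (A → Bool) → ℝ) (w : A → Bool) : ℂ := if w q then ephase (θ w) else 1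

/-- A Hadamard test of the phase `θ`, with the test qubit `q`. -/
def testOp (q : A) (θ : (A → Bool) → ℝ) : St A →ₗ[ℂ] St A :=
  hadOp q ∘ₗ diagOp (cphase q θ) ∘ₗ hadOp q

lemma testOp_apply (q : A) (θ : (A → Bool) → ℝ) (ψ : St A) :
    testOp q θ ψ = hadOp q (diagOp (cphase q θ) (hadOp q ψ)) := rfl

lemma testOp_neg_testOp (q : A) (θ : (A → Bool) → ℝ) (ψ : St A) :
    testOp q (fun w => -θ w) (testOp q θ ψ) = ψ := by
  rw [testOp_apply, testOp_apply, hadOp_hadOp]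
  have : ∀ φ : St A, diagOp (cphase q fun w => -θ w) (diagOp (cphase q θ) φ) = φ := by
    intro φ
    funext w
    rw [diagOp_apply, diagOp_apply, ← mul_assoc]
    simp only [cphase]
    split_ifs
    · rw [ephase_neg, one_mul]
    · simp
  rw [this, hadOp_hadOp]

/-- The function does not depend on the qubit `q`. -/
def IndepOf {β : Type*} (θ : (A → Bool) → β) (q : A) : Prop :=
  ∀ w b, θ (Function.update w q b) = θ w

/-- The state is supported where the qubit `q` is `|0⟩`. -/
def ZeroAt (q : A) (ψ : St A) : Prop := ∀ w : A → Bool, w q = true → ψ w = 0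

/-- On a clean test qubit the test is a coherent choice of the outcome: it multiplies each amplitude
by a factor that depends on the outcome and the phase only. -/
lemma testOp_of_zeroAt {q : A} {θ : (A → Bool) → ℝ} (hθ : IndepOf θ q) {ψ : St A}
    (hψ : ZeroAt q ψ) (w : A → Bool) :
    testOp q θ ψ w = amp (θ w) (w q) * ψ (Function.update w q false) := by
  have h2 := sqrt_two_inv_sq
  have h0 : ψ (Function.update w q true) = 0 := hψ _ (by simp)
  simp only [testOp_apply, hadOp_apply, diagOp_apply, cphase, Fintype.sum_bool,
    Function.update_self, Function.update_idem, hθ w, h0]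
  cases hw : w q
  · simp only [hcoef, amp, Bool.and_true, Bool.and_false,
      Bool.false_eq_true, if_true, if_false]
    push_cast
    linear_combination (ephase (θ w) + 1) * ψ (Function.update w q false) * h2
  · simp only [hcoef, amp, Bool.and_true, Bool.and_false,
      Bool.false_eq_true, if_true, if_false]
    push_cast
    linear_combination (-ephase (θ w) + 1) * ψ (Function.update w q false) * h2

variable {T : Type} [DecidableEq T] (τ : T ↪ A)

/-- A sequence of Hadamard tests. -/
def testSeq (θ : T → (A → Bool) → ℝ) (l : List T) (ψ : St A) : St A :=
  l.foldl (fun ψ t => testOp (τ t) (θ t) ψ) ψ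

/-- The inverse of a sequence of Hadamard tests. -/
def testSeqInv (θ : T → (A → Bool) → ℝ) (l : List T) (ψ : St A) : St A :=
  testSeq τ (fun t w => -θ t w) l.reverse ψ

lemma testSeqInv_testSeq (θ : T → (A → Bool) → ℝ) (l : List T) (ψ : St A) :
    testSeqInv τ θ l (testSeq τ θ l ψ) = ψ := by
  induction l generalizing ψ with
  | nil => rfl
  | cons t l ih =>
    have h1 : testSeq τ θ (t :: l) ψ = testSeq τ θ l (testOp (τ t) (θ t) ψ) := rfl
    have h2 : ∀ φ, testSeqInv τ θ (t :: l) φ =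
        testOp (τ t) (fun w => -θ t w) (testSeqInv τ θ l φ) := by
      intro φ
      simp [testSeqInv, testSeq, List.foldl_append]
    rw [h1, h2, ih, testOp_neg_testOp]

/-- Setting the test qubits of a list to zero. -/
def zeroL (l : List T) (w : A → Bool) : A → Bool := fun a => if ∃ t ∈ l, τ t = a then false else w a

open Classical in
lemma zeroL_cons (t : T) (l : List T) (w : A → Bool) :
    zeroL τ (t :: l) w = Function.update (zeroL τ l w) (τ t) false := by
  funext a
  by_cases ha : a = τ t
  · subst ha
    rw [Function.update_self]
    simp [zeroL]
  · rw [Function.update_of_ne ha]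
    simp only [zeroL, List.mem_cons, exists_eq_or_imp]
    have : ¬ τ t = a := fun h => ha h.symm
    simp [this]

lemma indepOf_zeroL {β : Type*} {θ : (A → Bool) → β} {l : List T}
    (h : ∀ t ∈ l, IndepOf θ (τ t)) (w : A → Bool) : θ (zeroL τ l w) = θ w := by
  induction l with
  | nil => congr 1
  | cons t l ih =>
    rw [zeroL_cons, h t (by simp), ih fun t ht => h t (by simp [ht])]

/-- The tests are adaptive, since a phase may depend on earlier outcomes. As it depends on no later
one, evaluating all phases at the final basis state is harmless, and the amplitudes multiply. -/
lemma testSeq_apply {θ : T → (A → Bool) → ℝ} {l : List T} (hnd : l.Nodup)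
    (hself : ∀ t ∈ l, IndepOf (θ t) (τ t))
    (hlater : l.Pairwise fun t t' => IndepOf (θ t) (τ t')) {ψ : St A}
    (hψ : ∀ t ∈ l, ZeroAt (τ t) ψ) (w : A → Bool) :
    testSeq τ θ l ψ w = (l.map fun t => amp (θ t w) (w (τ t))).prod * ψ (zeroL τ l w) := by
  induction l generalizing ψ with
  | nil =>
    have : zeroL τ [] w = w := by funext a; simp [zeroL]
    simp [testSeq, this]
  | cons t l ih =>
    obtain ⟨htl, hnd⟩ := List.nodup_cons.1 hnd
    obtain ⟨hl1, hl2⟩ := List.pairwise_cons.1 hlater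
    have hz := hψ t (by simp)
    have hs := hself t (by simp)
    have h1 : testSeq τ θ (t :: l) ψ = testSeq τ θ l (testOp (τ t) (θ t) ψ) := rfl
    rw [h1, ih hnd (fun t ht => hself t (by simp [ht])) hl2]
    · rw [testOp_of_zeroAt hs hz, indepOf_zeroL τ hl1, ← zeroL_cons, List.map_cons,
        List.prod_cons]
      have : zeroL τ l w (τ t) = w (τ t) := by
        simp only [zeroL]
        rw [if_neg]
        rintro ⟨t', ht', h⟩
        exact htl (τ.injective h ▸ ht')
      rw [this]
      ring
    · intro t' ht' w hw
      rw [testOp_of_zeroAt hs hz, hψ t' (by simp [ht']), mul_zero]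
      rwa [Function.update_of_ne]
      intro h
      exact htl (τ.injective h ▸ ht')

/-! ### Realization by macro gates -/

/-- The macro gates act as a linear operator. -/
def Realizes (f : Fin M → Fin N) (C : List (Mac M N A)) (X : St A → St A) : Prop :=
  ∀ z ψ F, run (C.map fun m => m.instr f) z ψ F = F z (X ψ)

lemma Realizes.nil (f : Fin M → Fin N) : Realizes (A := A) f [] id := fun _ _ _ => rfl

lemma Realizes.single {f : Fin M → Fin N} {m : Mac M N A} {X : St A →ₗ[ℂ] St A}
    (h : m.instr f = pureI X) : Realizes f [m] X := by
  intro z ψ F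
  rw [List.map_cons, h, List.map_nil, run_pureI_cons, run_nil]

lemma Realizes.append {f : Fin M → Fin N} {C D : List (Mac M N A)} {X Y : St A → St A}
    (hC : Realizes f C X) (hD : Realizes f D Y) : Realizes f (C ++ D) fun ψ => Y (X ψ) := by
  intro z ψ F
  rw [List.map_append, run_append, hC, hD]

/-- The macro gates act as multiplication by a function of the basis state. -/
def RealizesDiag (f : Fin M → Fin N) (C : List (Mac M N A)) (η : (A → Bool) → ℂ) : Prop :=
  Realizes f C (diagOp η)

lemma RealizesDiag.congr {f : Fin M → Fin N} {C : List (Mac M N A)} {η η' : (A → Bool) → ℂ}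
    (h : RealizesDiag f C η) (hη : ∀ w, η w = η' w) : RealizesDiag f C η' := by
  rwa [← (funext hη : η = η')]

lemma RealizesDiag.nil (f : Fin M → Fin N) : RealizesDiag (A := A) f [] fun _ => 1 := by
  intro z ψ F
  simp only [List.map_nil, run_nil]
  congr 1
  funext w
  simp

lemma RealizesDiag.append {f : Fin M → Fin N} {C D : List (Mac M N A)} {η η' : (A → Bool) → ℂ}
    (hC : RealizesDiag f C η) (hD : RealizesDiag f D η') :
    RealizesDiag f (C ++ D) fun w => η w * η' w := by
  intro z ψ F
  rw [Realizes.append hC hD]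
  congr 1
  funext w
  simp only [diagOp_apply]
  ring

lemma RealizesDiag.phase (f : Fin M → Fin N) (e : BExpr A) (x : ℝ) :
    RealizesDiag f [.phase e x] fun w => ephase (if e.eval w then x else 0) := by
  refine RealizesDiag.congr (Realizes.single rfl) fun w => ?_
  split_ifs <;> simp [ephase_zero]

lemma RealizesDiag.phases (f : Fin M → Fin N) {ι : Type*} (l : List ι) (e : ι → BExpr A)
    (x : ι → ℝ) : RealizesDiag f (l.map fun i => .phase (e i) (x i)) fun w =>
      ephase (l.map fun i => if (e i).eval w then x i else 0).sum := by
  induction l with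
  | nil => exact (RealizesDiag.nil f).congr fun w => by simp [ephase_zero]
  | cons i l ih =>
    exact ((RealizesDiag.phase f (e i) (x i)).append ih).congr fun w => by
      rw [List.map_cons, List.sum_cons, ephase_add]

/-- The oracle query at the point given by the formulas `hx`, with the phase register `P` if
the formula `c` is true and `0` otherwise. -/
def cquery (hx : Fin (Nat.clog 2 M) → BExpr A) (c : BExpr A) (P : ℕ) : Mac M N A :=
  .query (Sum.elim hx fun j => .op and c (.lit (P.testBit j)))

/-- The oracle gate itself has no control. Putting zero into the phase register makes it trivial,
and this serves as the control. -/
lemma realizes_cquery {f : Fin M → Fin N} {hx : Fin (Nat.clog 2 M) → BExpr A} (c : BExpr A)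
    {P : ℕ} (hP : P < N) (x : (A → Bool) → Fin M)
    (hxx : ∀ w, (Nat.ofBits fun j => (hx j).eval w) = x w) :
    RealizesDiag f [cquery hx c P] fun w =>
      ephase (if c.eval w then (P * (f (x w) : ℕ) / N : ℝ) else 0) := by
  refine RealizesDiag.congr (Realizes.single rfl) fun w => ?_
  simp only [Sum.elim_inl, Sum.elim_inr, hxx]
  have hlt : (Nat.ofBits fun j : Fin (Nat.clog 2 N) =>
      (BExpr.op and c (.lit (P.testBit j))).eval w) = if c.eval w then P else 0 := by
    by_cases hc : c.eval w = true
    · simp only [BExpr.eval, hc, Bool.true_and, if_true]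
      rw [Nat.ofBits_testBit, Nat.mod_eq_of_lt]
      exact lt_of_lt_of_le hP (Nat.le_pow_clog (by norm_num) N)
    · simp only [BExpr.eval, hc, Bool.false_and]
      have := Nat.ofBits_testBit 0 (Nat.clog 2 N)
      simpa using this
  rw [hlt]
  by_cases hc : c.eval w = true
  · rw [if_pos hc, if_pos hc, queryPhase_of_lt f (x w).2 hP]
    rfl
  · rw [if_neg hc, if_neg hc, queryPhase_of_lt f (x w).2 (by omega)]
    simp [ephase_zero]

/-- The macro gates of a Hadamard test. -/
def testMac (q : A) (D : List (Mac M N A)) : List (Mac M N A) := hadMac q :: (D ++ [hadMac q])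

lemma realizes_testMac {f : Fin M → Fin N} {q : A} {D : List (Mac M N A)}
    {θ : (A → Bool) → ℝ} (hD : RealizesDiag f D (cphase q θ)) :
    Realizes f (testMac q D) (testOp q θ) := by
  have h1 : Realizes f [hadMac q] (hadOp q) := Realizes.single (hadMac_instr f q)
  exact h1.append (Realizes.append hD h1)

lemma realizes_testSeq {f : Fin M → Fin N} {D : T → List (Mac M N A)}
    {θ : T → (A → Bool) → ℝ} {l : List T}
    (hD : ∀ t ∈ l, RealizesDiag f (D t) (cphase (τ t) (θ t))) :
    Realizes f (l.flatMap fun t => testMac (τ t) (D t)) (testSeq τ θ l) := by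
  induction l with
  | nil => exact Realizes.nil f
  | cons t l ih =>
    rw [List.flatMap_cons]
    exact (realizes_testMac (hD t (by simp))).append (ih fun t ht => hD t (by simp [ht]))

lemma Realizes.nsq_eq [Fintype A] {f : Fin M → Fin N} {C : List (Mac M N A)} {X : St A → St A}
    (h : Realizes f C X) (ψ : St A) : nsq (X ψ) = nsq ψ := by
  rw [← h [] ψ fun _ ψ => nsq ψ]
  refine run_nsq (fun I hI => ?_) _ _
  obtain ⟨m, _, rfl⟩ := List.mem_map.1 hI
  exact m.instr_iso f

end Tests

/-! ### Recursive majority -/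

/-- The majority of three bits. -/
def maj3 (a b c : Bool) : Bool := xor (xor (a && b) (b && c)) (c && a)

/-- The leaves of the ternary tree of depth `t`. -/
abbrev Leaf (t : ℕ) : Type := Fin t → Fin 3

/-- Recursive majority of the bits at the leaves. -/
def maj : (t : ℕ) → (Leaf t → Bool) → Bool
  | 0, x => x fun i => i.elim0
  | t + 1, x => maj3 (maj t fun l => x (Fin.cons 0 l)) (maj t fun l => x (Fin.cons 1 l))
      (maj t fun l => x (Fin.cons 2 l))

/-- The formula of recursive majority. -/
def majExpr {A : Type} : (t : ℕ) → (Leaf t → A) → BExpr A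
  | 0, x => .var (x fun i => i.elim0)
  | t + 1, x =>
      .op xor (.op xor
        (.op and (majExpr t fun l => x (Fin.cons 0 l)) (majExpr t fun l => x (Fin.cons 1 l)))
        (.op and (majExpr t fun l => x (Fin.cons 1 l)) (majExpr t fun l => x (Fin.cons 2 l))))
        (.op and (majExpr t fun l => x (Fin.cons 2 l)) (majExpr t fun l => x (Fin.cons 0 l)))

lemma eval_majExpr {A : Type} (t : ℕ) (x : Leaf t → A) (w : A → Bool) :
    (majExpr t x).eval w = maj t fun l => w (x l) := by
  induction t with
  | zero => rfl
  | succ t ih => simp [majExpr, maj, BExpr.eval, ih, maj3]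

lemma size_majExpr {A : Type} (t : ℕ) (x : Leaf t → A) : (majExpr t x).size + 1 = 2 * 6 ^ t := by
  induction t with
  | zero => rfl
  | succ t ih =>
    have h := fun i : Fin 3 => ih fun l => x (Fin.cons i l)
    have h0 := h 0
    have h1 := h 1
    have h2 := h 2
    simp only [majExpr, BExpr.size, pow_succ]
    omega

lemma sum_fin_three_arrow {Y : Type*} [Fintype Y] (h : (Fin 3 → Y) → ℝ) :
    ∑ y, h y = ∑ a, ∑ b, ∑ c, h ![a, b, c] := by
  let e : Y × Y × Y ≃ (Fin 3 → Y) :=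
    { toFun := fun p => ![p.1, p.2.1, p.2.2]
      invFun := fun y => (y 0, y 1, y 2)
      left_inv := fun p => rfl
      right_inv := fun y => by funext i; fin_cases i <;> rfl }
  rw [← e.sum_comp, Fintype.sum_prod_type]
  refine Finset.sum_congr rfl fun a _ => ?_
  rw [Fintype.sum_prod_type]
  rfl

/-- The weight of an outcome of independent bits. -/
def bitWeight {ι : Type*} [Fintype ι] (g : Bool → ℝ) (x : ι → Bool) : ℝ := ∏ i, g (x i)

lemma sum_bitWeight {ι : Type*} [Fintype ι] [DecidableEq ι] {g : Bool → ℝ}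
    (hg : g true + g false = 1) : ∑ x : ι → Bool, bitWeight g x = 1 := by
  have := (Finset.prod_univ_sum (fun _ : ι => (Finset.univ : Finset Bool)) fun _ b => g b).symm
  rw [Fintype.piFinset_univ] at this
  simp only [bitWeight]
  rw [this]
  simp [hg]

/-- The probability that the recursive majority is `v`. -/
def majProb (g : Bool → ℝ) (t : ℕ) (v : Bool) : ℝ :=
  ∑ x : Leaf t → Bool, bitWeight g x * if maj t x = v then 1 else 0

lemma majProb_zero (g : Bool → ℝ) (v : Bool) : majProb g 0 v = g v := by
  have : Unique (Leaf 0) := inferInstance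
  rw [majProb, ← (Equiv.funUnique (Leaf 0) Bool).symm.sum_comp]
  have h : ∀ b : Bool, bitWeight g ((Equiv.funUnique (Leaf 0) Bool).symm b) = g b := by
    intro b
    simp [bitWeight]
  have h' : ∀ b : Bool, maj 0 ((Equiv.funUnique (Leaf 0) Bool).symm b) = b := fun b => rfl
  simp only [h, h']
  cases v <;> simp

/-- The three subtrees are independent, and each has majority `v` with the same probability P, so
the root has it with probability 3P²(1 - P) + P³. -/
lemma majProb_succ {g : Bool → ℝ} (hg : g true + g false = 1) (t : ℕ) (v : Bool) :
    majProb g (t + 1) v = 3 * majProb g t v ^ 2 - 2 * majProb g t v ^ 3 := by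
  let e : (Fin 3 → Leaf t → Bool) ≃ (Leaf (t + 1) → Bool) :=
    (Equiv.curry (Fin 3) (Leaf t) Bool).symm.trans
      ((Fin.consEquiv fun _ : Fin (t + 1) => Fin 3).arrowCongr (Equiv.refl Bool))
  have he : ∀ y i l, e y (Fin.cons i l) = y i l := by
    intro y i l
    simp [e, Equiv.arrowCongr, Fin.consEquiv]
  have hw : ∀ y, bitWeight g (e y) = ∏ i, bitWeight g (y i) := by
    intro y
    simp only [bitWeight]
    rw [← Fintype.prod_prod_type' (fun i l => g (y i l)),
      ← (Fin.consEquiv fun _ : Fin (t + 1) => Fin 3).prod_comp]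
    refine Finset.prod_congr rfl fun p _ => ?_
    rw [← he y p.1 p.2]
    rfl
  have hm : ∀ y, maj (t + 1) (e y) = maj3 (maj t (y 0)) (maj t (y 1)) (maj t (y 2)) := by
    intro y
    simp only [maj, he]
  set P := majProb g t v with hP
  have hS := sum_bitWeight (ι := Leaf t) hg
  set φ : (Leaf t → Bool) → ℝ := fun x => bitWeight g x with hφ
  set χ : (Leaf t → Bool) → ℝ := fun x => if maj t x = v then 1 else 0 with hχ
  have hP' : ∑ x, φ x * χ x = P := rfl
  have hS' : ∑ x, φ x = 1 := hS
  -- Majority commutes with complementation, so one polynomial in the three indicators serves for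
  -- both values of `v`.
  have hind : ∀ a b c, (if maj3 (maj t a) (maj t b) (maj t c) = v then (1 : ℝ) else 0) =
      χ a * χ b + χ b * χ c + χ c * χ a - 2 * (χ a * χ b * χ c) := by
    intro a b c
    simp only [hχ]
    cases maj t a <;> cases maj t b <;> cases maj t c <;> cases v <;> norm_num [maj3]
  rw [majProb, ← e.sum_comp, sum_fin_three_arrow]
  have hterm : ∀ a b c, bitWeight g (e ![a, b, c]) *
      (if maj (t + 1) (e ![a, b, c]) = v then (1 : ℝ) else 0) =
      (φ a * χ a) * ((φ b * χ b) * φ c) + φ a * ((φ b * χ b) * (φ c * χ c)) +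
        (φ a * χ a) * (φ b * (φ c * χ c)) -
        2 * ((φ a * χ a) * ((φ b * χ b) * (φ c * χ c))) := by
    intro a b c
    rw [hw, hm, Fin.prod_univ_three]
    change bitWeight g a * bitWeight g b * bitWeight g c *
      (if maj3 (maj t a) (maj t b) (maj t c) = v then (1 : ℝ) else 0) = _
    rw [hind]
    simp only [hφ]
    ring
  simp only [hterm, Finset.sum_add_distrib, Finset.sum_sub_distrib, ← Finset.mul_sum,
    ← Finset.sum_mul, hP', hS']
  ring

lemma majProb_nonneg {g : Bool → ℝ} (hg : ∀ b, 0 ≤ g b) (t : ℕ) (v : Bool) :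
    0 ≤ majProb g t v := by
  refine Finset.sum_nonneg fun x _ => mul_nonneg (Finset.prod_nonneg fun i _ => hg _) ?_
  split_ifs <;> norm_num

/-- The error squares at each level, up to a constant, while the formula grows by the constant
factor 6. Depth t of order log log N thus gives inverse polynomial error at polylogarithmic cost. -/
lemma majProb_le {g : Bool → ℝ} (hg0 : ∀ b, 0 ≤ g b) (hg : g true + g false = 1) {v : Bool}
    (hv : g v ≤ 1 / 4) (t : ℕ) : majProb g t v ≤ (3 / 4) ^ 2 ^ t := by
  -- The bound P' ≤ 3P² reads 3P' ≤ (3P)², so the induction is on 3P, which starts below 3/4.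
  suffices h : 3 * majProb g t v ≤ (3 / 4) ^ 2 ^ t by
    have := majProb_nonneg hg0 t v
    linarith
  induction t with
  | zero => rw [majProb_zero]; norm_num; linarith
  | succ t ih =>
    rw [majProb_succ hg]
    have h0 := majProb_nonneg hg0 t v
    calc 3 * (3 * majProb g t v ^ 2 - 2 * majProb g t v ^ 3)
        ≤ (3 * majProb g t v) ^ 2 := by nlinarith [pow_nonneg h0 3]
      _ ≤ ((3 / 4) ^ 2 ^ t) ^ 2 := by gcongr
      _ = (3 / 4) ^ 2 ^ (t + 1) := by rw [← pow_mul, pow_succ]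

/-! ### Adaptive sequences of independent trials -/

section Seq

variable {X : Type*} [Fintype X]

lemma sum_cons_eq {J : ℕ} (h : (Fin (J + 1) → X) → ℝ) :
    ∑ t, h t = ∑ x, ∑ t : Fin J → X, h (Fin.cons x t) := by
  rw [← (Fin.consEquiv fun _ : Fin (J + 1) => X).sum_comp, Fintype.sum_prod_type]
  rfl

/-- A family of weights in which the `j`-th one depends on the first `j` outcomes. -/
structure Adaptive (J : ℕ) (G : Fin J → (Fin J → X) → ℝ) : Prop where
  nonneg : ∀ j t, 0 ≤ G j t
  dep : ∀ j t t', (∀ i ≤ j, t i = t' i) → G j t = G j t'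
  total : ∀ j t, ∑ x, G j (Function.update t j x) = 1

lemma Adaptive.tail {J : ℕ} {G : Fin (J + 1) → (Fin (J + 1) → X) → ℝ} (hG : Adaptive (J + 1) G)
    (x : X) : Adaptive J fun j t => G j.succ (Fin.cons x t) where
  nonneg j t := hG.nonneg _ _
  dep j t t' h := hG.dep _ _ _ fun i hi => by
    refine Fin.cases (fun _ => rfl) (fun i hi => ?_) i hi
    simpa using h i (by simpa using hi)
  total j t := by
    rw [← hG.total j.succ (Fin.cons x t)]
    simp only [Fin.cons_update]

lemma Adaptive.sum_head {J : ℕ} {G : Fin (J + 1) → (Fin (J + 1) → X) → ℝ}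
    (hG : Adaptive (J + 1) G) (t : Fin (J + 1) → X) :
    ∑ x, G 0 (Fin.cons x (Fin.tail t)) = 1 := by
  rw [← hG.total 0 t]
  refine Finset.sum_congr rfl fun x _ => ?_
  congr 1
  conv_rhs => rw [← Fin.cons_self_tail t]
  rw [Fin.update_cons_zero]

lemma Adaptive.head_eq {J : ℕ} {G : Fin (J + 1) → (Fin (J + 1) → X) → ℝ}
    (hG : Adaptive (J + 1) G) (x : X) (t t' : Fin J → X) :
    G 0 (Fin.cons x t) = G 0 (Fin.cons x t') :=
  hG.dep _ _ _ fun i hi => by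
    obtain rfl : i = 0 := by simpa using hi
    rfl

lemma Adaptive.sum_eq_one [Nonempty X] {J : ℕ} {G : Fin J → (Fin J → X) → ℝ} (hG : Adaptive J G) :
    ∑ t, ∏ j, G j t = 1 := by
  induction J with
  | zero => simp
  | succ J ih =>
    rw [sum_cons_eq]
    obtain ⟨x₀⟩ := ‹Nonempty X›
    have h : ∀ x, ∑ t : Fin J → X, ∏ j, G j (Fin.cons x t) = G 0 (Fin.cons x fun _ => x₀) := by
      intro x
      simp only [Fin.prod_univ_succ]
      rw [← mul_one (G 0 (Fin.cons x fun _ => x₀)), ← ih (hG.tail x), Finset.mul_sum]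
      exact Finset.sum_congr rfl fun t _ => by rw [hG.head_eq x t fun _ => x₀]
    simp only [h]
    exact hG.sum_head (fun _ => x₀)

open Classical in
-- A union bound for a sequential experiment: whatever the earlier outcomes, each stage goes wrong
-- with conditional probability at most `e`. The induction splits off the first stage.
lemma Adaptive.sum_bad_le [Nonempty X] {J : ℕ} {G : Fin J → (Fin J → X) → ℝ} (hG : Adaptive J G)
    {e : ℝ} {bad : Fin J → (Fin J → X) → Prop}
    (hdep : ∀ j t t', (∀ i ≤ j, t i = t' i) → (bad j t ↔ bad j t'))
    (hbad : ∀ j t, ∑ x, G j (Function.update t j x) *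
      (if bad j (Function.update t j x) then 1 else 0) ≤ e) :
    ∑ t, (∏ j, G j t) * (if ∃ j, bad j t then 1 else 0) ≤ J * e := by
  induction J with
  | zero => simp
  | succ J ih =>
    obtain ⟨x₀⟩ := ‹Nonempty X›
    have ihx : ∀ x, ∑ t : Fin J → X, (∏ j : Fin J, G j.succ (Fin.cons x t)) *
        (if ∃ j : Fin J, bad j.succ (Fin.cons x t) then 1 else 0) ≤ J * e := by
      intro x
      refine ih (hG.tail x) (bad := fun j t => bad j.succ (Fin.cons x t)) ?_ ?_
      · intro j t t' h
        refine hdep _ _ _ fun i hi => ?_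
        refine Fin.cases (fun _ => rfl) (fun i hi => ?_) i hi
        simpa using h i (by simpa using hi)
      · intro j t
        have := hbad j.succ (Fin.cons x t)
        simpa only [Fin.cons_update] using this
    have hb0 : ∀ x t, bad 0 (Fin.cons x t) ↔ bad 0 (Fin.cons x fun _ : Fin J => x₀) :=
      fun x t => hdep _ _ _ fun i hi => by
        obtain rfl : i = 0 := by simpa using hi
        rfl
    set g : X → ℝ := fun x => G 0 (Fin.cons x fun _ => x₀) with hg
    set b : X → ℝ := fun x => if bad 0 (Fin.cons x fun _ => x₀) then 1 else 0 with hb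
    have hg1 : ∑ x, g x = 1 := hG.sum_head fun _ => x₀
    have hgb : ∑ x, g x * b x ≤ e := by
      have := hbad 0 (Fin.cons x₀ fun _ => x₀)
      simpa only [Fin.update_cons_zero] using this
    have hstep : ∀ x, ∑ t : Fin J → X, (∏ j, G j (Fin.cons x t)) *
        (if ∃ j, bad j (Fin.cons x t) then 1 else 0) ≤ g x * b x + g x * (J * e) := by
      intro x
      calc ∑ t : Fin J → X, (∏ j, G j (Fin.cons x t)) *
            (if ∃ j, bad j (Fin.cons x t) then 1 else 0)
          ≤ ∑ t : Fin J → X, (g x * b x * ∏ j : Fin J, G j.succ (Fin.cons x t) +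
              g x * ((∏ j : Fin J, G j.succ (Fin.cons x t)) *
                (if ∃ j : Fin J, bad j.succ (Fin.cons x t) then 1 else 0))) := by
            refine Finset.sum_le_sum fun t _ => ?_
            rw [Fin.prod_univ_succ, hG.head_eq x t fun _ => x₀]
            have hp : 0 ≤ ∏ j : Fin J, G j.succ (Fin.cons x t) :=
              Finset.prod_nonneg fun j _ => hG.nonneg _ _
            have h0 : 0 ≤ g x := hG.nonneg _ _
            have hi : (if ∃ j, bad j (Fin.cons x t) then (1 : ℝ) else 0) ≤
                b x + if ∃ j : Fin J, bad j.succ (Fin.cons x t) then 1 else 0 := by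
              by_cases h : ∃ j, bad j (Fin.cons x t)
              · rw [if_pos h]
                obtain ⟨j, hj⟩ := h
                rcases Fin.eq_zero_or_eq_succ j with rfl | ⟨j, rfl⟩
                · have : b x = 1 := if_pos ((hb0 x t).1 hj)
                  rw [this]
                  split_ifs <;> norm_num
                · rw [if_pos ⟨j, hj⟩]
                  have : 0 ≤ b x := by simp only [hb]; split_ifs <;> norm_num
                  linarith
              · rw [if_neg h]
                have : 0 ≤ b x := by simp only [hb]; split_ifs <;> norm_num
                split_ifs <;> linarith
            have := mul_le_mul_of_nonneg_left hi (mul_nonneg h0 hp)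
            calc _ ≤ _ := this
              _ = _ := by ring
        _ = g x * b x + g x * ∑ t : Fin J → X, (∏ j : Fin J, G j.succ (Fin.cons x t)) *
                (if ∃ j : Fin J, bad j.succ (Fin.cons x t) then 1 else 0) := by
            rw [Finset.sum_add_distrib, ← Finset.mul_sum, (hG.tail x).sum_eq_one,
              ← Finset.mul_sum, mul_one]
        _ ≤ _ := by
            have h0 : 0 ≤ g x := hG.nonneg _ _
            have := mul_le_mul_of_nonneg_left (ihx x) h0
            linarith
    rw [sum_cons_eq]
    calc _ ≤ ∑ x, (g x * b x + g x * (J * e)) := Finset.sum_le_sum fun x _ => hstep x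
      _ = ∑ x, g x * b x + J * e := by
        rw [Finset.sum_add_distrib, ← Finset.sum_mul, hg1, one_mul]
      _ ≤ _ := by push_cast; linarith

end Seq

/-! ### Reading an integer from noisy phases -/

/-- `x` is within `1/6` of an integer. -/
def Near (x : ℝ) : Prop := ∃ z : ℤ, |x - z| ≤ 1 / 6

/-- A procedure that reads an integer `v < N` by adaptive decisions: the `j`-th decision concerns
the phase `F j * v / N + c₀ j + ∑ c j i`, where `i` ranges over the earlier positive decisions,
and the result is the sum of the weights `e j` of the positive decisions. -/
structure Reader where
  N : ℕ
  F : ℕ → ℕ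
  c₀ : ℕ → ℝ
  c : ℕ → ℕ → ℝ
  e : ℕ → ℕ

namespace Reader

/-- The phase of the `j`-th decision. -/
def phase (R : Reader) (v : ℕ) (d : ℕ → Bool) (j : ℕ) : ℝ :=
  R.F j * v / R.N + R.c₀ j + ∑ i ∈ Finset.range j, if d i then R.c j i else 0

/-- The `j`-th decision is right, if the phase is close to `0` or to `1/2`. -/
def Consistent (R : Reader) (v : ℕ) (d : ℕ → Bool) (j : ℕ) : Prop :=
  (Near (R.phase v d j) → d j = false) ∧ (Near (R.phase v d j - 1 / 2) → d j = true)

/-- The result of the decisions. -/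
def value (R : Reader) (J : ℕ) (d : ℕ → Bool) : ℕ :=
  ∑ j ∈ Finset.range J, if d j then R.e j else 0

end Reader

/-- The reader that determines first the binary expansion of `(v + 1/2) / N`, beginning with the
least significant bits, and then the binary digits of `v`. -/
def stdReader (N : ℕ) : Reader where
  N := N
  F j := if j ≤ Nat.clog 2 N then 2 ^ (Nat.clog 2 N - j) % N else 0
  c₀ j := if j ≤ Nat.clog 2 N then 2 ^ (Nat.clog 2 N - j) / (2 * N)
    else -(1 / 2) / 2 ^ (j - Nat.clog 2 N)
  c j i := if j ≤ Nat.clog 2 N then -((1 / 2) ^ (j - i) / 2)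
    else if i ≤ Nat.clog 2 N then N * (1 / 2) ^ (Nat.clog 2 N + 1 - i) / 2 ^ (j - Nat.clog 2 N)
    else -(2 ^ (i - Nat.clog 2 N - 1) / 2 ^ (j - Nat.clog 2 N))
  e j := if j ≤ Nat.clog 2 N then 0 else 2 ^ (j - Nat.clog 2 N - 1)

section Std

variable {N v : ℕ} {d : ℕ → Bool}

/-- The fraction with the binary digits `d (j - 1), …, d 0`. -/
def fracOf (d : ℕ → Bool) (j : ℕ) : ℝ := ∑ i ∈ Finset.range j, if d i then (1 / 2 : ℝ) ^ (j - i) else 0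

lemma fracOf_succ (d : ℕ → Bool) (j : ℕ) :
    fracOf d (j + 1) = (fracOf d j + if d j then 1 else 0) / 2 := by
  rw [fracOf, Finset.sum_range_succ, add_div, fracOf, Finset.sum_div]
  congr 1
  · refine Finset.sum_congr rfl fun i hi => ?_
    have : j + 1 - i = (j - i) + 1 := by have := Finset.mem_range.1 hi; omega
    split_ifs
    · rw [this, pow_succ]; ring
    · simp
  · split_ifs <;> simp

lemma fracOf_nonneg (d : ℕ → Bool) (j : ℕ) : 0 ≤ fracOf d j :=
  Finset.sum_nonneg fun i _ => by split_ifs <;> positivity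

lemma fracOf_lt_one (d : ℕ → Bool) (j : ℕ) : fracOf d j < 1 := by
  induction j with
  | zero => simp [fracOf]
  | succ j ih => rw [fracOf_succ]; split_ifs <;> linarith

/-- A frequency 2^(K-j) with K = `Nat.clog 2 N` may exceed the phase register; reducing it modulo N
changes the phase by an integer only. -/
lemma stdReader_phase_low (hN : 0 < N) {j : ℕ} (hj : j ≤ Nat.clog 2 N) :
    ∃ k : ℤ, (stdReader N).phase v d j =
      2 ^ (Nat.clog 2 N - j) * ((v + 1 / 2) / N) - fracOf d j / 2 + k := by
  have hN' : (N : ℝ) ≠ 0 := by positivity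
  obtain ⟨A, hA⟩ : ∃ A, A = 2 ^ (Nat.clog 2 N - j) % N := ⟨_, rfl⟩
  obtain ⟨B, hB⟩ : ∃ B, B = 2 ^ (Nat.clog 2 N - j) / N := ⟨_, rfl⟩
  refine ⟨-((B : ℤ) * v), ?_⟩
  have hdiv : (A : ℝ) + N * B = 2 ^ (Nat.clog 2 N - j) := by
    rw [hA, hB]
    exact_mod_cast Nat.mod_add_div (2 ^ (Nat.clog 2 N - j)) N
  have hsum : (∑ i ∈ Finset.range j, if d i then (stdReader N).c j i else 0) =
      -(fracOf d j / 2) := by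
    rw [fracOf, Finset.sum_div, ← Finset.sum_neg_distrib]
    refine Finset.sum_congr rfl fun i hi => ?_
    simp only [stdReader, if_pos hj]
    split_ifs <;> ring
  rw [Reader.phase, hsum]
  simp only [stdReader, if_pos hj]
  rw [← hA]
  push_cast
  rw [← hdiv]
  field_simp
  ring

/-- Let K = `Nat.clog 2 N` and θ = (v + 1/2)/N. After decision j, the number 2^(K-j) θ minus the
binary fraction read so far is within (1/3) 2^(-j) of an integer. The first phase can lie anywhere,
and either decision permitted by `Consistent` leaves an error of at most 1/3. Passing to the next
digit halves the error; from then on it is at most 1/6, the phase is near 0 or near 1/2, and the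
decision is forced. -/
lemma stdReader_stage_one (hN : 0 < N) (hv : v < N)
    (hd : ∀ j ≤ Nat.clog 2 N, (stdReader N).Consistent v d j) :
    |(N : ℝ) * fracOf d (Nat.clog 2 N + 1) - 1 / 2 - v| ≤ 1 / 3 := by
  set K := Nat.clog 2 N with hK
  set θ : ℝ := (v + 1 / 2) / N with hθ
  have hN' : (0 : ℝ) < N := by positivity
  have key : ∀ j ≤ K, ∃ z : ℤ,
      |2 ^ (K - j) * θ - fracOf d (j + 1) - z| ≤ (1 / 3) * (1 / 2) ^ j := by
    intro j
    induction j with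
    | zero =>
      intro hj
      obtain ⟨k, hk⟩ := stdReader_phase_low (v := v) (d := d) hN hj
      obtain ⟨h1, h2⟩ := hd 0 hj
      rw [hk] at h1 h2
      rw [fracOf_succ]
      rw [← hK, ← hθ] at h1 h2
      have hf0 : fracOf d 0 = 0 := by simp [fracOf]
      rw [hf0] at h1 h2 ⊢
      set y : ℝ := 2 ^ (K - 0) * θ
      have hr := abs_sub_round y
      rw [abs_le] at hr
      cases hd0 : d 0
      · refine ⟨round y, ?_⟩
        by_contra hcon
        have hfar : ¬ Near (y - 0 / 2 + k - 1 / 2) := fun h => by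
          have := h2 h; rw [hd0] at this; exact absurd this (by simp)
        apply hfar
        simp only [Bool.false_eq_true, if_false, pow_zero, mul_one] at hcon
        rw [abs_le, not_and_or, not_le, not_le] at hcon
        rcases hcon with hcon | hcon
        · refine ⟨round y + k - 1, ?_⟩
          rw [abs_le]
          push_cast
          constructor <;> linarith [hr.1, hr.2]
        · refine ⟨round y + k, ?_⟩
          rw [abs_le]
          push_cast
          constructor <;> linarith [hr.1, hr.2]
      · have hfar : ¬ Near (y - 0 / 2 + k) := fun h => by
          have := h1 h; rw [hd0] at this; exact absurd this (by simp)
        have hr' : ¬ |y - round y| ≤ 1 / 6 := fun h => hfar ⟨round y + k, by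
          rwa [show y - 0 / 2 + k - ((round y + k : ℤ) : ℝ) = y - round y by push_cast; ring]⟩
        rw [abs_le, not_and_or, not_le, not_le] at hr'
        rcases hr' with hr' | hr'
        · refine ⟨round y - 1, ?_⟩
          rw [abs_le]
          simp only [if_true]
          push_cast
          constructor <;> linarith [hr.1, hr.2]
        · refine ⟨round y, ?_⟩
          rw [abs_le]
          simp only [if_true]
          constructor <;> linarith [hr.1, hr.2]
    | succ j ih =>
      intro hj
      obtain ⟨z, hz⟩ := ih (by omega)
      obtain ⟨k, hk⟩ := stdReader_phase_low (v := v) (d := d) hN hj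
      obtain ⟨h1, h2⟩ := hd (j + 1) hj
      rw [hk] at h1 h2
      rw [← hK, ← hθ] at h1 h2
      rw [fracOf_succ]
      have hpow : (2 : ℝ) ^ (K - j) = 2 * 2 ^ (K - (j + 1)) := by
        rw [show K - j = (K - (j + 1)) + 1 by omega, pow_succ]; ring
      rw [hpow] at hz
      set y : ℝ := 2 ^ (K - (j + 1)) * θ
      set H := fracOf d (j + 1)
      have hsmall : (1 / 3 : ℝ) * (1 / 2) ^ (j + 1) ≤ 1 / 6 := by
        have : (1 / 2 : ℝ) ^ (j + 1) ≤ 1 / 2 := by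
          rw [pow_succ]
          have : (1 / 2 : ℝ) ^ j ≤ 1 := pow_le_one₀ (by norm_num) (by norm_num)
          linarith
        linarith
      have hz' : |y - H / 2 - z / 2| ≤ (1 / 3) * (1 / 2) ^ (j + 1) := by
        rw [show y - H / 2 - z / 2 = (2 * 2 ^ (K - (j + 1)) * θ - H - z) / 2 by
          simp only [y]; ring, abs_div, pow_succ]
        simp only [Nat.abs_ofNat]
        linarith
      -- Halving the relation for digit j, the parity of the nearest integer is the next digit: even
      -- puts the phase near 0, odd near 1/2.
      rcases Int.even_or_odd' z with ⟨u, rfl | rfl⟩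
      · have : Near (y - H / 2 + k) := ⟨u + k, by
          refine le_trans (le_of_eq ?_) (hz'.trans hsmall)
          congr 1
          push_cast
          ring⟩
        rw [h1 this]
        refine ⟨u, le_trans (le_of_eq ?_) hz'⟩
        congr 1
        push_cast
        simp
      · have : Near (y - H / 2 + k - 1 / 2) := ⟨u + k, by
          refine le_trans (le_of_eq ?_) (hz'.trans hsmall)
          congr 1
          push_cast
          ring⟩
        rw [h2 this]
        refine ⟨u, le_trans (le_of_eq ?_) hz'⟩
        congr 1
        push_cast
        simp
        ring
  obtain ⟨z, hz⟩ := key K le_rfl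
  rw [Nat.sub_self, pow_zero, one_mul] at hz
  have hpow : (1 / 2 : ℝ) ^ K ≤ 1 / N := by
    rw [one_div, inv_pow, ← one_div]
    have : (N : ℝ) ≤ 2 ^ K := by exact_mod_cast Nat.le_pow_clog (by norm_num) N
    exact one_div_le_one_div_of_le hN' this
  have hz1 : |θ - fracOf d (K + 1) - z| ≤ 1 / 3 * (1 / N) := by
    refine hz.trans ?_
    gcongr
  have hinv : (0 : ℝ) < 1 / N := by positivity
  -- The offset 1/2 keeps θ at distance 1/(2N) from 0 and from 1, more than the error 1/(3N). So the
  -- fraction approximates θ itself and not only θ modulo 1.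
  have hθ1 : 1 / N * (1 / 2) ≤ θ := by
    have : (0 : ℝ) ≤ v := Nat.cast_nonneg v
    rw [hθ, le_div_iff₀ hN', show 1 / (N : ℝ) * (1 / 2) * N = 1 / 2 by field_simp]
    linarith
  have hθ2 : θ ≤ 1 - 1 / N * (1 / 2) := by
    have : (v : ℝ) + 1 ≤ N := by exact_mod_cast hv
    rw [hθ, div_le_iff₀ hN']
    have : (1 - 1 / N * (1 / 2)) * (N : ℝ) = N - 1 / 2 := by field_simp
    linarith
  have hf1 := fracOf_nonneg d (K + 1)
  have hf2 := fracOf_lt_one d (K + 1)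
  rw [abs_le] at hz1
  have hz0 : z = 0 := by
    have h1 : (z : ℝ) < 1 := by linarith [hz1.1]
    have h2 : (-1 : ℝ) < z := by linarith [hz1.2]
    have h1' : z < 1 := by exact_mod_cast h1
    have h2' : -1 < z := by exact_mod_cast h2
    omega
  rw [hz0, Int.cast_zero, sub_zero] at hz1
  have hNθ : (N : ℝ) * θ = v + 1 / 2 := by rw [hθ]; field_simp
  have hN1 : (N : ℝ) * (1 / 3 * (1 / N)) = 1 / 3 := by field_simp
  rw [abs_le]
  have h1 := mul_le_mul_of_nonneg_left hz1.1 hN'.le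
  have h2 := mul_le_mul_of_nonneg_left hz1.2 hN'.le
  constructor <;> nlinarith

/-- A real number within 1/3 of `v` is known. Once the low k digits of `v` are subtracted, dividing
by 2^(k+1) gives half of `v / 2 ^ k` up to an error 1/6, so the phase reveals the next digit. These
tests have frequency 0; phases controlled by earlier decisions take the place of an arithmetic
circuit for rounding. -/
lemma stdReader_stage_two
    (hy : |(N : ℝ) * fracOf d (Nat.clog 2 N + 1) - 1 / 2 - v| ≤ 1 / 3)
    (hd : ∀ k < Nat.clog 2 N, (stdReader N).Consistent v d (Nat.clog 2 N + 1 + k)) :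
    ∀ k ≤ Nat.clog 2 N, (∑ l ∈ Finset.range k, if d (Nat.clog 2 N + 1 + l) then 2 ^ l else 0) =
      v % 2 ^ k := by
  set K := Nat.clog 2 N with hK
  intro k
  induction k with
  | zero => intro _; simp [Nat.mod_one]
  | succ k ih =>
    intro hk
    have ih := ih (by omega)
    obtain ⟨h1, h2⟩ := hd k (by omega)
    have hphase : (stdReader N).phase v d (K + 1 + k) =
        (N * fracOf d (K + 1) - 1 / 2 - (v % 2 ^ k : ℕ)) / 2 ^ (k + 1) := by
      have hnot : ¬ K + 1 + k ≤ K := by omega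
      have hexp : K + 1 + k - K = k + 1 := by omega
      rw [Reader.phase, Finset.sum_range_add]
      simp only [stdReader, ← hK, if_neg hnot, hexp]
      have e1 : (∑ i ∈ Finset.range (K + 1), if d i = true then
          (if i ≤ K then (N : ℝ) * (1 / 2) ^ (K + 1 - i) / 2 ^ (k + 1)
            else -(2 ^ (i - K - 1) / 2 ^ (k + 1))) else 0) =
          N * fracOf d (K + 1) / 2 ^ (k + 1) := by
        rw [fracOf, Finset.mul_sum, Finset.sum_div]
        refine Finset.sum_congr rfl fun i hi => ?_
        have : i ≤ K := by have := Finset.mem_range.1 hi; omega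
        rw [if_pos this]
        split_ifs <;> simp
      have e2 : (∑ l ∈ Finset.range k, if d (K + 1 + l) = true then
          (if K + 1 + l ≤ K then (N : ℝ) * (1 / 2) ^ (K + 1 - (K + 1 + l)) / 2 ^ (k + 1)
            else -(2 ^ (K + 1 + l - K - 1) / 2 ^ (k + 1))) else 0) =
          -((v % 2 ^ k : ℕ) : ℝ) / 2 ^ (k + 1) := by
        rw [← ih, Nat.cast_sum, ← Finset.sum_neg_distrib, Finset.sum_div]
        refine Finset.sum_congr rfl fun l hl => ?_
        have : ¬ K + 1 + l ≤ K := by omega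
        rw [if_neg this, show K + 1 + l - K - 1 = l by omega]
        split_ifs
        · push_cast; ring
        · simp
      rw [e1, e2]
      push_cast
      ring
    rw [hphase] at h1 h2
    set y : ℝ := N * fracOf d (K + 1) - 1 / 2 with hy'
    have h2k : (0 : ℝ) < 2 ^ k := by positivity
    have hmod : (v : ℝ) = (v % 2 ^ k : ℕ) + 2 ^ k * (v / 2 ^ k : ℕ) := by
      exact_mod_cast (Nat.mod_add_div v (2 ^ k)).symm
    have herr : |(y - v) / 2 ^ (k + 1)| ≤ 1 / 6 := by
      rw [abs_div, abs_of_pos (show (0 : ℝ) < 2 ^ (k + 1) by positivity), div_le_iff₀ (by positivity)]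
      have : (1 : ℝ) ≤ 2 ^ k := one_le_pow₀ (by norm_num)
      rw [pow_succ]
      linarith
    have hφ : (y - (v % 2 ^ k : ℕ)) / 2 ^ (k + 1) =
        (y - v) / 2 ^ (k + 1) + (v / 2 ^ k : ℕ) / 2 := by
      have : y - ((v % 2 ^ k : ℕ) : ℝ) = (y - v) + 2 ^ k * (v / 2 ^ k : ℕ) := by
        linarith
      rw [this, pow_succ]
      field_simp
    rw [hφ] at h1 h2
    rw [Finset.sum_range_succ, ih, Nat.mod_pow_succ]
    congr 1
    rcases Nat.even_or_odd' (v / 2 ^ k) with ⟨u, hu | hu⟩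
    · have : d (K + 1 + k) = false := h1 ⟨u, by
        rw [hu]
        push_cast
        rwa [show (y - v) / 2 ^ (k + 1) + 2 * (u : ℝ) / 2 - u = (y - v) / 2 ^ (k + 1) by ring]⟩
      rw [this, hu]
      simp
    · have : d (K + 1 + k) = true := h2 ⟨u, by
        rw [hu]
        push_cast
        rwa [show (y - v) / 2 ^ (k + 1) + (2 * (u : ℝ) + 1) / 2 - 1 / 2 - u =
          (y - v) / 2 ^ (k + 1) by ring]⟩
      rw [this, hu]
      simp [Nat.add_mod]

lemma stdReader_value (hN : 0 < N) (hv : v < N)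
    (hd : ∀ j < 2 * Nat.clog 2 N + 1, (stdReader N).Consistent v d j) :
    (stdReader N).value (2 * Nat.clog 2 N + 1) d = v := by
  have h1 := stdReader_stage_one hN hv fun j hj => hd j (by omega)
  have h2 := stdReader_stage_two h1 (fun k hk => hd _ (by omega)) _ le_rfl
  rw [Nat.mod_eq_of_lt (lt_of_lt_of_le hv (Nat.le_pow_clog (by norm_num) N))] at h2
  rw [Reader.value, show 2 * Nat.clog 2 N + 1 = (Nat.clog 2 N + 1) + Nat.clog 2 N by ring,
    Finset.sum_range_add]
  rw [Finset.sum_eq_zero, zero_add, ← h2]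
  · refine Finset.sum_congr rfl fun l hl => ?_
    have hnot : ¬ Nat.clog 2 N + 1 + l ≤ Nat.clog 2 N := by omega
    simp only [stdReader, if_neg hnot]
    rw [show Nat.clog 2 N + 1 + l - Nat.clog 2 N - 1 = l by omega]
  · intro j hj
    have : j ≤ Nat.clog 2 N := by have := Finset.mem_range.1 hj; omega
    simp [stdReader, this]

lemma stdReader_F_lt (hN : 0 < N) (j : ℕ) : (stdReader N).F j < N := by
  simp only [stdReader]
  split_ifs
  · exact Nat.mod_lt _ hN
  · exact hN

end Std

/-! ### The outcomes of the tests of a reader -/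

/-- The decisions from the outcomes of the tests. -/
def decs {J t : ℕ} (s : Fin J → Leaf t → Bool) (i : ℕ) : Bool :=
  if h : i < J then maj t (s ⟨i, h⟩) else false

lemma decs_fin {J t : ℕ} (s : Fin J → Leaf t → Bool) (j : Fin J) : decs s j = maj t (s j) :=
  dif_pos j.2

lemma decs_congr {J t : ℕ} {s s' : Fin J → Leaf t → Bool} {i : ℕ}
    (h : ∀ k : Fin J, (k : ℕ) = i → s k = s' k) : decs s i = decs s' i := by
  unfold decs
  split_ifs with hi
  · rw [h ⟨i, hi⟩ rfl]
  · rfl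

namespace Reader

lemma phase_congr (R : Reader) (v : ℕ) {d d' : ℕ → Bool} {j : ℕ} (h : ∀ i < j, d i = d' i) :
    R.phase v d j = R.phase v d' j := by
  unfold phase
  congr 1
  exact Finset.sum_congr rfl fun i hi => by rw [h i (Finset.mem_range.1 hi)]

end Reader

/-- The threshold 1/6 in `Near` is chosen so that sin²(π/6) = 1/4. -/
lemma normSq_amp_true_le {x : ℝ} (h : Near x) : ‖amp x true‖ ^ 2 ≤ 1 / 4 := by
  obtain ⟨z, hz⟩ := h
  rw [normSq_amp, if_pos rfl]
  have h1 : Real.sin (Real.pi * x) ^ 2 = 1 / 2 - Real.cos (2 * (Real.pi * x)) / 2 :=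
    Real.sin_sq_eq_half_sub _
  have h2 : Real.cos (2 * (Real.pi * x)) = Real.cos |2 * Real.pi * (x - z)| := by
    rw [Real.cos_abs, ← Real.cos_sub_int_mul_two_pi (2 * (Real.pi * x)) z]
    congr 1
    ring
  have h3 : Real.cos (Real.pi / 3) ≤ Real.cos |2 * Real.pi * (x - z)| := by
    refine Real.cos_le_cos_of_nonneg_of_le_pi (abs_nonneg _) ?_ ?_
    · linarith [Real.pi_pos]
    · rw [abs_mul, abs_of_pos (by positivity)]
      nlinarith [Real.pi_pos]
  rw [Real.cos_pi_div_three] at h3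
  linarith

lemma normSq_amp_false_le {x : ℝ} (h : Near (x - 1 / 2)) : ‖amp x false‖ ^ 2 ≤ 1 / 4 := by
  have h1 := normSq_amp_true_le h
  rw [normSq_amp, if_pos rfl] at h1
  rw [normSq_amp, if_neg (by simp)]
  rw [show Real.pi * (x - 1 / 2) = Real.pi * x - Real.pi / 2 by ring, Real.sin_sub_pi_div_two,
    neg_sq] at h1
  exact h1

lemma not_near_both {x : ℝ} (h : Near x) (h' : Near (x - 1 / 2)) : False := by
  obtain ⟨z, hz⟩ := h
  obtain ⟨y, hy⟩ := h'
  rw [abs_le] at hz hy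
  have h1 : ((z - y : ℤ) : ℝ) < 1 := by push_cast; linarith [hz.1, hy.2]
  have h2 : (0 : ℝ) < ((z - y : ℤ) : ℝ) := by push_cast; linarith [hz.2, hy.1]
  have h1' : z - y < 1 := by exact_mod_cast h1
  have h2' : 0 < z - y := by exact_mod_cast h2
  omega

/-- The probability of the outcomes of the tests for the `j`-th decision, given the earlier ones. -/
def readWeight (R : Reader) (v : ℕ) {J t : ℕ} (j : Fin J) (s : Fin J → Leaf t → Bool) : ℝ :=
  bitWeight (fun b => ‖amp (R.phase v (decs s) j) b‖ ^ 2) (s j)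

lemma phase_update (R : Reader) (v : ℕ) {J t : ℕ} (j : Fin J) (s : Fin J → Leaf t → Bool) (x) :
    R.phase v (decs (Function.update s j x)) j = R.phase v (decs s) j :=
  R.phase_congr v fun i hi => decs_congr fun k hk =>
    Function.update_of_ne (by rintro rfl; omega) _ _

lemma adaptive_readWeight (R : Reader) (v : ℕ) (J t : ℕ) :
    Adaptive J (readWeight R v : Fin J → (Fin J → Leaf t → Bool) → ℝ) where
  nonneg j s := Finset.prod_nonneg fun _ _ => by positivity
  dep j s s' h := by
    unfold readWeight
    rw [h j le_rfl, R.phase_congr v fun i hi => decs_congr fun k hk => h k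
      (by rw [Fin.le_def]; omega)]
  total j s := by
    simp only [readWeight, phase_update, Function.update_self]
    exact sum_bitWeight (by rw [add_comm]; exact sum_normSq_amp _)

open Classical in
-- Given the earlier outcomes, the phase of a decision is fixed. If it is near 0 or near 1/2 a wrong
-- majority has probability at most (3/4)^(2^t); otherwise no decision counts as wrong. The adaptive
-- union bound adds the stages.
lemma sum_inconsistent_le (R : Reader) (v : ℕ) (J t : ℕ) :
    ∑ s : Fin J → Leaf t → Bool, (∏ j, readWeight R v j s) *
      (if ∃ j : Fin J, ¬ R.Consistent v (decs s) j then 1 else 0) ≤ J * (3 / 4) ^ 2 ^ t := by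
  refine le_trans (le_of_eq (Finset.sum_congr rfl fun s _ => by congr))
    ((adaptive_readWeight R v J t).sum_bad_le (e := (3 / 4) ^ 2 ^ t)
      (bad := fun j s => ¬ R.Consistent v (decs s) j) ?_ ?_)
  · intro j s s' h
    have h1 : R.phase v (decs s) j = R.phase v (decs s') j :=
      R.phase_congr v fun i hi => decs_congr fun k hk => h k (by rw [Fin.le_def]; omega)
    have h2 : decs s j = decs s' j := by rw [decs_fin, decs_fin, h j le_rfl]
    simp only [Reader.Consistent, h1, h2]
  · intro j s
    simp only [readWeight, phase_update, Function.update_self]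
    set φ := R.phase v (decs s) j with hφ
    have hcons : ∀ x, R.Consistent v (decs (Function.update s j x)) j ↔
        (Near φ → maj t x = false) ∧ (Near (φ - 1 / 2) → maj t x = true) := by
      intro x
      rw [Reader.Consistent, phase_update, decs_fin, Function.update_self]
    have hg0 : ∀ b, 0 ≤ ‖amp φ b‖ ^ 2 := fun b => by positivity
    have hg1 : ‖amp φ true‖ ^ 2 + ‖amp φ false‖ ^ 2 = 1 := by
      rw [add_comm]; exact sum_normSq_amp _
    simp only [hcons]
    by_cases h1 : Near φ
    · have h2 : ¬ Near (φ - 1 / 2) := fun h => not_near_both h1 h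
      refine le_trans (le_of_eq ?_) (majProb_le hg0 hg1 (v := true) (normSq_amp_true_le h1) t)
      rw [majProb]
      refine Finset.sum_congr rfl fun x _ => ?_
      simp only [h1, h2, false_implies, true_implies]
      cases maj t x <;> simp
    · by_cases h2 : Near (φ - 1 / 2)
      · refine le_trans (le_of_eq ?_) (majProb_le hg0 hg1 (v := false) (normSq_amp_false_le h2) t)
        rw [majProb]
        refine Finset.sum_congr rfl fun x _ => ?_
        simp only [h1, h2, false_implies, true_implies]
        cases maj t x <;> simp
      · simp only [h1, h2, false_implies, and_self, not_true_eq_false, if_false, mul_zero,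
          Finset.sum_const_zero]
        positivity

/-! ### Simulation of a query -/

lemma ofBits_eq_sum {n : ℕ} (b : Fin n → Bool) :
    Nat.ofBits b = ∑ i : Fin n, if b i then 2 ^ (i : ℕ) else 0 := by
  induction n with
  | zero => simp [Nat.ofBits_zero]
  | succ n ih =>
    rw [Nat.ofBits_succ, ih, Fin.sum_univ_succ, Finset.mul_sum, add_comm]
    congr 1
    · cases b 0 <;> simp
    · refine Finset.sum_congr rfl fun i _ => ?_
      simp only [Function.comp, Fin.val_succ, pow_succ]
      split_ifs <;> simp [mul_comm]

lemma nsq_hadOp {A : Type} [Fintype A] [DecidableEq A] (q : A) (ψ : St A) :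
    nsq (hadOp q ψ) = nsq ψ :=
  Realizes.nsq_eq (M := 0) (N := 0) (f := id) (C := [hadMac q])
    (Realizes.single (hadMac_instr _ q)) ψ

lemma nsq_testOp {A : Type} [Fintype A] [DecidableEq A] (q : A) (θ) (ψ : St A) :
    nsq (testOp q θ ψ) = nsq ψ := by
  rw [testOp_apply, nsq_hadOp, nsq_diagOp, nsq_hadOp]
  intro w
  unfold cphase
  split_ifs <;> simp [norm_ephase]

lemma nsq_testSeq {A T : Type} [Fintype A] [DecidableEq A] [DecidableEq T] (τ : T ↪ A) (θ) (l)
    (ψ : St A) : nsq (testSeq τ θ l ψ) = nsq ψ := by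
  induction l generalizing ψ with
  | nil => rfl
  | cons t l ih => exact (ih _).trans (nsq_testOp _ _ _)

lemma testSeq_sub {A T : Type} [DecidableEq A] [DecidableEq T] (τ : T ↪ A) (θ) (l)
    (ψ φ : St A) : testSeq τ θ l (ψ - φ) = testSeq τ θ l ψ - testSeq τ θ l φ := by
  induction l generalizing ψ φ with
  | nil => rfl
  | cons t l ih =>
    have h : ∀ ψ, testSeq τ θ (t :: l) ψ = testSeq τ θ l (testOp (τ t) (θ t) ψ) := fun _ => rfl
    rw [h, h, h, map_sub, ih]

/-- The tests of the standard reader for numbers below `N`. -/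
abbrev Tests (N t : ℕ) : Type := Fin (2 * Nat.clog 2 N + 1) × Leaf t

/-- All tests in their order. -/
def testList (N t : ℕ) : List (Tests N t) :=
  (List.finRange _).flatMap fun j => (Finset.univ : Finset (Leaf t)).toList.map fun l => (j, l)

lemma mem_testList {N t : ℕ} (q : Tests N t) : q ∈ testList N t := by
  simp [testList]

lemma testList_nodup (N t : ℕ) : (testList N t).Nodup := by
  refine List.nodup_flatMap.2 ⟨fun j _ => ?_, ?_⟩
  · exact (Finset.nodup_toList _).map fun a b h => (Prod.mk.inj h).2
  · refine (List.nodup_finRange _).imp fun {i j} hij => ?_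
    intro q hq hq'
    simp only [List.mem_map] at hq hq'
    obtain ⟨_, _, rfl⟩ := hq
    obtain ⟨_, _, h⟩ := hq'
    exact hij (Prod.mk.inj h).1.symm

lemma testList_pairwise (N t : ℕ) : (testList N t).Pairwise fun q q' => q.1 ≤ q'.1 := by
  refine List.pairwise_flatMap.2 ⟨fun j _ => ?_, ?_⟩
  · rw [List.pairwise_map]
    exact List.pairwise_of_forall fun _ _ => le_rfl
  · refine (List.pairwise_lt_finRange _).imp fun {i j} hij => ?_
    simp only [List.mem_map]
    rintro _ ⟨_, _, rfl⟩ _ ⟨_, _, rfl⟩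
    exact hij.le

lemma length_testList (N t : ℕ) : (testList N t).length = (2 * Nat.clog 2 N + 1) * 3 ^ t := by
  simp [testList, List.length_flatMap]

/-- The data of a simulated query: the test qubits, the formulas for the bits of the point `x`
where the available oracle is to be queried, for the phase register `p` and for the validity of
the query. -/
structure QuerySim (M N t P : ℕ) (A : Type) where
  τ : Tests N t ↪ A
  hx : Fin (Nat.clog 2 M) → BExpr A
  pe : Fin P → BExpr A
  valid : BExpr A
  hx_uses : ∀ j q, ¬ (hx j).Uses (τ q)
  pe_uses : ∀ j q, ¬ (pe j).Uses (τ q)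
  valid_uses : ∀ q, ¬ valid.Uses (τ q)
  x : (A → Bool) → Fin M
  hxx : ∀ w, (Nat.ofBits fun j => (hx j).eval w) = x w

namespace QuerySim

variable {M N t P : ℕ} {A : Type} [DecidableEq A] (Z : QuerySim M N t P A) (f : Fin M → Fin N)
  (m : ℕ)

/-- The outcomes of the tests. -/
def outc (w : A → Bool) : Fin (2 * Nat.clog 2 N + 1) → Leaf t → Bool := fun j l => w (Z.τ (j, l))

/-- The formula of a decision. -/
def decE (i : ℕ) : BExpr A :=
  if h : i < 2 * Nat.clog 2 N + 1 then majExpr t fun l => Z.τ (⟨i, h⟩, l) else .lit false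

lemma eval_decE (i : ℕ) (w : A → Bool) : (Z.decE i).eval w = decs (Z.outc w) i := by
  unfold decE decs
  split_ifs
  · rw [eval_majExpr]; rfl
  · rfl

lemma size_decE_le (i : ℕ) : (Z.decE i).size ≤ 2 * 6 ^ t := by
  unfold decE
  split_ifs
  · have := size_majExpr t fun l => Z.τ (⟨i, by assumption⟩, l)
    omega
  · have : 0 < 6 ^ t := by positivity
    simp only [BExpr.size]
    omega

/-- The phase of a test. -/
def θ (q : Tests N t) (w : A → Bool) : ℝ :=
  (stdReader N).phase (f (Z.x w)) (decs (Z.outc w)) q.1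

lemma x_indep (q : Tests N t) : IndepOf Z.x (Z.τ q) := by
  intro w b
  apply Fin.ext
  rw [← Z.hxx, ← Z.hxx]
  simp only [BExpr.eval_update (Z.hx_uses _ q)]

lemma θ_indep {q q' : Tests N t} (h : q.1 ≤ q'.1) : IndepOf (Z.θ f q) (Z.τ q') := by
  intro w b
  unfold θ
  rw [Z.x_indep q' w b]
  refine Reader.phase_congr _ _ fun i hi => decs_congr fun k hk => ?_
  funext l
  refine Function.update_of_ne (fun h' => ?_) _ _
  have := congrArg Prod.fst (Z.τ.injective h')
  simp only at this
  rw [Fin.le_def] at h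
  rw [this] at hk
  omega

/-- The macro gates of the phase of a test. -/
def fwd (q : Tests N t) : List (Mac M N A) :=
  [cquery Z.hx (.var (Z.τ q)) ((stdReader N).F q.1)] ++
    (.phase (.var (Z.τ q)) ((stdReader N).c₀ q.1) ::
      (List.finRange q.1).map fun i =>
        .phase (.op and (.var (Z.τ q)) (Z.decE i)) ((stdReader N).c q.1 i))

/-- The macro gates of the opposite phase. -/
def bwd (q : Tests N t) : List (Mac M N A) :=
  [cquery Z.hx (.var (Z.τ q)) ((N - (stdReader N).F q.1) % N)] ++
    (.phase (.var (Z.τ q)) (-(stdReader N).c₀ q.1) ::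
      (List.finRange q.1).map fun i =>
        .phase (.op and (.var (Z.τ q)) (Z.decE i)) (-(stdReader N).c q.1 i))

/-- The macro gates of the query phase, from the decisions. -/
def mid : List (Mac M N A) :=
  (Finset.univ : Finset (Fin P × Fin (2 * Nat.clog 2 N + 1))).toList.map fun u =>
    .phase (.op and Z.valid (.op and (Z.pe u.1) (Z.decE u.2)))
      (2 ^ (u.1 : ℕ) * (stdReader N).e u.2 / m)

/-- The macro gates of the simulated query. -/
def macs : List (Mac M N A) :=
  ((testList N t).flatMap fun q => testMac (Z.τ q) (Z.fwd q)) ++ (Z.mid m ++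
    (testList N t).reverse.flatMap fun q => testMac (Z.τ q) (Z.bwd q))

/-- The phase of the query, from the decisions. -/
def midPhase (w : A → Bool) : ℂ :=
  ephase (if Z.valid.eval w then ((Nat.ofBits fun j => (Z.pe j).eval w : ℕ) : ℝ) *
    (stdReader N).value (2 * Nat.clog 2 N + 1) (decs (Z.outc w)) / m else 0)

/-- The ideal phase of the query. -/
def ideal (w : A → Bool) : ℂ :=
  ephase (if Z.valid.eval w then ((Nat.ofBits fun j => (Z.pe j).eval w : ℕ) : ℝ) *
    (f (Z.x w) : ℕ) / m else 0)

/-- The operator of the simulated query. -/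
def op (ψ : St A) : St A :=
  testSeqInv Z.τ (Z.θ f) (testList N t) (diagOp (Z.midPhase m)
    (testSeq Z.τ (Z.θ f) (testList N t) ψ))

lemma realizes_fwd (q : Tests N t) : RealizesDiag f (Z.fwd q) (cphase (Z.τ q) (Z.θ f q)) := by
  have hN : 0 < N := by
    by_contra h
    obtain rfl : N = 0 := by omega
    exact (f (Z.x fun _ => false)).elim0
  refine RealizesDiag.congr ((realizes_cquery (.var (Z.τ q)) (stdReader_F_lt hN q.1) Z.x
    Z.hxx).append ((RealizesDiag.phase f (.var (Z.τ q)) _).append (RealizesDiag.phases f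
      (List.finRange q.1) (fun i => .op and (.var (Z.τ q)) (Z.decE i)) fun i => _))) fun w => ?_
  simp only [BExpr.eval, eval_decE, cphase, θ]
  rw [← ephase_add, ← ephase_add]
  by_cases hw : w (Z.τ q) = true
  · simp only [hw, if_true, Bool.true_and]
    rw [Reader.phase, Finset.sum_range, ← List.sum_ofFn, List.ofFn_eq_map, ← add_assoc]
    rfl
  · simp [hw, ephase_zero]

/-- The phase register holds natural numbers below N, so the opposite frequency is represented by (N
- F) mod N; the difference is an integer phase. -/
lemma realizes_bwd (q : Tests N t) :
    RealizesDiag f (Z.bwd q) (cphase (Z.τ q) fun w => -Z.θ f q w) := by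
  have hN : 0 < N := by
    by_contra h
    obtain rfl : N = 0 := by omega
    exact (f (Z.x fun _ => false)).elim0
  refine RealizesDiag.congr ((realizes_cquery (.var (Z.τ q)) (Nat.mod_lt _ hN) Z.x
    Z.hxx).append ((RealizesDiag.phase f (.var (Z.τ q)) _).append (RealizesDiag.phases f
      (List.finRange q.1) (fun i => .op and (.var (Z.τ q)) (Z.decE i)) fun i => _))) fun w => ?_
  simp only [BExpr.eval, eval_decE, cphase, θ]
  rw [← ephase_add, ← ephase_add]
  by_cases hw : w (Z.τ q) = true
  · simp only [hw, if_true, Bool.true_and]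
    have hN' : (N : ℝ) ≠ 0 := by positivity
    obtain ⟨k, hk⟩ : ∃ k : ℤ, (((N - (stdReader N).F q.1) % N : ℕ) : ℝ) * (f (Z.x w) : ℕ) / N =
        -((stdReader N).F q.1 * (f (Z.x w) : ℕ) / N) + k := by
      have hF := stdReader_F_lt hN q.1
      obtain ⟨a, ha⟩ : ∃ a, a = (N - (stdReader N).F q.1) % N := ⟨_, rfl⟩
      obtain ⟨b, hb⟩ : ∃ b, b = (N - (stdReader N).F q.1) / N := ⟨_, rfl⟩
      have hab : (a : ℝ) + N * b = N - (stdReader N).F q.1 := by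
        rw [← Nat.cast_sub hF.le, ha, hb]
        exact_mod_cast Nat.mod_add_div _ N
      refine ⟨(1 - b) * (f (Z.x w) : ℕ), ?_⟩
      rw [← ha, show (a : ℝ) = N - (stdReader N).F q.1 - N * b by linarith]
      push_cast
      field_simp
      ring
    have hs : (List.map (fun i : Fin q.1 => if decs (Z.outc w) i = true then
        -(stdReader N).c q.1 i else 0) (List.finRange q.1)).sum =
        -∑ i ∈ Finset.range q.1, if decs (Z.outc w) i = true then (stdReader N).c q.1 i else 0 := by
      rw [Finset.sum_range, ← Finset.sum_neg_distrib, ← List.sum_ofFn, List.ofFn_eq_map]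
      congr 2
      funext i
      split_ifs <;> simp
    rw [hk, hs, Reader.phase, ← ephase_add_int (-_) k]
    congr 1
    simp only [stdReader]
    ring
  · simp [hw, ephase_zero]

/-- The product of p and the value read is bilinear in the bits of p and the decisions, so one
controlled phase for each pair of them is enough and no multiplication has to be computed. -/
lemma realizes_mid : RealizesDiag f (Z.mid m) (Z.midPhase m) := by
  refine RealizesDiag.congr (RealizesDiag.phases f _ _ _) fun w => ?_
  rw [Finset.sum_map_toList, midPhase]
  congr 1
  simp only [BExpr.eval, eval_decE]
  by_cases hv : Z.valid.eval w = true
  · simp only [hv, Bool.true_and, if_true]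
    rw [ofBits_eq_sum, Reader.value, Finset.sum_range, Fintype.sum_prod_type]
    push_cast
    rw [Finset.sum_mul_sum, Finset.sum_div]
    refine Finset.sum_congr rfl fun u _ => ?_
    rw [Finset.sum_div]
    refine Finset.sum_congr rfl fun j _ => ?_
    by_cases h1 : (Z.pe u).eval w = true <;> by_cases h2 : decs (Z.outc w) j = true <;>
      simp [h1, h2]
  · simp [hv]

lemma realizes_macs : Realizes f (Z.macs m) (Z.op f m) :=
  (realizes_testSeq Z.τ fun q _ => Z.realizes_fwd f q).append
    (Realizes.append (Z.realizes_mid f m) (realizes_testSeq Z.τ fun q _ => Z.realizes_bwd f q))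

variable [Fintype A]

lemma testSeq_eq {ψ : St A} (hψ : ∀ q, ZeroAt (Z.τ q) ψ) (w : A → Bool) :
    testSeq Z.τ (Z.θ f) (testList N t) ψ w =
      (∏ q, amp (Z.θ f q w) (w (Z.τ q))) * ψ (zeroL Z.τ (testList N t) w) := by
  rw [testSeq_apply Z.τ (testList_nodup N t) (fun q _ => Z.θ_indep f le_rfl)
    ((testList_pairwise N t).imp fun h => Z.θ_indep f h) (fun q _ => hψ q),
    ← List.prod_toFinset _ (testList_nodup N t)]
  congr 2
  ext q
  simp [mem_testList]

lemma zeroL_eq (w : A → Bool) :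
    zeroL Z.τ (testList N t) w = Function.extend Z.τ (fun _ => false) w := by
  funext a
  by_cases h : ∃ q, Z.τ q = a
  · obtain ⟨q, rfl⟩ := h
    rw [Z.τ.injective.extend_apply, zeroL, if_pos ⟨q, mem_testList q, rfl⟩]
  · rw [Function.extend_apply' _ _ _ h, zeroL, if_neg]
    rintro ⟨q, -, hq⟩
    exact h ⟨q, hq⟩

lemma x_extend (b : Tests N t → Bool) (w : A → Bool) : Z.x (Function.extend Z.τ b w) = Z.x w := by
  apply Fin.ext
  rw [← Z.hxx, ← Z.hxx]
  congr 1
  funext j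
  refine BExpr.eval_congr fun a ha => Function.extend_apply' _ _ _ ?_
  rintro ⟨q, rfl⟩
  exact Z.hx_uses j q ha

lemma ideal_extend (b : Tests N t → Bool) (w : A → Bool) :
    Z.ideal f m (Function.extend Z.τ b w) = Z.ideal f m w := by
  have h1 : Z.valid.eval (Function.extend Z.τ b w) = Z.valid.eval w :=
    BExpr.eval_congr fun a ha => Function.extend_apply' _ _ _ (by
      rintro ⟨q, rfl⟩
      exact Z.valid_uses q ha)
  have h2 : ∀ j, (Z.pe j).eval (Function.extend Z.τ b w) = (Z.pe j).eval w := fun j =>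
    BExpr.eval_congr fun a ha => Function.extend_apply' _ _ _ (by
      rintro ⟨q, rfl⟩
      exact Z.pe_uses j q ha)
  simp only [ideal, h1, h2, x_extend]

open Classical in
-- If all decisions are right the value is read exactly and the phases agree; otherwise two unit
-- numbers differ by at most 2.
lemma midPhase_sub_ideal (w : A → Bool) :
    ‖Z.midPhase m w - Z.ideal f m w‖ ^ 2 ≤ 4 * if ∃ j : Fin (2 * Nat.clog 2 N + 1),
      ¬ (stdReader N).Consistent (f (Z.x w)) (decs (Z.outc w)) j then 1 else 0 := by
  split_ifs with h
  · have : ‖Z.midPhase m w - Z.ideal f m w‖ ≤ 2 := by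
      refine (norm_sub_le _ _).trans ?_
      rw [midPhase, ideal, norm_ephase, norm_ephase]
      norm_num
    have h0 := norm_nonneg (Z.midPhase m w - Z.ideal f m w)
    nlinarith
  · push Not at h
    rw [midPhase, ideal, stdReader_value (lt_of_le_of_lt (Nat.zero_le _) (f (Z.x w)).2)
      (f (Z.x w)).2 fun j hj => h ⟨j, hj⟩]
    simp

open Classical in
-- Let W be the sequence of tests. The ideal phase does not depend on the test qubits and so
-- commutes with W on clean states. The error is therefore W⁻¹ applied to (actual phase - ideal
-- phase) W ψ, whose norm is at most twice the square root of the weight of the inconsistent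
-- outcomes.
lemma nsq_op_sub_le {ψ : St A} (hψ : ∀ q, ZeroAt (Z.τ q) ψ) :
    nsq (Z.op f m ψ - diagOp (Z.ideal f m) ψ) ≤
      4 * ((2 * Nat.clog 2 N + 1 : ℕ) * (3 / 4) ^ 2 ^ t) * nsq ψ := by
  set W := testSeq Z.τ (Z.θ f) (testList N t) with hW
  have hinv : diagOp (Z.ideal f m) ψ =
      testSeqInv Z.τ (Z.θ f) (testList N t) (W (diagOp (Z.ideal f m) ψ)) :=
    (testSeqInv_testSeq Z.τ (Z.θ f) (testList N t) _).symm
  have hcomm : W (diagOp (Z.ideal f m) ψ) = diagOp (Z.ideal f m) (W ψ) := by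
    funext w
    rw [diagOp_apply, hW, Z.testSeq_eq f hψ, Z.testSeq_eq f, diagOp_apply, zeroL_eq,
      ideal_extend]
    · ring
    · intro q w hw
      rw [diagOp_apply, hψ q w hw, mul_zero]
  have h1 : nsq (Z.op f m ψ - diagOp (Z.ideal f m) ψ) =
      nsq (diagOp (Z.midPhase m) (W ψ) - diagOp (Z.ideal f m) (W ψ)) := by
    rw [hinv, op, testSeqInv, testSeqInv, ← testSeq_sub, nsq_testSeq, hcomm]
  rw [h1]
  set bad : (A → Bool) → ℝ := fun w => if ∃ j : Fin (2 * Nat.clog 2 N + 1),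
      ¬ (stdReader N).Consistent (f (Z.x w)) (decs (Z.outc w)) j then 1 else 0 with hbad
  set ε : ℝ := (2 * Nat.clog 2 N + 1 : ℕ) * (3 / 4) ^ 2 ^ t with hε
  have hε0 : 0 ≤ ε := by positivity
  have h2 : nsq (diagOp (Z.midPhase m) (W ψ) - diagOp (Z.ideal f m) (W ψ)) ≤
      4 * ∑ w, bad w * ‖W ψ w‖ ^ 2 := by
    rw [nsq, Finset.mul_sum]
    refine Finset.sum_le_sum fun w _ => ?_
    rw [Pi.sub_apply, diagOp_apply, diagOp_apply, ← sub_mul, norm_mul, mul_pow, ← mul_assoc]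
    exact mul_le_mul_of_nonneg_right (Z.midPhase_sub_ideal f m w) (by positivity)
  refine h2.trans ?_
  rw [mul_assoc]
  refine mul_le_mul_of_nonneg_left ?_ (by norm_num)
  have hcard : (0 : ℝ) < Fintype.card (Tests N t → Bool) := by exact_mod_cast Fintype.card_pos
  refine le_of_mul_le_mul_left ?_ hcard
  rw [← sum_extend Z.τ]
  -- With the qubits other than the test qubits fixed, the squared amplitudes of W ψ are a single
  -- amplitude of ψ times the classical distribution of the adaptive tests.
  have hinner : ∀ w, ∑ b, bad (Function.extend Z.τ b w) * ‖W ψ (Function.extend Z.τ b w)‖ ^ 2 ≤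
      ε * ‖ψ (Function.extend Z.τ (fun _ => false) w)‖ ^ 2 := by
    intro w
    set v : ℕ := (f (Z.x w) : ℕ) with hv
    have hs := sum_inconsistent_le (stdReader N) v (2 * Nat.clog 2 N + 1) t
    have houtc : ∀ b : Tests N t → Bool, Z.outc (Function.extend Z.τ b w) = Function.curry b := by
      intro b
      funext j l
      exact Z.τ.injective.extend_apply b w (j, l)
    rw [← (Equiv.curry (Fin (2 * Nat.clog 2 N + 1)) (Leaf t) Bool).sum_comp] at hs
    refine le_trans (le_of_eq ?_) (mul_le_mul_of_nonneg_right hs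
      (sq_nonneg ‖ψ (Function.extend Z.τ (fun _ => false) w)‖))
    rw [Finset.sum_mul]
    refine Finset.sum_congr rfl fun b _ => ?_
    rw [hW, Z.testSeq_eq f hψ, zeroL_eq, extend_extend, norm_mul, mul_pow, norm_prod,
      ← Finset.prod_pow]
    have e1 : bad (Function.extend Z.τ b w) = if ∃ j : Fin (2 * Nat.clog 2 N + 1),
        ¬ (stdReader N).Consistent v (decs (Equiv.curry _ _ _ b)) j then 1 else 0 := by
      simp only [hbad, x_extend, houtc]
      rfl
    have e2 : ∏ q, ‖amp (Z.θ f q (Function.extend Z.τ b w))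
        (Function.extend Z.τ b w (Z.τ q))‖ ^ 2 =
        ∏ j, readWeight (stdReader N) v j (Equiv.curry _ _ _ b) := by
      rw [Fintype.prod_prod_type]
      refine Finset.prod_congr rfl fun j _ => ?_
      rw [readWeight, bitWeight]
      refine Finset.prod_congr rfl fun l _ => ?_
      rw [Z.τ.injective.extend_apply, θ, x_extend, houtc]
      rfl
    rw [e1, e2]
    ring
  refine (Finset.sum_le_sum fun w _ => hinner w).trans ?_
  rw [← Finset.mul_sum, mul_left_comm]
  refine mul_le_mul_of_nonneg_left ?_ hε0
  rw [nsq, ← sum_extend Z.τ]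
  refine Finset.sum_le_sum fun w _ => ?_
  exact Finset.single_le_sum (f := fun b => ‖ψ (Function.extend Z.τ b w)‖ ^ 2)
    (fun b _ => by positivity) (Finset.mem_univ _)

end QuerySim

/-! ### Resetting and outputting qubits -/

section Reset

variable {M N : ℕ} {A : Type} [DecidableEq A]

/-- The macro gates that reset the qubits of a list. -/
def resets (l : List A) : List (Mac M N A) := l.map fun q => .gate (.reset q)

lemma run_reset_cons (f : Fin M → Fin N) (q : A) (C : List (Instr A)) (z) (ψ : St A) (F) :
    run ((.gate (.reset q) : Mac M N A).instr f :: C) z ψ F =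
      run C z (resetOp q false ψ) F + run C z (resetOp q true ψ) F := by
  rw [Mac.instr, GGate.instr_reset, run_cons]
  simp

lemma zeroAt_resetOp_self (q : A) (b : Bool) (ψ : St A) : ZeroAt q (resetOp q b ψ) := by
  intro w hw
  rw [resetOp_apply, if_neg (by simp [hw])]

lemma ZeroAt.resetOp {q : A} {ψ : St A} (h : ZeroAt q ψ) {q' : A} (hq : q ≠ q') (b : Bool) :
    ZeroAt q (resetOp q' b ψ) := by
  intro w hw
  rw [resetOp_apply]
  split_ifs
  · exact h _ (by rwa [Function.update_of_ne hq])
  · rfl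

/-- After the resets every branch is supported where these qubits vanish, so the functionals need to
agree only there. The auxiliary list `s` collects the qubits already reset. -/
lemma run_resets_congr (f : Fin M → Fin N) (l : List A) {F G : List Bool → St A → ℝ}
    (hFG : ∀ z ψ, (∀ q ∈ l, ZeroAt q ψ) → F z ψ = G z ψ) (z) (ψ : St A) :
    run ((resets l).map fun m : Mac M N A => m.instr f) z ψ F =
      run ((resets l).map fun m : Mac M N A => m.instr f) z ψ G := by
  suffices h : ∀ (l s : List A) (ψ : St A), (∀ q ∈ s, ZeroAt q ψ) →
      (∀ z ψ, (∀ q ∈ s ++ l, ZeroAt q ψ) → F z ψ = G z ψ) →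
      run ((resets l).map fun m : Mac M N A => m.instr f) z ψ F =
      run ((resets l).map fun m : Mac M N A => m.instr f) z ψ G from
    h l [] ψ (by simp) (by simpa using hFG)
  intro l
  induction l with
  | nil => intro s ψ hs h; exact h z ψ (by simpa using hs)
  | cons q l ih =>
    intro s ψ hs h
    have hz : ∀ b, ∀ q' ∈ s ++ [q], ZeroAt q' (resetOp q b ψ) := by
      intro b q' hq'
      by_cases hqq : q' = q
      · subst hqq; exact zeroAt_resetOp_self _ _ _
      · exact (hs q' (by simpa [hqq] using hq')).resetOp hqq b
    have h' : ∀ z ψ, (∀ q' ∈ (s ++ [q]) ++ l, ZeroAt q' ψ) → F z ψ = G z ψ := by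
      intro z ψ hh
      exact h z ψ (by simpa using hh)
    simp only [resets, List.map_cons, run_reset_cons] at ih ⊢
    rw [ih _ _ (hz false) h', ih _ _ (hz true) h']

variable [Fintype A]

lemma sum_resetOp (q : A) {H : (A → Bool) → ℝ} (hH : IndepOf H q) (ψ : St A) :
    ∑ w, ‖resetOp q false ψ w‖ ^ 2 * H w + ∑ w, ‖resetOp q true ψ w‖ ^ 2 * H w =
      ∑ w, ‖ψ w‖ ^ 2 * H w := by
  rw [← Finset.sum_add_distrib, sum_split_bit q fun w => ‖ψ w‖ ^ 2 * H w]
  refine Finset.sum_congr rfl fun w _ => ?_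
  simp only [resetOp_apply, hH w]
  split_ifs
  · rfl
  · simp

lemma run_resets_dia (f : Fin M → Fin N) (l : List A) {H : List Bool → (A → Bool) → ℝ}
    (hH : ∀ q ∈ l, ∀ z, IndepOf (H z) q) (z) (ψ : St A) :
    run ((resets l).map fun m : Mac M N A => m.instr f) z ψ (dia H) = dia H z ψ := by
  induction l generalizing ψ with
  | nil => rfl
  | cons q l ih =>
    have ih := ih fun q hq => hH q (by simp [hq])
    simp only [resets, List.map_cons, run_reset_cons] at ih ⊢
    rw [ih, ih, dia, dia, sum_resetOp q (hH q (by simp) z), dia]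

/-- The macro gates that reset all qubits. -/
def resetAll (M N : ℕ) (A : Type) [Fintype A] : List (Mac M N A) := resets Finset.univ.toList

/-- Every branch ends in a multiple of the initial state, and homogeneity extracts the squared
factor. The branches together carry the squared norm of ψ. -/
lemma run_resetAll (f : Fin M → Fin N) {F : List Bool → St A → ℝ} (hF : Homog F) (z) (ψ : St A) :
    run ((resetAll M N A).map fun m => m.instr f) z ψ F =
      dia (fun z _ => F z (initSt A)) z ψ := by
  have h1 := run_resets_congr f (Finset.univ.toList) (F := F)
    (G := dia fun z _ => F z (initSt A)) (fun z ψ hψ => by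
      have hzero : ∀ w, w ≠ (fun _ => false) → ψ w = 0 := by
        intro w hw
        obtain ⟨q, hq⟩ := Function.ne_iff.1 hw
        exact hψ q (by simp) w (by simpa using hq)
      have hψ' : ψ = ψ (fun _ => false) • initSt A := by
        funext w
        by_cases hw : w = fun _ => false
        · subst hw; simp [initSt]
        · simp [initSt, hw, hzero w hw]
      have h2 : F z ψ = ‖ψ fun _ => false‖ ^ 2 * F z (initSt A) := by
        conv_lhs => rw [hψ', hF]
      rw [h2, dia, Finset.sum_eq_single (fun _ => false)]
      · intro w _ hw; simp [hzero w hw]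
      · simp) z ψ
  rw [resetAll, h1]
  exact run_resets_dia f _ (fun q _ z w b => rfl) z ψ

open Classical in
/-- Addition of a formula to a qubit, provided that it does not occur in the formula. -/
def xorMac (a : A) (e : BExpr A) : Mac M N A :=
  if h : e.Uses a then .phase (.lit false) 0 else .xor a e h

lemma xorMac_instr (f : Fin M → Fin N) {a : A} {e : BExpr A} (h : ¬ e.Uses a) :
    (xorMac a e : Mac M N A).instr f =
      pureI (permOp fun w => Function.update w a (Bool.xor (w a) (e.eval w))) := by
  rw [xorMac, dif_neg h]
  rfl

/-- The macro gates that output the value of a formula. -/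
def outMac (o : A) (e : BExpr A) : List (Mac M N A) :=
  [.gate (.reset o), xorMac o e, .gate (.output o)]

/-- The cleared qubit receives the value by xor, so the measurement at the output is determined by
the rest of the basis state. The two branches of the reset add up to the old weight, because neither
the formula nor the functional depends on `o`. -/
lemma run_outMac (f : Fin M → Fin N) {o : A} {e : BExpr A} (h : ¬ e.Uses o)
    {H : List Bool → (A → Bool) → ℝ} (hH : ∀ z, IndepOf (H z) o) (z) (ψ : St A) :
    run ((outMac o e).map fun m : Mac M N A => m.instr f) z ψ (dia H) =
      dia (fun z w => H (z ++ [e.eval w]) w) z ψ := by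
  have key : ∀ b w, ‖(projOp o false (permOp (fun w => Function.update w o
      (Bool.xor (w o) (e.eval w))) (resetOp o b ψ))) w‖ ^ 2 * H (z ++ [false]) w +
      ‖(projOp o true (permOp (fun w => Function.update w o
      (Bool.xor (w o) (e.eval w))) (resetOp o b ψ))) w‖ ^ 2 * H (z ++ [true]) w =
      if w o = e.eval w then ‖ψ (Function.update w o b)‖ ^ 2 * H (z ++ [e.eval w]) w else 0 := by
    intro b w
    simp only [projOp, diagOp_apply, permOp_apply, resetOp_apply, Function.update_self,
      Function.update_idem]
    cases h1 : w o <;> cases h2 : e.eval w <;> simp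
  simp only [outMac, List.map_cons, List.map_nil, run_reset_cons, xorMac_instr f h,
    run_pureI_cons]
  simp only [Mac.instr, GGate.instr_output, run_cons, run_nil, List.map_cons, List.map_nil,
    List.sum_cons, List.sum_nil, add_zero, dia]
  rw [← Finset.sum_add_distrib, ← Finset.sum_add_distrib]
  simp only [key]
  rw [← Finset.sum_add_distrib, sum_split_bit o, sum_split_bit o fun w => ‖ψ w‖ ^ 2 * _]
  refine Finset.sum_congr rfl fun w _ => ?_
  simp only [Function.update_self, Function.update_idem, BExpr.eval_update h, hH _ w]
  cases e.eval w <;> simp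

/-- The macro gates that output the values of formulas. -/
def outMacs (o : A) (l : List (BExpr A)) : List (Mac M N A) := l.flatMap (outMac o)

lemma run_outMacs (f : Fin M → Fin N) {o : A} {l : List (BExpr A)} (h : ∀ e ∈ l, ¬ e.Uses o)
    {H : List Bool → (A → Bool) → ℝ} (hH : ∀ z, IndepOf (H z) o) (z) (ψ : St A) :
    run ((outMacs o l).map fun m : Mac M N A => m.instr f) z ψ (dia H) =
      dia (fun z w => H (z ++ l.map fun e => e.eval w) w) z ψ := by
  induction l generalizing z ψ H with
  | nil => simp [outMacs]
  | cons e l ih =>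
    rw [outMacs, List.flatMap_cons, List.map_append, run_append]
    have ih := fun z ψ => ih (fun e he => h e (by simp [he])) hH z ψ
    rw [outMacs] at ih
    simp only [ih]
    rw [run_outMac f (h e (by simp)) (H := fun z w => H (z ++ l.map fun e => e.eval w) w)]
    · simp
    · intro z w b
      have : ∀ e' ∈ l, e'.eval (Function.update w o b) = e'.eval w := fun e' he' =>
        BExpr.eval_update (h e' (by simp [he'])) w b
      simp only [List.map_congr_left this, hH _ w]

end Reset

/-! ### Testing equality of two values -/

/-- The frequencies of an equality test. -/
def freq (N s : ℕ) : ℕ := 2 ^ s % N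

/-- Both coefficients are residues modulo N of 2^s and of its negative, so two queries together
produce the phase of a difference modulo 1. -/
lemma exists_freq (N s : ℕ) (hN : 0 < N) (u v : ℕ) : ∃ k : ℤ,
    ((freq N s * u + (N - freq N s) % N * v : ℕ) : ℝ) / N = 2 ^ s * (((u : ℝ) - v) / N) + k := by
  have hlt : freq N s < N := Nat.mod_lt _ hN
  obtain ⟨a, ha⟩ : ∃ a, a = (N - freq N s) % N := ⟨_, rfl⟩
  obtain ⟨b, hb⟩ : ∃ b, b = (N - freq N s) / N := ⟨_, rfl⟩
  obtain ⟨c, hc⟩ : ∃ c, c = 2 ^ s / N := ⟨_, rfl⟩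
  have hab : (a : ℝ) + N * b = N - freq N s := by
    rw [← Nat.cast_sub hlt.le, ha, hb]
    exact_mod_cast Nat.mod_add_div _ N
  have hfc : (freq N s : ℝ) + N * c = 2 ^ s := by
    rw [hc, freq]
    exact_mod_cast Nat.mod_add_div (2 ^ s) N
  refine ⟨-(c * u) + (1 - b + c) * v, ?_⟩
  have hN' : (N : ℝ) ≠ 0 := by positivity
  rw [← ha]
  push_cast
  rw [show (a : ℝ) = N - freq N s - N * b by linarith,
    show (freq N s : ℝ) = 2 ^ s - N * c by linarith]
  field_simp
  ring

lemma amp_add_int (x : ℝ) (k : ℤ) (b : Bool) : amp (x + k) b = amp x b := by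
  rw [amp, amp, ephase_add_int]

/-- The product telescopes by sin 2y = 2 sin y cos y. -/
lemma prod_cos (x : ℝ) (K : ℕ) :
    (∏ s ∈ Finset.range K, Real.cos (2 ^ s * x)) * (2 ^ K * Real.sin x) = Real.sin (2 ^ K * x) := by
  induction K with
  | zero => simp
  | succ K ih =>
    rw [Finset.prod_range_succ, pow_succ, show (2 : ℝ) ^ K * 2 * x = 2 * (2 ^ K * x) by ring,
      Real.sin_two_mul, ← ih]
    ring

/-- Jordan's inequality on the first half of the period; the symmetry d ↦ N - d gives the second
half. -/
lemma two_mul_le_sin {N d : ℕ} (h0 : 0 < d) (hd : d < N) :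
    2 / N ≤ Real.sin (Real.pi * (d / N)) := by
  have hN : (0 : ℝ) < N := by exact_mod_cast h0.trans hd
  have key : ∀ e : ℕ, 0 < e → 2 * e ≤ N → 2 / N ≤ Real.sin (Real.pi * ((e : ℝ) / N)) := by
    intro e h0 he
    have h1 : (1 : ℝ) ≤ e := by exact_mod_cast h0
    have h2 : (2 : ℝ) * e ≤ N := by exact_mod_cast he
    have h3 : (e : ℝ) / N ≤ 1 / 2 := by rw [div_le_iff₀ hN]; linarith
    have h4 := Real.mul_le_sin (x := Real.pi * ((e : ℝ) / N)) (by positivity)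
      (by nlinarith [Real.pi_pos])
    refine le_trans ?_ h4
    rw [show 2 / Real.pi * (Real.pi * ((e : ℝ) / N)) = 2 * e / N by
      field_simp]
    gcongr
    linarith
  by_cases h : 2 * d ≤ N
  · exact key d h0 h
  · have := key (N - d) (by omega) (by omega)
    rwa [Nat.cast_sub hd.le, sub_div, div_self hN.ne', mul_sub, mul_one, Real.sin_pi_sub] at this

/-- With x = π(u - v)/N the product of the cosines is sin(2^K x) / (2^K sin x). Since 2^K ≥ N and
sin x ≥ 2/N, the denominator is at least 2. -/
lemma prod_cos_sq_le {N u v : ℕ} (hu : u < N) (hv : v < N) (huv : u ≠ v) :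
    ∏ s ∈ Finset.range (Nat.clog 2 N), Real.cos (Real.pi * (2 ^ s * (((u : ℝ) - v) / N))) ^ 2 ≤
      1 / 4 := by
  wlog h : v < u generalizing u v
  · refine le_trans (le_of_eq ?_) (this hv hu huv.symm (by omega))
    refine Finset.prod_congr rfl fun s _ => ?_
    rw [← Real.cos_neg]
    congr 2
    ring
  set K := Nat.clog 2 N
  have hN : (0 : ℝ) < N := by exact_mod_cast (Nat.zero_le _).trans_lt hu
  have hs := two_mul_le_sin (N := N) (d := u - v) (by omega) (by omega)
  rw [Nat.cast_sub h.le] at hs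
  set x := Real.pi * (((u : ℝ) - v) / N)
  have hp := prod_cos x K
  set Pr := ∏ s ∈ Finset.range K, Real.cos (2 ^ s * x) with hPr
  have hK : (N : ℝ) ≤ 2 ^ K := by exact_mod_cast Nat.le_pow_clog (by norm_num) N
  have h2 : 2 ≤ 2 ^ K * Real.sin x := by
    calc (2 : ℝ) = N * (2 / N) := by field_simp
      _ ≤ _ := by gcongr
  have h3 : |Pr| * (2 ^ K * Real.sin x) ≤ 1 := by
    rw [← abs_of_pos (show 0 < 2 ^ K * Real.sin x by linarith), ← abs_mul, hp]
    exact Real.abs_sin_le_one _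
  have h4 : |Pr| ≤ 1 / 2 := by nlinarith [abs_nonneg Pr]
  have h5 : ∏ s ∈ Finset.range K, Real.cos (Real.pi * (2 ^ s * (((u : ℝ) - v) / N))) ^ 2 =
      Pr ^ 2 := by
    rw [hPr, ← Finset.prod_pow]
    refine Finset.prod_congr rfl fun s _ => ?_
    congr 2
    simp only [x]
    ring
  rw [h5, ← sq_abs]
  nlinarith [abs_nonneg Pr]

/-- The test qubits of an equality test with `r` repetitions. -/
abbrev EqTests (N r : ℕ) : Type := Fin r × Fin (Nat.clog 2 N)

/-- The phase of a test for the equality of `u` and `v`. -/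
def eqPhase (N s u v : ℕ) : ℝ := ((freq N s * u + (N - freq N s) % N * v : ℕ) : ℝ) / N

/-- The probability that an equality test finds no difference. -/
def passProb (N r u v : ℕ) : ℝ := ∏ q : EqTests N r, ‖amp (eqPhase N q.2 u v) false‖ ^ 2

lemma passProb_nonneg (N r u v : ℕ) : 0 ≤ passProb N r u v :=
  Finset.prod_nonneg fun _ _ => by positivity

lemma passProb_le_one (N r u v : ℕ) : passProb N r u v ≤ 1 := by
  refine Finset.prod_le_one (fun _ _ => by positivity) fun q _ => ?_
  have := sum_normSq_amp (eqPhase N q.2 u v)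
  nlinarith [sq_nonneg ‖amp (eqPhase N q.2 u v) true‖]

/-- The test has one-sided error: a true collision is never rejected, so verification does not lower
the success probability. -/
lemma passProb_self {N u : ℕ} (hu : u < N) (r : ℕ) : passProb N r u u = 1 := by
  refine Finset.prod_eq_one fun q _ => ?_
  obtain ⟨k, hk⟩ := exists_freq N q.2 (by omega) u u
  rw [eqPhase, hk, amp_add_int, sub_self, zero_div, mul_zero, amp, ephase_zero]
  norm_num

lemma passProb_le {N u v : ℕ} (hu : u < N) (hv : v < N) (huv : u ≠ v) (r : ℕ) :
    passProb N r u v ≤ (1 / 4) ^ r := by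
  rw [passProb, Fintype.prod_prod_type]
  have h : ∏ s : Fin (Nat.clog 2 N), ‖amp (eqPhase N s u v) false‖ ^ 2 ≤ 1 / 4 := by
    refine le_trans (le_of_eq ?_) (prod_cos_sq_le hu hv huv)
    rw [Finset.prod_range]
    refine Finset.prod_congr rfl fun s _ => ?_
    obtain ⟨k, hk⟩ := exists_freq N s (by omega) u v
    rw [eqPhase, hk, amp_add_int, normSq_amp, if_neg (by simp)]
  calc _ ≤ ∏ i : Fin r, (1 / 4 : ℝ) := Finset.prod_le_prod
        (fun i _ => Finset.prod_nonneg fun _ _ => by positivity) fun i _ => h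
    _ = _ := by simp

/-! ### The verification of a pair -/

/-- The data of a verification: test qubits, an output qubit, and formulas for the two points. -/
structure Verif (M N r : ℕ) (A : Type) where
  ν : EqTests N r ↪ A
  o : A
  ex : Fin (Nat.clog 2 M) → BExpr A
  ey : Fin (Nat.clog 2 M) → BExpr A
  ho : ∀ q, ν q ≠ o
  ex_uses : ∀ j q, ¬ (ex j).Uses (ν q)
  ey_uses : ∀ j q, ¬ (ey j).Uses (ν q)
  ex_o : ∀ j, ¬ (ex j).Uses o
  ey_o : ∀ j, ¬ (ey j).Uses o
  x : (A → Bool) → Fin M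
  y : (A → Bool) → Fin M
  hxx : ∀ w, (Nat.ofBits fun j => (ex j).eval w) = x w
  hyy : ∀ w, (Nat.ofBits fun j => (ey j).eval w) = y w

/-- The disjunction of the bits of a list. -/
def orE {A : Type} : List A → BExpr A
  | [] => .lit false
  | a :: l => .op or (.var a) (orE l)

lemma eval_orE {A : Type} (l : List A) (w : A → Bool) : (orE l).eval w = l.any w := by
  induction l with
  | nil => rfl
  | cons a l ih => simp [orE, BExpr.eval, ih]

lemma size_orE {A : Type} (l : List A) : (orE l).size = 2 * l.length + 1 := by
  induction l with
  | nil => rfl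
  | cons a l ih => simp only [orE, BExpr.size, ih, List.length_cons]; omega

lemma uses_orE {A : Type} {l : List A} {a : A} : (orE l).Uses a ↔ a ∈ l := by
  induction l with
  | nil => simp [orE, BExpr.Uses]
  | cons b l ih => simp [orE, BExpr.Uses, ih, eq_comm]

/-- `if f then a else b`. -/
def muxE {A : Type} (f a b : BExpr A) : BExpr A :=
  .op or (.op and f a) (.op (fun x y => !x && y) f b)

lemma eval_muxE {A : Type} (f a b : BExpr A) (w : A → Bool) :
    (muxE f a b).eval w = if f.eval w then a.eval w else b.eval w := by
  cases h : f.eval w <;> simp [muxE, BExpr.eval, h]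

namespace Verif

variable {M N r : ℕ} {A : Type} [DecidableEq A] (V : Verif M N r A) (f : Fin M → Fin N)

/-- All tests. -/
def tests (N r : ℕ) : List (EqTests N r) := Finset.univ.toList

/-- Some test has found a difference. -/
def flag : BExpr A := orE ((tests N r).map V.ν)

/-- The phases of the tests. -/
def θ (q : EqTests N r) (w : A → Bool) : ℝ := eqPhase N q.2 (f (V.x w)) (f (V.y w))

/-- The macro gates of the phase of a test. -/
def fwd (q : EqTests N r) : List (Mac M N A) :=
  [cquery V.ex (.var (V.ν q)) (freq N q.2)] ++
    [cquery V.ey (.var (V.ν q)) ((N - freq N q.2) % N)]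

/-- The macro gates of the tests. -/
def pre : List (Mac M N A) :=
  resets ((tests N r).map V.ν) ++ (tests N r).flatMap fun q => testMac (V.ν q) (V.fwd q)

/-- The pair that is going to be output. -/
def pair (w : A → Bool) : Fin M × Fin M := (V.x w, if V.flag.eval w then V.x w else V.y w)

/-- The formulas of the output. -/
def outs : List (BExpr A) :=
  List.ofFn V.ex ++ List.ofFn fun j => muxE V.flag (V.ex j) (V.ey j)

lemma x_update {a : A} (ha : ∀ j, ¬ (V.ex j).Uses a) : IndepOf V.x a := by
  intro w b
  apply Fin.ext
  rw [← V.hxx, ← V.hxx]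
  simp only [BExpr.eval_update (ha _)]

lemma y_update {a : A} (ha : ∀ j, ¬ (V.ey j).Uses a) : IndepOf V.y a := by
  intro w b
  apply Fin.ext
  rw [← V.hyy, ← V.hyy]
  simp only [BExpr.eval_update (ha _)]

lemma flag_not_uses_o : ¬ V.flag.Uses V.o := by
  rw [flag, uses_orE]
  simp only [List.mem_map, not_exists, not_and]
  exact fun q _ h => V.ho q h

lemma outs_not_uses_o : ∀ e ∈ V.outs, ¬ e.Uses V.o := by
  intro e he
  simp only [outs, List.mem_append, List.mem_ofFn] at he
  rcases he with ⟨j, rfl⟩ | ⟨j, rfl⟩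
  · exact V.ex_o j
  · simp only [muxE, BExpr.Uses, not_or]
    exact ⟨⟨V.flag_not_uses_o, V.ex_o j⟩, V.flag_not_uses_o, V.ey_o j⟩

lemma eval_outs (w : A → Bool) : (V.outs.map fun e => e.eval w) = encodePair (V.pair w) := by
  have hx : ∀ j, (V.ex j).eval w = Nat.testBit (V.x w : ℕ) j := by
    intro j
    rw [← V.hxx, Nat.testBit_ofBits_lt _ _ j.2]
  have hy : ∀ j, (V.ey j).eval w = Nat.testBit (V.y w : ℕ) j := by
    intro j
    rw [← V.hyy, Nat.testBit_ofBits_lt _ _ j.2]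
  rw [outs, encodePair, List.map_append, List.map_ofFn, List.map_ofFn]
  congr 1
  · congr 1
    funext j
    exact hx j
  · congr 1
    funext j
    simp only [Function.comp, eval_muxE, hx, hy, pair]
    split_ifs <;> rfl

lemma realizes_fwd (q : EqTests N r) : RealizesDiag f (V.fwd q) (cphase (V.ν q) (V.θ f q)) := by
  have hN : 0 < N := by
    by_contra h
    obtain rfl : N = 0 := by omega
    exact (f (V.x fun _ => false)).elim0
  refine RealizesDiag.congr ((realizes_cquery (.var (V.ν q)) (Nat.mod_lt _ hN) V.x V.hxx).append
    (realizes_cquery (.var (V.ν q)) (Nat.mod_lt _ hN) V.y V.hyy)) fun w => ?_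
  simp only [BExpr.eval, cphase, θ, eqPhase]
  rw [← ephase_add]
  by_cases hw : w (V.ν q) = true
  · simp only [hw, if_true]
    congr 1
    push_cast
    simp only [freq]
    ring
  · simp [hw, ephase_zero]

lemma tests_nodup : (tests N r).Nodup := Finset.nodup_toList _

lemma θ_indep (q q' : EqTests N r) : IndepOf (V.θ f q) (V.ν q') := by
  intro w b
  rw [θ, θ, V.x_update (fun j => V.ex_uses j q') w b, V.y_update (fun j => V.ey_uses j q') w b]

variable [Fintype A]

lemma testSeq_eq {ψ : St A} (hψ : ∀ q, ZeroAt (V.ν q) ψ) (w : A → Bool) :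
    testSeq V.ν (V.θ f) (tests N r) ψ w =
      (∏ q, amp (V.θ f q w) (w (V.ν q))) * ψ (Function.extend V.ν (fun _ => false) w) := by
  rw [testSeq_apply V.ν tests_nodup (fun q _ => V.θ_indep f q q)
    (List.pairwise_of_forall fun q q' => V.θ_indep f q q') (fun q _ => hψ q)]
  congr 1
  · rw [tests, Finset.prod_map_toList]
  · congr 1
    funext a
    by_cases h : ∃ q, V.ν q = a
    · obtain ⟨q, rfl⟩ := h
      rw [V.ν.injective.extend_apply, zeroL, if_pos ⟨q, by simp [tests], rfl⟩]
    · rw [Function.extend_apply' _ _ _ h, zeroL, if_neg]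
      rintro ⟨q, -, hq⟩
      exact h ⟨q, hq⟩

lemma eval_extend {e : BExpr A} (he : ∀ q, ¬ e.Uses (V.ν q)) (b : EqTests N r → Bool)
    (w : A → Bool) : e.eval (Function.extend V.ν b w) = e.eval w :=
  BExpr.eval_congr fun a ha => Function.extend_apply' _ _ _ (by
    rintro ⟨q, rfl⟩
    exact he q ha)

lemma x_extend (b : EqTests N r → Bool) (w : A → Bool) : V.x (Function.extend V.ν b w) = V.x w := by
  apply Fin.ext
  rw [← V.hxx, ← V.hxx]
  simp only [V.eval_extend (V.ex_uses _)]

lemma y_extend (b : EqTests N r → Bool) (w : A → Bool) : V.y (Function.extend V.ν b w) = V.y w := by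
  apply Fin.ext
  rw [← V.hyy, ← V.hyy]
  simp only [V.eval_extend (V.ey_uses _)]

lemma flag_extend (b : EqTests N r → Bool) (w : A → Bool) :
    V.flag.eval (Function.extend V.ν b w) = !decide (b = fun _ => false) := by
  rw [flag, eval_orE, Bool.eq_iff_iff, List.any_eq_true]
  simp only [List.mem_map, Bool.not_eq_true', decide_eq_false_iff_not]
  constructor
  · rintro ⟨_, ⟨q, _, rfl⟩, h⟩ hb
    rw [V.ν.injective.extend_apply, hb] at h
    simp at h
  · intro h
    obtain ⟨q, hq⟩ := Function.ne_iff.1 h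
    exact ⟨_, ⟨q, by simp [tests], rfl⟩, by rw [V.ν.injective.extend_apply]; simpa using hq⟩

/-- The expectation of a function of the two points and the flag after the tests. -/
def avg (g : Fin M → Fin M → Bool → ℝ) (w : A → Bool) : ℝ :=
  passProb N r (f (V.x w)) (f (V.y w)) * g (V.x w) (V.y w) false +
    (1 - passProb N r (f (V.x w)) (f (V.y w))) * g (V.x w) (V.y w) true

/-- The flag is false for exactly one pattern of outcomes, the zero pattern, and its probability is
`passProb`. On fibres over the other qubits this is the stated average. -/
lemma dia_testSeq (g : List Bool → Fin M → Fin M → Bool → ℝ) (z) {ψ : St A}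
    (hψ : ∀ q, ZeroAt (V.ν q) ψ) :
    dia (fun z w => g z (V.x w) (V.y w) (V.flag.eval w)) z
      (testSeq V.ν (V.θ f) (tests N r) ψ) = dia (fun z w => V.avg f (g z) w) z ψ := by
  have hcard : (Fintype.card (EqTests N r → Bool) : ℝ) ≠ 0 := by
    exact_mod_cast Fintype.card_ne_zero
  refine mul_left_cancel₀ hcard ?_
  rw [dia, dia, ← sum_extend V.ν, ← sum_extend V.ν]
  refine Finset.sum_congr rfl fun w _ => ?_
  have hψ0 : ∀ b : EqTests N r → Bool, b ≠ (fun _ => false) → ψ (Function.extend V.ν b w) = 0 := by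
    intro b hb
    obtain ⟨q, hq⟩ := Function.ne_iff.1 hb
    exact hψ q _ (by rw [V.ν.injective.extend_apply]; simpa using hq)
  rw [Finset.sum_eq_single (fun _ => false) (f := fun b =>
    ‖ψ (Function.extend V.ν b w)‖ ^ 2 * V.avg f (g z) (Function.extend V.ν b w))]
  rotate_left
  · intro b _ hb; simp [hψ0 b hb]
  · simp
  set a : EqTests N r → Bool → ℝ := fun q b =>
    ‖amp (eqPhase N q.2 (f (V.x w)) (f (V.y w))) b‖ ^ 2 with ha
  have hsum : ∑ b : EqTests N r → Bool, ∏ q, a q (b q) = 1 := by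
    have h := (Finset.prod_univ_sum (fun _ : EqTests N r => (Finset.univ : Finset Bool)) a).symm
    rw [Fintype.piFinset_univ] at h
    rw [h]
    refine Finset.prod_eq_one fun q _ => ?_
    rw [Fintype.sum_bool, add_comm]
    exact sum_normSq_amp _
  have hterm : ∀ b : EqTests N r → Bool, ‖testSeq V.ν (V.θ f) (tests N r) ψ
      (Function.extend V.ν b w)‖ ^ 2 = (∏ q, a q (b q)) *
        ‖ψ (Function.extend V.ν (fun _ => false) w)‖ ^ 2 := by
    intro b
    rw [V.testSeq_eq f hψ, extend_extend, norm_mul, mul_pow, norm_prod, ← Finset.prod_pow]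
    congr 1
    refine Finset.prod_congr rfl fun q _ => ?_
    rw [V.ν.injective.extend_apply, θ, x_extend, y_extend]
  simp only [hterm, x_extend, y_extend, flag_extend, avg]
  set u := g z (V.x w) (V.y w)
  set c := ‖ψ (Function.extend V.ν (fun _ => false) w)‖ ^ 2
  have hp : passProb N r (f (V.x w)) (f (V.y w)) = ∏ q, a q false := rfl
  have hsplit : ∀ b : EqTests N r → Bool, (∏ q, a q (b q)) * c * u (!decide (b = fun _ => false)) =
      c * u true * (∏ q, a q (b q)) + if b = (fun _ => false) then
        c * (u false - u true) * ∏ q, a q false else 0 := by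
    intro b
    by_cases hb : b = fun _ => false
    · subst hb
      simp
      ring
    · simp [hb]
      ring
  rw [Finset.sum_congr rfl fun b _ => hsplit b, Finset.sum_add_distrib, ← Finset.mul_sum, hsum,
    Finset.sum_ite_eq' Finset.univ, if_pos (Finset.mem_univ _), hp]
  ring

lemma run_pre (g : List Bool → Fin M → Fin M → Bool → ℝ) (z) (ψ : St A) :
    run (V.pre.map fun m => m.instr f) z ψ
      (dia fun z w => g z (V.x w) (V.y w) (V.flag.eval w)) =
      dia (fun z w => V.avg f (g z) w) z ψ := by
  have h1 : Realizes f ((tests N r).flatMap fun q => testMac (V.ν q) (V.fwd q))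
      (testSeq V.ν (V.θ f) (tests N r)) := realizes_testSeq V.ν fun q _ => V.realizes_fwd f q
  rw [pre, List.map_append, run_append]
  simp only [h1 _ _ _]
  rw [run_resets_congr f _ (G := dia fun z w => V.avg f (g z) w)]
  · refine run_resets_dia f _ ?_ z ψ
    intro a ha z w b
    simp only [List.mem_map] at ha
    obtain ⟨q, _, rfl⟩ := ha
    simp only [avg, V.x_update (fun j => V.ex_uses j q) w b,
      V.y_update (fun j => V.ey_uses j q) w b]
  · intro z ψ hψ
    exact V.dia_testSeq f g z fun q => hψ _ (List.mem_map_of_mem (by simp [tests]))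

/-- The macro gates of the verification and the output of a pair. All qubits are reset. -/
def macs : List (Mac M N A) := V.pre ++ (outMacs V.o V.outs ++ resetAll M N A)

/-- The expectation of a function of the output pair, in terms of the two points. -/
def avgPair (g : Fin M × Fin M → ℝ) (w : A → Bool) : ℝ :=
  V.avg f (fun x y b => g (x, if b then x else y)) w

/-- Whatever follows is evaluated at the initial state, because the qubits are reset. The output is
a classical randomized function of the pair of points that the memory held before. -/
lemma run_macs {F : List Bool → St A → ℝ} (hF : Homog F) (z) (ψ : St A) :
    run (V.macs.map fun m => m.instr f) z ψ F =
      dia (fun z w => V.avgPair f (fun P => F (z ++ encodePair P) (initSt A)) w) z ψ := by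
  rw [macs, List.map_append, List.map_append, run_append]
  simp only [run_append, run_resetAll f hF]
  have h := fun z ψ => run_outMacs f V.outs_not_uses_o
    (H := fun z _ => F z (initSt A)) (fun z w b => rfl) z ψ
  simp only [h, eval_outs, pair]
  exact V.run_pre f (fun z x y b => F (z ++ encodePair (x, if b then x else y)) (initSt A)) z ψ

end Verif

/-! ### Formulas -/

namespace BExpr

/-- Substitution of formulas for the variables. -/
def subst {A B : Type} : BExpr A → (A → BExpr B) → BExpr B
  | lit b, _ => lit b
  | var a, s => s a
  | op φ e₁ e₂, s => op φ (e₁.subst s) (e₂.subst s)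

lemma eval_subst {A B : Type} (e : BExpr A) (s : A → BExpr B) (w : B → Bool) :
    (e.subst s).eval w = e.eval fun a => (s a).eval w := by
  induction e with
  | lit b => rfl
  | var a => rfl
  | op φ e₁ e₂ h₁ h₂ => simp [subst, eval, h₁, h₂]

lemma size_subst_var {A B : Type} (e : BExpr A) (s : A → B) :
    (e.subst fun a => var (s a)).size = e.size := by
  induction e with
  | lit b => rfl
  | var a => rfl
  | op φ e₁ e₂ h₁ h₂ => simp [subst, size, h₁, h₂]

lemma uses_subst_var {A B : Type} {e : BExpr A} {s : A → B} {b : B}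
    (h : (e.subst fun a => var (s a)).Uses b) : ∃ a, s a = b := by
  induction e with
  | lit b => exact h.elim
  | var a => exact ⟨a, h⟩
  | op φ e₁ e₂ h₁ h₂ => exact h.elim h₁ h₂

/-- The formula for `u < n`, where `u` is the number with the given bits. -/
def lt {A : Type} : (k : ℕ) → (Fin k → A) → ℕ → BExpr A
  | 0, _, n => lit (decide (0 < n))
  | k + 1, u, n =>
    if n ≤ 2 ^ k then op (fun b l => !b && l) (var (u (Fin.last k))) (lt k (u ∘ Fin.castSucc) n)
    else op (fun b l => !b || l) (var (u (Fin.last k))) (lt k (u ∘ Fin.castSucc) (n - 2 ^ k))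

lemma size_lt {A : Type} (k : ℕ) (u : Fin k → A) (n : ℕ) : (lt k u n).size = 2 * k + 1 := by
  induction k generalizing n with
  | zero => rfl
  | succ k ih =>
    rw [lt]
    split_ifs <;> simp only [size, ih] <;> omega

lemma uses_lt {A : Type} {k : ℕ} {u : Fin k → A} {n : ℕ} {a : A} (h : (lt k u n).Uses a) :
    ∃ j, u j = a := by
  induction k generalizing n with
  | zero => exact h.elim
  | succ k ih =>
    rw [lt] at h
    split_ifs at h
    · rcases h with h | h
      · exact ⟨_, h⟩
      · obtain ⟨j, hj⟩ := ih h
        exact ⟨_, hj⟩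
    · rcases h with h | h
      · exact ⟨_, h⟩
      · obtain ⟨j, hj⟩ := ih h
        exact ⟨_, hj⟩

end BExpr

lemma ofBits_last {k : ℕ} (u : Fin (k + 1) → Bool) :
    Nat.ofBits u = Nat.ofBits (u ∘ Fin.castSucc) + if u (Fin.last k) then 2 ^ k else 0 := by
  rw [ofBits_eq_sum, ofBits_eq_sum, Fin.sum_univ_castSucc]
  rfl

lemma BExpr.eval_lt {A : Type} (k : ℕ) (u : Fin k → A) (n : ℕ) (w : A → Bool) :
    (BExpr.lt k u n).eval w = decide (Nat.ofBits (fun j => w (u j)) < n) := by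
  induction k generalizing n with
  | zero => rw [Nat.ofBits_zero]; rfl
  | succ k ih =>
    have hlt := Nat.ofBits_lt_two_pow fun j : Fin k => w (u j.castSucc)
    have hl := ofBits_last fun j => w (u j)
    simp only [Function.comp_def] at hl
    rw [hl, BExpr.lt]
    split_ifs with h1 h2 h2
    · simp only [BExpr.eval, ih, h2, Function.comp_apply]
      simp
      omega
    · simp only [BExpr.eval, ih, h2, Function.comp_apply]
      simp
    · simp only [BExpr.eval, ih, h2, Function.comp_apply]
      simp
      omega
    · simp only [BExpr.eval, ih, h2, Function.comp_apply]
      simp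
      omega

/-- The bits of a number. -/
def bitsOf (k i : ℕ) : Fin k → Bool := fun j => i.testBit j

lemma bitsOf_ofBits {k : ℕ} (u : Fin k → Bool) : bitsOf k (Nat.ofBits u) = u := by
  funext j
  exact Nat.testBit_ofBits_lt _ _ j.2

lemma bitsOf_injOn {k i j : ℕ} (hi : i < 2 ^ k) (hj : j < 2 ^ k) (h : bitsOf k i = bitsOf k j) :
    i = j := by
  have h1 := Nat.ofBits_testBit i k
  have h2 := Nat.ofBits_testBit j k
  rw [Nat.mod_eq_of_lt hi] at h1
  rw [Nat.mod_eq_of_lt hj] at h2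
  rw [← h1, ← h2]
  exact congrArg Nat.ofBits h

/-- A map from the `k`-bit strings to `[M]` that is computed by formulas. -/
structure Curve (k M : ℕ) where
  φ : Fin (Nat.clog 2 M) → BExpr (Fin k)
  pt : (Fin k → Bool) → Fin M
  spec : ∀ u, (Nat.ofBits fun j => (φ j).eval u) = pt u

/-! ### States with a classical part -/

section Emb

variable {Q X : Type}

open Classical in
/-- The state whose second part is the basis state `u`. -/
def emb (u : X → Bool) : St Q →ₗ[ℂ] St (Q ⊕ X) where
  toFun ψ w := if (fun x => w (Sum.inr x)) = u then ψ fun q => w (Sum.inl q) else 0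
  map_add' ψ φ := by
    funext w
    simp only [Pi.add_apply]
    split_ifs <;> simp
  map_smul' c ψ := by
    funext w
    simp only [Pi.smul_apply, RingHom.id_apply]
    split_ifs <;> simp

lemma emb_of_eq {u : X → Bool} (ψ : St Q) {w : Q ⊕ X → Bool} (h : ∀ x, w (Sum.inr x) = u x) :
    emb u ψ w = ψ fun q => w (Sum.inl q) := if_pos (funext h)

lemma emb_of_ne {u : X → Bool} (ψ : St Q) {w : Q ⊕ X → Bool} (h : ¬ ∀ x, w (Sum.inr x) = u x) :
    emb u ψ w = 0 := if_neg fun h' => h (congrFun h')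

/-- The embedding of the first part of a memory. -/
abbrev inlQ (Q X : Type) : Q ↪ Q ⊕ X := ⟨Sum.inl, Sum.inl_injective⟩

lemma applyU_emb (u : X → Bool) {r : ℕ} (t : Fin r ↪ Q) (U) (ψ : St Q) :
    applyU (t.trans (inlQ Q X)) U (emb u ψ) = emb u (applyU t U ψ) := by
  have hr : ∀ (b : Fin r → Bool) (w : Q ⊕ X → Bool) x, Function.extend (t.trans (inlQ Q X)) b w (Sum.inr x) = w (Sum.inr x) := by
    intro b w x
    exact extend_trans_of_notMem (inlQ Q X) t b w (by rintro ⟨_, h⟩; simp [inlQ] at h)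
  have hl : ∀ (b : Fin r → Bool) (w : Q ⊕ X → Bool), (fun q => Function.extend (t.trans (inlQ Q X)) b w (Sum.inl q)) =
      Function.extend t b fun q => w (Sum.inl q) := fun b w =>
    extend_trans_comp (inlQ Q X) t b w
  funext w
  by_cases h : ∀ x, w (Sum.inr x) = u x
  · rw [emb_of_eq _ h, applyU_apply, applyU_apply]
    refine Finset.sum_congr rfl fun b _ => ?_
    rw [emb_of_eq _ fun x => by rw [hr, h], hl]
    rfl
  · rw [emb_of_ne _ h, applyU_apply]
    refine Finset.sum_eq_zero fun b _ => ?_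
    rw [emb_of_ne _ fun h' => h fun x => by rw [← h', hr], mul_zero]

lemma diagOp_emb (u : X → Bool) {θ : (Q ⊕ X → Bool) → ℂ} {η : (Q → Bool) → ℂ}
    (h : ∀ w, (∀ x, w (Sum.inr x) = u x) → θ w = η fun q => w (Sum.inl q)) (ψ : St Q) :
    diagOp θ (emb u ψ) = emb u (diagOp η ψ) := by
  funext w
  by_cases hw : ∀ x, w (Sum.inr x) = u x
  · rw [diagOp_apply, emb_of_eq _ hw, emb_of_eq _ hw, diagOp_apply, h w hw]
  · rw [diagOp_apply, emb_of_ne _ hw, emb_of_ne _ hw, mul_zero]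

variable [DecidableEq Q] [DecidableEq X]

lemma resetOp_emb (u : X → Bool) (i : Q) (b : Bool) (ψ : St Q) :
    resetOp (Sum.inl i) b (emb u ψ) = emb u (resetOp i b ψ) := by
  funext w
  rw [resetOp_apply]
  have hr : ∀ x, Function.update w (Sum.inl i) b (Sum.inr x) = w (Sum.inr x) := fun x =>
    Function.update_of_ne (by simp) _ _
  by_cases h : ∀ x, w (Sum.inr x) = u x
  · rw [emb_of_eq _ h, emb_of_eq _ fun x => by rw [hr, h], resetOp_apply]
    congr 2
    funext q
    by_cases hq : q = i
    · subst hq; simp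
    · rw [Function.update_of_ne hq, Function.update_of_ne (by simpa using hq)]
  · rw [emb_of_ne _ h, emb_of_ne _ fun h' => h fun x => by rw [← h', hr]]
    simp

lemma zeroAt_emb {u : X → Bool} {x : X} (hx : u x = false) (ψ : St Q) :
    ZeroAt (Sum.inr x) (emb u ψ) := by
  intro w hw
  refine emb_of_ne _ fun h => ?_
  rw [h, hx] at hw
  simp at hw

/-- Copying the qubit `q` to `o` and measuring it, by means of the auxiliary qubit `a`. -/
lemma resetOp_copy_emb (u : X → Bool) {a o : X} (hao : a ≠ o) (hua : u a = false)
    (huo : u o = false) (q : Q) (b : Bool) (ψ : St Q) :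
    resetOp (Sum.inr a) b
      (permOp (fun w => Function.update w (Sum.inr o) (Bool.xor (w (Sum.inr o)) (w (Sum.inr a))))
        (permOp (fun w => Function.update w (Sum.inr a) (Bool.xor (w (Sum.inr a)) (w (Sum.inl q))))
          (emb u ψ))) = emb (Function.update u o b) (projOp q b ψ) := by
  have hne : (Sum.inr o : Q ⊕ X) ≠ Sum.inr a := fun h => hao (Sum.inr_injective h).symm
  funext w
  rw [resetOp_apply, permOp_apply, permOp_apply]
  simp only [Function.update_self, Function.update_of_ne hne, Function.update_of_ne hne.symm,
    Function.update_of_ne (Sum.inl_ne_inr : (Sum.inl q : Q ⊕ X) ≠ Sum.inr _)]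
  set w' := Function.update (Function.update (Function.update w (Sum.inr a) b) (Sum.inr o)
    (Bool.xor (w (Sum.inr o)) b)) (Sum.inr a) (Bool.xor b (w (Sum.inl q))) with hw'
  have hl : (fun q => w' (Sum.inl q)) = fun q => w (Sum.inl q) := by
    funext q'
    simp [hw']
  have ha : w' (Sum.inr a) = Bool.xor b (w (Sum.inl q)) := by simp [hw']
  have ho : w' (Sum.inr o) = Bool.xor (w (Sum.inr o)) b := by
    rw [hw', Function.update_of_ne hne, Function.update_self]
  have hx : ∀ x, x ≠ a → x ≠ o → w' (Sum.inr x) = w (Sum.inr x) := by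
    intro x h1 h2
    rw [hw', Function.update_of_ne, Function.update_of_ne, Function.update_of_ne]
    · exact fun h => h1 (Sum.inr_injective h)
    · exact fun h => h2 (Sum.inr_injective h)
    · exact fun h => h1 (Sum.inr_injective h)
  by_cases hwa : w (Sum.inr a) = false
  · rw [if_pos hwa]
    by_cases hq : w (Sum.inl q) = b
    · by_cases hu : ∀ x, w (Sum.inr x) = Function.update u o b x
      · rw [emb_of_eq _ hu, emb_of_eq, hl]
        · simp [projOp, hq]
        · intro x
          by_cases h1 : x = a
          · subst h1; rw [ha, hq, hua]; simp
          · by_cases h2 : x = o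
            · subst h2; rw [ho, hu, huo]; simp
            · rw [hx x h1 h2, hu, Function.update_of_ne h2]
      · rw [emb_of_ne _ hu, emb_of_ne]
        intro h
        apply hu
        intro x
        by_cases h2 : x = o
        · subst h2
          have := h x
          rw [ho, huo] at this
          rw [Function.update_self]
          cases hh : w (Sum.inr x) <;> cases b <;> simp_all
        · rw [Function.update_of_ne h2, ← h x]
          by_cases h1 : x = a
          · subst h1; rw [ha, hq, hwa]; simp
          · rw [hx x h1 h2]
    · rw [emb_of_ne]
      · by_cases hu : ∀ x, w (Sum.inr x) = Function.update u o b x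
        · rw [emb_of_eq _ hu]
          simp [projOp, hq]
        · rw [emb_of_ne _ hu]
      · intro h
        have := h a
        rw [ha, hua] at this
        apply hq
        cases hh : w (Sum.inl q) <;> cases b <;> simp_all
  · rw [if_neg hwa, emb_of_ne]
    intro h
    apply hwa
    rw [h, Function.update_of_ne hao, hua]

variable [Fintype Q] [Fintype X]

lemma sum_emb (u : X → Bool) (ψ : St Q) (H : (Q ⊕ X → Bool) → ℝ) :
    ∑ w, ‖emb u ψ w‖ ^ 2 * H w = ∑ w, ‖ψ w‖ ^ 2 * H (Sum.elim w u) := by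
  classical
  rw [← (Equiv.sumArrowEquivProdArrow Q X Bool).symm.sum_comp, Fintype.sum_prod_type]
  refine Finset.sum_congr rfl fun v _ => ?_
  rw [Finset.sum_eq_single u]
  · rw [emb_of_eq]
    · rfl
    · intro x; rfl
  · intro u' _ hu'
    rw [emb_of_ne]
    · simp
    · intro h
      exact hu' (funext h)
  · simp

lemma nsq_emb (u : X → Bool) (ψ : St Q) : nsq (emb u ψ) = nsq ψ := by
  have := sum_emb u ψ fun _ => 1
  simpa [nsq] using this

lemma emb_initSt : emb (fun _ : X => false) (initSt Q) = initSt (Q ⊕ X) := by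
  funext w
  by_cases h : ∀ x, w (Sum.inr x) = false
  · rw [emb_of_eq _ h]
    by_cases hw : w = fun _ => false
    · subst hw
      simp [initSt]
    · rw [initSt, initSt, Pi.single_eq_of_ne hw, Pi.single_eq_of_ne]
      intro h'
      apply hw
      funext q
      rcases q with q | x
      · exact congrFun h' q
      · exact h x
  · rw [emb_of_ne _ h, initSt, Pi.single_eq_of_ne]
    rintro rfl
    simp at h

end Emb

/-! ### Simulation of a circuit -/

/-- The number of bits that a gate outputs. -/
def GGate.outs {M N : ℕ} {Q : Type} : GGate M N Q → ℕ
  | .output _ => 1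
  | _ => 0

/-- The number of bits that a circuit outputs. -/
def numOut {M N : ℕ} {Q : Type} (C : List (GGate M N Q)) : ℕ := (C.map GGate.outs).sum

/-- Output gates are at fixed places, so every branch emits the same number of bits. -/
lemma run_congr_length {M N : ℕ} {Q : Type} [DecidableEq Q] (f : Fin M → Fin N)
    (C : List (GGate M N Q)) {z : List Bool} {ψ : St Q} {F G : List Bool → St Q → ℝ}
    (h : ∀ z' ψ, z'.length = z.length + numOut C → F z' ψ = G z' ψ) :
    run (C.map fun g => g.instr f) z ψ F = run (C.map fun g => g.instr f) z ψ G := by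
  induction C generalizing z ψ with
  | nil => exact h z ψ (by simp [numOut])
  | cons g C ih =>
    cases g with
    | unitary r hr t U =>
      simp only [List.map_cons, GGate.instr_unitary, run_pureI_cons]
      exact ih fun z' ψ hz => h z' ψ (by rw [hz]; simp [numOut, GGate.outs])
    | query t =>
      simp only [List.map_cons, GGate.instr_query, run_pureI_cons]
      exact ih fun z' ψ hz => h z' ψ (by rw [hz]; simp [numOut, GGate.outs])
    | output i =>
      simp only [List.map_cons, GGate.instr_output, run_cons, List.map_nil]
      have h' : ∀ b, ∀ z' ψ, z'.length = (z ++ [b]).length + numOut C → F z' ψ = G z' ψ :=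
        fun b z' ψ hz => h z' ψ (by rw [hz]; simp [numOut, GGate.outs]; omega)
      rw [ih (h' _), ih (h' _)]
    | reset i =>
      simp only [List.map_cons, GGate.instr_reset, run_cons, List.map_nil, List.append_nil]
      have h' : ∀ z' ψ, z'.length = z.length + numOut C → F z' ψ = G z' ψ :=
        fun z' ψ hz => h z' ψ (by rw [hz]; simp [numOut, GGate.outs])
      rw [ih h', ih h']

/-- The additional qubits of a simulation: a register for the output of the simulated circuit,
two auxiliary qubits, and the test qubits. -/
abbrev Ext (N k t r : ℕ) : Type := (Fin (2 * k) ⊕ Bool) ⊕ (Tests N t ⊕ EqTests N r)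

instance (N t : ℕ) : DecidableEq (Tests N t) := inferInstanceAs (DecidableEq (_ × _))

instance (N r : ℕ) : DecidableEq (EqTests N r) := inferInstanceAs (DecidableEq (_ × _))

instance (N k t r : ℕ) : DecidableEq (Ext N k t r) := inferInstanceAs (DecidableEq (_ ⊕ _))

instance (N k t r : ℕ) : Fintype (Ext N k t r) := inferInstanceAs (Fintype (_ ⊕ _))

section Sim

variable {M N n m t r : ℕ} {Q : Type}

/-- The qubits of the output register. -/
abbrev regQ (Q : Type) (N t r : ℕ) {k : ℕ} (c : Fin (2 * k)) : Q ⊕ Ext N k t r :=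
  Sum.inr (Sum.inl (Sum.inl c))

/-- The auxiliary qubits. -/
abbrev auxQ (Q : Type) (N k t r : ℕ) (b : Bool) : Q ⊕ Ext N k t r := Sum.inr (Sum.inl (Sum.inr b))

/-- The test qubits of a simulated query. -/
abbrev testQ (Q : Type) (N k t r : ℕ) : Tests N t ↪ Q ⊕ Ext N k t r :=
  ⟨fun q => Sum.inr (Sum.inr (Sum.inl q)), fun q q' h => by simpa using h⟩

/-- The test qubits of an equality test. -/
abbrev eqQ (Q : Type) (N k t r : ℕ) : EqTests N r ↪ Q ⊕ Ext N k t r :=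
  ⟨fun q => Sum.inr (Sum.inr (Sum.inr q)), fun q q' h => by simpa using h⟩

variable (L : Curve (Nat.clog 2 n) M)

/-- The simulation of a query gate. -/
def querySim (N t r : ℕ) (g : Fin (Nat.clog 2 n) ⊕ Fin (Nat.clog 2 m) ↪ Q) :
    QuerySim M N t (Nat.clog 2 m) (Q ⊕ Ext N (Nat.clog 2 n) t r) where
  τ := testQ Q N _ t r
  hx j := (L.φ j).subst fun l => .var (Sum.inl (g (Sum.inl l)))
  pe u := .var (Sum.inl (g (Sum.inr u)))
  valid := .op and (.lt _ (fun l => Sum.inl (g (Sum.inl l))) n)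
    (.lt _ (fun u => Sum.inl (g (Sum.inr u))) m)
  hx_uses j q h := by
    obtain ⟨a, ha⟩ := BExpr.uses_subst_var h
    simp at ha
  pe_uses j q h := by simp [BExpr.Uses] at h
  valid_uses q h := by
    rcases h with h | h
    · obtain ⟨a, ha⟩ := BExpr.uses_lt h
      simp at ha
    · obtain ⟨a, ha⟩ := BExpr.uses_lt h
      simp at ha
  x w := L.pt fun l => w (Sum.inl (g (Sum.inl l)))
  hxx w := by simp only [BExpr.eval_subst, BExpr.eval, L.spec]

variable {f : Fin M → Fin N} {F : Fin n → Fin m}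

/-- The circuit for `F` numbers its points from 0 to n - 1 while the oracle is queried at their
images on the curve. The validity formula makes the phase trivial where the registers leave [n] or
[m], as the model demands. -/
lemma querySim_ideal (N t r : ℕ)
    (f : Fin M → Fin N) (hF : ∀ i : Fin n, (F i : ℕ) = f (L.pt (bitsOf _ i)))
    (g : Fin (Nat.clog 2 n) ⊕ Fin (Nat.clog 2 m) ↪ Q) (w) :
    (querySim L N t r g).ideal f m w = queryPhase F
      (Nat.ofBits fun l => w (Sum.inl (g (Sum.inl l))))
      (Nat.ofBits fun u => w (Sum.inl (g (Sum.inr u)))) := by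
  simp only [QuerySim.ideal, querySim, BExpr.eval, BExpr.eval_lt]
  by_cases h1 : (Nat.ofBits fun l => w (Sum.inl (g (Sum.inl l)))) < n
  · by_cases h2 : (Nat.ofBits fun u => w (Sum.inl (g (Sum.inr u)))) < m
    · rw [if_pos (by simp [h1, h2]), queryPhase_of_lt F h1 h2, hF ⟨_, h1⟩]
      simp only [bitsOf_ofBits]
      rfl
    · rw [if_neg (by simp [h2]), ephase_zero]
      simp [queryPhase, h2]
  · rw [if_neg (by simp [h1]), ephase_zero]
    simp [queryPhase, h1]

variable [DecidableEq Q]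

/-- The simulation of a gate, after the output of `c` bits. -/
def simGate (N t r c : ℕ) : GGate n m Q → List (Mac M N (Q ⊕ Ext N (Nat.clog 2 n) t r))
  | .unitary s hs g U => [.gate (.unitary s hs (g.trans (inlQ _ _)) U)]
  | .query g => (querySim L N t r g).macs m
  | .output q => if h : c < 2 * Nat.clog 2 n then
      [xorMac (auxQ Q N _ t r false) (.var (Sum.inl q)),
        xorMac (regQ Q N t r ⟨c, h⟩) (.var (auxQ Q N _ t r false)),
        .gate (.reset (auxQ Q N _ t r false))] else []
  | .reset q => [.gate (.reset (Sum.inl q))]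

/-- The simulation of a circuit, after the output of `c` bits. -/
def sim (N t r : ℕ) : ℕ → List (GGate n m Q) → List (Mac M N (Q ⊕ Ext N (Nat.clog 2 n) t r))
  | _, [] => []
  | c, g :: C => simGate L N t r c g ++ sim N t r (c + g.outs) C

/-- The additional qubits when the simulated circuit has output `z`. -/
def extOf (N k t r : ℕ) (z : List Bool) : Ext N k t r → Bool :=
  Sum.elim (Sum.elim (fun c => z.getD c false) fun _ => false) fun _ => false

lemma extOf_append (N k t r : ℕ) {z : List Bool} (b : Bool) (hz : z.length < 2 * k) :
    extOf N k t r (z ++ [b]) =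
      Function.update (extOf N k t r z) (Sum.inl (Sum.inl ⟨z.length, hz⟩)) b := by
  funext x
  rcases x with (c | b') | x
  · by_cases hc : c = ⟨z.length, hz⟩
    · subst hc
      simp [extOf]
    · rw [Function.update_of_ne (by simpa using hc)]
      simp only [extOf, Sum.elim_inl]
      have hc' : (c : ℕ) ≠ z.length := fun h => hc (Fin.ext h)
      rcases lt_or_gt_of_ne hc' with h | h
      · rw [List.getD_append _ _ _ _ h]
      · rw [List.getD_eq_default, List.getD_eq_default]
        · omega
        · simp; omega
  · rw [Function.update_of_ne (by simp)]
    rfl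
  · rw [Function.update_of_ne (by simp)]
    rfl

lemma extOf_nil (N k t r : ℕ) : extOf N k t r [] = fun _ => false := by
  funext x
  rcases x with (c | b') | x <;> simp [extOf]

variable [Fintype Q]

/-- The error of a simulated query. -/
def queryErr (N t : ℕ) : ℝ := 4 * ((2 * Nat.clog 2 N + 1 : ℕ) * (3 / 4) ^ 2 ^ t)

lemma queryErr_nonneg (N t : ℕ) : 0 ≤ queryErr N t := by
  unfold queryErr
  positivity

set_option maxHeartbeats 1000000 in
-- Induction on the gates, with the rest of the simulation as the functional. All gates but the
-- queries are simulated exactly. At a query the ideal state is the actual one plus a small error,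
-- and the quasi-triangle inequality gives a factor 1 + κ and an additive (1 + κ⁻¹) `queryErr`. Only
-- this direction, a lower bound for the simulation, is needed. An output bit goes to a register,
-- whose content is described classically by `extOf`.
theorem run_le_sim (N t r : ℕ) (f : Fin M → Fin N)
    (hF : ∀ i : Fin n, (F i : ℕ) = f (L.pt (bitsOf _ i))) {κ : ℝ} (hκ : 0 < κ)
    {G : St (Q ⊕ Ext N (Nat.clog 2 n) t r) → ℝ} (hG : QuasiTri κ fun _ => G)
    (hG0 : ∀ φ, 0 ≤ G φ) (hG1 : ∀ φ, G φ ≤ nsq φ) {H : List Bool → ℝ}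
    (hGH : ∀ z ψ, z.length = 2 * Nat.clog 2 n → H z * nsq ψ ≤ G (emb (extOf N _ t r z) ψ))
    (C : List (GGate n m Q)) (z : List Bool) (hz : z.length + numOut C = 2 * Nat.clog 2 n)
    (ψ : St Q) :
    run (C.map fun g => g.instr F) z ψ (fun z ψ => H z * nsq ψ) ≤
      (1 + κ) ^ C.length * (run ((sim L N t r z.length C).map fun m => m.instr f) []
        (emb (extOf N _ t r z) ψ) (fun _ φ => G φ) +
          C.length * ((1 + κ⁻¹) * queryErr N t) * nsq ψ) := by
  have hδ : 0 ≤ (1 + κ⁻¹) * queryErr N t := mul_nonneg (by positivity) (queryErr_nonneg N t)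
  set δ := (1 + κ⁻¹) * queryErr N t with hδdef
  induction C generalizing z ψ with
  | nil =>
    have := hGH z ψ (by simpa [numOut] using hz)
    simpa [sim] using this
  | cons g C ih =>
    -- For uniformity every gate is charged like a query; the exact gates waste the factor and the
    -- additive term.
    have hmono : ∀ p x : ℝ, 0 ≤ p → 0 ≤ x → (1 + κ) ^ C.length * (p + C.length * δ * x) ≤
        (1 + κ) ^ (C.length + 1) * (p + (C.length + 1 : ℕ) * δ * x) := by
      intro p x hp hx
      rw [pow_succ]
      have h1 : (0 : ℝ) ≤ (1 + κ) ^ C.length := by positivity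
      rw [mul_assoc ((1 + κ) ^ C.length)]
      refine mul_le_mul_of_nonneg_left ?_ h1
      have h2 : p + C.length * δ * x ≤ p + (C.length + 1 : ℕ) * δ * x := by
        push_cast
        nlinarith [mul_nonneg hδ hx]
      have h3 : 0 ≤ p + (C.length + 1 : ℕ) * δ * x := by positivity
      nlinarith
    have hrun0 : ∀ D : List (Mac M N (Q ⊕ Ext N (Nat.clog 2 n) t r)), ∀ φ,
        0 ≤ run (D.map fun m => m.instr f) [] φ (fun _ φ => G φ) :=
      fun D φ => run_nonneg _ _ _ fun _ φ => hG0 φ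
    rw [sim, List.map_append, run_append, List.length_cons]
    cases g with
    | unitary s hs g U =>
      have h := ih z (by rw [← hz]; simp [numOut, GGate.outs]) (applyU g U.1 ψ)
      rw [nsq_applyU, ← applyU_emb] at h
      simp only [List.map_cons, GGate.instr_unitary, run_pureI_cons, simGate, List.map_nil,
        Mac.instr, run_nil, GGate.outs, add_zero]
      exact h.trans (hmono _ _ (hrun0 _ _) (nsq_nonneg _))
    | query g =>
      set Z := querySim L N t r g with hZ
      have hideal : emb (extOf N _ t r z) (applyQ F g ψ) =
          diagOp (Z.ideal f m) (emb (extOf N _ t r z) ψ) := by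
        rw [applyQ]
        exact (diagOp_emb _ (fun w hw => querySim_ideal L N t r f hF g w) ψ).symm
      have h := ih z (by rw [← hz]; simp [numOut, GGate.outs]) (applyQ F g ψ)
      have hn : nsq (applyQ F g ψ) = nsq ψ := nsq_diagOp (fun w => norm_queryPhase _ _ _) _
      rw [hn, hideal] at h
      simp only [List.map_cons, GGate.instr_query, run_pureI_cons, simGate, GGate.outs, add_zero]
      rw [← hZ, Z.realizes_macs f m]
      refine h.trans ?_
      set Φ := emb (extOf N (Nat.clog 2 n) t r z) ψ with hΦ
      have herr := Z.nsq_op_sub_le f m (ψ := Φ) fun q => zeroAt_emb (by simp [extOf]) ψ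
      rw [hΦ, nsq_emb, ← hΦ] at herr
      -- The remaining simulation is applied to the actual state plus the deviation of the ideal
      -- state from it.
      have hq := (hG.run ((sim L N t r z.length C).map fun m => m.instr f)) [] (Z.op f m Φ)
        (diagOp (Z.ideal f m) Φ - Z.op f m Φ)
      rw [add_sub_cancel] at hq
      have hle : run ((sim L N t r z.length C).map fun m => m.instr f) []
          (diagOp (Z.ideal f m) Φ - Z.op f m Φ) (fun _ φ => G φ) ≤ queryErr N t * nsq ψ := by
        refine (run_mono _ _ _ fun _ φ => hG1 φ).trans ?_
        rw [run_nsq]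
        · refine le_trans (le_of_eq ?_) herr
          exact Finset.sum_congr rfl fun w _ => by rw [Pi.sub_apply, Pi.sub_apply, norm_sub_rev]
        · intro I hI
          obtain ⟨m, _, rfl⟩ := List.mem_map.1 hI
          exact m.instr_iso f
      set p := run ((sim L N t r z.length C).map fun m => m.instr f) [] (Z.op f m Φ)
        (fun _ φ => G φ)
      set x := nsq ψ
      have hx : 0 ≤ x := nsq_nonneg _
      have hp : 0 ≤ p := hrun0 _ _
      have h2 : (1 + κ⁻¹) * run ((sim L N t r z.length C).map fun m => m.instr f) []
          (diagOp (Z.ideal f m) Φ - Z.op f m Φ) (fun _ φ => G φ) ≤ δ * x := by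
        rw [hδdef, mul_assoc]
        exact mul_le_mul_of_nonneg_left hle (by positivity)
      rw [pow_succ, mul_assoc ((1 + κ) ^ C.length)]
      refine mul_le_mul_of_nonneg_left ?_ (by positivity)
      push_cast
      have h3 : 0 ≤ δ * x := mul_nonneg hδ hx
      have h4 : 0 ≤ (C.length : ℝ) * (δ * x) := by positivity
      nlinarith
    | output q =>
      have hlt : z.length < 2 * Nat.clog 2 n := by
        rw [← hz]; simp [numOut, GGate.outs]
      have h := fun b => ih (z ++ [b]) (by rw [← hz]; simp [numOut, GGate.outs]; omega)
        (projOp q b ψ)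
      simp only [extOf_append N _ t r _ hlt, List.length_append, List.length_cons,
        List.length_nil, zero_add] at h
      have hcopy := fun b => resetOp_copy_emb (extOf N (Nat.clog 2 n) t r z)
        (a := Sum.inl (Sum.inr false)) (o := Sum.inl (Sum.inl ⟨z.length, hlt⟩)) (by simp)
        (by simp [extOf]) (by simp [extOf]) q b ψ
      simp only [← hcopy] at h
      simp only [List.map_cons, GGate.instr_output, simGate, dif_pos hlt, List.map_nil,
        GGate.outs]
      rw [xorMac_instr f (by simp [BExpr.Uses]), xorMac_instr f (by simp [BExpr.Uses]),
        run_pureI_cons, run_pureI_cons, run_reset_cons, run_cons]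
      simp only [List.map_cons, List.map_nil, List.sum_cons, List.sum_nil, add_zero, run_nil,
        BExpr.eval]
      have hn := nsq_projOp q ψ
      have h1 := (h false).trans (hmono _ _ (hrun0 _ _) (nsq_nonneg _))
      have h2 := (h true).trans (hmono _ _ (hrun0 _ _) (nsq_nonneg _))
      rw [← hn]
      refine (add_le_add h1 h2).trans (le_of_eq ?_)
      ring
    | reset q =>
      have h := fun b => ih z (by rw [← hz]; simp [numOut, GGate.outs]) (resetOp q b ψ)
      simp only [← resetOp_emb] at h
      simp only [List.map_cons, GGate.instr_reset, simGate, List.map_nil, GGate.outs, add_zero]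
      rw [run_reset_cons, run_cons]
      simp only [List.map_cons, List.map_nil, List.sum_cons, List.sum_nil, add_zero, run_nil,
        List.append_nil]
      have hn := nsq_resetOp q ψ
      have h1 := (h false).trans (hmono _ _ (hrun0 _ _) (nsq_nonneg _))
      have h2 := (h true).trans (hmono _ _ (hrun0 _ _) (nsq_nonneg _))
      rw [← hn]
      refine (add_le_add h1 h2).trans (le_of_eq ?_)
      ring

end Sim

/-! ### Macro gates without output -/

section Quiet

variable {M N : ℕ} {A : Type} [DecidableEq A]

/-- The macro gate is not an output gate. -/
def Mac.Quiet : Mac M N A → Prop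
  | .gate (.output _) => False
  | _ => True

lemma silent_of_quiet (f : Fin M → Fin N) {C : List (Mac M N A)} (hC : ∀ m ∈ C, m.Quiet) :
    Silent (C.map fun m => m.instr f) := by
  intro I hI b hb
  obtain ⟨m, hm, rfl⟩ := List.mem_map.1 hI
  have := hC m hm
  cases m with
  | gate g =>
    cases g with
    | unitary r hr t U =>
      simp only [Mac.instr, GGate.instr_unitary, pureI, List.mem_singleton] at hb
      rw [hb]
    | query t =>
      simp only [Mac.instr, GGate.instr_query, pureI, List.mem_singleton] at hb
      rw [hb]
    | output i => exact this.elim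
    | reset i =>
      simp only [Mac.instr, GGate.instr_reset, List.mem_cons, List.not_mem_nil, or_false] at hb
      rcases hb with rfl | rfl <;> rfl
  | phase e θ =>
    simp only [Mac.instr, pureI, List.mem_singleton] at hb
    rw [hb]
  | query ex =>
    simp only [Mac.instr, pureI, List.mem_singleton] at hb
    rw [hb]
  | xor a e h =>
    simp only [Mac.instr, pureI, List.mem_singleton] at hb
    rw [hb]

lemma quiet_xorMac (a : A) (e : BExpr A) : (xorMac a e : Mac M N A).Quiet := by
  unfold xorMac
  split_ifs <;> trivial

lemma quiet_testMac {q : A} {D : List (Mac M N A)} (hD : ∀ m ∈ D, m.Quiet) :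
    ∀ m ∈ testMac q D, m.Quiet := by
  intro m hm
  simp only [testMac, List.mem_cons, List.mem_append, List.not_mem_nil, or_false] at hm
  rcases hm with rfl | hm | rfl
  · trivial
  · exact hD m hm
  · trivial

lemma QuerySim.quiet_macs {t P : ℕ} (Z : QuerySim M N t P A) (m' : ℕ) :
    ∀ m ∈ Z.macs m', m.Quiet := by
  intro m hm
  simp only [QuerySim.macs, List.mem_append, List.mem_flatMap] at hm
  rcases hm with ⟨q, _, hm⟩ | hm | ⟨q, _, hm⟩
  · refine quiet_testMac ?_ m hm
    intro m hm
    simp only [QuerySim.fwd, List.mem_append, List.mem_cons, List.not_mem_nil, or_false,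
      List.mem_map] at hm
    rcases hm with rfl | rfl | ⟨i, _, rfl⟩ <;> trivial
  · simp only [QuerySim.mid, List.mem_map] at hm
    obtain ⟨u, _, rfl⟩ := hm
    trivial
  · refine quiet_testMac ?_ m hm
    intro m hm
    simp only [QuerySim.bwd, List.mem_append, List.mem_cons, List.not_mem_nil, or_false,
      List.mem_map] at hm
    rcases hm with rfl | rfl | ⟨i, _, rfl⟩ <;> trivial

lemma quiet_sim {n m : ℕ} {Q : Type} [DecidableEq Q] (L : Curve (Nat.clog 2 n) M) (t r c : ℕ)
    (C : List (GGate n m Q)) : ∀ m ∈ sim L N t r c C, m.Quiet := by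
  induction C generalizing c with
  | nil => simp [sim]
  | cons g C ih =>
    intro m hm
    rw [sim, List.mem_append] at hm
    rcases hm with hm | hm
    · cases g with
      | unitary s hs g U =>
        simp only [simGate, List.mem_singleton] at hm
        subst hm
        trivial
      | query g => exact QuerySim.quiet_macs _ _ m hm
      | output q =>
        simp only [simGate] at hm
        split_ifs at hm
        · simp only [List.mem_cons, List.not_mem_nil, or_false] at hm
          rcases hm with rfl | rfl | rfl
          · exact quiet_xorMac _ _
          · exact quiet_xorMac _ _
          · trivial
        · simp at hm
      | reset q =>
        simp only [simGate, List.mem_singleton] at hm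
        subst hm
        trivial
    · exact ih _ m hm

end Quiet

/-! ### Blocks that output one pair -/

section Block

variable {M N r : ℕ} {A : Type} [DecidableEq A] [Fintype A]

/-- On the initial state, the macro gates output a random pair with distribution `p`, and return to
the initial state. -/
def Emits (f : Fin M → Fin N) (D : List (Mac M N A)) (p : Fin M × Fin M → ℝ) : Prop :=
  ∀ F : List Bool → St A → ℝ, Homog F → ∀ z, run (D.map fun m => m.instr f) z (initSt A) F =
    ∑ P, p P * F (z ++ encodePair P) (initSt A)

/-- Each block leaves the initial state behind, so the next block starts afresh and the
distributions multiply. -/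
lemma run_blocks {f : Fin M → Fin N} {B : ℕ} {D : Fin B → List (Mac M N A)}
    {p : Fin B → Fin M × Fin M → ℝ} (h : ∀ i, Emits f (D i) (p i))
    {F : List Bool → St A → ℝ} (hF : Homog F) (z) :
    run ((List.ofFn D).flatten.map fun m => m.instr f) z (initSt A) F =
      ∑ ω : Fin B → Fin M × Fin M, (∏ i, p i (ω i)) *
        F (z ++ (List.ofFn ω).flatMap encodePair) (initSt A) := by
  induction B generalizing z with
  | zero => simp
  | succ B ih =>
    rw [List.ofFn_succ, List.flatten_cons, List.map_append, run_append, h 0 _ (hF.run _),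
      sum_cons_eq]
    refine Finset.sum_congr rfl fun P _ => ?_
    rw [ih fun i => h i.succ, Finset.mul_sum]
    refine Finset.sum_congr rfl fun ω _ => ?_
    rw [Fin.prod_univ_succ, List.ofFn_succ, List.flatMap_cons]
    simp only [Fin.cons_zero, Fin.cons_succ, List.append_assoc]
    ring

namespace Verif

variable (V : Verif M N r A) (f : Fin M → Fin N)

lemma avgPair_eq (g : Fin M × Fin M → ℝ) (w : A → Bool) :
    V.avgPair f g w = passProb N r (f (V.x w)) (f (V.y w)) * g (V.x w, V.y w) +
      (1 - passProb N r (f (V.x w)) (f (V.y w))) * g (V.x w, V.x w) := by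
  simp [avgPair, avg]

lemma avgPair_sum (g : Fin M × Fin M → ℝ) (w : A → Bool) :
    V.avgPair f g w = ∑ P, g P * V.avgPair f (fun P' => if P' = P then 1 else 0) w := by
  simp only [avgPair_eq, mul_add, Finset.sum_add_distrib]
  congr 1
  · rw [Finset.sum_eq_single (V.x w, V.y w)]
    · simp [mul_comm]
    · intro P _ hP; simp [Ne.symm hP]
    · simp
  · rw [Finset.sum_eq_single (V.x w, V.x w)]
    · simp [mul_comm]
    · intro P _ hP; simp [Ne.symm hP]
    · simp

lemma avgPair_mono {g g' : Fin M × Fin M → ℝ} (h : ∀ P, g P ≤ g' P) (w : A → Bool) :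
    V.avgPair f g w ≤ V.avgPair f g' w := by
  rw [avgPair_eq, avgPair_eq]
  have h0 := passProb_nonneg N r (f (V.x w)) (f (V.y w))
  have h1 := passProb_le_one N r (f (V.x w)) (f (V.y w))
  exact add_le_add (mul_le_mul_of_nonneg_left (h _) h0)
    (mul_le_mul_of_nonneg_left (h _) (by linarith))

lemma avgPair_const (c : ℝ) (w : A → Bool) : V.avgPair f (fun _ => c) w = c := by
  rw [avgPair_eq]
  ring

/-- The distribution of the output pair. -/
def prob (C₀ : List (Mac M N A)) (P : Fin M × Fin M) : ℝ :=
  run (C₀.map fun m => m.instr f) [] (initSt A)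
    (dia fun _ w => V.avgPair f (fun P' => if P' = P then 1 else 0) w)

lemma sum_prob_mul (C₀ : List (Mac M N A)) (g : Fin M × Fin M → ℝ) :
    ∑ P, V.prob f C₀ P * g P = run (C₀.map fun m => m.instr f) [] (initSt A)
      (dia fun _ w => V.avgPair f g w) := by
  have h : (dia fun _ w => V.avgPair f g w) = fun z ψ => ∑ P, g P *
      dia (fun _ w => V.avgPair f (fun P' => if P' = P then 1 else 0) w) z ψ := by
    funext z ψ
    simp only [dia, Finset.mul_sum]
    rw [Finset.sum_comm]
    refine Finset.sum_congr rfl fun w _ => ?_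
    rw [V.avgPair_sum, Finset.mul_sum]
    exact Finset.sum_congr rfl fun P _ => by ring
  rw [h, run_sum]
  simp only [run_mul_left, prob, mul_comm]

lemma emits {C₀ : List (Mac M N A)} (hC₀ : ∀ m ∈ C₀, m.Quiet) :
    Emits f (C₀ ++ V.macs) (V.prob f C₀) := by
  intro F hF z
  rw [List.map_append, run_append]
  simp only [V.run_macs f hF]
  rw [run_silent (silent_of_quiet f hC₀), sum_prob_mul]
  rfl

lemma dia_nonneg {H : List Bool → (A → Bool) → ℝ} (hH : ∀ z w, 0 ≤ H z w) (z) (ψ : St A) :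
    0 ≤ dia H z ψ := Finset.sum_nonneg fun w _ => mul_nonneg (by positivity) (hH z w)

lemma dia_mono {H H' : List Bool → (A → Bool) → ℝ} (hH : ∀ z w, H z w ≤ H' z w) (z) (ψ : St A) :
    dia H z ψ ≤ dia H' z ψ :=
  Finset.sum_le_sum fun w _ => mul_le_mul_of_nonneg_left (hH z w) (by positivity)

lemma prob_nonneg (C₀ : List (Mac M N A)) (P) : 0 ≤ V.prob f C₀ P := by
  refine run_nonneg _ _ _ fun z ψ => dia_nonneg (fun _ w => ?_) z ψ
  have h := V.avgPair_mono f (g := fun _ => 0) (g' := fun P' => if P' = P then 1 else 0)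
    (fun P' => by split_ifs <;> norm_num) w
  rwa [avgPair_const] at h

lemma run_const (C₀ : List (Mac M N A)) (c : ℝ) :
    run (C₀.map fun m => m.instr f) [] (initSt A) (dia fun _ _ => c) = c := by
  have h : (dia fun _ _ => c) = fun z (ψ : St A) => c * nsq ψ := by
    funext z ψ
    simp [dia, nsq, Finset.mul_sum, mul_comm]
  rw [h, run_mul_left, run_nsq, nsq_initSt, mul_one]
  intro I hI
  obtain ⟨m, _, rfl⟩ := List.mem_map.1 hI
  exact m.instr_iso f

lemma sum_prob (C₀ : List (Mac M N A)) : ∑ P, V.prob f C₀ P = 1 := by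
  have := V.sum_prob_mul f C₀ fun _ => 1
  simp only [mul_one, avgPair_const, run_const f] at this
  exact this

/-- A wrong claim. -/
def Wrong (f : Fin M → Fin N) (P : Fin M × Fin M) : Prop := P.1 ≠ P.2 ∧ f P.1 ≠ f P.2

open Classical in
-- Whatever `C₀` leaves in the register, a wrong claim requires an equality test on different values
-- to pass. The simulation therefore need not be reliable for this bound.
lemma sum_prob_wrong_le (C₀ : List (Mac M N A)) :
    ∑ P, V.prob f C₀ P * (if Wrong f P then 1 else 0) ≤ (1 / 4) ^ r := by
  rw [sum_prob_mul, ← run_const f C₀ ((1 / 4 : ℝ) ^ r)]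
  refine run_mono _ _ _ fun z ψ => dia_mono (fun _ w => ?_) z ψ
  rw [avgPair_eq]
  have h2 : ¬ Wrong f (V.x w, V.x w) := fun h => h.1 rfl
  rw [if_neg h2, mul_zero, add_zero]
  split_ifs with h
  · rw [mul_one]
    exact passProb_le (f (V.x w)).2 (f (V.y w)).2 (fun h' => h.2 (Fin.ext h')) r
  · rw [mul_zero]
    positivity

end Verif

end Block

/-! ### The simulation of a circuit for Element Distinctness -/

section EDBlock

variable {M N n m t r : ℕ} {Q : Type}

/-- The verification of the pair in the output register. -/
def simVerif (N t r : ℕ) (Q : Type) {k : ℕ} (L : Curve k M) : Verif M N r (Q ⊕ Ext N k t r) where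
  ν := eqQ Q N k t r
  o := auxQ Q N k t r true
  ex j := (L.φ j).subst fun l => .var (regQ Q N t r ⟨l, by omega⟩)
  ey j := (L.φ j).subst fun l => .var (regQ Q N t r ⟨k + l, by omega⟩)
  ho q h := Sum.inr_ne_inl (Sum.inr_injective h)
  ex_uses j q h := by
    obtain ⟨a, ha⟩ := BExpr.uses_subst_var h
    exact Sum.inl_ne_inr (Sum.inr_injective ha)
  ey_uses j q h := by
    obtain ⟨a, ha⟩ := BExpr.uses_subst_var h
    exact Sum.inl_ne_inr (Sum.inr_injective ha)
  ex_o j h := by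
    obtain ⟨a, ha⟩ := BExpr.uses_subst_var h
    simp at ha
  ey_o j h := by
    obtain ⟨a, ha⟩ := BExpr.uses_subst_var h
    simp at ha
  x w := L.pt fun l => w (regQ Q N t r ⟨l, by omega⟩)
  y w := L.pt fun l => w (regQ Q N t r ⟨k + l, by omega⟩)
  hxx w := by simp only [BExpr.eval_subst, BExpr.eval, L.spec]
  hyy w := by simp only [BExpr.eval_subst, BExpr.eval, L.spec]

/-- A collision of `f` on the curve `L`. -/
def OnCurve {k : ℕ} (f : Fin M → Fin N) (L : Curve k M) (P : Fin M × Fin M) : Prop :=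
  IsCollision f P ∧ P.1 ∈ Set.range L.pt ∧ P.2 ∈ Set.range L.pt

lemma getD_encodePair {n : ℕ} (P : Fin n × Fin n) (l : Fin (Nat.clog 2 n)) :
    (encodePair P).getD l false = bitsOf (Nat.clog 2 n) P.1 l ∧
      (encodePair P).getD (Nat.clog 2 n + l) false = bitsOf (Nat.clog 2 n) P.2 l := by
  constructor
  · rw [encodePair, List.getD_append _ _ _ _ (by simp), List.getD_eq_getElem _ _ (by simp)]
    simp [bitsOf]
  · rw [encodePair, List.getD_append_right _ _ _ _ (by simp), List.getD_eq_getElem _ _ (by simp)]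
    simp [bitsOf]

variable [DecidableEq Q] [Fintype Q]

open Classical in
-- A collision of `F` in the register decodes to a collision of `f` on the curve, and the equality
-- test lets it pass with certainty. So the observable after the simulation dominates the success of
-- the original circuit.
theorem ed_le_prob (N t r : ℕ) (L : Curve (Nat.clog 2 n) M) (hL : Function.Injective L.pt)
    (f : Fin M → Fin N) {F : Fin n → Fin m}
    (hF : ∀ i : Fin n, (F i : ℕ) = f (L.pt (bitsOf _ i))) {κ : ℝ} (hκ : 0 < κ)
    (C : List (GGate n m Q)) (hC : numOut C = 2 * Nat.clog 2 n) :
    run (C.map fun g => g.instr F) [] (initSt Q)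
      (fun z ψ => (if OutputsCollision F z then 1 else 0) * nsq ψ) ≤
      (1 + κ) ^ C.length * (∑ P, (simVerif N t r Q L).prob f (sim L N t r 0 C) P *
        (if OnCurve f L P then 1 else 0) + C.length * ((1 + κ⁻¹) * queryErr N t)) := by
  set V := simVerif N t r Q L with hV
  set g : Fin M × Fin M → ℝ := fun P => if OnCurve f L P then 1 else 0 with hg
  have hg0 : ∀ w, 0 ≤ V.avgPair f g w := fun w => by
    rw [← V.avgPair_const f 0 w]
    exact V.avgPair_mono f (fun P => by simp only [hg]; split_ifs <;> norm_num) w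
  have hg1 : ∀ w, V.avgPair f g w ≤ 1 := fun w => by
    rw [← V.avgPair_const f 1 w]
    exact V.avgPair_mono f (fun P => by simp only [hg]; split_ifs <;> norm_num) w
  have h := run_le_sim L N t r f hF hκ (G := dia (fun _ w => V.avgPair f g w) [])
    (fun z ψ φ => dia_quasiTri hκ (fun _ w => hg0 w) [] ψ φ)
    (fun φ => Verif.dia_nonneg (fun _ w => hg0 w) [] φ)
    (fun φ => by
      rw [← dia_one []]
      exact Verif.dia_mono (fun _ w => hg1 w) [] φ)
    (H := fun z => if OutputsCollision F z then 1 else 0) ?_ C [] (by simpa using hC) (initSt Q)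
  · rw [nsq_initSt, mul_one, extOf_nil, emb_initSt, List.length_nil] at h
    refine h.trans (le_of_eq ?_)
    rw [V.sum_prob_mul]
    rfl
  · intro z ψ hz
    split_ifs with hout
    · rw [one_mul, dia, sum_emb]
      obtain ⟨P, rfl, hP⟩ := hout
      rw [nsq]
      refine Finset.sum_le_sum fun w _ => ?_
      have hx : V.x (Sum.elim w (extOf N _ t r (encodePair P))) = L.pt (bitsOf _ P.1) := by
        simp only [hV, simVerif, Sum.elim_inr, extOf, Sum.elim_inl, (getD_encodePair P _).1]
      have hy : V.y (Sum.elim w (extOf N _ t r (encodePair P))) = L.pt (bitsOf _ P.2) := by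
        simp only [hV, simVerif, Sum.elim_inr, extOf, Sum.elim_inl, (getD_encodePair P _).2]
      have hne : L.pt (bitsOf (Nat.clog 2 n) P.1) ≠ L.pt (bitsOf (Nat.clog 2 n) P.2) := fun h =>
        hP.1 (Fin.ext (bitsOf_injOn (P.1.2.trans_le (Nat.le_pow_clog (by norm_num) n))
          (P.2.2.trans_le (Nat.le_pow_clog (by norm_num) n)) (hL h)))
      have hf : f (L.pt (bitsOf (Nat.clog 2 n) P.1)) = f (L.pt (bitsOf (Nat.clog 2 n) P.2)) :=
        Fin.ext (by rw [← hF, ← hF, hP.2])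
      have h1 : V.avgPair f g (Sum.elim w (extOf N _ t r (encodePair P))) = 1 := by
        rw [Verif.avgPair_eq, hx, hy, hf, passProb_self (Fin.is_lt _)]
        have : OnCurve f L (L.pt (bitsOf (Nat.clog 2 n) P.1), L.pt (bitsOf (Nat.clog 2 n) P.2)) :=
          ⟨⟨hne, hf⟩, ⟨_, rfl⟩, ⟨_, rfl⟩⟩
        simp [hg, this]
      rw [h1, mul_one]
    · rw [zero_mul]
      exact Verif.dia_nonneg (fun _ w => hg0 w) [] _

end EDBlock

/-! ### Product distributions -/

section Product

variable {ι Ω : Type*} [Fintype ι] [DecidableEq ι] [Fintype Ω]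

/-- The expectation for the product of the distributions `p i`. -/
def pexp (p : ι → Ω → ℝ) (h : (ι → Ω) → ℝ) : ℝ := ∑ ω, (∏ i, p i (ω i)) * h ω

variable {p : ι → Ω → ℝ}

lemma pexp_prod (u : ι → Ω → ℝ) :
    pexp p (fun ω => ∏ i, u i (ω i)) = ∏ i, ∑ P, p i P * u i P := by
  have h := (Finset.prod_univ_sum (fun _ : ι => (Finset.univ : Finset Ω))
    fun i P => p i P * u i P).symm
  rw [Fintype.piFinset_univ] at h
  rw [← h, pexp]
  exact Finset.sum_congr rfl fun ω _ => Finset.prod_mul_distrib.symm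

lemma pexp_mono (hp : ∀ i P, 0 ≤ p i P) {g h : (ι → Ω) → ℝ} (hgh : ∀ ω, g ω ≤ h ω) :
    pexp p g ≤ pexp p h :=
  Finset.sum_le_sum fun ω _ => mul_le_mul_of_nonneg_left (hgh ω)
    (Finset.prod_nonneg fun i _ => hp i _)

lemma pexp_add (g h : (ι → Ω) → ℝ) : pexp p (fun ω => g ω + h ω) = pexp p g + pexp p h := by
  simp only [pexp, mul_add, Finset.sum_add_distrib]

lemma pexp_sub (g h : (ι → Ω) → ℝ) : pexp p (fun ω => g ω - h ω) = pexp p g - pexp p h := by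
  simp only [pexp, mul_sub, Finset.sum_sub_distrib]

lemma pexp_mul_left (c : ℝ) (h : (ι → Ω) → ℝ) :
    pexp p (fun ω => c * h ω) = c * pexp p h := by
  simp only [pexp, Finset.mul_sum]
  exact Finset.sum_congr rfl fun ω _ => by ring

lemma pexp_sum {κ : Type*} (s : Finset κ) (h : κ → (ι → Ω) → ℝ) :
    pexp p (fun ω => ∑ k ∈ s, h k ω) = ∑ k ∈ s, pexp p (h k) := by
  simp only [pexp, Finset.mul_sum]
  exact Finset.sum_comm

lemma pexp_const (hp1 : ∀ i, ∑ P, p i P = 1) (c : ℝ) : pexp p (fun _ => c) = c := by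
  have h := pexp_prod (p := p) fun _ _ => 1
  simp only [mul_one, hp1, Finset.prod_const_one] at h
  have h2 := pexp_mul_left (p := p) c fun _ => 1
  simp only [mul_one] at h2
  rw [h2, h, mul_one]

lemma pexp_coord (hp1 : ∀ i, ∑ P, p i P = 1) (i : ι) (g : Ω → ℝ) :
    pexp p (fun ω => g (ω i)) = ∑ P, p i P * g P := by
  have h := pexp_prod (p := p) fun j P => if j = i then g P else 1
  rw [Finset.prod_eq_single i] at h
  · simp only [if_true] at h
    rw [← h]
    congr 1
    funext ω
    rw [Finset.prod_eq_single i]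
    · simp
    · intro j _ hj; simp [hj]
    · simp
  · intro j _ hj
    simp [hj, hp1]
  · simp

end Product

/-! ### Disjoint collisions -/

section Collisions

variable {M N : ℕ} {f : Fin M → Fin N}

lemma disjointPairs_symm {P Q : Fin M × Fin M} (h : DisjointPairs P Q) : DisjointPairs Q P :=
  ⟨h.1.symm, h.2.2.1.symm, h.2.1.symm, h.2.2.2.symm⟩

lemma exists_maximal_disjoint (S : Finset (Fin M × Fin M)) :
    ∃ D ⊆ S, (∀ P ∈ D, ∀ Q ∈ D, P ≠ Q → DisjointPairs P Q) ∧
      ∀ P ∈ S, ∃ Q ∈ D, ¬ DisjointPairs P Q := by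
  classical
  obtain ⟨D, hD, hmax⟩ := Finset.exists_max_image
    (S.powerset.filter fun D => ∀ P ∈ D, ∀ Q ∈ D, P ≠ Q → DisjointPairs P Q) Finset.card
    ⟨∅, by simp⟩
  simp only [Finset.mem_filter, Finset.mem_powerset] at hD hmax
  refine ⟨D, hD.1, hD.2, fun P hP => ?_⟩
  by_contra! hcon
  have hPD : P ∉ D := fun h => (hcon P h).1 rfl
  have := hmax (insert P D) ⟨Finset.insert_subset hP hD.1, ?_⟩
  · rw [Finset.card_insert_of_notMem hPD] at this
    omega
  · intro A hA B hB hAB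
    rcases Finset.mem_insert.1 hA with hA' | hA'
    · rcases Finset.mem_insert.1 hB with hB' | hB'
      · exact (hAB (hA'.trans hB'.symm)).elim
      · exact hA' ▸ hcon B hB'
    · rcases Finset.mem_insert.1 hB with hB' | hB'
      · exact hB' ▸ disjointPairs_symm (hcon A hA')
      · exact hD.2 A hA' B hB' hAB

/-- No value is attained more than `m₀` times. -/
def LoadLE (f : Fin M → Fin N) (m₀ : ℕ) : Prop :=
  ∀ v, (Finset.univ.filter fun x => f x = v).card ≤ m₀

/-- Take a maximal disjoint subfamily D. Every collision in S shares an entry with some member of D,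
and an entry x belongs to at most 2 m₀ ordered pairs whose other entry has the same value; each
member of D has two entries. -/
lemma exists_disjoint_of_load {m₀ : ℕ} (hf : LoadLE f m₀) {S : Finset (Fin M × Fin M)}
    (hS : ∀ P ∈ S, IsCollision f P) :
    ∃ D ⊆ S, (∀ P ∈ D, ∀ Q ∈ D, P ≠ Q → DisjointPairs P Q) ∧ S.card ≤ D.card * (4 * m₀) := by
  classical
  obtain ⟨D, hDS, hD, hmax⟩ := exists_maximal_disjoint S
  refine ⟨D, hDS, hD, ?_⟩
  let star : Fin M → Finset (Fin M × Fin M) := fun x =>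
    (Finset.univ.filter fun y => f y = f x).image (fun y => (x, y)) ∪
      (Finset.univ.filter fun y => f y = f x).image (fun y => (y, x))
  have hstar : ∀ x, (star x).card ≤ 2 * m₀ := by
    intro x
    refine (Finset.card_union_le _ _).trans ?_
    have h1 := Finset.card_image_le (s := Finset.univ.filter fun y => f y = f x)
      (f := fun y => (x, y))
    have h2 := Finset.card_image_le (s := Finset.univ.filter fun y => f y = f x)
      (f := fun y => (y, x))
    have h3 := hf (f x)
    omega
  have hsub : S ⊆ D.biUnion fun Q => star Q.1 ∪ star Q.2 := by
    intro P hP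
    obtain ⟨Q, hQ, hPQ⟩ := hmax P hP
    have hc := (hS P hP).2
    refine Finset.mem_biUnion.2 ⟨Q, hQ, ?_⟩
    have hl : ∀ x, P.1 = x → P ∈ star x := by
      rintro x rfl
      exact Finset.mem_union_left _ (Finset.mem_image.2 ⟨P.2, by simp [hc], rfl⟩)
    have hr : ∀ x, P.2 = x → P ∈ star x := by
      rintro x rfl
      exact Finset.mem_union_right _ (Finset.mem_image.2 ⟨P.1, by simp [hc], rfl⟩)
    rw [Finset.mem_union]
    by_contra! hcon
    exact hPQ ⟨fun h => hcon.1 (hl _ h), fun h => hcon.2 (hl _ h), fun h => hcon.1 (hr _ h),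
      fun h => hcon.2 (hr _ h)⟩
  refine (Finset.card_le_card hsub).trans (Finset.card_biUnion_le_card_mul _ _ _ fun Q _ => ?_)
  refine (Finset.card_union_le _ _).trans ?_
  have h1 := hstar Q.1
  have h2 := hstar Q.2
  omega

/-- Take a maximal family of disjoint collisions. On the points that it does not cover f is
injective, so there are at most N of them. -/
lemma exists_disjoint_all (f : Fin M → Fin N) :
    ∃ D : Finset (Fin M × Fin M), (∀ P ∈ D, IsCollision f P) ∧
      (∀ P ∈ D, ∀ Q ∈ D, P ≠ Q → DisjointPairs P Q) ∧ M ≤ 2 * D.card + N := by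
  classical
  obtain ⟨D, hDS, hD, hmax⟩ := exists_maximal_disjoint
    (Finset.univ.filter fun P => IsCollision f P)
  have hmax' : ∀ P, IsCollision f P → ∃ Q ∈ D, ¬ DisjointPairs P Q := fun P hP =>
    hmax P (by simpa using hP)
  refine ⟨D, fun P hP => by simpa using hDS hP, hD, ?_⟩
  set E := D.image Prod.fst ∪ D.image Prod.snd with hE
  have hEc : E.card ≤ 2 * D.card := by
    refine (Finset.card_union_le _ _).trans ?_
    have h1 := Finset.card_image_le (s := D) (f := Prod.fst)
    have h2 := Finset.card_image_le (s := D) (f := Prod.snd)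
    omega
  have hinj : Set.InjOn f (Eᶜ : Finset (Fin M)) := by
    intro x hx y hy hxy
    by_contra hne
    obtain ⟨Q, hQ, hPQ⟩ := hmax' (x, y) ⟨hne, hxy⟩
    have h1 : Q.1 ∈ E := Finset.mem_union_left _ (Finset.mem_image_of_mem _ hQ)
    have h2 : Q.2 ∈ E := Finset.mem_union_right _ (Finset.mem_image_of_mem _ hQ)
    simp only [Finset.coe_compl, Set.mem_compl_iff, Finset.mem_coe] at hx hy
    have hm : ∀ u v, u = v → v ∈ E → u ∈ E := fun u v h hv => h ▸ hv
    exact hPQ ⟨fun h => hx (hm _ _ h h1), fun h => hx (hm _ _ h h2), fun h => hy (hm _ _ h h1),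
      fun h => hy (hm _ _ h h2)⟩
  have h3 : (Eᶜ : Finset (Fin M)).card ≤ N := by
    rw [← Finset.card_image_of_injOn hinj]
    exact (Finset.card_le_univ _).trans (by simp)
  rw [Finset.card_compl, Fintype.card_fin] at h3
  omega

end Collisions

/-! ### Success from many blocks -/

section Success

variable {M N : ℕ}

open Classical in
/-- The indicator that the output of the pairs `ω` contains enough disjoint collisions. -/
def succInd {ι : Type*} (f : Fin M → Fin N) (K : ℕ) {B : ℕ} (e : Fin B → ι)
    (ω : ι → Fin M × Fin M) : ℝ :=
  if OutputsDisjointCollisions f K ((List.ofFn fun i => ω (e i)).flatMap encodePair) then 1 else 0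

open Classical in
-- Different blocks cannot be good with the same pair, so the good blocks provide as many different
-- collisions, from which the load bound extracts a disjoint family.
lemma outputs_of_good {Γ O : Type*} [Fintype Γ] [Fintype O] [DecidableEq Γ] [DecidableEq O]
    {f : Fin M → Fin N} {K B : ℕ} (e : Fin B ≃ Γ × O) {ω : Γ × O → Fin M × Fin M}
    {Good : Γ × O → Fin M × Fin M → Prop} (hGood : ∀ i P, Good i P → IsCollision f P)
    (hdist : ∀ i j P, Good i P → Good j P → i = j) {m₀ k : ℕ} (hm₀ : 0 < m₀)
    (hK : K * (4 * m₀) ≤ Fintype.card Γ * k) (hload : LoadLE f m₀)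
    (hwrong : ∀ i, ¬ Verif.Wrong f (ω i))
    (hcount : ∀ a, k ≤ (Finset.univ.filter fun b => Good (a, b) (ω (a, b))).card) :
    OutputsDisjointCollisions f K ((List.ofFn fun i => ω (e i)).flatMap encodePair) := by
  classical
  set I := Finset.univ.filter fun i => Good i (ω i) with hI
  have hinj : Set.InjOn ω I := by
    intro i hi j hj hij
    simp only [hI, Finset.coe_filter, Finset.mem_univ, true_and, Set.mem_ofPred_eq] at hi hj
    exact hdist i j (ω i) hi (hij ▸ hj)
  have hIc : Fintype.card Γ * k ≤ I.card := by
    rw [hI, Finset.card_filter, Fintype.sum_prod_type]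
    calc Fintype.card Γ * k = ∑ a : Γ, k := by simp
      _ ≤ _ := Finset.sum_le_sum fun a _ => by
        rw [← Finset.card_filter]
        exact hcount a
  obtain ⟨D, hDS, hD, hcard⟩ := exists_disjoint_of_load hload (S := I.image ω) (by
    intro P hP
    obtain ⟨i, hi, rfl⟩ := Finset.mem_image.1 hP
    exact hGood i _ (by simpa [hI] using hi))
  rw [Finset.card_image_of_injOn hinj] at hcard
  have hmem : ∀ P ∈ D, P ∈ List.ofFn fun i => ω (e i) := by
    intro P hP
    obtain ⟨i, _, rfl⟩ := Finset.mem_image.1 (hDS hP)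
    exact List.mem_ofFn.2 ⟨e.symm i, by simp⟩
  have hcoll : ∀ P ∈ List.ofFn fun i => ω (e i), P.1 ≠ P.2 → IsCollision f P := by
    intro P hP hne
    obtain ⟨i, rfl⟩ := List.mem_ofFn.1 hP
    refine ⟨hne, ?_⟩
    by_contra h
    exact hwrong _ ⟨hne, h⟩
  refine ⟨_, rfl, hcoll, D, ?_, fun P hP => ⟨hmem P hP, ?_⟩, hD⟩
  · exact Nat.le_of_mul_le_mul_right (hK.trans (hIc.trans hcard)) (by omega)
  · obtain ⟨i, hi, rfl⟩ := Finset.mem_image.1 (hDS hP)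
    exact hGood i _ (by simpa [hI] using hi)

open Classical in
-- Failure has three causes: an overloaded value, a wrong claim, or a group `a` with fewer than `k`
-- successes. The last is bounded by the exponential moment of the number of successes at base 1/2,
-- which factors over the independent blocks. The product is kept and not estimated here, as it is
-- to be averaged over f later.
theorem one_sub_le_success {Γ O : Type*} [Fintype Γ] [Fintype O] [DecidableEq Γ] [DecidableEq O]
    {f : Fin M → Fin N} {K B : ℕ} (e : Fin B ≃ Γ × O) {p : Γ × O → Fin M × Fin M → ℝ}
    (hp : ∀ i P, 0 ≤ p i P) (hp1 : ∀ i, ∑ P, p i P = 1)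
    {Good : Γ × O → Fin M × Fin M → Prop} (hGood : ∀ i P, Good i P → IsCollision f P)
    (hdist : ∀ i j P, Good i P → Good j P → i = j) {m₀ k : ℕ} (hm₀ : 0 < m₀)
    (hK : K * (4 * m₀) ≤ Fintype.card Γ * k) {ε : ℝ}
    (hε : ∀ i, ∑ P, p i P * (if Verif.Wrong f P then 1 else 0) ≤ ε) :
    1 - ((if LoadLE f m₀ then 0 else 1) + (Fintype.card Γ * Fintype.card O * ε +
      ∑ a, 2 ^ k * ∏ b, (1 - (∑ P, p (a, b) P * if Good (a, b) P then 1 else 0) / 2))) ≤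
      pexp p (succInd f K e) := by
  set u : Γ × O → Fin M × Fin M → ℝ := fun i P => if Good i P then 1 / 2 else 1 with hu
  have hpt : ∀ ω : Γ × O → Fin M × Fin M, 1 - ((if LoadLE f m₀ then 0 else 1) +
      (∑ i, (if Verif.Wrong f (ω i) then 1 else 0) +
        ∑ a, 2 ^ k * ∏ b, u (a, b) (ω (a, b)))) ≤ succInd f K e ω := by
    intro ω
    have hu0 : ∀ i P, 0 < u i P := by
      intro i P
      simp only [hu]
      split_ifs <;> norm_num
    have t1 : (0 : ℝ) ≤ if LoadLE f m₀ then 0 else 1 := by split_ifs <;> norm_num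
    have t2 : ∀ i, (0 : ℝ) ≤ if Verif.Wrong f (ω i) then 1 else 0 := fun i => by
      split_ifs <;> norm_num
    have t3 : ∀ a, 0 ≤ 2 ^ k * ∏ b, u (a, b) (ω (a, b)) := fun a =>
      mul_nonneg (by positivity) (Finset.prod_nonneg fun b _ => (hu0 _ _).le)
    have t2' := Finset.sum_nonneg fun i (_ : i ∈ Finset.univ) => t2 i
    have t3' := Finset.sum_nonneg fun a (_ : a ∈ Finset.univ) => t3 a
    unfold succInd
    split_ifs with h1 h2 h2
    · linarith
    · by_cases hw : ∃ i, Verif.Wrong f (ω i)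
      · obtain ⟨i, hi⟩ := hw
        have := Finset.single_le_sum (fun i _ => t2 i) (Finset.mem_univ i)
        rw [if_pos hi] at this
        linarith
      · push Not at hw
        by_cases hc : ∀ a, k ≤ (Finset.univ.filter fun b => Good (a, b) (ω (a, b))).card
        · exact (h2 (outputs_of_good e hGood hdist hm₀ hK h1 hw hc)).elim
        · push Not at hc
          obtain ⟨a, ha⟩ := hc
          have := Finset.single_le_sum (fun i _ => t3 i) (Finset.mem_univ a)
          -- Markov's inequality pointwise: the product is 2 to the minus number of successes.
          have h4 : (1 : ℝ) ≤ 2 ^ k * ∏ b, u (a, b) (ω (a, b)) := by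
            simp only [hu]
            rw [Finset.prod_ite, Finset.prod_const, Finset.prod_const_one, mul_one]
            have : (1 / 2 : ℝ) ^ k ≤ (1 / 2) ^
                (Finset.univ.filter fun b => Good (a, b) (ω (a, b))).card :=
              pow_le_pow_of_le_one (by norm_num) (by norm_num) ha.le
            calc (1 : ℝ) = 2 ^ k * (1 / 2) ^ k := by rw [← mul_pow]; norm_num
              _ ≤ _ := by gcongr
          linarith
    · linarith
    · linarith
  refine le_trans ?_ (pexp_mono hp hpt)
  rw [pexp_sub, pexp_const hp1, pexp_add, pexp_const hp1, pexp_add, pexp_sum, pexp_sum]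
  have h1 : ∑ i, pexp p (fun ω => if Verif.Wrong f (ω i) then 1 else 0) ≤
      Fintype.card Γ * Fintype.card O * ε := by
    calc _ ≤ ∑ i : Γ × O, ε := Finset.sum_le_sum fun i _ => by
          rw [pexp_coord hp1 i fun P => if Verif.Wrong f P then 1 else 0]
          exact hε i
      _ = _ := by simp
  have h2 : ∀ a, pexp p (fun ω => 2 ^ k * ∏ b, u (a, b) (ω (a, b))) =
      2 ^ k * ∏ b, (1 - (∑ P, p (a, b) P * if Good (a, b) P then 1 else 0) / 2) := by
    intro a
    rw [pexp_mul_left]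
    congr 1
    have h3 := pexp_prod (p := p) fun i P => if i.1 = a then u i P else 1
    have h4 : ∀ ω : Γ × O → Fin M × Fin M, ∏ i : Γ × O, (if i.1 = a then u i (ω i) else 1) =
        ∏ b, u (a, b) (ω (a, b)) := by
      intro ω
      rw [Fintype.prod_prod_type, Finset.prod_eq_single a]
      · simp
      · intro a' _ ha'; simp [ha']
      · simp
    simp only [h4] at h3
    rw [h3, Fintype.prod_prod_type, Finset.prod_eq_single a]
    · refine Finset.prod_congr rfl fun b _ => ?_
      simp only [if_true, hu]
      have h5 : ∀ x : ℝ, 1 - x = ∑ P, p (a, b) P - x := fun x => by rw [hp1]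
      rw [h5, Finset.sum_div, ← Finset.sum_sub_distrib]
      refine Finset.sum_congr rfl fun P _ => ?_
      split_ifs <;> ring
    · intro a' _ ha'; simp [ha', hp1]
    · simp
  simp only [h2]
  linarith

open Classical in
-- If every block gives the right verdict on its pair, all collisions are output, among them a large
-- disjoint family. A union bound over the M² pairs does the rest.
theorem one_sub_le_success_all {f : Fin M → Fin N} {K B : ℕ} (e : Fin B ≃ Fin M × Fin M)
    {p : Fin M × Fin M → Fin M × Fin M → ℝ} (hp : ∀ i P, 0 ≤ p i P) (hp1 : ∀ i, ∑ P, p i P = 1)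
    (hK : 2 * K + N ≤ M) {ε : ℝ}
    (hε : ∀ i, ∑ P, p i P * (if P = (i.1, if f i.1 = f i.2 then i.2 else i.1) then 0 else 1) ≤ ε) :
    1 - M * M * ε ≤ pexp p (succInd f K e) := by
  set ex : Fin M × Fin M → Fin M × Fin M := fun i => (i.1, if f i.1 = f i.2 then i.2 else i.1)
    with hex
  have hpt : ∀ ω : Fin M × Fin M → Fin M × Fin M,
      1 - ∑ i, (if ω i = ex i then (0 : ℝ) else 1) ≤ succInd f K e ω := by
    intro ω
    have t : ∀ i, (0 : ℝ) ≤ if ω i = ex i then 0 else 1 := fun i => by split_ifs <;> norm_num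
    have t' := Finset.sum_nonneg fun i (_ : i ∈ Finset.univ) => t i
    unfold succInd
    split_ifs with h
    · linarith
    · by_cases hw : ∀ i, ω i = ex i
      · refine (h ?_).elim
        obtain ⟨D, hD1, hD2, hD3⟩ := exists_disjoint_all f
        refine ⟨_, rfl, ?_, D, by omega, fun P hP => ⟨?_, hD1 P hP⟩, hD2⟩
        · intro P hP hne
          obtain ⟨i, rfl⟩ := List.mem_ofFn.1 hP
          rw [hw, hex] at hne ⊢
          simp only at hne ⊢
          split_ifs at hne ⊢ with hf
          · exact ⟨hne, hf⟩
          · exact (hne rfl).elim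
        · refine List.mem_ofFn.2 ⟨e.symm P, ?_⟩
          rw [Equiv.apply_symm_apply, hw, hex]
          simp [(hD1 P hP).2]
      · push Not at hw
        obtain ⟨i, hi⟩ := hw
        have := Finset.single_le_sum (fun i _ => t i) (Finset.mem_univ i)
        rw [if_neg hi] at this
        linarith
  refine le_trans ?_ (pexp_mono hp hpt)
  rw [pexp_sub, pexp_const hp1, pexp_sum]
  have h1 : ∑ i, pexp p (fun ω => if ω i = ex i then (0 : ℝ) else 1) ≤ M * M * ε := by
    calc _ ≤ ∑ i : Fin M × Fin M, ε := Finset.sum_le_sum fun i _ => by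
          rw [pexp_coord hp1 i fun P => if P = ex i then (0 : ℝ) else 1]
          exact hε i
      _ = _ := by simp
  linarith

end Success

/-! ### Lines of a plane over a field of characteristic two -/

section Lines

variable {k : ℕ}

/-- A basis of the field with `2 ^ k` elements. -/
def gfBasis (hk : k ≠ 0) : Module.Basis (Fin k) (ZMod 2) (GaloisField 2 k) :=
  have : FiniteDimensional (ZMod 2) (GaloisField 2 k) :=
    Module.finite_of_finrank_pos (by rw [GaloisField.finrank 2 hk]; omega)
  Module.finBasisOfFinrankEq _ _ (GaloisField.finrank 2 hk)

/-- The coordinates of an element of the field. -/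
def gfBits (hk : k ≠ 0) (x : GaloisField 2 k) : Fin k → Bool :=
  fun j => decide ((gfBasis hk).repr x j = 1)

/-- The element of the field with given coordinates. -/
def gfOf (hk : k ≠ 0) (u : Fin k → Bool) : GaloisField 2 k := ∑ l, if u l then gfBasis hk l else 0

lemma zmod_two_decide_add (x y : ZMod 2) :
    decide (x + y = 1) = xor (decide (x = 1)) (decide (y = 1)) := by
  revert x y
  decide

lemma gfBits_add (hk : k ≠ 0) (x y : GaloisField 2 k) (j : Fin k) :
    gfBits hk (x + y) j = xor (gfBits hk x j) (gfBits hk y j) := by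
  simp only [gfBits, map_add, Finsupp.add_apply]
  exact zmod_two_decide_add _ _

lemma gfBits_zero (hk : k ≠ 0) (j : Fin k) : gfBits hk 0 j = false := by
  simp [gfBits]

lemma gfBits_injective (hk : k ≠ 0) : Function.Injective (gfBits hk) := by
  intro x y h
  apply (gfBasis hk).repr.injective
  ext j
  have hj := congrFun h j
  simp only [gfBits] at hj
  have key : ∀ a b : ZMod 2, decide (a = 1) = decide (b = 1) → a = b := by decide
  exact key _ _ hj

lemma gfBits_gfOf (hk : k ≠ 0) (u : Fin k → Bool) : gfBits hk (gfOf hk u) = u := by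
  funext j
  have h : (gfBasis hk).repr (gfOf hk u) j = if u j then 1 else 0 := by
    rw [gfOf, map_sum, Finsupp.finsetSum_apply, Finset.sum_eq_single j]
    · split_ifs <;> simp
    · intro l _ hl
      split_ifs
      · rw [Module.Basis.repr_self, Finsupp.single_apply, if_neg hl]
      · simp
    · simp
  rw [gfBits, h]
  cases u j <;> simp

lemma gfOf_injective (hk : k ≠ 0) : Function.Injective (gfOf hk) :=
  Function.LeftInverse.injective (gfBits_gfOf hk)

/-- The formula of an affine function over the field with two elements. -/
def affE (c : Bool) (m : Fin k → Bool) (l : List (Fin k)) : BExpr (Fin k) :=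
  l.foldr (fun i e => .op (fun x acc => xor (m i && x) acc) (.var i) e) (.lit c)

lemma size_affE (c : Bool) (m : Fin k → Bool) (l) : (affE c m l).size = 2 * l.length + 1 := by
  induction l with
  | nil => rfl
  | cons i l ih =>
    change 1 + (affE c m l).size + 1 = _
    rw [ih, List.length_cons]
    omega

/-- Multiplication by a fixed field element is linear over the field with two elements, so each
digit of a u + b is a parity of digits of u. This keeps the formulas of linear size without
computing products in the field. -/
lemma eval_affE (hk : k ≠ 0) (a b : GaloisField 2 k) (u : Fin k → Bool) (j : Fin k)
    (l : List (Fin k)) :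
    (affE (gfBits hk b j) (fun i => gfBits hk (a * gfBasis hk i) j) l).eval u =
      gfBits hk (a * (l.map fun i => if u i then gfBasis hk i else 0).sum + b) j := by
  induction l with
  | nil => simp [affE, BExpr.eval]
  | cons i l ih =>
    have h : (affE (gfBits hk b j) (fun i => gfBits hk (a * gfBasis hk i) j) (i :: l)).eval u =
        xor (gfBits hk (a * gfBasis hk i) j && u i)
          ((affE (gfBits hk b j) (fun i => gfBits hk (a * gfBasis hk i) j) l).eval u) := rfl
    rw [h, ih, List.map_cons, List.sum_cons, mul_add, add_assoc,
      gfBits_add hk (a * if u i = true then gfBasis hk i else 0)]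
    congr 1
    cases u i <;> simp [gfBits_zero]

/-- The formulas for the binary digits of the point `(u, a u + b)` of the line with slope `a`. -/
def lineE (hk : k ≠ 0) (a b : GaloisField 2 k) (j : ℕ) : BExpr (Fin k) :=
  if h : j < k then .var ⟨j, h⟩
  else if h : j - k < k then affE (gfBits hk b ⟨j - k, h⟩)
    (fun i => gfBits hk (a * gfBasis hk i) ⟨j - k, h⟩) (List.finRange k)
  else .lit false

lemma size_lineE_le (hk : k ≠ 0) (a b : GaloisField 2 k) (j : ℕ) :
    (lineE hk a b j).size ≤ 2 * k + 1 := by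
  unfold lineE
  split_ifs
  · simp [BExpr.size]
  · rw [size_affE, List.length_finRange]
  · simp [BExpr.size]

lemma eval_lineE_low (hk : k ≠ 0) (a b : GaloisField 2 k) (u : Fin k → Bool) (j : Fin k) :
    (lineE hk a b j).eval u = u j := by
  simp [lineE, BExpr.eval]

lemma eval_lineE_high (hk : k ≠ 0) (a b : GaloisField 2 k) (u : Fin k → Bool) (j : Fin k) :
    (lineE hk a b (k + j)).eval u = gfBits hk (a * gfOf hk u + b) j := by
  have h : ∀ h : k + (j : ℕ) - k < k, (⟨k + j - k, h⟩ : Fin k) = j := fun h => by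
    apply Fin.ext; simp
  rw [lineE, dif_neg (by omega), dif_pos (by simp), h, eval_affE, gfOf, Fin.sum_univ_def]

/-- The line with slope `a` and offset `b`. -/
def line {M : ℕ} (hk : k ≠ 0) (hM : 4 ^ k ≤ M) (a b : Fin k → Bool) : Curve k M where
  φ j := lineE hk (gfOf hk a) (gfOf hk b) j
  pt u := ⟨Nat.ofBits fun j : Fin (Nat.clog 2 M) => (lineE hk (gfOf hk a) (gfOf hk b) j).eval u, by
    have h : (Nat.ofBits fun j : Fin (Nat.clog 2 M) =>
        (lineE hk (gfOf hk a) (gfOf hk b) j).eval u) < 2 ^ (2 * k) := by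
      refine Nat.lt_pow_two_of_testBit _ fun i hi => ?_
      by_cases h : i < Nat.clog 2 M
      · rw [Nat.testBit_ofBits_lt _ _ h]
        change (lineE hk (gfOf hk a) (gfOf hk b) i).eval u = false
        rw [lineE, dif_neg (by omega), dif_neg (by omega), BExpr.eval]
      · exact Nat.testBit_ofBits_ge _ _ (by omega)
    rw [pow_mul] at h
    exact h.trans_le (by simpa using hM)⟩
  spec u := rfl

lemma two_mul_le_clog {M : ℕ} (hM : 4 ^ k ≤ M) : 2 * k ≤ Nat.clog 2 M := by
  have h : 2 ^ (2 * k) ≤ 2 ^ Nat.clog 2 M := by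
    rw [pow_mul]
    exact hM.trans (Nat.le_pow_clog (by norm_num) M)
  exact (Nat.pow_le_pow_iff_right (by norm_num)).1 h

/-! ### Incidence of points and lines -/

section Points

variable {M : ℕ} (hk : k ≠ 0) (hM : 4 ^ k ≤ M)

lemma testBit_line_pt (a b u : Fin k → Bool) {j : ℕ} (hj : j < 2 * k) :
    ((line hk hM a b).pt u : ℕ).testBit j = (lineE hk (gfOf hk a) (gfOf hk b) j).eval u :=
  Nat.testBit_ofBits_lt (n := Nat.clog 2 M)
    (fun j : Fin (Nat.clog 2 M) => (lineE hk (gfOf hk a) (gfOf hk b) j).eval u) j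
    (hj.trans_le (two_mul_le_clog hM))

/-- The low k digits of a point are its abscissa u and the next k digits are its ordinate a u + b.
-/
lemma eq_of_line_pt_eq {a b u a' b' u' : Fin k → Bool}
    (h : (line hk hM a b).pt u = (line hk hM a' b').pt u') :
    u = u' ∧ gfOf hk a * gfOf hk u + gfOf hk b = gfOf hk a' * gfOf hk u + gfOf hk b' := by
  have h1 : ∀ j, j < 2 * k → (lineE hk (gfOf hk a) (gfOf hk b) j).eval u =
      (lineE hk (gfOf hk a') (gfOf hk b') j).eval u' := fun j hj => by
    rw [← testBit_line_pt hk hM a b u hj, ← testBit_line_pt hk hM a' b' u' hj, h]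
  have hu : u = u' := by
    funext j
    have := h1 j (by omega)
    rwa [eval_lineE_low, eval_lineE_low] at this
  subst hu
  refine ⟨rfl, gfBits_injective hk (funext fun j => ?_)⟩
  have := h1 (k + j) (by omega)
  rwa [eval_lineE_high, eval_lineE_high] at this

/-- Parallel lines are disjoint; this is the source of independence among blocks with the same
slope. -/
lemma line_pt_injective (a : Fin k → Bool) :
    Function.Injective fun bu : (Fin k → Bool) × (Fin k → Bool) => (line hk hM a bu.1).pt bu.2 := by
  rintro ⟨b, u⟩ ⟨b', u'⟩ h
  obtain ⟨rfl, h2⟩ := eq_of_line_pt_eq hk hM h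
  rw [add_right_inj] at h2
  exact Prod.ext (gfOf_injective hk h2) rfl

lemma line_pt_injective' (a b : Fin k → Bool) : Function.Injective (line hk hM a b).pt :=
  fun _ _ h => (eq_of_line_pt_eq hk hM h).1

/-- Two distinct points are on at most one line. -/
lemma eq_of_onCurve {N : ℕ} {f : Fin M → Fin N} {a b a' b' : Fin k → Bool} {P : Fin M × Fin M}
    (h : OnCurve f (line hk hM a b) P) (h' : OnCurve f (line hk hM a' b') P) :
    (a, b) = (a', b') := by
  obtain ⟨⟨hne, -⟩, ⟨u, hu⟩, ⟨v, hv⟩⟩ := h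
  obtain ⟨-, ⟨u', hu'⟩, ⟨v', hv'⟩⟩ := h'
  obtain ⟨-, h1⟩ := eq_of_line_pt_eq hk hM (hu.trans hu'.symm)
  obtain ⟨-, h2⟩ := eq_of_line_pt_eq hk hM (hv.trans hv'.symm)
  have huv : gfOf hk u - gfOf hk v ≠ 0 := fun h0 => hne <| by
    rw [← hu, ← hv, gfOf_injective hk (sub_eq_zero.1 h0)]
  have ha : gfOf hk a = gfOf hk a' := by
    apply sub_eq_zero.1
    apply (mul_eq_zero.1 (?_ : _ * (gfOf hk u - gfOf hk v) = 0)).resolve_right huv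
    linear_combination h1 - h2
  rw [ha, add_right_inj] at h1
  rw [gfOf_injective hk ha, gfOf_injective hk h1]

end Points

end Lines

/-! ### Averages over all functions -/

section Average

variable {V : Type} [Fintype V] [Nonempty V]

/-- The restriction of a uniformly random function is uniformly random. -/
lemma expect_comp {Y Z : Type} [Fintype Y] [Fintype Z] [DecidableEq Y] [DecidableEq Z] (j : Y ↪ Z) (h : (Y → V) → ℝ) :
    Finset.expect Finset.univ (fun f : Z → V => h fun y => f (j y)) =
      Finset.expect Finset.univ h := by
  have h1 := sum_extend (V := V) j fun w : Z → V => h fun y => w (j y)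
  have h2 : ∀ (w : Z → V) (b : Y → V), (fun y => Function.extend j b w (j y)) = b := fun w b =>
    funext fun y => j.injective.extend_apply _ _ _
  simp only [h2, Finset.sum_const, Finset.card_univ, nsmul_eq_mul] at h1
  have hZ : (Fintype.card (Z → V) : ℝ) ≠ 0 := by exact_mod_cast Fintype.card_ne_zero
  have hY : (Fintype.card (Y → V) : ℝ) ≠ 0 := by exact_mod_cast Fintype.card_ne_zero
  rw [Fintype.expect_eq_sum_div_card, Fintype.expect_eq_sum_div_card, div_eq_div_iff hZ hY]
  linarith

lemma expect_prod {O X : Type} [Fintype O] [Fintype X] [DecidableEq O] [DecidableEq X] (h : (X → V) → ℝ) :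
    Finset.expect Finset.univ (fun f : O × X → V => ∏ b, h fun x => f (b, x)) =
      (Finset.expect Finset.univ h) ^ Fintype.card O := by
  have h1 : ∑ f : O × X → V, ∏ b, h (fun x => f (b, x)) = (∑ g, h g) ^ Fintype.card O := by
    rw [← Finset.card_univ, ← Finset.prod_const, Finset.prod_univ_sum, Fintype.piFinset_univ]
    exact Fintype.sum_equiv (Equiv.curry O X V) _ _ fun f => rfl
  rw [Fintype.expect_eq_sum_div_card, Fintype.expect_eq_sum_div_card, h1, div_pow]
  congr 1
  rw [Fintype.card_fun, Fintype.card_fun, Fintype.card_prod]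
  push_cast
  rw [← pow_mul, mul_comm]

/-- The values of a random function on disjoint sets are independent. -/
lemma expect_prod_comp {O X Z : Type} [Fintype O] [Fintype X] [Fintype Z] [DecidableEq O]
    [DecidableEq X] [DecidableEq Z] (j : O × X ↪ Z)
    (h : (X → V) → ℝ) :
    Finset.expect Finset.univ (fun f : Z → V => ∏ b, h fun x => f (j (b, x))) =
      (Finset.expect Finset.univ h) ^ Fintype.card O :=
  (expect_comp j fun g : O × X → V => ∏ b, h fun x => g (b, x)).trans (expect_prod h)

end Average

open Classical in
-- The exponential moment of base 2: the number of preimages of v is a sum of M independent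
-- indicators with mean 1/N, so 2 to this number has mean (1 + 1/N)^M. Markov's inequality and a
-- union bound over v finish.
lemma expect_load_le {M N m₀ : ℕ} (hN : N ≠ 0) :
    Finset.expect Finset.univ (fun f : Fin M → Fin N => if LoadLE f m₀ then (0 : ℝ) else 1) ≤
      N * (1 + 1 / N) ^ M / 2 ^ m₀ := by
  have h0 : (N : ℝ) ≠ 0 := by exact_mod_cast hN
  have hpt : ∀ f : Fin M → Fin N, (if LoadLE f m₀ then (0 : ℝ) else 1) ≤
      ∑ v, (∏ x, if f x = v then (2 : ℝ) else 1) / 2 ^ m₀ := fun f => by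
    have hnn : ∀ v, 0 ≤ (∏ x, if f x = v then (2 : ℝ) else 1) / 2 ^ m₀ := fun v =>
      div_nonneg (Finset.prod_nonneg fun x _ => by split_ifs <;> norm_num) (by positivity)
    split_ifs with h
    · exact Finset.sum_nonneg fun v _ => hnn v
    · simp only [LoadLE, not_forall, not_le] at h
      obtain ⟨v, hv⟩ := h
      refine le_trans ?_ (Finset.single_le_sum (fun v _ => hnn v) (Finset.mem_univ v))
      rw [Finset.prod_ite, Finset.prod_const, Finset.prod_const_one, mul_one, one_le_div (by positivity)]
      exact pow_le_pow_right₀ (by norm_num) hv.le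
  have hv : ∀ v : Fin N, ∑ f : Fin M → Fin N, (∏ x, if f x = v then (2 : ℝ) else 1) =
      ((N : ℝ) + 1) ^ M := fun v => by
    have h1 := Finset.prod_univ_sum (fun _ : Fin M => (Finset.univ : Finset (Fin N)))
      fun _ w => if w = v then (2 : ℝ) else 1
    rw [Fintype.piFinset_univ] at h1
    rw [← h1, Finset.prod_const, Finset.card_univ, Fintype.card_fin]
    congr 1
    have h2 : ∀ w : Fin N, (if w = v then (2 : ℝ) else 1) = 1 + if w = v then 1 else 0 := fun w => by
      split_ifs <;> norm_num
    simp only [h2, Finset.sum_add_distrib, Finset.sum_ite_eq', Finset.mem_univ, if_true]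
    simp
  rw [Fintype.expect_eq_sum_div_card]
  have hsum : ∑ f : Fin M → Fin N, (if LoadLE f m₀ then (0 : ℝ) else 1) ≤
      N * ((N : ℝ) + 1) ^ M / 2 ^ m₀ := by
    refine (Finset.sum_le_sum fun f _ => hpt f).trans ?_
    rw [Finset.sum_comm]
    simp only [← Finset.sum_div, hv]
    simp
  have hc : (Fintype.card (Fin M → Fin N) : ℝ) = (N : ℝ) ^ M := by simp
  rw [hc, div_le_iff₀ (by positivity)]
  refine hsum.trans_eq ?_
  have : (1 + 1 / (N : ℝ)) = (N + 1) / N := by field_simp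
  rw [this, div_pow]
  field_simp

/-- The average of a function of `G` that is supported by the `G` with small values. -/
lemma expect_ge_of_extend {X : Type} [Fintype X] [DecidableEq X] {m N : ℕ} (hm : m ≤ N) (hm0 : m ≠ 0)
    {v : (X → Fin N) → ℝ} {σ : (X → Fin m) → ℝ} (hv : ∀ G, 0 ≤ v G)
    (hσ : ∀ F, σ F ≤ v fun x => (F x).castLE hm) :
    ((m : ℝ) / N) ^ Fintype.card X * Finset.expect Finset.univ σ ≤ Finset.expect Finset.univ v := by
  have hm' : (m : ℝ) ≠ 0 := by exact_mod_cast hm0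
  have hN' : (N : ℝ) ≠ 0 := by exact_mod_cast (show N ≠ 0 by omega)
  rw [Fintype.expect_eq_sum_div_card, Fintype.expect_eq_sum_div_card, Fintype.card_fun,
    Fintype.card_fun, Fintype.card_fin, Fintype.card_fin, div_pow]
  push_cast
  rw [div_mul_div_comm, mul_comm, mul_div_mul_right _ _ (pow_ne_zero _ hm')]
  have hinj : Function.Injective fun (F : X → Fin m) x => (F x).castLE hm := fun F F' h =>
    funext fun x => Fin.castLE_injective hm (congrFun h x)
  gcongr
  calc ∑ F, σ F ≤ ∑ F : X → Fin m, v fun x => (F x).castLE hm := Finset.sum_le_sum fun F _ => hσ F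
    _ = ∑ G ∈ Finset.univ.map ⟨_, hinj⟩, v G := by rw [Finset.sum_map]; rfl
    _ ≤ ∑ G, v G := Finset.sum_le_sum_of_subset_of_nonneg (Finset.subset_univ _)
        fun G _ _ => hv G

open Classical in
/-- A random function from `n` to `n ^ 2` has a collision with constant probability. -/
lemma card_collision_ge {n : ℕ} (hn : 2 ≤ n) :
    (1 / 5 : ℝ) * Fintype.card (Fin n → Fin (n ^ 2)) ≤
      (Finset.univ.filter fun f : Fin n → Fin (n ^ 2) => ∃ P, IsCollision f P).card := by
  set A := Finset.univ.filter fun f : Fin n → Fin (n ^ 2) => ∃ P, IsCollision f P with hA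
  have hinj : (Finset.univ.filter fun f : Fin n → Fin (n ^ 2) => ¬ ∃ P, IsCollision f P).card =
      (n ^ 2).descFactorial n := by
    have h := Fintype.card_embedding_eq (α := Fin n) (β := Fin (n ^ 2))
    rw [Fintype.card_fin, Fintype.card_fin] at h
    rw [← h, ← Fintype.card_subtype]
    refine Fintype.card_congr ((Equiv.subtypeEquivRight fun f => ?_).trans
      (Equiv.subtypeInjectiveEquivEmbedding (Fin n) (Fin (n ^ 2))))
    constructor
    · intro h x y hxy
      by_contra hne
      exact h ⟨(x, y), hne, hxy⟩
    · rintro h ⟨P, hne, hP⟩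
      exact hne (h hP)
  have hsum : A.card + (n ^ 2).descFactorial n = Fintype.card (Fin n → Fin (n ^ 2)) := by
    rw [← hinj, hA, Finset.card_filter_add_card_filter_not, Finset.card_univ]
  have hn0 : (0 : ℝ) < n := by exact_mod_cast (show 0 < n by omega)
  -- The product of the factors 1 - i/n² is at most exp(-(n - 1)/(2n)), hence at most exp(-1/4), and
  -- 1 + 1/4 ≤ exp(1/4).
  have hle : ((n ^ 2).descFactorial n : ℝ) ≤ 4 / 5 * Fintype.card (Fin n → Fin (n ^ 2)) := by
    rw [Fintype.card_fun, Fintype.card_fin, Fintype.card_fin, Nat.descFactorial_eq_prod_range]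
    have h1 : ∀ i ∈ Finset.range n, ((n ^ 2 - i : ℕ) : ℝ) ≤ n ^ 2 * Real.exp (-(i / n ^ 2)) := by
      intro i hi
      have hi' : i ≤ n ^ 2 := by
        have := Finset.mem_range.1 hi
        nlinarith
      rw [Nat.cast_sub hi']
      have := Real.add_one_le_exp (-((i : ℝ) / n ^ 2))
      have h2 : ((n ^ 2 : ℕ) : ℝ) - i = n ^ 2 * (-((i : ℝ) / n ^ 2) + 1) := by
        push_cast
        field_simp
        ring
      rw [h2]
      gcongr
    have h2 : (∏ i ∈ Finset.range n, ((n ^ 2 - i : ℕ) : ℝ)) ≤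
        ∏ i ∈ Finset.range n, ((n : ℝ) ^ 2 * Real.exp (-(i / n ^ 2))) :=
      Finset.prod_le_prod (fun i _ => by positivity) h1
    rw [Finset.prod_mul_distrib, Finset.prod_const, Finset.card_range, ← Real.exp_sum,
      Finset.sum_neg_distrib, ← Finset.sum_div] at h2
    have hs : (∑ i ∈ Finset.range n, (i : ℝ)) = n * (n - 1) / 2 := by
      have := Finset.sum_range_id_mul_two n
      have h3 : ((∑ i ∈ Finset.range n, i : ℕ) : ℝ) * 2 = n * ((n - 1 : ℕ) : ℝ) := by
        exact_mod_cast this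
      rw [Nat.cast_sub (by omega)] at h3
      push_cast at h3
      linarith
    have he : Real.exp (-((∑ i ∈ Finset.range n, (i : ℝ)) / n ^ 2)) ≤ 4 / 5 := by
      rw [Real.exp_neg, inv_le_comm₀ (Real.exp_pos _) (by norm_num)]
      have h4 : (1 / 4 : ℝ) ≤ (∑ i ∈ Finset.range n, (i : ℝ)) / n ^ 2 := by
        rw [hs, le_div_iff₀ (by positivity)]
        have : (2 : ℝ) ≤ n := by exact_mod_cast hn
        nlinarith
      have := Real.add_one_le_exp ((∑ i ∈ Finset.range n, (i : ℝ)) / n ^ 2)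
      linarith
    push_cast
    refine h2.trans ?_
    rw [mul_comm]
    gcongr
  have hsum' : (A.card : ℝ) + ((n ^ 2).descFactorial n : ℕ) =
      Fintype.card (Fin n → Fin (n ^ 2)) := by exact_mod_cast hsum
  linarith

/-! ### Realization by circuits -/

section Realize

variable {M N : ℕ} {A : Type} [Fintype A] [DecidableEq A]

/-- A gate without effect. -/
def idGate (M N S : ℕ) : Gate M N S :=
  .unitary 0 (by omega) ⟨Fin.elim0, fun i => i.elim0⟩ 1

lemma probFrom_idGate {S : ℕ} (f : Fin M → Fin N) (R) (C : Circuit M N S) (p : ℕ) (z ψ) :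
    probFrom f R (List.replicate p (idGate M N S) ++ C) z ψ = probFrom f R C z ψ := by
  induction p with
  | zero => rfl
  | succ p ih =>
    rw [List.replicate_succ, List.cons_append, idGate, probFrom]
    have h : applyUnitary (⟨Fin.elim0, fun i => i.elim0⟩ : Fin 0 ↪ Fin S)
        (1 : Matrix.unitaryGroup (Fin 0 → Bool) ℂ).1 ψ = ψ := by
      funext w
      have hw : ∀ b : Fin 0 → Bool, Function.extend (⟨Fin.elim0, fun i => i.elim0⟩ : Fin 0 ↪ Fin S)
          b w = w := fun b => funext fun q => Function.extend_apply' _ _ _ fun ⟨j, _⟩ => j.elim0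
      simp only [applyUnitary, hw, Fintype.sum_unique]
      have h1 : ∀ a b : Fin 0 → Bool, (1 : Matrix.unitaryGroup (Fin 0 → Bool) ℂ).1 a b = 1 :=
        fun a b => by rw [Subsingleton.elim a b]; exact Matrix.one_apply_eq b
      rw [h1, one_mul]
    rw [h]
    exact ih

lemma ofGate_toGate {S : ℕ} (g : GGate M N (Fin S)) : GGate.ofGate g.toGate = g := by
  cases g <;> rfl

open Classical in
theorem exists_circuit {B : ℕ} {C : List (Mac M N A)} (hC : ∀ m ∈ C, m.Fits B) {S T : ℕ}
    (hS : Fintype.card A + (Nat.clog 2 M + Nat.clog 2 N + 1) * (B + 1) ≤ S)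
    (hT : C.length * (2 * ((Nat.clog 2 M + Nat.clog 2 N + 1) * (B + 1)) + 1) ≤ T) :
    ∃ D : Circuit M N S, D.time = T ∧ ∀ (f : Fin M → Fin N) (R : List Bool → Prop),
      successProb D f R = run (C.map fun m => m.instr f) [] (initSt A)
        (dia fun z _ => if R z then 1 else 0) := by
  have hcard : Fintype.card (WithScratch M N B A) ≤ Fintype.card (Fin S) := by
    rw [Fintype.card_fin]
    refine le_trans (le_of_eq ?_) hS
    simp [WithScratch, Slot]
  obtain ⟨ι⟩ := Function.Embedding.nonempty_of_card_le hcard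
  have hlen := Mac.length_compileL_le hC
  set E := (Mac.compileL B C).map fun g => (g.map ι).toGate with hE
  -- The time is padded to be exactly T: for a negative exponent α a lower bound for the time is
  -- needed as well.
  refine ⟨List.replicate (T - E.length) (idGate M N S) ++ E, ?_, fun f R => ?_⟩
  · rw [Circuit.time, List.length_append, List.length_replicate]
    have : E.length ≤ T := by
      rw [hE, List.length_map]
      exact hlen.trans hT
    omega
  · rw [successProb, probFrom_idGate, probFrom_eq_run, hE, List.map_map]
    have h1 : (fun g : Gate M N S => (GGate.ofGate g).instr f) ∘
        (fun g : GGate M N (WithScratch M N B A) => (g.map ι).toGate) =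
        fun g => (g.map ι).instr f := by
      funext g
      simp only [Function.comp_apply, ofGate_toGate]
    have h2 : initState S = lift ι (lift (Mac.inlE M N B A) (initSt A)) := by
      rw [lift_initSt, lift_initSt]
      rfl
    rw [h1, h2, run_map_lift, Mac.run_compileL f hC]
    congr 1
    funext z ψ
    have h3 : ∀ {Q Q' : Type} [Fintype Q] [Fintype Q'] [DecidableEq Q] [DecidableEq Q'] (ι : Q ↪ Q')
        (φ : St Q), dia (fun z _ => if R z then (1 : ℝ) else 0) z (lift ι φ) =
          dia (fun z _ => if R z then (1 : ℝ) else 0) z φ := fun ι φ => by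
      simp only [dia]
      exact sum_lift ι φ fun _ => if R z then 1 else 0
    rw [h3, h3]

open Classical in
theorem exists_circuit_blocks {ι : Type} [Fintype ι] [DecidableEq ι] {B ℓ : ℕ}
    {D : ι → List (Mac M N A)} (hD : ∀ i, ∀ m ∈ D i, m.Fits B) (hℓ : ∀ i, (D i).length ≤ ℓ)
    {p : (Fin M → Fin N) → ι → Fin M × Fin M → ℝ} (hp : ∀ f i, Emits f (D i) (p f i)) {S T : ℕ}
    (hS : Fintype.card A + (Nat.clog 2 M + Nat.clog 2 N + 1) * (B + 1) ≤ S)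
    (hT : Fintype.card ι * ℓ * (2 * ((Nat.clog 2 M + Nat.clog 2 N + 1) * (B + 1)) + 1) ≤ T) :
    ∃ (e : Fin (Fintype.card ι) ≃ ι) (C : Circuit M N S), C.time = T ∧
      ∀ (f : Fin M → Fin N) (K : ℕ), successProb C f (OutputsDisjointCollisions f K) =
        pexp (p f) (succInd f K e) := by
  set e := (Fintype.equivFin ι).symm
  set L := (List.ofFn fun i => D (e i)).flatten with hL
  have hlen : L.length ≤ Fintype.card ι * ℓ := by
    rw [hL, List.length_flatten, List.map_ofFn, List.sum_ofFn]
    refine (Finset.sum_le_card_nsmul _ _ ℓ fun i _ => hℓ (e i)).trans_eq ?_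
    simp
  obtain ⟨C, hC, hC2⟩ := exists_circuit (M := M) (N := N) (C := L) (B := B) (S := S) (T := T)
    (by
      intro m hm
      rw [hL, List.mem_flatten] at hm
      obtain ⟨l, hl, hm⟩ := hm
      obtain ⟨i, rfl⟩ := (List.mem_ofFn' _ _).1 hl
      exact hD _ m hm) hS
    ((Nat.mul_le_mul_right _ hlen).trans hT)
  refine ⟨e, C, hC, fun f K => ?_⟩
  rw [hC2, hL, run_blocks (fun i => hp f (e i)) (dia_homog _), pexp]
  refine Fintype.sum_equiv (Equiv.arrowCongr e (Equiv.refl _)) _ _ fun ω => ?_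
  have h1 : ∀ i, Equiv.arrowCongr e (Equiv.refl (Fin M × Fin M)) ω (e i) = ω i := fun i => by simp
  congr 1
  · rw [← e.prod_comp]
    exact Finset.prod_congr rfl fun i _ => by rw [h1]
  · simp only [succInd, h1, List.nil_append]
    have h2 : nsq (initSt A) = 1 := nsq_initSt A
    rw [nsq] at h2
    rw [dia, ← Finset.sum_mul, h2, one_mul]

end Realize

/-! ### Unused qubits -/

section Compress

variable {M N : ℕ} {Q : Type} [DecidableEq Q]

/-- The qubits of a gate. -/
def GGate.support : GGate M N Q → Finset Q
  | .unitary _ _ t _ => Finset.univ.map t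
  | .query t => Finset.univ.map t
  | .output i => {i}
  | .reset i => {i}

lemma GGate.card_support_le (g : GGate M N Q) :
    g.support.card ≤ 3 + (Nat.clog 2 M + Nat.clog 2 N) := by
  cases g with
  | unitary r hr t U => simp [support]; omega
  | query t => simp [support]
  | output i => simp [support]; omega
  | reset i => simp [support]; omega

lemma GGate.exists_map_eq (g : GGate M N Q) {s : Finset Q} (h : g.support ⊆ s) :
    ∃ g' : GGate M N s, g'.map (Function.Embedding.subtype _) = g := by
  cases g with
  | unitary r hr t U =>
    exact ⟨.unitary r hr ⟨fun j => ⟨t j, h (by simp [support])⟩, fun i j hij =>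
      t.injective (congrArg Subtype.val hij)⟩ U, rfl⟩
  | query t =>
    exact ⟨.query ⟨fun j => ⟨t j, h (Finset.mem_map_of_mem _ (Finset.mem_univ _))⟩, fun i j hij =>
      t.injective (congrArg Subtype.val hij)⟩, rfl⟩
  | output i => exact ⟨.output ⟨i, h (by simp [support])⟩, rfl⟩
  | reset i => exact ⟨.reset ⟨i, h (by simp [support])⟩, rfl⟩

lemma exists_map_eq (C : List (GGate M N Q)) : ∃ s : Finset Q,
    s.card ≤ C.length * (3 + (Nat.clog 2 M + Nat.clog 2 N)) ∧
      ∃ C' : List (GGate M N s), C'.map (GGate.map (Function.Embedding.subtype _)) = C := by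
  have key : ∀ (C : List (GGate M N Q)) (s : Finset Q), (∀ g ∈ C, g.support ⊆ s) →
      ∃ C' : List (GGate M N s), C'.map (GGate.map (Function.Embedding.subtype _)) = C := by
    intro C s h
    induction C with
    | nil => exact ⟨[], rfl⟩
    | cons g C ih =>
      obtain ⟨C', hC'⟩ := ih fun g' hg' => h g' (List.mem_cons_of_mem _ hg')
      obtain ⟨g', hg'⟩ := g.exists_map_eq (h g List.mem_cons_self)
      exact ⟨g' :: C', by rw [List.map_cons, hC', hg']⟩
  refine ⟨C.foldr (fun g s => g.support ∪ s) ∅, ?_, key C _ ?_⟩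
  · induction C with
    | nil => simp
    | cons g C ih =>
      rw [List.foldr_cons, List.length_cons, Nat.succ_mul]
      have := Finset.card_union_le g.support (C.foldr (fun g s => g.support ∪ s) ∅)
      have := g.card_support_le
      omega
  · induction C with
    | nil => simp
    | cons g C ih =>
      intro g' hg'
      rw [List.foldr_cons]
      rcases List.mem_cons.1 hg' with rfl | hg'
      · exact Finset.subset_union_left
      · exact (ih g' hg').trans Finset.subset_union_right

open Classical in
/-- Every circuit operates on few of its qubits. -/
theorem exists_compress {S : ℕ} (C : Circuit M N S) : ∃ (s : Finset (Fin S))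
    (C' : List (GGate M N s)), C'.length = C.time ∧
      s.card ≤ C.time * (3 + (Nat.clog 2 M + Nat.clog 2 N)) ∧
      ∀ (f : Fin M → Fin N) (R : List Bool → Prop), successProb C f R =
        run (C'.map fun g => g.instr f) [] (initSt s) fun z ψ => (if R z then 1 else 0) * nsq ψ := by
  obtain ⟨s, hs, C', hC'⟩ := exists_map_eq (C.map GGate.ofGate)
  refine ⟨s, C', ?_, ?_, fun f R => ?_⟩
  · rw [Circuit.time, ← List.length_map (f := GGate.ofGate) (as := C), ← hC', List.length_map]
  · rwa [List.length_map] at hs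
  · have h1 : C.map (fun g => (GGate.ofGate g).instr f) =
        C'.map fun g => (g.map (Function.Embedding.subtype _)).instr f := by
      have h0 := congrArg (List.map fun g => g.instr f) hC'
      rw [List.map_map, List.map_map] at h0
      exact h0.symm
    have h2 : initState S = lift (Function.Embedding.subtype _) (initSt s) := by
      rw [lift_initSt]
      rfl
    rw [successProb, probFrom_eq_run, h1, h2, run_map_lift]
    congr 1
    funext z ψ
    simp only [dia]
    rw [sum_lift _ ψ fun _ => if R z then 1 else 0, ← Finset.sum_mul, mul_comm]
    rfl

end Compress

/-! ### Sizes -/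

section Sizes

variable {M N n m t r w : ℕ}

lemma length_flatMap_le {α β : Type} {l : List α} {f : α → List β} {b : ℕ}
    (h : ∀ a ∈ l, (f a).length ≤ b) : (l.flatMap f).length ≤ l.length * b := by
  induction l with
  | nil => simp
  | cons a l ih =>
    rw [List.flatMap_cons, List.length_append, List.length_cons, Nat.succ_mul]
    have h1 := h a List.mem_cons_self
    have h2 := ih fun a' ha' => h a' (List.mem_cons_of_mem _ ha')
    omega

section QuerySim

variable {A : Type} [DecidableEq A] {P : ℕ} (Z : QuerySim M N t P A)

lemma QuerySim.length_fwd (q : Tests N t) : (Z.fwd q).length = 2 + q.1 := by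
  simp [fwd]; omega

lemma QuerySim.length_bwd (q : Tests N t) : (Z.bwd q).length = 2 + q.1 := by
  simp [bwd]; omega

lemma QuerySim.length_macs_le (hN : 2 * Nat.clog 2 N + 1 ≤ w) (ht : 3 ^ t ≤ w) (hP : P ≤ w)
    (hw : 3 ≤ w) : (Z.macs m).length ≤ 5 * w ^ 3 := by
  have h1 : ∀ q : Tests N t, (q.1 : ℕ) < 2 * Nat.clog 2 N + 1 := fun q => q.1.2
  have h2 : (testList N t).length ≤ w * w := by
    rw [length_testList]
    exact Nat.mul_le_mul hN ht
  have h3 : ((testList N t).flatMap fun q => testMac (Z.τ q) (Z.fwd q)).length ≤ w * w * (2 * w) := by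
    refine (length_flatMap_le (b := 2 * w) fun q _ => ?_).trans (Nat.mul_le_mul_right _ h2)
    have := h1 q
    simp only [testMac, List.length_cons, List.length_append, Z.length_fwd, List.length_nil]
    omega
  have h4 : ((testList N t).reverse.flatMap fun q => testMac (Z.τ q) (Z.bwd q)).length ≤
      w * w * (2 * w) := by
    refine (length_flatMap_le (b := 2 * w) fun q _ => ?_).trans
      (Nat.mul_le_mul_right _ (by rwa [List.length_reverse]))
    have := h1 q
    simp only [testMac, List.length_cons, List.length_append, Z.length_bwd, List.length_nil]
    omega
  have h5 : (Z.mid m).length ≤ w * w := by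
    simp only [mid, List.length_map, Finset.length_toList, Finset.card_univ, Fintype.card_prod,
      Fintype.card_fin]
    exact Nat.mul_le_mul hP hN
  rw [macs, List.length_append, List.length_append]
  nlinarith [Nat.mul_le_mul_left (w * w) (show 1 ≤ w by omega)]

lemma fits_cquery {B : ℕ} {hx : Fin (Nat.clog 2 M) → BExpr A} {c : BExpr A} {p : ℕ}
    (hhx : ∀ j, (hx j).size ≤ B + 1) (hc : c.size + 1 ≤ B) :
    (cquery hx c p : Mac M N A).Fits B := by
  rintro (j | j)
  · exact hhx j
  · simp only [Sum.elim_inr, BExpr.size]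
    omega

lemma QuerySim.fits_macs {B : ℕ} (hhx : ∀ j, (Z.hx j).size ≤ B + 1)
    (hpe : ∀ j, (Z.pe j).size ≤ 1) (hv : Z.valid.size + 2 * 6 ^ t + 2 ≤ B)
    (hB : 2 ≤ B) : ∀ q ∈ Z.macs m, q.Fits B := by
  have hdec : ∀ i, (Z.decE i).size ≤ 2 * 6 ^ t := Z.size_decE_le
  have hv0 := Z.valid.size_pos
  have hfwd : ∀ q, ∀ x ∈ testMac (Z.τ q) (Z.fwd q), x.Fits B := by
    intro q x hx
    simp only [testMac, fwd, List.mem_cons, List.mem_append, List.not_mem_nil, or_false,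
      List.mem_map] at hx
    rcases hx with rfl | (rfl | rfl | ⟨i, -, rfl⟩) | rfl
    · trivial
    · exact fits_cquery hhx (by simpa [BExpr.size] using hB)
    · simp [Mac.Fits, BExpr.size]
    · have := hdec i
      simp only [Mac.Fits, BExpr.size]
      omega
    · trivial
  have hbwd : ∀ q, ∀ x ∈ testMac (Z.τ q) (Z.bwd q), x.Fits B := by
    intro q x hx
    simp only [testMac, bwd, List.mem_cons, List.mem_append, List.not_mem_nil, or_false,
      List.mem_map] at hx
    rcases hx with rfl | (rfl | rfl | ⟨i, -, rfl⟩) | rfl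
    · trivial
    · exact fits_cquery hhx (by simpa [BExpr.size] using hB)
    · simp [Mac.Fits, BExpr.size]
    · have := hdec i
      simp only [Mac.Fits, BExpr.size]
      omega
    · trivial
  intro x hx
  simp only [macs, List.mem_append, List.mem_flatMap] at hx
  rcases hx with ⟨q, -, hx⟩ | hx | ⟨q, -, hx⟩
  · exact hfwd q x hx
  · simp only [mid, List.mem_map] at hx
    obtain ⟨u, -, rfl⟩ := hx
    have := hdec u.2
    have := hpe u.1
    simp only [Mac.Fits, BExpr.size]
    omega
  · exact hbwd q x hx

end QuerySim

section Verif

variable {A : Type} [DecidableEq A] [Fintype A] (V : Verif M N r A)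

lemma length_resetAll : (resetAll M N A).length = Fintype.card A := by
  simp [resetAll, resets]

lemma Verif.length_tests : (tests N r).length = r * Nat.clog 2 N := by
  simp [tests, EqTests]

lemma Verif.length_macs_le (hr : r ≤ w) (hN : Nat.clog 2 N ≤ w) (hM : Nat.clog 2 M ≤ w)
    (hw : 3 ≤ w) : V.macs.length ≤ Fintype.card A + 7 * w ^ 2 := by
  have h1 : (tests N r).length ≤ w * w := by
    rw [length_tests]
    exact Nat.mul_le_mul hr hN
  have h2 : ((tests N r).flatMap fun q => testMac (V.ν q) (V.fwd q)).length ≤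
      (tests N r).length * 4 := length_flatMap_le fun q _ => by simp [testMac, fwd]
  have h3 : (outMacs (M := M) (N := N) V.o V.outs).length ≤ V.outs.length * 3 :=
    length_flatMap_le fun e _ => by simp [outMac]
  have h4 : V.outs.length = 2 * Nat.clog 2 M := by simp [outs]; omega
  rw [macs, List.length_append, List.length_append, length_resetAll, pre, List.length_append]
  have h5 : (resets (M := M) (N := N) ((tests N r).map V.ν)).length = (tests N r).length := by
    simp [resets]
  rw [h5]
  nlinarith

lemma Verif.fits_macs {B s : ℕ} (hex : ∀ j, (V.ex j).size ≤ s) (hey : ∀ j, (V.ey j).size ≤ s)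
    (hB : 2 * (2 * (r * Nat.clog 2 N) + 1) + 2 * s + 2 ≤ B) : ∀ x ∈ V.macs, x.Fits B := by
  have hflag : V.flag.size = 2 * (r * Nat.clog 2 N) + 1 := by
    rw [flag, size_orE, List.length_map, length_tests]
  intro x hx
  simp only [macs, pre, List.mem_append, resets, resetAll, outMacs, List.mem_map, List.mem_flatMap]
    at hx
  rcases hx with (⟨q, -, rfl⟩ | ⟨q, -, hx⟩) | ⟨e, he, hx⟩ | ⟨q, -, rfl⟩
  · trivial
  · simp only [testMac, fwd, List.mem_cons, List.mem_append, List.not_mem_nil, or_false] at hx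
    rcases hx with rfl | (rfl | rfl) | rfl
    · trivial
    · exact fits_cquery (fun j => by have := hex j; omega) (by simp [BExpr.size]; omega)
    · exact fits_cquery (fun j => by have := hey j; omega) (by simp [BExpr.size]; omega)
    · trivial
  · have hsize : e.size ≤ B + 1 := by
      simp only [outs, List.mem_append, List.mem_ofFn] at he
      rcases he with ⟨j, rfl⟩ | ⟨j, rfl⟩
      · have := hex j
        omega
      · have := hex j
        have := hey j
        simp only [muxE, BExpr.size]
        omega
    simp only [outMac, List.mem_cons, List.not_mem_nil, or_false] at hx
    rcases hx with rfl | rfl | rfl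
    · trivial
    · unfold xorMac
      split_ifs
      · simp [Mac.Fits, BExpr.size]
      · exact hsize
    · trivial
  · trivial

end Verif

section Sim

variable {Q : Type} [DecidableEq Q] (L : Curve (Nat.clog 2 n) M)

lemma length_simGate_le (hN : 2 * Nat.clog 2 N + 1 ≤ w) (ht : 3 ^ t ≤ w) (hm : Nat.clog 2 m ≤ w)
    (hw : 3 ≤ w) (c : ℕ) (g : GGate n m Q) : (simGate L N t r c g).length ≤ 5 * w ^ 3 := by
  have h1 : 3 ≤ 5 * w ^ 3 := by nlinarith [Nat.pow_le_pow_left hw 3]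
  cases g with
  | query g => exact (querySim L N t r g).length_macs_le hN ht hm hw
  | output q =>
    unfold simGate
    split_ifs
    · exact h1
    · simp
  | unitary s hs g U => simp [simGate]; omega
  | reset q => simp [simGate]; omega

lemma length_sim_le (hN : 2 * Nat.clog 2 N + 1 ≤ w) (ht : 3 ^ t ≤ w) (hm : Nat.clog 2 m ≤ w)
    (hw : 3 ≤ w) (c : ℕ) (C : List (GGate n m Q)) :
    (sim L N t r c C).length ≤ C.length * (5 * w ^ 3) := by
  induction C generalizing c with
  | nil => simp [sim]
  | cons g C ih =>
    rw [sim, List.length_append, List.length_cons, Nat.succ_mul]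
    have := ih (c + g.outs)
    have := length_simGate_le L (r := r) hN ht hm hw c g
    omega

lemma fits_sim {B : ℕ} (hφ : ∀ j, (L.φ j).size ≤ B + 1)
    (hB : 2 * Nat.clog 2 n + 2 * Nat.clog 2 m + 2 * 6 ^ t + 5 ≤ B) (c : ℕ) (C : List (GGate n m Q)) :
    ∀ x ∈ sim L N t r c C, x.Fits B := by
  induction C generalizing c with
  | nil => simp [sim]
  | cons g C ih =>
    intro x hx
    rw [sim, List.mem_append] at hx
    rcases hx with hx | hx
    · cases g with
      | query g =>
        refine (querySim L N t r g).fits_macs (fun j => ?_) (fun j => ?_) ?_ (by omega) x hx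
        · change ((L.φ j).subst _).size ≤ _
          rw [BExpr.size_subst_var]
          exact hφ j
        · exact le_rfl
        · change (BExpr.op _ _ _).size + _ + _ ≤ _
          simp only [BExpr.size, BExpr.size_lt]
          omega
      | output q =>
        unfold simGate at hx
        split_ifs at hx
        · simp only [List.mem_cons, List.not_mem_nil, or_false] at hx
          rcases hx with rfl | rfl | rfl
          · unfold xorMac
            split_ifs <;> simp [Mac.Fits, BExpr.size]
          · unfold xorMac
            split_ifs <;> simp [Mac.Fits, BExpr.size]
          · trivial
        · simp at hx
      | unitary s hs g U =>
        simp only [simGate, List.mem_singleton] at hx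
        subst hx
        trivial
      | reset q =>
        simp only [simGate, List.mem_singleton] at hx
        subst hx
        trivial
    · exact ih _ x hx

lemma card_ext_le (hN : 2 * Nat.clog 2 N + 1 ≤ w) (ht : 3 ^ t ≤ w) (hn : Nat.clog 2 n ≤ w)
    (hr : r ≤ w) (hw : 3 ≤ w) [Fintype Q] :
    Fintype.card (Q ⊕ Ext N (Nat.clog 2 n) t r) ≤ Fintype.card Q + 4 * w ^ 2 := by
  have h1 : Fintype.card (Q ⊕ Ext N (Nat.clog 2 n) t r) =
      Fintype.card Q + ((2 * Nat.clog 2 n + 2) + ((2 * Nat.clog 2 N + 1) * 3 ^ t +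
        r * Nat.clog 2 N)) := by
    simp [Ext, Tests, EqTests, Leaf]
  have h2 := Nat.mul_le_mul hN ht
  have h3 : r * Nat.clog 2 N ≤ w * w := Nat.mul_le_mul hr (by omega)
  rw [h1]
  nlinarith

end Sim

end Sizes

/-! ### From Element Distinctness to disjoint collisions -/

section Success

lemma length_encodePair {M : ℕ} (P : Fin M × Fin M) :
    (encodePair P).length = 2 * Nat.clog 2 M := by
  simp [encodePair]; omega

variable {n m : ℕ} {Q : Type} [DecidableEq Q] [Fintype Q]

open Classical in
-- The number of output bits is the same in all branches, so a circuit that ever succeeds outputs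
-- exactly the length of an encoded pair. The output register of the simulation is then filled
-- exactly.
lemma numOut_eq_of_pos {C : List (GGate n m Q)} {F : Fin n → Fin m}
    (h : run (C.map fun g => g.instr F) [] (initSt Q)
      (fun z ψ => (if OutputsCollision F z then 1 else 0) * nsq ψ) ≠ 0) :
    numOut C = 2 * Nat.clog 2 n := by
  by_contra hne
  refine h ((run_congr_length F C (G := fun _ _ => 0) fun z' ψ hz => ?_).trans (run_zero _ _ _))
  rw [if_neg, zero_mul]
  rintro ⟨P, rfl, -⟩
  rw [length_encodePair] at hz
  simp at hz
  omega

open Classical in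
lemma run_le_one (C : List (GGate n m Q)) (F : Fin n → Fin m) (R : List Bool → Prop) :
    run (C.map fun g => g.instr F) [] (initSt Q)
      (fun z ψ => (if R z then 1 else 0) * nsq ψ) ≤ 1 := by
  have h1 : run (C.map fun g => g.instr F) [] (initSt Q) (fun z ψ => nsq ψ) = 1 := by
    rw [run_nsq, nsq_initSt]
    intro I hI
    obtain ⟨g, -, rfl⟩ := List.mem_map.1 hI
    exact g.instr_iso F
  refine (run_mono _ _ _ fun z ψ => ?_).trans_eq h1
  have : 0 ≤ nsq ψ := Finset.sum_nonneg fun _ _ => by positivity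
  split_ifs <;> simp [this]

open Classical in
lemma run_nonneg' (C : List (GGate n m Q)) (F : Fin n → Fin m) (R : List Bool → Prop) :
    0 ≤ run (C.map fun g => g.instr F) [] (initSt Q)
      (fun z ψ => (if R z then 1 else 0) * nsq ψ) := by
  refine run_nonneg _ _ _ fun z ψ => ?_
  have : 0 ≤ nsq ψ := Finset.sum_nonneg fun _ _ => by positivity
  split_ifs <;> simp [this]

end Success

/-! ### Elementary estimates for the plane, the range and the load -/

lemma two_pow_clog_lt {n : ℕ} (hn : 2 ≤ n) : 2 ^ Nat.clog 2 n < 2 * n := by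
  have h1 := Nat.pow_pred_clog_lt_self (b := 2) (by norm_num) (show 1 < n by omega)
  have h2 : 0 < Nat.clog 2 n := Nat.clog_pos (by norm_num) hn
  calc 2 ^ Nat.clog 2 n = 2 * 2 ^ (Nat.clog 2 n).pred := by
        rw [← pow_succ', ← Nat.succ_eq_add_one, Nat.succ_pred h2.ne']
    _ < 2 * n := by omega

/-- The plane fits into the domain: 2^k < 2n gives 4^k < 4n² ≤ 4N. -/
lemma four_pow_clog_le {n N : ℕ} (hn : 2 ≤ n) (h : n ^ 2 ≤ N) : 4 ^ Nat.clog 2 n ≤ 10 * N := by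
  have := two_pow_clog_lt hn
  have h4 : 4 ^ Nat.clog 2 n = 2 ^ Nat.clog 2 n * 2 ^ Nat.clog 2 n := by
    rw [← mul_pow]; norm_num
  rw [h4]
  have := Nat.mul_le_mul this.le this.le
  nlinarith

/-- A value of the oracle on a curve is small with constant probability. -/
lemma small_prob_ge {n N : ℕ} (hn : 2 ≤ n) (h2 : N ≤ n ^ 2 + 2 * n) (h1 : n ^ 2 ≤ N) :
    (1 / 9 : ℝ) ≤ (((n ^ 2 : ℕ) : ℝ) / N) ^ n := by
  have hn0 : (0 : ℝ) < n := by exact_mod_cast (show 0 < n by omega)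
  have hN0 : (0 : ℝ) < N := by
    have : 0 < n ^ 2 := by positivity
    exact_mod_cast this.trans_le h1
  have h3 : ((N : ℝ) / (n ^ 2 : ℕ)) ^ n ≤ 9 := by
    have h4 : (N : ℝ) / (n ^ 2 : ℕ) ≤ Real.exp (2 / n) := by
      refine le_trans ?_ (Real.add_one_le_exp _)
      rw [div_le_iff₀ (by positivity)]
      have : (N : ℝ) ≤ n ^ 2 + 2 * n := by exact_mod_cast h2
      push_cast
      refine this.trans_eq ?_
      field_simp
      ring
    refine (pow_le_pow_left₀ (by positivity) h4 n).trans ?_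
    rw [← Real.exp_nat_mul]
    have h5 : (n : ℝ) * (2 / n) = 1 + 1 := by field_simp; norm_num
    rw [h5, Real.exp_add]
    have := Real.exp_one_lt_d9
    have := Real.exp_pos 1
    nlinarith
  rw [← inv_div (N : ℝ), inv_pow, one_div]
  exact inv_anti₀ (by positivity) h3

/-- The moment (1 + 1/N)^(10N) is at most e^10 < 2^15, and the allowed load exceeds log₂ N by 20,
which leaves 2^(-5). -/
lemma load_bound {N : ℕ} (hN : N ≠ 0) :
    (N : ℝ) * (1 + 1 / N) ^ (10 * N) / 2 ^ (Nat.clog 2 N + 20) ≤ 1 / 32 := by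
  have hN0 : (0 : ℝ) < N := by positivity
  have h1 : (1 + 1 / (N : ℝ)) ^ (10 * N) ≤ 2 ^ 15 := by
    have h2 : 1 + 1 / (N : ℝ) ≤ Real.exp (1 / N) := by
      rw [add_comm]; exact Real.add_one_le_exp _
    refine (pow_le_pow_left₀ (by positivity) h2 _).trans ?_
    rw [← Real.exp_nat_mul]
    have h5 : ((10 * N : ℕ) : ℝ) * (1 / N) = (10 : ℕ) * 1 := by push_cast; field_simp
    rw [h5, Real.exp_nat_mul]
    refine (pow_le_pow_left₀ (Real.exp_pos _).le (Real.exp_one_lt_d9.le.trans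
      (show (2.7182818286 : ℝ) ≤ 2.8 by norm_num)) 10).trans ?_
    norm_num
  have h2 : (N : ℝ) ≤ 2 ^ Nat.clog 2 N := by exact_mod_cast Nat.le_pow_clog (by norm_num) N
  rw [div_le_iff₀ (by positivity), pow_add]
  nlinarith [mul_le_mul h2 h1 (by positivity) (by positivity)]

lemma one_add_inv_pow_le {T : ℕ} (hT : T ≠ 0) : (1 + 1 / (T : ℝ)) ^ T ≤ 3 := by
  have hT0 : (0 : ℝ) < T := by positivity
  have h2 : 1 + 1 / (T : ℝ) ≤ Real.exp (1 / T) := by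
    rw [add_comm]; exact Real.add_one_le_exp _
  refine (pow_le_pow_left₀ (by positivity) h2 _).trans ?_
  rw [← Real.exp_nat_mul, mul_one_div_cancel hT0.ne']
  linarith [Real.exp_one_lt_d9]

lemma expect_mono' {ι : Type} [Fintype ι] {f g : ι → ℝ} (h : ∀ i, f i ≤ g i) :
    Finset.expect Finset.univ f ≤ Finset.expect Finset.univ g := by
  rw [Fintype.expect_eq_sum_div_card, Fintype.expect_eq_sum_div_card]
  gcongr with i
  exact h i

/-! ### The success probability of one block -/

section Reduction

variable {n N t r : ℕ} {Q : Type} [DecidableEq Q] [Fintype Q]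

open Classical in
/-- The success probability of a list of gates for Element Distinctness. -/
def edProb {m : ℕ} (C : List (GGate n m Q)) (F : Fin n → Fin m) : ℝ :=
  run (C.map fun g => g.instr F) [] (initSt Q)
    (fun z ψ => (if OutputsCollision F z then 1 else 0) * nsq ψ)

open Classical in
/-- A lower bound for the probability that a block finds a collision. -/
def blockBound (C : List (GGate n (n ^ 2) Q)) (G : Fin n → Fin N) : ℝ :=
  if h : ∀ i, (G i : ℕ) < n ^ 2 then max 0 (edProb C (fun i => ⟨G i, h i⟩) / 3 - 1 / 45) else 0

lemma blockBound_nonneg (C : List (GGate n (n ^ 2) Q)) (G : Fin n → Fin N) :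
    0 ≤ blockBound C G := by
  unfold blockBound
  split_ifs
  · exact le_max_left _ _
  · exact le_rfl

lemma blockBound_le_one (C : List (GGate n (n ^ 2) Q)) (G : Fin n → Fin N) :
    blockBound C G ≤ 1 := by
  unfold blockBound
  split_ifs with h
  · refine max_le (by norm_num) ?_
    have := run_le_one C (fun i => ⟨G i, h i⟩ : Fin n → Fin (n ^ 2))
      (OutputsCollision (fun i => ⟨G i, h i⟩ : Fin n → Fin (n ^ 2)))
    rw [edProb]
    linarith
  · norm_num

open Classical in
-- With κ = 1/T the simulation loses at most the factor (1 + 1/T)^T ≤ 3 and the additive T(1 + T)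
-- `queryErr`, at most 1/45; this explains both constants in `blockBound`.
lemma blockBound_le (L : Curve (Nat.clog 2 n) (10 * N)) (hL : Function.Injective L.pt) {C : List (GGate n (n ^ 2) Q)}
    (hout : numOut C = 2 * Nat.clog 2 n) (hC : C.length ≠ 0)
    (hδ : C.length * (1 + C.length) * queryErr N t ≤ 1 / 45) (f : Fin (10 * N) → Fin N) :
    blockBound C (fun i => f (L.pt (bitsOf _ i))) ≤
      ∑ P, (simVerif N t r Q L).prob f (sim L N t r 0 C) P * (if OnCurve f L P then 1 else 0) := by
  have h0 : 0 ≤ ∑ P, (simVerif N t r Q L).prob f (sim L N t r 0 C) P *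
      (if OnCurve f L P then (1 : ℝ) else 0) :=
    Finset.sum_nonneg fun P _ => mul_nonneg (Verif.prob_nonneg _ _ _ _)
      (by split_ifs <;> norm_num)
  unfold blockBound
  split_ifs with h
  · refine max_le h0 ?_
    have hT : (0 : ℝ) < C.length := by positivity
    have h1 := ed_le_prob (F := fun i => ⟨f (L.pt (bitsOf _ i)), h i⟩) N t r L hL f (fun i => rfl)
      (κ := 1 / C.length) (by positivity) C hout
    have h2 := one_add_inv_pow_le hC
    have h3 : (C.length : ℝ) * ((1 + (1 / (C.length : ℝ))⁻¹) * queryErr N t) ≤ 1 / 45 := by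
      rw [one_div, inv_inv, ← mul_assoc]
      exact hδ
    have hq : 0 ≤ queryErr N t := by unfold queryErr; positivity
    have h4 : 0 ≤ (C.length : ℝ) * ((1 + (1 / (C.length : ℝ))⁻¹) * queryErr N t) := by positivity
    have h5 := mul_le_mul_of_nonneg_right h2 (add_nonneg h0 h4)
    rw [edProb]
    linarith
  · exact h0

open Classical in
-- The condition that a collision exists has probability at least 1/5 and is dropped at this price:
-- 2/15 = (2/3)(1/5).
lemma expect_edProb_ge {S : ℕ} (hn : 2 ≤ n) {D : Circuit n (n ^ 2) S} (hD : SolvesED D)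
    {C : List (GGate n (n ^ 2) Q)}
    (hCD : ∀ F : Fin n → Fin (n ^ 2), successProb D F (OutputsCollision F) = edProb C F) :
    (2 / 15 : ℝ) ≤ Finset.expect Finset.univ (edProb C) := by
  have hc := card_collision_ge hn
  rw [SolvesED] at hD
  set A := Finset.univ.filter fun f : Fin n → Fin (n ^ 2) => ∃ P, IsCollision f P with hA
  have hcard : (0 : ℝ) < Fintype.card (Fin n → Fin (n ^ 2)) := by
    rw [Fintype.card_fun, Fintype.card_fin, Fintype.card_fin]
    have : 0 < n := by omega
    positivity
  have hApos : (0 : ℝ) < A.card := by linarith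
  rw [Finset.expect_eq_sum_div_card, le_div_iff₀ hApos] at hD
  rw [Fintype.expect_eq_sum_div_card, le_div_iff₀ hcard]
  have h1 : ∑ f ∈ A, successProb D f (OutputsCollision f) ≤ ∑ F, edProb C F := by
    simp only [hCD]
    exact Finset.sum_le_sum_of_subset_of_nonneg (Finset.subset_univ _)
      fun F _ _ => run_nonneg' C F _
  linarith

/-- Only functions with values below n² are counted, a fraction (n²/N)^n ≥ 1/9, and on these the
mean is at least (2/15)/3 - 1/45 = 1/45. -/
lemma expect_blockBound_ge (hn : 2 ≤ n) (h1 : n ^ 2 ≤ N) (h2 : N ≤ n ^ 2 + 2 * n)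
    {C : List (GGate n (n ^ 2) Q)} (hC : (2 / 15 : ℝ) ≤ Finset.expect Finset.univ (edProb C)) :
    (1 / 405 : ℝ) ≤ Finset.expect Finset.univ (blockBound (N := N) C) := by
  have h3 := expect_ge_of_extend (X := Fin n) h1 (by positivity)
    (σ := fun F => edProb C F / 3 - 1 / 45) (blockBound_nonneg (N := N) C) (fun F => by
      rw [blockBound, dif_pos fun i => by simp]
      exact le_max_right _ _)
  have h4 := small_prob_ge hn h2 h1
  rw [Fintype.card_fin] at h3
  have h5 : Finset.expect Finset.univ (fun F => edProb C F / 3 - 1 / 45) =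
      Finset.expect Finset.univ (edProb C) / 3 - 1 / 45 := by
    have : 0 < n ^ 2 := by positivity
    have : Nonempty (Fin (n ^ 2)) := ⟨⟨0, this⟩⟩
    rw [Finset.expect_sub_distrib, Fintype.expect_const, Finset.expect_div]
  rw [h5] at h3
  have h6 : (1 / 45 : ℝ) ≤ Finset.expect Finset.univ (edProb C) / 3 - 1 / 45 := by linarith
  nlinarith [mul_le_mul h4 h6 (by norm_num) (by positivity)]

end Reduction

/-! ### Many blocks: independence, counting and the complete circuit -/

section Reduction

variable {n N : ℕ}

open Classical in
/-- The lines with a given slope are examined independently of each other. -/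
lemma expect_prod_blockBound {Q : Type} [DecidableEq Q] [Fintype Q] (hN : N ≠ 0)
    (hk : Nat.clog 2 n ≠ 0) (hM : 4 ^ Nat.clog 2 n ≤ 10 * N)
    (C : List (GGate n (n ^ 2) Q)) (a : Fin (Nat.clog 2 n) → Bool) :
    Finset.expect Finset.univ (fun f : Fin (10 * N) → Fin N => ∏ b : Fin (Nat.clog 2 n) → Bool,
      (1 - blockBound C (fun i => f ((line hk hM a b).pt (bitsOf _ i))) / 2)) =
      (1 - Finset.expect Finset.univ (blockBound (N := N) C) / 2) ^ 2 ^ Nat.clog 2 n := by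
  have : Nonempty (Fin N) := ⟨⟨0, by omega⟩⟩
  -- The first n points of all lines with this slope are different points of the domain, so f
  -- restricted to them is a family of independent random functions.
  have hinj : Function.Injective fun p : (Fin (Nat.clog 2 n) → Bool) × Fin n =>
      (line hk hM a p.1).pt (bitsOf _ p.2) := by
    rintro ⟨b, i⟩ ⟨b', i'⟩ h
    have h1 := line_pt_injective hk hM a (a₁ := (b, bitsOf _ i)) (a₂ := (b', bitsOf _ i')) h
    simp only [Prod.mk.injEq] at h1 ⊢
    exact ⟨h1.1, Fin.ext (bitsOf_injOn (i.2.trans_le (Nat.le_pow_clog (by norm_num) n))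
      (i'.2.trans_le (Nat.le_pow_clog (by norm_num) n)) h1.2)⟩
  have h := expect_prod_comp (V := Fin N) ⟨_, hinj⟩ fun G => 1 - blockBound C G / 2
  have h2 : Finset.expect Finset.univ (fun G : Fin n → Fin N => 1 - blockBound C G / 2) =
      1 - Finset.expect Finset.univ (blockBound (N := N) C) / 2 := by
    rw [Finset.expect_sub_distrib, Fintype.expect_const, Finset.expect_div]
  rw [h2, Fintype.card_fun, Fintype.card_bool, Fintype.card_fin] at h
  exact h

open Classical in
/-- Enough independent blocks with a constant success probability find many disjoint
collisions. -/
lemma findsDisjointCollisions_of_blocks {S q K : ℕ} {Q : Type} [DecidableEq Q] [Fintype Q]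
    {ε : ℝ} (hn : 2 ≤ n) (h1 : n ^ 2 ≤ N) (h2 : N ≤ n ^ 2 + 2 * n) (hk : Nat.clog 2 n ≠ 0)
    (hM : 4 ^ Nat.clog 2 n ≤ 10 * N) {C : List (GGate n (n ^ 2) Q)}
    (hED : (2 / 15 : ℝ) ≤ Finset.expect Finset.univ (edProb C))
    (hr : (4 : ℝ) ^ Nat.clog 2 n * ε ≤ 1 / 10)
    (hq : (2 : ℝ) ^ Nat.clog 2 n * (2 ^ q * (1 - 1 / 810) ^ 2 ^ Nat.clog 2 n) ≤ 1 / 10)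
    (hK : K * (4 * (Nat.clog 2 N + 20)) ≤ 2 ^ Nat.clog 2 n * q) {B : ℕ}
    {e : Fin B ≃ (Fin (Nat.clog 2 n) → Bool) × (Fin (Nat.clog 2 n) → Bool)}
    {p : (Fin (10 * N) → Fin N) → (Fin (Nat.clog 2 n) → Bool) × (Fin (Nat.clog 2 n) → Bool) →
      Fin (10 * N) × Fin (10 * N) → ℝ}
    (hp0 : ∀ f i P, 0 ≤ p f i P) (hp1 : ∀ f i, ∑ P, p f i P = 1)
    (hpw : ∀ f i, ∑ P, p f i P * (if Verif.Wrong f P then 1 else 0) ≤ ε)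
    (hpb : ∀ f a b, blockBound C (fun j => f ((line hk hM a b).pt (bitsOf _ j))) ≤
      ∑ P, p f (a, b) P * (if OnCurve f (line hk hM a b) P then 1 else 0))
    {D : Circuit (10 * N) N S} (hD : ∀ f, successProb D f (OutputsDisjointCollisions f K) =
      pexp (p f) (succInd f K e)) : FindsDisjointCollisions D K := by
  have hN : N ≠ 0 := by
    have : 0 < n ^ 2 := by positivity
    omega
  have hpos : ∀ f, 1 - ((if LoadLE f (Nat.clog 2 N + 20) then 0 else 1) + (1 / 10 +
      ∑ a : Fin (Nat.clog 2 n) → Bool, 2 ^ q * ∏ b : Fin (Nat.clog 2 n) → Bool,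
        (1 - blockBound C (fun i => f ((line hk hM a b).pt (bitsOf _ i))) / 2))) ≤
      successProb D f (OutputsDisjointCollisions f K) := fun f => by
    rw [hD]
    have c1 : Fintype.card (Fin (Nat.clog 2 n) → Bool) = 2 ^ Nat.clog 2 n := by simp
    have hd : ∀ (i j : (Fin (Nat.clog 2 n) → Bool) × (Fin (Nat.clog 2 n) → Bool)) (P), OnCurve f (line hk hM i.1 i.2) P → OnCurve f (line hk hM j.1 j.2) P → i = j := fun i j P hi hj =>
      eq_of_onCurve (a := i.1) (b := i.2) (a' := j.1) (b' := j.2) hk hM hi hj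
    have hK' : K * (4 * (Nat.clog 2 N + 20)) ≤ Fintype.card (Fin (Nat.clog 2 n) → Bool) * q := by
      rw [c1]; exact hK
    have key := one_sub_le_success e (hp0 f) (hp1 f) (Good := fun i P => OnCurve f (line hk hM i.1 i.2) P) (fun i P h => h.1) hd
      (show 0 < Nat.clog 2 N + 20 by omega) hK' (hpw f)
    refine le_trans ?_ key
    -- There is one block for each line, hence 4^k of them.
    have c2 : (Fintype.card (Fin (Nat.clog 2 n) → Bool) : ℝ) * Fintype.card (Fin (Nat.clog 2 n) → Bool) * ε ≤
        1 / 10 := by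
      refine le_trans (le_of_eq ?_) hr
      rw [c1]
      push_cast
      rw [← mul_pow]
      norm_num
    have c3 : ∀ a : Fin (Nat.clog 2 n) → Bool, (2 : ℝ) ^ q * ∏ b : Fin (Nat.clog 2 n) → Bool,
        (1 - (∑ P, p f (a, b) P * if OnCurve f (line hk hM a b) P then 1 else 0) / 2) ≤
        2 ^ q * ∏ b : Fin (Nat.clog 2 n) → Bool,
          (1 - blockBound C (fun i => f ((line hk hM a b).pt (bitsOf _ i))) / 2) := fun a => by
      refine mul_le_mul_of_nonneg_left (Finset.prod_le_prod (fun b _ => ?_) fun b _ => ?_)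
        (by positivity)
      · have d1 : (∑ P, p f (a, b) P * if OnCurve f (line hk hM a b) P then 1 else 0) ≤
            ∑ P, p f (a, b) P := Finset.sum_le_sum fun P _ =>
          mul_le_of_le_one_right (hp0 _ _ _) (by split_ifs <;> norm_num)
        have d2 : ∑ P, p f (a, b) P = 1 := hp1 _ _
        linarith
      · have := hpb f a b
        linarith
    have c4 := Finset.sum_le_sum fun a (_ : a ∈ Finset.univ) => c3 a
    linarith
  have hexp := expect_mono' hpos
  rw [FindsDisjointCollisions]
  refine le_trans ?_ hexp
  have : Nonempty (Fin N) := ⟨⟨0, by omega⟩⟩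
  rw [Finset.expect_sub_distrib, Finset.expect_add_distrib, Finset.expect_add_distrib,
    Fintype.expect_const, Fintype.expect_const, Finset.expect_sum_comm]
  simp only [← Finset.mul_expect]
  have e1 := (expect_load_le (M := 10 * N) (N := N) (m₀ := Nat.clog 2 N + 20) hN).trans
    (load_bound hN)
  have e2 := expect_blockBound_ge hn h1 h2 hED
  have e3 : Finset.expect Finset.univ (blockBound (N := N) C) ≤ 1 := by
    have := expect_mono' (blockBound_le_one (N := N) C)
    rwa [Fintype.expect_const] at this
  have e4 : ∑ a : Fin (Nat.clog 2 n) → Bool, (2 : ℝ) ^ q * Finset.expect Finset.univ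
      (fun f : Fin (10 * N) → Fin N => ∏ b : Fin (Nat.clog 2 n) → Bool,
        (1 - blockBound C (fun i => f ((line hk hM a b).pt (bitsOf _ i))) / 2)) ≤ 1 / 10 := by
    simp only [expect_prod_blockBound hN hk hM C]
    refine le_trans ?_ hq
    rw [Finset.sum_const, Finset.card_univ, nsmul_eq_mul]
    have : (Fintype.card (Fin (Nat.clog 2 n) → Bool) : ℝ) = 2 ^ Nat.clog 2 n := by simp
    rw [this]
    have e5 : (0 : ℝ) ≤ 1 - Finset.expect Finset.univ (blockBound (N := N) C) / 2 := by linarith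
    have e6 : 1 - Finset.expect Finset.univ (blockBound (N := N) C) / 2 ≤ (1 - 1 / 810 : ℝ) := by
      linarith
    exact mul_le_mul_of_nonneg_left (mul_le_mul_of_nonneg_left (pow_le_pow_left₀ e5 e6 _)
      (by positivity)) (by positivity)
  -- The failure probabilities 1/32, 1/10 and 1/10 add up to less than 1/3.
  linarith

set_option maxHeartbeats 1000000 in
/-- A circuit for Element Distinctness gives a circuit that finds many disjoint collisions. -/
theorem exists_findsDisjointCollisions {S S' T' t r w q K : ℕ} (hn : 2 ≤ n) (h1 : n ^ 2 ≤ N)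
    (h2 : N ≤ n ^ 2 + 2 * n) {C : Circuit n (n ^ 2) S} (hC : SolvesED C)
    (hδ : (C.time : ℝ) * (1 + C.time) * queryErr N t ≤ 1 / 45)
    (hr : (4 : ℝ) ^ Nat.clog 2 n * (1 / 4) ^ r ≤ 1 / 10)
    (hq : (2 : ℝ) ^ Nat.clog 2 n * (2 ^ q * (1 - 1 / 810) ^ 2 ^ Nat.clog 2 n) ≤ 1 / 10)
    (hK : K * (4 * (Nat.clog 2 N + 20)) ≤ 2 ^ Nat.clog 2 n * q)
    (hwN : 2 * Nat.clog 2 N + 1 ≤ w) (hwM : Nat.clog 2 (10 * N) ≤ w) (hwn : Nat.clog 2 n ≤ w)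
    (hwm : Nat.clog 2 (n ^ 2) ≤ w) (hwt : 6 ^ t ≤ w) (hwr : r ≤ w) (hw : 3 ≤ w)
    (hS : S + 25 * w ^ 3 ≤ S') (hT : 400 * 4 ^ Nat.clog 2 n * C.time * w ^ 6 ≤ T') :
    ∃ D : Circuit (10 * N) N S', D.time = T' ∧ FindsDisjointCollisions D K := by
  classical
  obtain ⟨s, C', hlen, hs, hprob⟩ := exists_compress C
  set k := Nat.clog 2 n with hkdef
  have hk : k ≠ 0 := (Nat.clog_pos (by norm_num) hn).ne'
  have hM : 4 ^ k ≤ 10 * N := four_pow_clog_le hn h1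
  have hN : N ≠ 0 := by
    have : 0 < n ^ 2 := by positivity
    omega
  have hprob' : ∀ F : Fin n → Fin (n ^ 2),
      successProb C F (OutputsCollision F) = edProb C' F := fun F => hprob F _
  have hED := expect_edProb_ge hn hC hprob'
  have hout : numOut C' = 2 * k := by
    by_contra hne
    have : ∀ F, edProb C' F = 0 := fun F => by
      by_contra h
      exact hne (numOut_eq_of_pos h)
    simp only [this, Finset.expect_const_zero] at hED
    norm_num at hED
  -- A circuit that outputs something has a gate; the choice κ = 1/T needs this.
  have hT0 : C'.length ≠ 0 := by
    intro h0
    rw [List.length_eq_zero_iff.1 h0] at hout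
    simp [numOut] at hout
    omega
  rw [← hlen] at hs hδ hT
  have h3t : 3 ^ t ≤ w := (Nat.pow_le_pow_left (by norm_num) t).trans hwt
  have hw2 : 9 ≤ w ^ 2 := Nat.pow_le_pow_left hw 2
  have hw23 : 3 * w ^ 2 ≤ w ^ 3 := by rw [pow_succ w 2, mul_comm]; exact Nat.mul_le_mul_left _ hw
  have hww : 3 * w ≤ w ^ 2 := by rw [pow_two]; exact Nat.mul_le_mul_right _ hw
  set L : (Fin k → Bool) × (Fin k → Bool) → Curve k (10 * N) := fun i => line hk hM i.1 i.2 with hL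
  set V : (Fin k → Bool) × (Fin k → Bool) → Verif (10 * N) N r (s ⊕ Ext N k t r) := fun i => simVerif N t r s (L i) with hV
  have hφ : ∀ i j, ((L i).φ j).size ≤ 2 * w + 1 := fun i j =>
    (size_lineE_le hk _ _ _).trans (by omega)
  have hcard := card_ext_le (Q := s) hwN h3t hwn hwr hw
  have hregs : Nat.clog 2 (10 * N) + Nat.clog 2 N + 1 ≤ 2 * w := by omega
  have hscr : (Nat.clog 2 (10 * N) + Nat.clog 2 N + 1) * (6 * w ^ 2 + 1) ≤ 14 * w ^ 3 := by
    refine (Nat.mul_le_mul hregs (show 6 * w ^ 2 + 1 ≤ 7 * w ^ 2 by omega)).trans_eq ?_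
    ring
  have hrN : r * Nat.clog 2 N ≤ w * w := Nat.mul_le_mul hwr (by omega)
  obtain ⟨e, D, hDT, hD⟩ := exists_circuit_blocks (M := 10 * N) (N := N) (ι := (Fin k → Bool) × (Fin k → Bool)) (B := 6 * w ^ 2)
    (ℓ := 10 * C'.length * w ^ 3) (D := fun i => sim (L i) N t r 0 C' ++ (V i).macs)
    (S := S') (T := T') (p := fun f i => (V i).prob f (sim (L i) N t r 0 C'))
    (by
      intro i x hx
      rcases List.mem_append.1 hx with hx | hx
      · refine fits_sim (L i) (fun j => ?_) ?_ 0 C' x hx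
        · have := hφ i j
          omega
        · have : 2 * 6 ^ t ≤ 2 * w := by omega
          omega
      · refine (V i).fits_macs (s := 2 * w + 1) (fun j => ?_) (fun j => ?_) ?_ x hx
        · change (((L i).φ j).subst _).size ≤ _
          rw [BExpr.size_subst_var]
          exact hφ i j
        · change (((L i).φ j).subst _).size ≤ _
          rw [BExpr.size_subst_var]
          exact hφ i j
        · nlinarith)
    (by
      intro i
      rw [List.length_append]
      have a1 := length_sim_le (r := r) (L i) hwN h3t hwm hw 0 C'
      have a2 := (V i).length_macs_le hwr (by omega : Nat.clog 2 N ≤ w) hwM hw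
      -- A block resets all its qubits, and S is not bounded in terms of the time. Only the qubits
      -- that some gate touches are kept, and there are at most T · polylog of them, so the resets
      -- do not dominate.
      have a3 : Fintype.card s ≤ C'.length * w ^ 2 := by
        rw [Fintype.card_coe]
        refine hs.trans (Nat.mul_le_mul_left _ ?_)
        omega
      have a4 : 1 * w ^ 2 ≤ C'.length * w ^ 2 := Nat.mul_le_mul_right _ (by omega)
      have a5 : C'.length * (3 * w ^ 2) ≤ C'.length * w ^ 3 := Nat.mul_le_mul_left _ hw23
      nlinarith)
    (fun f i => (V i).emits f (quiet_sim (L i) t r 0 C'))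
    (by
      have : Fintype.card s ≤ S := (Fintype.card_coe s).le.trans
        ((Finset.card_le_univ s).trans (Fintype.card_fin S).le)
      omega)
    (by
      refine le_trans ?_ hT
      have b1 : Fintype.card ((Fin k → Bool) × (Fin k → Bool)) = 4 ^ k := by
        simp only [Fintype.card_prod, Fintype.card_fun, Fintype.card_bool, Fintype.card_fin]
        rw [← mul_pow]; norm_num
      have b2 : 2 * ((Nat.clog 2 (10 * N) + Nat.clog 2 N + 1) * (6 * w ^ 2 + 1)) + 1 ≤
          40 * w ^ 3 := by omega
      rw [b1]
      refine (Nat.mul_le_mul_left _ b2).trans_eq ?_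
      ring)
  refine ⟨D, hDT, findsDisjointCollisions_of_blocks (e := e)
    (p := fun f i => (V i).prob f (sim (L i) N t r 0 C')) hn h1 h2 hk hM hED hr hq hK
    (fun f i P => (V i).prob_nonneg f _ P) (fun f i => (V i).sum_prob f _)
    (fun f i => (V i).sum_prob_wrong_le f _) (fun f a b => ?_) (fun f => hD f K)⟩
  exact blockBound_le (line hk hM a b) (line_pt_injective' hk hM a b) hout hT0 hδ f

end Reduction

/-! ### Examination of all pairs -/

/-- The verification of a given pair. -/
def pairVerif (M N r : ℕ) (P : Fin M × Fin M) : Verif M N r (EqTests N r ⊕ Unit) where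
  ν := ⟨Sum.inl, Sum.inl_injective⟩
  o := Sum.inr ()
  ex j := .lit ((P.1 : ℕ).testBit j)
  ey j := .lit ((P.2 : ℕ).testBit j)
  ho q h := Sum.inl_ne_inr h
  ex_uses j q h := h
  ey_uses j q h := h
  ex_o j h := h
  ey_o j h := h
  x _ := P.1
  y _ := P.2
  hxx _ := by
    simp only [BExpr.eval]
    rw [Nat.ofBits_testBit, Nat.mod_eq_of_lt (P.1.2.trans_le (Nat.le_pow_clog (by norm_num) M))]
  hyy _ := by
    simp only [BExpr.eval]
    rw [Nat.ofBits_testBit, Nat.mod_eq_of_lt (P.2.2.trans_le (Nat.le_pow_clog (by norm_num) M))]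

open Classical in
-- Equal values are always recognized; for different values the verdict is wrong only if the
-- equality test passes.
lemma sum_pairVerif_prob_le {M N r : ℕ} (f : Fin M → Fin N) (i : Fin M × Fin M) :
    ∑ P, (pairVerif M N r i).prob f [] P *
      (if P = (i.1, if f i.1 = f i.2 then i.2 else i.1) then 0 else 1) ≤ (1 / 4 : ℝ) ^ r := by
  have h := (pairVerif M N r i).sum_prob_mul f []
    fun P => if P = (i.1, if f i.1 = f i.2 then i.2 else i.1) then (0 : ℝ) else 1
  rw [h, List.map_nil, run_nil]
  have h2 : ∀ w, (pairVerif M N r i).avgPair f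
      (fun P => if P = (i.1, if f i.1 = f i.2 then i.2 else i.1) then (0 : ℝ) else 1) w ≤
        (1 / 4) ^ r := fun w => by
    change passProb N r (f i.1) (f i.2) * (if (i.1, i.2) = _ then 0 else 1) +
      (1 - passProb N r (f i.1) (f i.2)) * (if (i.1, i.1) = _ then 0 else 1) ≤ _
    by_cases hf : f i.1 = f i.2
    · rw [if_pos hf, if_pos rfl, hf, passProb_self (f i.2).2]
      simp
    · rw [if_neg hf, if_pos rfl, mul_zero, add_zero]
      have h3 := passProb_le (r := r) (f i.1).2 (f i.2).2 fun h => hf (Fin.ext h)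
      have h4 := passProb_nonneg N r (f i.1) (f i.2)
      split_ifs
      · simp
      · linarith
  have h5 := Verif.dia_mono (fun (_ : List Bool) w => h2 w) [] (initSt (EqTests N r ⊕ Unit))
  refine h5.trans (le_of_eq ?_)
  have h6 := nsq_initSt (EqTests N r ⊕ Unit)
  rw [nsq] at h6
  rw [dia, ← Finset.sum_mul, h6, one_mul]

theorem exists_findsDisjointCollisions_of_all {M N S T r w K : ℕ} (hN : N ≠ 0)
    (hr : (M : ℝ) * M * (1 / 4) ^ r ≤ 1 / 3) (hK : 2 * K + N ≤ M)
    (hwN : Nat.clog 2 N ≤ w) (hwM : Nat.clog 2 M ≤ w) (hwr : r ≤ w) (hw : 3 ≤ w)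
    (hS : 25 * w ^ 3 ≤ S) (hT : 400 * M ^ 2 * w ^ 5 ≤ T) :
    ∃ D : Circuit M N S, D.time = T ∧ FindsDisjointCollisions D K := by
  have hw2 : 9 ≤ w ^ 2 := Nat.pow_le_pow_left hw 2
  have hw23 : 3 * w ^ 2 ≤ w ^ 3 := by rw [pow_succ w 2, mul_comm]; exact Nat.mul_le_mul_left _ hw
  have hww : 3 * w ≤ w ^ 2 := by rw [pow_two]; exact Nat.mul_le_mul_right _ hw
  have hrN : r * Nat.clog 2 N ≤ w * w := Nat.mul_le_mul hwr hwN
  have hcard : Fintype.card (EqTests N r ⊕ Unit) ≤ 2 * w ^ 2 := by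
    have : Fintype.card (EqTests N r ⊕ Unit) = r * Nat.clog 2 N + 1 := by simp [EqTests]
    nlinarith
  have hscr : (Nat.clog 2 M + Nat.clog 2 N + 1) * (6 * w ^ 2 + 1) ≤ 21 * w ^ 3 := by
    refine (Nat.mul_le_mul (show _ ≤ 3 * w by omega)
      (show 6 * w ^ 2 + 1 ≤ 7 * w ^ 2 by omega)).trans_eq ?_
    ring
  obtain ⟨e, D, hDT, hD⟩ := exists_circuit_blocks (M := M) (N := N) (ι := Fin M × Fin M)
    (B := 6 * w ^ 2) (ℓ := 9 * w ^ 2) (D := fun i => (pairVerif M N r i).macs)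
    (S := S) (T := T) (p := fun f i => (pairVerif M N r i).prob f [])
    (by
      intro i x hx
      refine (pairVerif M N r i).fits_macs (s := 1) (fun j => le_rfl) (fun j => le_rfl) ?_ x hx
      nlinarith)
    (by
      intro i
      have := (pairVerif M N r i).length_macs_le hwr hwN hwM hw
      omega)
    (fun f i => (pairVerif M N r i).emits f (C₀ := []) (by simp))
    (by omega)
    (by
      refine le_trans ?_ hT
      rw [Fintype.card_prod, Fintype.card_fin]
      have b2 : 2 * ((Nat.clog 2 M + Nat.clog 2 N + 1) * (6 * w ^ 2 + 1)) + 1 ≤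
          43 * w ^ 3 := by omega
      refine (Nat.mul_le_mul_left _ b2).trans ?_
      have : M * M * (9 * w ^ 2) * (43 * w ^ 3) = 387 * M ^ 2 * w ^ 5 := by ring
      rw [this]
      gcongr
      norm_num)
  refine ⟨D, hDT, ?_⟩
  have hpos : ∀ f, (2 / 3 : ℝ) ≤ successProb D f (OutputsDisjointCollisions f K) := fun f => by
    rw [hD]
    refine le_trans ?_ (one_sub_le_success_all e (fun i P => (pairVerif M N r i).prob_nonneg f _ P)
      (fun i => (pairVerif M N r i).sum_prob f _) hK (fun i => sum_pairVerif_prob_le f i))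
    linarith
  have : Nonempty (Fin N) := ⟨⟨0, by omega⟩⟩
  have h := expect_mono' hpos
  rwa [Fintype.expect_const] at h

/-! ### Choice of the parameters -/

/-- A circuit without qubits has no output. -/
lemma pos_of_solvesED {n S : ℕ} (hn : 2 ≤ n) {C : Circuit n (n ^ 2) S} (hC : SolvesED C) : 0 < S := by
  classical
  by_contra h0
  obtain rfl : S = 0 := by omega
  obtain ⟨s, C', -, -, hprob⟩ := exists_compress C
  have hout : numOut C' = 0 := by
    rw [numOut, List.sum_eq_zero]
    intro x hx
    obtain ⟨g, -, rfl⟩ := List.mem_map.1 hx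
    cases g with
    | output i => exact (i : Fin 0).elim0
    | unitary r hr t U => rfl
    | query t => rfl
    | reset i => rfl
  have h2 := expect_edProb_ge hn hC (C := C') fun F => hprob F _
  have : ∀ F, edProb C' F = 0 := fun F => by
    by_contra h
    have h3 := numOut_eq_of_pos h
    have := Nat.clog_pos (b := 2) (by norm_num) hn
    omega
  simp only [this, Finset.expect_const_zero] at h2
  norm_num at h2

/-- The size of the simulated circuits. -/
def simSize (b N : ℕ) : ℕ := (6 * ((2 * b + 1) * Nat.clog 2 (10 * N) + 10)) ^ 3

lemma le_simSize (b N : ℕ) : 6 * ((2 * b + 1) * Nat.clog 2 (10 * N) + 10) ≤ simSize b N :=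
  Nat.le_self_pow (by norm_num) _

/-- As (3/4)³ < 1/2, the tests err with probability at most 2^(-x) for x = (2b + 1)ℓ + 10. Here 2bℓ
pays for T², ℓ for the number of decisions and 10 for the constants. -/
lemma queryErr_small {b ℓ N t T : ℕ} (hN : Nat.clog 2 N ≤ ℓ) (hT : T ≤ 2 ^ (b * ℓ))
    (ht : 3 * ((2 * b + 1) * ℓ + 10) ≤ 2 ^ t) :
    (T : ℝ) * (1 + T) * queryErr N t ≤ 1 / 45 := by
  have hT' : (T : ℝ) ≤ 2 ^ (b * ℓ) := by exact_mod_cast hT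
  have h1 : (1 : ℝ) ≤ 2 ^ (b * ℓ) := one_le_pow₀ (by norm_num)
  have h2 : ((2 * Nat.clog 2 N + 1 : ℕ) : ℝ) ≤ 2 * 2 ^ ℓ := by
    have := Nat.lt_two_pow_self (n := ℓ)
    exact_mod_cast (show 2 * Nat.clog 2 N + 1 ≤ 2 * 2 ^ ℓ by omega)
  have h3 : ((3 : ℝ) / 4) ^ 2 ^ t ≤ (1 / 2) ^ ((2 * b + 1) * ℓ + 10) := by
    refine (pow_le_pow_of_le_one (by norm_num) (by norm_num) ht).trans ?_
    rw [pow_mul]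
    exact pow_le_pow_left₀ (by norm_num) (by norm_num) _
  have h4 : (T : ℝ) * (1 + T) ≤ 2 ^ (b * ℓ) * (2 * 2 ^ (b * ℓ)) :=
    mul_le_mul hT' (by linarith) (by positivity) (by positivity)
  have h5 : queryErr N t ≤ 4 * ((2 * 2 ^ ℓ) * (1 / 2) ^ ((2 * b + 1) * ℓ + 10)) := by
    unfold queryErr
    gcongr
  refine (mul_le_mul h4 h5 (queryErr_nonneg _ _) (by positivity)).trans ?_
  have h6 : ((1 : ℝ) / 2) ^ ((2 * b + 1) * ℓ + 10) * (2 ^ (b * ℓ) * 2 ^ (b * ℓ) * 2 ^ ℓ) =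
      1 / 1024 := by
    rw [← pow_add, ← pow_add, show b * ℓ + b * ℓ + ℓ = (2 * b + 1) * ℓ by ring, pow_add,
      mul_right_comm, ← mul_pow]
    norm_num
  calc (2 : ℝ) ^ (b * ℓ) * (2 * 2 ^ (b * ℓ)) *
        (4 * ((2 * 2 ^ ℓ) * (1 / 2) ^ ((2 * b + 1) * ℓ + 10)))
      = 16 * ((1 / 2) ^ ((2 * b + 1) * ℓ + 10) * (2 ^ (b * ℓ) * 2 ^ (b * ℓ) * 2 ^ ℓ)) := by ring
    _ ≤ 1 / 45 := by rw [h6]; norm_num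

/-- All auxiliary parameters are fixed: t with 2^t of order log N, r = ℓ + 2 repetitions of the
equality test, and a single polylogarithmic size that bounds everything else. Polynomial time of the
given circuit is what makes a polylogarithmic size sufficient. -/
theorem exists_findsDisjointCollisions_of_solvesED {n N S b K : ℕ} (hn : 2 ≤ n) (h1 : n ^ 2 ≤ N)
    (h2 : N ≤ n ^ 2 + 2 * n) {C : Circuit n (n ^ 2) S} (hC : SolvesED C) (hT : C.time ≤ n ^ b)
    (hq : (2 : ℝ) ^ Nat.clog 2 n * (2 ^ (2 ^ Nat.clog 2 n / 1620) *
      (1 - 1 / 810) ^ 2 ^ Nat.clog 2 n) ≤ 1 / 10)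
    (hK : K * (4 * (Nat.clog 2 N + 20)) ≤ 2 ^ Nat.clog 2 n * (2 ^ Nat.clog 2 n / 1620)) :
    ∃ D : Circuit (10 * N) N (S + 25 * simSize b N ^ 3),
      D.time = 400 * 4 ^ Nat.clog 2 n * C.time * simSize b N ^ 6 ∧
        FindsDisjointCollisions D K := by
  set ℓ := Nat.clog 2 (10 * N) with hℓ
  have hw := le_simSize b N
  have hℓb : ℓ ≤ (2 * b + 1) * ℓ := Nat.le_mul_of_pos_left _ (by omega)
  have hn2 : n ≤ n ^ 2 := Nat.le_self_pow (by norm_num) n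
  have hM : 10 * N ≤ 2 ^ ℓ := Nat.le_pow_clog (by norm_num) _
  have hclN : Nat.clog 2 N ≤ ℓ := Nat.clog_mono_right 2 (by omega)
  have hcln : Nat.clog 2 n ≤ ℓ := Nat.clog_mono_right 2 (by omega)
  have hcln2 : Nat.clog 2 (n ^ 2) ≤ ℓ := Nat.clog_mono_right 2 (by omega)
  set x := (2 * b + 1) * ℓ + 10 with hx
  set t := Nat.clog 2 (3 * x) with ht
  have ht1 : 3 * x ≤ 2 ^ t := Nat.le_pow_clog (by norm_num) _
  have ht2 : 2 ^ t ≤ 6 * x := by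
    have := two_pow_clog_lt (n := 3 * x) (by omega)
    exact this.le.trans (by omega)
  refine exists_findsDisjointCollisions (t := t) (r := ℓ + 2) (w := simSize b N) hn h1 h2 hC ?_ ?_
    hq hK ?_ ?_ ?_ ?_ ?_ ?_ ?_ le_rfl le_rfl
  · refine queryErr_small hclN (hT.trans ?_) ht1
    rw [mul_comm, pow_mul]
    exact Nat.pow_le_pow_left (by omega) b
  · have h4 : (4 : ℝ) ^ Nat.clog 2 n ≤ 4 ^ ℓ := pow_le_pow_right₀ (by norm_num) hcln
    have h5 : (4 : ℝ) ^ ℓ * (1 / 4) ^ (ℓ + 2) = 1 / 16 := by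
      rw [pow_add, ← mul_assoc, ← mul_pow]
      norm_num
    have h6 := mul_le_mul_of_nonneg_right h4 (show (0 : ℝ) ≤ (1 / 4) ^ (ℓ + 2) by positivity)
    linarith
  · omega
  · omega
  · omega
  · omega
  -- The formula of a decision has size of order 6^t; as 2^t is of order log N, this is
  -- polylogarithmic, and it determines the exponent 3 in `simSize`.
  · calc 6 ^ t ≤ 8 ^ t := Nat.pow_le_pow_left (by norm_num) t
      _ = (2 ^ t) ^ 3 := by rw [← pow_mul, mul_comm, pow_mul]; norm_num
      _ ≤ (6 * x) ^ 3 := Nat.pow_le_pow_left ht2 3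
  · omega
  · omega

/-- The factors N^p and N^q are padding of time and space. By the pigeonhole argument 10N points
yield at least 4N disjoint collisions. -/
theorem exists_findsDisjointCollisions_of_le {N K p q : ℕ} (hN : 1 ≤ N) (hK : K ≤ 4 * N) :
    ∃ D : Circuit (10 * N) N (25 * (Nat.clog 2 (10 * N) + 3) ^ 3 * N ^ q),
      D.time = 400 * (10 * N) ^ 2 * (Nat.clog 2 (10 * N) + 3) ^ 5 * N ^ p ∧
        FindsDisjointCollisions D K := by
  set ℓ := Nat.clog 2 (10 * N) with hℓ
  have hM : 10 * N ≤ 2 ^ ℓ := Nat.le_pow_clog (by norm_num) _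
  have hclN : Nat.clog 2 N ≤ ℓ := Nat.clog_mono_right 2 (by omega)
  refine exists_findsDisjointCollisions_of_all (r := ℓ + 1) (w := ℓ + 3) (by omega) ?_
    (by omega) (by omega) (by omega) (by omega) (by omega)
    (Nat.le_mul_of_pos_right _ (by positivity)) (Nat.le_mul_of_pos_right _ (by positivity))
  have h1 : ((10 * N : ℕ) : ℝ) ≤ 2 ^ ℓ := by exact_mod_cast hM
  have h2 : ((10 * N : ℕ) : ℝ) * (10 * N : ℕ) ≤ 2 ^ ℓ * 2 ^ ℓ :=
    mul_le_mul h1 h1 (by positivity) (by positivity)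
  have h3 : (2 : ℝ) ^ ℓ * 2 ^ ℓ * (1 / 4) ^ (ℓ + 1) = 1 / 4 := by
    rw [pow_succ, ← mul_assoc, ← mul_pow, ← mul_pow]
    norm_num
  have h4 := mul_le_mul_of_nonneg_right h2 (show (0 : ℝ) ≤ (1 / 4) ^ (ℓ + 1) by positivity)
  linarith

/-! ### Asymptotics -/

lemma tendsto_log_natCast : Tendsto (fun N : ℕ => Real.log N) atTop atTop :=
  Real.tendsto_log_atTop.comp tendsto_natCast_atTop_atTop

lemma clog_mul_log_two_le {m : ℕ} (hm : 2 ≤ m) :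
    (Nat.clog 2 m : ℝ) * Real.log 2 ≤ Real.log 2 + Real.log m := by
  have h : ((2 : ℝ) ^ Nat.clog 2 m) ≤ 2 * m := by exact_mod_cast (two_pow_clog_lt hm).le
  have h2 := Real.log_le_log (by positivity) h
  rwa [Real.log_pow, Real.log_mul (by norm_num) (by positivity)] at h2

lemma eventually_clog_le : ∀ᶠ N : ℕ in atTop, (Nat.clog 2 (10 * N) : ℝ) ≤ 3 * Real.log N := by
  filter_upwards [tendsto_log_natCast.eventually_ge_atTop 10, eventually_ge_atTop 1] with N h1 hN
  have h2 := clog_mul_log_two_le (m := 10 * N) (by omega)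
  have hN0 : (N : ℝ) ≠ 0 := by positivity
  push_cast at h2
  rw [Real.log_mul (by norm_num) hN0] at h2
  have h3 := Real.log_two_gt_d9
  have h4 := Real.log_two_lt_d9
  have h5 : Real.log 10 ≤ 4 * Real.log 2 := by
    rw [← Real.log_rpow (by norm_num)]
    exact Real.log_le_log (by norm_num) (by norm_num)
  have h6 : (0 : ℝ) ≤ Nat.clog 2 (10 * N) := by positivity
  nlinarith

/-- The mean number of successes for a slope is governed by the loss X/810 in the exponent, and
asking for X/1620 successes costs at most half of it. What remains is X exp(-X/1620), bounded by the
quadratic term of the exponential: 2 · 1620² = 5248800. -/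
lemma tail_bound {X : ℕ} (hX : 52488000 ≤ X) :
    (X : ℝ) * (2 ^ (X / 1620) * (1 - 1 / 810) ^ X) ≤ 1 / 10 := by
  have hX' : (52488000 : ℝ) ≤ X := by exact_mod_cast hX
  have h1 : (2 : ℝ) ^ (X / 1620) ≤ Real.exp (X / 1620) := by
    have h2 : (2 : ℝ) ≤ Real.exp 1 := by linarith [Real.add_one_le_exp (1 : ℝ)]
    refine (pow_le_pow_left₀ (by norm_num) h2 _).trans ?_
    rw [← Real.exp_nat_mul, mul_one]
    exact Real.exp_le_exp.2 Nat.cast_div_le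
  have h2 : (1 - 1 / 810 : ℝ) ^ X ≤ Real.exp (-(X / 810)) := by
    have h3 : (1 - 1 / 810 : ℝ) ≤ Real.exp (-(1 / 810)) := by
      linarith [Real.add_one_le_exp (-(1 / 810) : ℝ)]
    refine (pow_le_pow_left₀ (by norm_num) h3 _).trans_eq ?_
    rw [← Real.exp_nat_mul]
    ring_nf
  have h3 : Real.exp ((X : ℝ) / 1620) * Real.exp (-(X / 810)) = (Real.exp (X / 1620))⁻¹ := by
    rw [← Real.exp_add, ← Real.exp_neg]
    ring_nf
  have h4 : ((X : ℝ) / 1620) ^ 2 / 2 ≤ Real.exp (X / 1620) := by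
    have := Real.quadratic_le_exp_of_nonneg (show (0 : ℝ) ≤ X / 1620 by positivity)
    have : (0 : ℝ) ≤ X / 1620 := by positivity
    linarith
  calc (X : ℝ) * (2 ^ (X / 1620) * (1 - 1 / 810) ^ X)
      ≤ X * (Real.exp (X / 1620) * Real.exp (-(X / 810))) := by gcongr
    _ = X * (Real.exp (X / 1620))⁻¹ := by rw [h3]
    _ ≤ X * (((X : ℝ) / 1620) ^ 2 / 2)⁻¹ := by gcongr
    _ = 5248800 / X := by field_simp; norm_num
    _ ≤ 1 / 10 := by rw [div_le_iff₀ (by linarith)]; linarith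

lemma sq_sqrt_le (N : ℕ) : Nat.sqrt N ^ 2 ≤ N := Nat.sqrt_le' N

lemma le_sq_sqrt_add (N : ℕ) : N ≤ Nat.sqrt N ^ 2 + 2 * Nat.sqrt N := by
  have := Nat.sqrt_le_add N
  rw [pow_two]
  omega

lemma tendsto_sqrt : Tendsto Nat.sqrt atTop atTop :=
  tendsto_atTop.2 fun b => by
    filter_upwards [eventually_ge_atTop (b ^ 2)] with N hN
    exact Nat.le_sqrt'.2 hN

lemma eventually_tail_le : ∀ᶠ N : ℕ in atTop, (2 : ℝ) ^ Nat.clog 2 (Nat.sqrt N) *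
    (2 ^ (2 ^ Nat.clog 2 (Nat.sqrt N) / 1620) *
      (1 - 1 / 810) ^ 2 ^ Nat.clog 2 (Nat.sqrt N)) ≤ 1 / 10 := by
  obtain ⟨X₀, hX₀⟩ : ∃ X₀ : ℕ, ∀ X : ℕ, X₀ ≤ X →
    (X : ℝ) * (2 ^ (X / 1620) * (1 - 1 / 810) ^ X) ≤ 1 / 10 := ⟨_, fun X hX => tail_bound hX⟩
  filter_upwards [tendsto_sqrt.eventually_ge_atTop X₀] with N hN
  have h := hX₀ _ (hN.trans (Nat.le_pow_clog (by norm_num : 1 < 2) (Nat.sqrt N)))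
  push_cast at h
  exact h

/-- The number of collisions to be found is below the number that the blocks find. -/
lemma eventually_count_le : ∀ᶠ N : ℕ in atTop,
    ⌈(1 / 100000 : ℝ) * N / Real.log N⌉₊ * (4 * (Nat.clog 2 N + 20)) ≤
      2 ^ Nat.clog 2 (Nat.sqrt N) * (2 ^ Nat.clog 2 (Nat.sqrt N) / 1620) := by
  have hlog : ∀ᶠ N : ℕ in atTop, Real.log N ≤ 1 / 1000000 * N := by
    have h := Real.isLittleO_log_id_atTop.comp_tendsto tendsto_natCast_atTop_atTop 
    filter_upwards [h.bound (show (0 : ℝ) < 1 / 1000000 by norm_num)] with N hN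
    simp only [Function.comp_apply, id, Real.norm_eq_abs, Nat.abs_cast] at hN
    exact (le_abs_self _).trans hN
  filter_upwards [hlog, tendsto_log_natCast.eventually_ge_atTop 100, eventually_ge_atTop 2,
    tendsto_sqrt.eventually_ge_atTop 3240] with N h1 h2 hN hn
  set n := Nat.sqrt N with hndef
  set X := 2 ^ Nat.clog 2 n with hXdef
  have hX : n ≤ X := Nat.le_pow_clog (by norm_num) n
  have hnN := le_sq_sqrt_add N
  rw [← hndef] at hnN
  have h3 : X ≤ 3240 * (X / 1620) := by omega
  have hL : 0 < Real.log N := by linarith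
  have h4 := clog_mul_log_two_le hN
  have h5 : (Nat.clog 2 N : ℝ) ≤ 3 / 2 * Real.log N + 1 := by
    have := Real.log_two_gt_d9
    have h6 : (0 : ℝ) ≤ Nat.clog 2 N := by positivity
    nlinarith
  have h6 : (⌈(1 / 100000 : ℝ) * N / Real.log N⌉₊ : ℝ) ≤ (1 / 100000 : ℝ) * N / Real.log N + 1 :=
    (Nat.ceil_lt_add_one (by positivity)).le
  have h7 : (4 * (Nat.clog 2 N + 20) : ℝ) ≤ 8 * Real.log N := by linarith
  have h8 : (⌈(1 / 100000 : ℝ) * N / Real.log N⌉₊ : ℝ) * (4 * (Nat.clog 2 N + 20)) ≤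
      1 / 10000 * N := by
    refine (mul_le_mul h6 h7 (by positivity) (by positivity)).trans ?_
    have : ((1 / 100000 : ℝ) * N / Real.log N + 1) * (8 * Real.log N) =
        8 / 100000 * N + 8 * Real.log N := by field_simp
    rw [this]
    linarith
  -- Rounding down costs at most a factor 2 since X ≥ 1620, so the right side is at least X²/3240 ≥
  -- n²/3240, and N exceeds n² by at most 2n ≤ n²/1620.
  have h9 : (1 / 10000 : ℝ) * N ≤ X * ((X / 1620 : ℕ) : ℝ) := by
    have a1 : (n : ℝ) ≤ X := by exact_mod_cast hX
    have a2 : (X : ℝ) ≤ 3240 * ((X / 1620 : ℕ) : ℝ) := by exact_mod_cast h3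
    have a3 : (N : ℝ) ≤ n ^ 2 + 2 * n := by exact_mod_cast hnN
    have a4 : (3240 : ℝ) ≤ n := by exact_mod_cast hn
    have a5 : (X : ℝ) * X ≤ 3240 * (X * ((X / 1620 : ℕ) : ℝ)) := by
      have := mul_le_mul_of_nonneg_left a2 (show (0 : ℝ) ≤ X by positivity)
      linarith
    have a6 : (n : ℝ) * n ≤ X * X := mul_le_mul a1 a1 (by positivity) (by positivity)
    have a7 : (3240 : ℝ) * n ≤ n * n := mul_le_mul_of_nonneg_right a4 (by positivity)
    rw [pow_two] at a3
    linarith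
  have h10 := h8.trans h9
  exact_mod_cast h10

lemma eventually_count_le' : ∀ᶠ N : ℕ in atTop,
    ⌈(1 / 100000 : ℝ) * N / Real.log N⌉₊ ≤ 4 * N := by
  filter_upwards [tendsto_log_natCast.eventually_ge_atTop 1] with N h1
  refine Nat.ceil_le.2 ?_
  rw [div_le_iff₀ (by linarith)]
  push_cast
  have : (0 : ℝ) ≤ N := by positivity
  nlinarith

lemma isTildeO_of_le {u v : ℕ → ℝ} {k : ℕ} (c : ℝ)
    (h : ∀ᶠ N : ℕ in atTop, |u N| ≤ c * (v N * Real.log N ^ k)) : IsTildeO u v := by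
  refine ⟨k, IsBigO.of_bound |c| ?_⟩
  filter_upwards [h] with N hN
  rw [Real.norm_eq_abs, Real.norm_eq_abs, ← abs_mul]
  exact hN.trans (le_abs_self _)

/-- Powers of a polylogarithmic function. -/
lemma exists_rpow_le {g : ℕ → ℕ} {c : ℝ} {j : ℕ}
    (h : ∀ᶠ N : ℕ in atTop, 1 ≤ g N ∧ (g N : ℝ) ≤ c * Real.log N ^ j) (e : ℝ) :
    ∃ (c' : ℝ) (k : ℕ), ∀ᶠ N : ℕ in atTop, (g N : ℝ) ^ e ≤ c' * Real.log N ^ k := by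
  refine ⟨c ^ ⌈e⌉₊, j * ⌈e⌉₊, ?_⟩
  filter_upwards [h] with N hN
  have h1 : (1 : ℝ) ≤ g N := by exact_mod_cast hN.1
  calc (g N : ℝ) ^ e ≤ (g N : ℝ) ^ (⌈e⌉₊ : ℝ) := Real.rpow_le_rpow_of_exponent_le h1 (Nat.le_ceil e)
    _ = (g N : ℝ) ^ ⌈e⌉₊ := Real.rpow_natCast _ _
    _ ≤ (c * Real.log N ^ j) ^ ⌈e⌉₊ := pow_le_pow_left₀ (by positivity) hN.2 _
    _ = c ^ ⌈e⌉₊ * Real.log N ^ (j * ⌈e⌉₊) := by rw [mul_pow, pow_mul]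

lemma simSize_polylog (b : ℕ) : ∀ᶠ N : ℕ in atTop, 1 ≤ simSize b N ∧
    (simSize b N : ℝ) ≤ (6 * ((2 * b + 1) * 3 + 10)) ^ 3 * Real.log N ^ 3 := by
  filter_upwards [eventually_clog_le, tendsto_log_natCast.eventually_ge_atTop 1] with N h1 h2
  refine ⟨Nat.one_le_pow _ _ (by omega), ?_⟩
  rw [simSize, ← mul_pow]
  push_cast
  refine pow_le_pow_left₀ (by positivity) ?_ 3
  have h3 : ((2 * b + 1 : ℝ)) * Nat.clog 2 (10 * N) ≤ (2 * b + 1) * (3 * Real.log N) :=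
    mul_le_mul_of_nonneg_left h1 (by positivity)
  linarith

lemma clog_polylog : ∀ᶠ N : ℕ in atTop, 1 ≤ Nat.clog 2 (10 * N) + 3 ∧
    ((Nat.clog 2 (10 * N) + 3 : ℕ) : ℝ) ≤ 6 * Real.log N ^ 1 := by
  filter_upwards [eventually_clog_le, tendsto_log_natCast.eventually_ge_atTop 1] with N h1 h2
  refine ⟨by omega, ?_⟩
  push_cast
  linarith

/-- Polylogarithmic factors are absorbed by any power. -/
lemma eventually_mul_log_pow_le (c : ℝ) (k : ℕ) {e : ℝ} (he : 0 < e) :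
    ∀ᶠ n : ℕ in atTop, |c * Real.log n ^ k| ≤ (n : ℝ) ^ e := by
  have h := ((isLittleO_log_rpow_rpow_atTop (k : ℝ) he).const_mul_left c).comp_tendsto
    tendsto_natCast_atTop_atTop 
  filter_upwards [h.bound one_pos] with n hn
  simp only [Function.comp_apply, Real.rpow_natCast, Real.norm_eq_abs, one_mul] at hn
  rwa [abs_of_nonneg (Real.rpow_nonneg (Nat.cast_nonneg n) e)] at hn

/-- n² ≤ N ≤ 2n², where the first inequality serves for γ ≥ 0 and the second for γ ≤ 0. -/
lemma rpow_sq_sqrt_le {N : ℕ} (hN : 2 ≤ Nat.sqrt N) (γ : ℝ) :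
    ((Nat.sqrt N : ℝ) ^ 2) ^ γ ≤ 2 ^ |γ| * (N : ℝ) ^ γ := by
  set n := Nat.sqrt N with hn
  have h1 : (n : ℝ) ^ 2 ≤ N := by exact_mod_cast sq_sqrt_le N
  have h2 : (N : ℝ) ≤ 2 * n ^ 2 := by
    have := le_sq_sqrt_add N
    rw [← hn] at this
    exact_mod_cast (show N ≤ 2 * n ^ 2 by nlinarith)
  have hn0 : (0 : ℝ) < n ^ 2 := by
    have : (2 : ℝ) ≤ n := by exact_mod_cast hN
    positivity
  rcases le_total 0 γ with h | h
  · calc ((n : ℝ) ^ 2) ^ γ ≤ 1 * (N : ℝ) ^ γ := by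
          rw [one_mul]; exact Real.rpow_le_rpow hn0.le h1 h
      _ ≤ 2 ^ |γ| * (N : ℝ) ^ γ := by
          gcongr
          exact Real.one_le_rpow (by norm_num) (abs_nonneg _)
  · rw [abs_of_nonpos h]
    have h3 : (2 : ℝ) ^ (-γ) * (2 * n ^ 2 : ℝ) ^ γ = ((n : ℝ) ^ 2) ^ γ := by
      rw [Real.mul_rpow (by norm_num) hn0.le, ← mul_assoc, ← Real.rpow_add (by norm_num)]
      simp
    rw [← h3]
    exact mul_le_mul_of_nonneg_left (Real.rpow_le_rpow_of_nonpos (hn0.trans_le h1) h2 h)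
      (Real.rpow_nonneg (by norm_num) _)

/-- Circuits that exist for large `N` form a family. -/
lemma exists_family {M : ℕ → ℕ} {S T K : ℕ → ℕ} (h : ∀ᶠ N in atTop,
    ∃ D : Circuit (M N) N (S N), D.time = T N ∧ FindsDisjointCollisions D (K N)) :
    ∃ C : ∀ N, Circuit (M N) N (S N),
      ∀ᶠ N in atTop, (C N).time = T N ∧ FindsDisjointCollisions (C N) (K N) := by
  classical
  refine ⟨fun N => if h : ∃ D : Circuit (M N) N (S N), D.time = T N ∧
    FindsDisjointCollisions D (K N) then h.choose else [], ?_⟩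
  filter_upwards [h] with N hN
  rw [dif_pos hN]
  exact hN.choose_spec

/-- The examination of all pairs, with arbitrary additional time and space. -/
theorem exists_family_of_all {α β γ : ℝ} (p q : ℕ) (hpq : (2 + p) * α + q * β ≤ γ) :
    ∃ (S : ℕ → ℕ) (C : ∀ N : ℕ, Circuit (10 * N) N (S N)),
      (∀ᶠ N : ℕ in atTop,
        FindsDisjointCollisions (C N) ⌈(1 / 100000 : ℝ) * (N : ℝ) / Real.log N⌉₊) ∧
      IsTildeO (fun N => ((C N).time : ℝ) ^ α * (S N : ℝ) ^ β) (fun N => (N : ℝ) ^ γ) := by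
  obtain ⟨C, hC⟩ := exists_family (M := fun N => 10 * N)
    (S := fun N => 25 * (Nat.clog 2 (10 * N) + 3) ^ 3 * N ^ q)
    (T := fun N => 400 * (10 * N) ^ 2 * (Nat.clog 2 (10 * N) + 3) ^ 5 * N ^ p)
    (K := fun N => ⌈(1 / 100000 : ℝ) * (N : ℝ) / Real.log N⌉₊) (by
      filter_upwards [eventually_count_le', eventually_ge_atTop 1] with N h1 hN
      exact exists_findsDisjointCollisions_of_le hN h1)
  refine ⟨_, C, hC.mono fun N h => h.2, ?_⟩
  -- The polylogarithmic factors of time and space have exponents 5 and 3. The combined exponent may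
  -- be negative, which does no harm because the base is at least 1.
  obtain ⟨c, k, hck⟩ := exists_rpow_le clog_polylog (5 * α + 3 * β)
  refine isTildeO_of_le (k := k) ((40000 : ℝ) ^ α * 25 ^ β * c) ?_
  filter_upwards [hC, hck, eventually_ge_atTop 1] with N h1 h2 hN
  have hN1 : (1 : ℝ) ≤ N := by exact_mod_cast hN
  have hN0 : (0 : ℝ) < N := by linarith
  rw [h1.1]
  set w : ℝ := ((Nat.clog 2 (10 * N) + 3 : ℕ) : ℝ) with hw
  have hw0 : 0 < w := by positivity
  have e1 : ((400 * (10 * N) ^ 2 * (Nat.clog 2 (10 * N) + 3) ^ 5 * N ^ p : ℕ) : ℝ) =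
      40000 * (N : ℝ) ^ (2 + p : ℝ) * w ^ (5 : ℝ) := by
    rw [Real.rpow_add hN0, Real.rpow_natCast, show (2 : ℝ) = ((2 : ℕ) : ℝ) by norm_num,
      Real.rpow_natCast, show (5 : ℝ) = ((5 : ℕ) : ℝ) by norm_num, Real.rpow_natCast, hw]
    push_cast
    ring
  have e2 : ((25 * (Nat.clog 2 (10 * N) + 3) ^ 3 * N ^ q : ℕ) : ℝ) =
      25 * (N : ℝ) ^ (q : ℝ) * w ^ (3 : ℝ) := by
    rw [Real.rpow_natCast, show (3 : ℝ) = ((3 : ℕ) : ℝ) by norm_num, Real.rpow_natCast, hw]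
    push_cast
    ring
  have e3 : ((40000 * (N : ℝ) ^ (2 + p : ℝ) * w ^ (5 : ℝ)) ^ α *
      (25 * (N : ℝ) ^ (q : ℝ) * w ^ (3 : ℝ)) ^ β) =
      40000 ^ α * 25 ^ β * ((N : ℝ) ^ ((2 + p) * α + q * β) * w ^ (5 * α + 3 * β)) := by
    rw [Real.mul_rpow (by positivity) (by positivity), Real.mul_rpow (by positivity) (by positivity),
      Real.mul_rpow (by positivity) (by positivity), Real.mul_rpow (by positivity) (by positivity),
      Real.rpow_add hN0 ((2 + p) * α), Real.rpow_add hw0, ← Real.rpow_mul hN0.le, ← Real.rpow_mul hN0.le,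
      ← Real.rpow_mul hw0.le, ← Real.rpow_mul hw0.le]
    ring
  rw [e1, e2, e3, abs_of_nonneg (by positivity)]
  have h3 : (N : ℝ) ^ ((2 + p) * α + q * β) ≤ (N : ℝ) ^ γ :=
    Real.rpow_le_rpow_of_exponent_le hN1 hpq
  calc (40000 : ℝ) ^ α * 25 ^ β * ((N : ℝ) ^ ((2 + p) * α + q * β) * w ^ (5 * α + 3 * β))
      ≤ 40000 ^ α * 25 ^ β * ((N : ℝ) ^ γ * (c * Real.log N ^ k)) := by gcongr
    _ = (40000 : ℝ) ^ α * 25 ^ β * c * ((N : ℝ) ^ γ * Real.log N ^ k) := by ring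

/-! ### From a family for Element Distinctness to a family for disjoint collisions -/

section Family

variable {α β γ : ℝ} {S : ℕ → ℕ} {C : ∀ n : ℕ, Circuit n (n ^ 2) (S n)}

lemma eventually_pos (hC : ∀ᶠ n : ℕ in atTop, SolvesED (C n)) : ∀ᶠ n : ℕ in atTop, 1 ≤ S n := by
  filter_upwards [hC, eventually_ge_atTop 2] with n h hn
  exact pos_of_solvesED hn h

lemma exists_bound (hT : IsTildeO (fun n => ((C n).time : ℝ) ^ α * (S n : ℝ) ^ β)
    (fun n => (n : ℝ) ^ (2 * (γ - α)))) :
    ∃ (c : ℝ) (k : ℕ), 0 ≤ c ∧ ∀ᶠ n : ℕ in atTop, ((C n).time : ℝ) ^ α * (S n : ℝ) ^ β ≤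
      c * ((n : ℝ) ^ (2 * (γ - α)) * Real.log n ^ k) := by
  obtain ⟨k, hk⟩ := hT
  obtain ⟨c, hc⟩ := hk.bound
  refine ⟨|c|, k, abs_nonneg c, ?_⟩
  filter_upwards [hc, eventually_ge_atTop 1] with n hn hn1
  have h1 : (0 : ℝ) ≤ Real.log n := Real.log_natCast_nonneg n
  rw [Real.norm_eq_abs, Real.norm_eq_abs, abs_of_nonneg (show (0 : ℝ) ≤
    (n : ℝ) ^ (2 * (γ - α)) * Real.log n ^ k by positivity)] at hn
  exact (le_abs_self _).trans (hn.trans (mul_le_mul_of_nonneg_right (le_abs_self c) (by positivity)))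

/-- The time is polynomial. -/
lemma exists_time_le (hα : 0 < α) (hβ : 0 ≤ β) (hC : ∀ᶠ n : ℕ in atTop, SolvesED (C n))
    (hT : IsTildeO (fun n => ((C n).time : ℝ) ^ α * (S n : ℝ) ^ β)
      (fun n => (n : ℝ) ^ (2 * (γ - α)))) :
    ∃ b : ℕ, ∀ᶠ n : ℕ in atTop, (C n).time ≤ n ^ b := by
  obtain ⟨c, k, hc, hck⟩ := exists_bound hT
  refine ⟨⌈(1 + 2 * (γ - α)) / α⌉₊, ?_⟩
  filter_upwards [hck, eventually_pos hC, eventually_mul_log_pow_le c k one_pos,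
    eventually_ge_atTop 1] with n h1 h2 h3 hn
  have hn1 : (1 : ℝ) ≤ n := by exact_mod_cast hn
  have hn0 : (0 : ℝ) < n := by linarith
  have h4 : (1 : ℝ) ≤ (S n : ℝ) ^ β := Real.one_le_rpow (by exact_mod_cast h2) hβ
  have h5 : ((C n).time : ℝ) ^ α ≤ (n : ℝ) ^ (1 + 2 * (γ - α)) := by
    calc ((C n).time : ℝ) ^ α ≤ ((C n).time : ℝ) ^ α * (S n : ℝ) ^ β :=
          le_mul_of_one_le_right (by positivity) h4
      _ ≤ (c * Real.log n ^ k) * (n : ℝ) ^ (2 * (γ - α)) := h1.trans_eq (by ring)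
      _ ≤ (n : ℝ) ^ (1 : ℝ) * (n : ℝ) ^ (2 * (γ - α)) :=
          mul_le_mul_of_nonneg_right ((le_abs_self _).trans h3) (by positivity)
      _ = (n : ℝ) ^ (1 + 2 * (γ - α)) := by rw [← Real.rpow_add hn0]
  have h6 : ((C n).time : ℝ) ≤ (n : ℝ) ^ ((1 + 2 * (γ - α)) / α) := by
    have h7 := Real.rpow_le_rpow (by positivity) h5 (show 0 ≤ α⁻¹ by positivity)
    rwa [← Real.rpow_mul (by positivity), mul_inv_cancel₀ hα.ne', Real.rpow_one,
      ← Real.rpow_mul hn0.le, ← div_eq_mul_inv] at h7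
  have h7 := h6.trans (Real.rpow_le_rpow_of_exponent_le hn1 (Nat.le_ceil ((1 + 2 * (γ - α)) / α)))
  rw [Real.rpow_natCast] at h7
  exact_mod_cast h7

/-- A circuit with output has at least one qubit, so S^β ≥ 1, while for γ < 0 the bound n^(2γ) ·
polylog tends to 0. -/
lemma gamma_nonneg (hβ : 0 ≤ β) (hC : ∀ᶠ n : ℕ in atTop, SolvesED (C n))
    (hT : IsTildeO (fun n => ((C n).time : ℝ) ^ (0 : ℝ) * (S n : ℝ) ^ β)
      (fun n => (n : ℝ) ^ (2 * (γ - 0)))) : 0 ≤ γ := by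
  by_contra hγ
  obtain ⟨c, k, hc, hck⟩ := exists_bound hT
  obtain ⟨n, h1, h2, h3, hn⟩ := (hck.and ((eventually_pos hC).and
    ((eventually_mul_log_pow_le c k (show 0 < -γ by linarith)).and (eventually_ge_atTop 2)))).exists
  have hn1 : (1 : ℝ) < n := by exact_mod_cast (show 1 < n by omega)
  have hn0 : (0 : ℝ) < n := by linarith
  have h4 : (1 : ℝ) ≤ (S n : ℝ) ^ β := Real.one_le_rpow (by exact_mod_cast h2) hβ
  rw [Real.rpow_zero, one_mul, sub_zero] at h1
  have h5 : (1 : ℝ) ≤ (n : ℝ) ^ γ := by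
    calc (1 : ℝ) ≤ (c * Real.log n ^ k) * (n : ℝ) ^ (2 * γ) := (h4.trans h1).trans_eq (by ring)
      _ ≤ (n : ℝ) ^ (-γ) * (n : ℝ) ^ (2 * γ) :=
          mul_le_mul_of_nonneg_right ((le_abs_self _).trans h3) (by positivity)
      _ = (n : ℝ) ^ γ := by rw [← Real.rpow_add hn0]; ring_nf
  exact absurd h5 (not_le.2 (Real.rpow_lt_one_of_one_lt_of_neg hn1 (by linarith)))

/-- The exponent 2(γ - α) of the assumption is designed for this computation: the number of lines
contributes (n²)^α, which completes n^(2(γ-α)) to (n²)^γ, comparable with N^γ. The constants come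
from 400 · 4^k ≤ 1600 n² and S + 25w³ ≤ 26 S w³. -/
lemma cost_le {n N T S w j k : ℕ} {c c₁ : ℝ} (hα : 0 ≤ α) (hβ : 0 ≤ β) (hc₁ : 0 ≤ c₁) (hn : 2 ≤ n)
    (hw1 : 1 ≤ w) (h4 : 1 ≤ S) (hnN : (n : ℝ) ≤ N)
    (h2 : (w : ℝ) ^ (6 * α + 3 * β) ≤ c * Real.log N ^ k)
    (h3 : (T : ℝ) ^ α * (S : ℝ) ^ β ≤ c₁ * ((n : ℝ) ^ (2 * (γ - α)) * Real.log n ^ j))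
    (h7 : ((n : ℝ) ^ 2) ^ γ ≤ 2 ^ |γ| * (N : ℝ) ^ γ) :
    ((400 * 4 ^ Nat.clog 2 n * T * w ^ 6 : ℕ) : ℝ) ^ α * ((S + 25 * w ^ 3 : ℕ) : ℝ) ^ β ≤
      1600 ^ α * 26 ^ β * c₁ * 2 ^ |γ| * c * ((N : ℝ) ^ γ * Real.log N ^ (j + k)) := by
  have hn2 : (2 : ℝ) ≤ n := by exact_mod_cast hn
  have hn0 : (0 : ℝ) < n := by linarith
  have hw1' : (1 : ℝ) ≤ w := by exact_mod_cast hw1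
  have hw0 : (0 : ℝ) < w := by linarith
  have e1 : ((400 * 4 ^ Nat.clog 2 n * T * w ^ 6 : ℕ) : ℝ) ≤
      1600 * ((n : ℝ) ^ 2) * T * w ^ (6 : ℝ) := by
    have a1 : 4 ^ Nat.clog 2 n ≤ 4 * n ^ 2 := by
      have a2 := (two_pow_clog_lt hn).le
      calc 4 ^ Nat.clog 2 n = (2 ^ Nat.clog 2 n) ^ 2 := by rw [← pow_mul, mul_comm, pow_mul]; norm_num
        _ ≤ (2 * n) ^ 2 := Nat.pow_le_pow_left a2 2
        _ = 4 * n ^ 2 := by ring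
    rw [show (6 : ℝ) = ((6 : ℕ) : ℝ) by norm_num, Real.rpow_natCast]
    have a3 : 400 * 4 ^ Nat.clog 2 n * T * w ^ 6 ≤ 400 * (4 * n ^ 2) * T * w ^ 6 := by gcongr
    refine (show ((400 * 4 ^ Nat.clog 2 n * T * w ^ 6 : ℕ) : ℝ) ≤
      ((400 * (4 * n ^ 2) * T * w ^ 6 : ℕ) : ℝ) by exact_mod_cast a3).trans_eq ?_
    push_cast
    ring
  have e2 : ((S + 25 * w ^ 3 : ℕ) : ℝ) ≤ 26 * S * w ^ (3 : ℝ) := by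
    rw [show (3 : ℝ) = ((3 : ℕ) : ℝ) by norm_num, Real.rpow_natCast]
    have b1 : 1 ≤ w ^ 3 := Nat.one_le_pow _ _ hw1
    have b2 : S * 1 ≤ S * w ^ 3 := Nat.mul_le_mul_left _ b1
    have b3 : 1 * w ^ 3 ≤ S * w ^ 3 := Nat.mul_le_mul_right _ h4
    have b4 : S + 25 * w ^ 3 ≤ 26 * S * w ^ 3 := by nlinarith
    exact_mod_cast b4
  have e3 : ((1600 * ((n : ℝ) ^ 2) * T * w ^ (6 : ℝ)) ^ α * (26 * S * w ^ (3 : ℝ)) ^ β) =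
      1600 ^ α * 26 ^ β * ((n : ℝ) ^ 2) ^ α * ((T : ℝ) ^ α * (S : ℝ) ^ β) *
        (w : ℝ) ^ (6 * α + 3 * β) := by
    rw [Real.mul_rpow (by positivity) (by positivity), Real.mul_rpow (by positivity) (by positivity),
      Real.mul_rpow (by positivity) (by positivity), Real.mul_rpow (by positivity) (by positivity),
      Real.mul_rpow (by positivity) (by positivity), Real.rpow_add hw0, ← Real.rpow_mul hw0.le,
      ← Real.rpow_mul hw0.le]
    ring
  have hlog0 : 0 ≤ Real.log n := Real.log_natCast_nonneg n
  have hlogN : 0 ≤ Real.log N := Real.log_natCast_nonneg N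
  have h5 : Real.log n ^ j ≤ Real.log N ^ j := pow_le_pow_left₀ hlog0 (Real.log_le_log hn0 hnN) j
  have h6 : ((n : ℝ) ^ 2) ^ α * (n : ℝ) ^ (2 * (γ - α)) = ((n : ℝ) ^ 2) ^ γ := by
    rw [show (n : ℝ) ^ (2 * (γ - α)) = ((n : ℝ) ^ 2) ^ (γ - α) by
      rw [Real.rpow_mul hn0.le, show (2 : ℝ) = ((2 : ℕ) : ℝ) by norm_num, Real.rpow_natCast],
      ← Real.rpow_add (by positivity)]
    ring_nf
  have h8 : 0 ≤ c * Real.log N ^ k := le_trans (by positivity) h2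
  calc ((400 * 4 ^ Nat.clog 2 n * T * w ^ 6 : ℕ) : ℝ) ^ α * ((S + 25 * w ^ 3 : ℕ) : ℝ) ^ β
      ≤ (1600 * ((n : ℝ) ^ 2) * T * w ^ (6 : ℝ)) ^ α * (26 * S * w ^ (3 : ℝ)) ^ β :=
        mul_le_mul (Real.rpow_le_rpow (by positivity) e1 hα)
          (Real.rpow_le_rpow (by positivity) e2 hβ) (by positivity) (by positivity)
    _ = 1600 ^ α * 26 ^ β * ((n : ℝ) ^ 2) ^ α * ((T : ℝ) ^ α * (S : ℝ) ^ β) *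
        (w : ℝ) ^ (6 * α + 3 * β) := e3
    _ ≤ 1600 ^ α * 26 ^ β * ((n : ℝ) ^ 2) ^ α * (c₁ * ((n : ℝ) ^ (2 * (γ - α)) * Real.log N ^ j)) *
        (c * Real.log N ^ k) := by
        refine mul_le_mul (mul_le_mul_of_nonneg_left (h3.trans ?_) (by positivity)) h2
          (by positivity) (by positivity)
        gcongr
    _ = 1600 ^ α * 26 ^ β * (((n : ℝ) ^ 2) ^ α * (n : ℝ) ^ (2 * (γ - α))) * (c₁ * Real.log N ^ j) *
        (c * Real.log N ^ k) := by ring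
    _ ≤ 1600 ^ α * 26 ^ β * (2 ^ |γ| * (N : ℝ) ^ γ) * (c₁ * Real.log N ^ j) *
        (c * Real.log N ^ k) := by
        rw [h6]
        gcongr
    _ = 1600 ^ α * 26 ^ β * c₁ * 2 ^ |γ| * c * ((N : ℝ) ^ γ * Real.log N ^ (j + k)) := by
        rw [pow_add]; ring

theorem exists_family_of_solvesED (hα : 0 < α) (hβ : 0 ≤ β)
    (hC : ∀ᶠ n : ℕ in atTop, SolvesED (C n))
    (hT : IsTildeO (fun n => ((C n).time : ℝ) ^ α * (S n : ℝ) ^ β)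
      (fun n => (n : ℝ) ^ (2 * (γ - α)))) :
    ∃ (S : ℕ → ℕ) (C : ∀ N : ℕ, Circuit (10 * N) N (S N)),
      (∀ᶠ N : ℕ in atTop,
        FindsDisjointCollisions (C N) ⌈(1 / 100000 : ℝ) * (N : ℝ) / Real.log N⌉₊) ∧
      IsTildeO (fun N => ((C N).time : ℝ) ^ α * (S N : ℝ) ^ β) (fun N => (N : ℝ) ^ γ) := by
  obtain ⟨b, hb⟩ := exists_time_le hα hβ hC hT
  obtain ⟨D, hD⟩ := exists_family (M := fun N => 10 * N)
    (S := fun N => S (Nat.sqrt N) + 25 * simSize b N ^ 3)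
    (T := fun N => 400 * 4 ^ Nat.clog 2 (Nat.sqrt N) * (C (Nat.sqrt N)).time * simSize b N ^ 6)
    (K := fun N => ⌈(1 / 100000 : ℝ) * (N : ℝ) / Real.log N⌉₊) (by
      filter_upwards [eventually_count_le, tendsto_sqrt.eventually hC, tendsto_sqrt.eventually hb,
        tendsto_sqrt.eventually_ge_atTop 2, eventually_tail_le] with N h1 h2 h3 hn h4
      exact exists_findsDisjointCollisions_of_solvesED hn (sq_sqrt_le N) (le_sq_sqrt_add N) h2 h3
        h4 h1)
  refine ⟨_, D, hD.mono fun N h => h.2, ?_⟩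
  obtain ⟨c₁, j, hc₁, hcj⟩ := exists_bound hT
  obtain ⟨c, k, hck⟩ := exists_rpow_le (simSize_polylog b) (6 * α + 3 * β)
  refine isTildeO_of_le (k := j + k) ((1600 : ℝ) ^ α * 26 ^ β * c₁ * 2 ^ |γ| * c) ?_
  filter_upwards [hD, hck, tendsto_sqrt.eventually hcj, tendsto_sqrt.eventually (eventually_pos hC),
    tendsto_sqrt.eventually_ge_atTop 2, simSize_polylog b] with N h1 h2 h3 h4 hn hw1
  rw [h1.1, abs_of_nonneg (by positivity)]
  exact cost_le hα.le hβ hc₁ hn hw1.1 h4 (by exact_mod_cast Nat.sqrt_le_self N) h2 h3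
    (rpow_sq_sqrt_le hn γ)

end Family

end QCirc

end

theorem proposition6p3 :
    ∃ c : ℝ, 0 < c ∧ ∀ α β γ : ℝ,
      (∃ (S : ℕ → ℕ) (C : ∀ n : ℕ, Circuit n (n ^ 2) (S n)),
        (∀ᶠ n : ℕ in atTop, SolvesED (C n)) ∧
        IsTildeO (fun n => ((C n).time : ℝ) ^ α * (S n : ℝ) ^ β)
          (fun n => (n : ℝ) ^ (2 * (γ - α)))) →
      ∃ (S : ℕ → ℕ) (C : ∀ N : ℕ, Circuit (10 * N) N (S N)),
        (∀ᶠ N : ℕ in atTop,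
          FindsDisjointCollisions (C N) ⌈c * (N : ℝ) / Real.log N⌉₊) ∧
        IsTildeO (fun N => ((C N).time : ℝ) ^ α * (S N : ℝ) ^ β)
          (fun N => (N : ℝ) ^ γ) := by
  -- The constant is small enough for the count of successes on lines, 4^k/3240 up to rounding,
  -- divided by four times the maximal load.
  refine ⟨1 / 100000, by norm_num, fun α β γ ⟨S, C, hC, hT⟩ => ?_⟩
  rcases lt_trichotomy α 0 with hα | rfl | hα
  -- Negative α: padding the time by N^p makes the product as small as desired, since p α ≤ γ.
  · obtain ⟨p, hp⟩ := exists_nat_ge (γ / α)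
    refine QCirc.exists_family_of_all p 0 ?_
    have h1 := mul_le_mul_of_nonpos_right hp hα.le
    rw [div_mul_cancel₀ _ hα.ne] at h1
    push_cast
    linarith
  · rcases lt_or_ge β 0 with hβ | hβ
    -- Negative β: the space is padded by N^q instead.
    · obtain ⟨q, hq⟩ := exists_nat_ge (γ / β)
      refine QCirc.exists_family_of_all 0 q ?_
      have h1 := mul_le_mul_of_nonpos_right hq hβ.le
      rw [div_mul_cancel₀ _ hβ.ne] at h1
      linarith
    · refine QCirc.exists_family_of_all 0 0 ?_
      have := QCirc.gamma_nonneg hβ hC hT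
      simpa using this
  · rcases lt_or_ge β 0 with hβ | hβ
    -- Here the N² pairs cost (N²)^α, and the padding of the space has to compensate for this too.
    · obtain ⟨q, hq⟩ := exists_nat_ge ((γ - 2 * α) / β)
      refine QCirc.exists_family_of_all 0 q ?_
      have h1 := mul_le_mul_of_nonpos_right hq hβ.le
      rw [div_mul_cancel₀ _ hβ.ne] at h1
      push_cast
      linarith
    · exact QCirc.exists_family_of_solvesED hα hβ hC hT
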